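/- **Setting.** $G$ is a simple graph with vertex set $\{0,\dots,n-1\}$, $m$ edges, maximum degree $d$ and no isolated vertices, given to a randomized unit-cost random access machine as a list of its edges (in any order; all other memory has arbitrary contents). Every memory access, random draw from $\{0,\dots,k-1\}$, loop iteration and recursive call counts as one step. *Random-Euler-Color* colors $G$ with the colors $1,\dots,d+1$ recursively. If $d\le 1$, all edges get color $1$. Otherwise: (Partition) the edges are removed in maximal tours, starting at vertices of odd degree as long as there are any, and assigned alternately to two subgraphs $G_1,G_2$; (Recurse) $G_1$ and $G_2$, of maximum degrees $d_1$ and $d_2$, are colored recursively with $d_1+1$ and $d_2+1$ colors, the two sets of colors being made disjoint; (Prune) while more than $d+1$ colors are used, all edges of a least common color are uncolored; the remaining colors are renamed to lie in $\{1,\dots,d+1\}$; (Repair) while there are uncolored edges, *Random-Color-One* is called. *Random-Color-One* chooses an uncolored edge $vx_0$ uniformly at random, with $v$ a uniformly random one of its endpoints, and a color $\alpha$ uniformly at random among the colors of $\{1,\dots,d+1\}$ missing at $v$. It builds a fan $x_0,x_1,\dots,x_k$ of neighbours of $v$: it picks a color $\beta$ missing at the last leaf $x_k$ and stops if $\beta$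 is missing at $v$ or if $\beta$ is the color of $vx_j$ for a leaf $x_j$ with $1\le j\le k$; else it appends the neighbour joined to $v$ by color $\beta$. In the first case it shifts the fan from $x_k$ (that is, it gives $vx_{i-1}$ the color of $vx_i$ for $i=1,\dots,k$ and uncolors $vx_k$) and colors $vx_k$ by $\beta$. In the second case it interchanges $\alpha$ and $\beta$ on the $\alpha\beta$-path from $v$, with other endpoint $w$, and then shifts the fan from $x_{j-1}$ and colors $vx_{j-1}$ by $\beta$ if $w\ne x_{j-1}$, and shifts the fan from $x_k$ and colors $vx_k$ by $\beta$ if $w=x_{j-1}$. Missing colors and the edge of a given color at a given vertex are found in constant time, by means of lists $\mu(v)$ of the colors in $\{1,\dots,\deg v+1\}$ missing at $v$ and of a two-level dictionary on pairs (vertex, color); the initialization of all data structures is part of the running time. **Theorem.** There is an absolute constant $C>0$ such that for every such graph $G$ and every initial memory that contains it, Random-Euler-Color halts within $C\,m\sqrt n$ steps with probability at least $1-e^{-\sqrt m}$. Moreover, whenever it halts, its output is a proper edge-coloring of $G$ with the colors $1,\dots,d+1$. -/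

import Mathlib

/-! ### A randomized unit-cost random access machine -/

namespace EdgeColoring

noncomputable section

/-- The arrays of the machine. Each of them is a sequence of natural numbers; scalars that have to
survive a procedure call are stored in cell `0` of an array of their own. -/
inductive Arr
  /-- input: the two endpoints of each edge -/
  | src | dst
  /-- output: the color of each edge (`0` if the edge is uncolored) -/
  | col
  /-- the edges, ordered so that the current subgraph is a contiguous segment -/
  | ord
  /-- degree of a vertex in the current subgraph, its non-isolated vertices, storage offsets -/
  | deg | verts | off
  /-- Euler partition: incidence lists, their ends, remaining degrees, used edges -/
  | adj | ptr | rem | used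
  /-- pruning: size of each color class, new name of each color -/
  | cnt | lab
  /-- the set of uncolored edges: items, positions, size -/
  | unc | uncPos | uncSize
  /-- the sets `μ(v)`: items, positions, sizes -/
  | mu | muPos | muSize
  /-- the dictionary: array of ranges, counters, block arrays, unused blocks and their number -/
  | dictA | dictC | dictB | dictE | dictTop
  /-- leaves of the fan, marks of the leaves, alternating path, candidates for `α` -/
  | fan | mark | path | cand
  deriving DecidableEq

/-- Memory contents. -/
abbrev Mem := Arr → ℕ → ℕ

/-- A randomized program with result type `α`. Run on an initial memory and a number `t` of time
steps, it yields the distribution of the outcome: `none` if the program has not halted within `t`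
steps, and `some (a, mem, t')` if it has halted with result `a` and final memory `mem` with `t'` of
the `t` steps left over.

Every memory access, every random draw, every loop iteration and every recursive call costs one step.
The fixed, constant number of word operations (arithmetic, comparisons, procedure calls) between two
of these is not charged separately; this changes running times by a constant factor only. -/
def Prog (α : Type) : Type := Mem → ℕ → PMF (Option (α × Mem × ℕ))

instance : Monad Prog where
  pure a := fun mem t => PMF.pure (some (a, mem, t))
  bind p f := fun mem t => (p mem t).bind fun o =>
    match o with
    | none => PMF.pure none
    | some (a, mem', t') => f a mem' t'

/-- The run does not halt within the time available. -/
def timeout {α : Type} : Prog α := fun _ _ => PMF.pure none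

/-- Spend one time step. -/
def tick : Prog Unit := fun mem t =>
  match t with
  | 0 => PMF.pure none
  | t + 1 => PMF.pure (some ((), mem, t))

/-- Read cell `i` of array `a` (one step). -/
def read (a : Arr) (i : ℕ) : Prog ℕ := do
  tick
  fun mem t => PMF.pure (some (mem a i, mem, t))

/-- Write `x` into cell `i` of array `a` (one step). -/
def write (a : Arr) (i x : ℕ) : Prog Unit := do
  tick
  fun mem t => PMF.pure (some ((), Function.update mem a (Function.update (mem a) i x), t))

/-- Draw a uniformly random element of `{0, …, k - 1}` with fresh randomness (one step). -/
def rand (k : ℕ) : Prog ℕ := do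
  tick
  if h : (Finset.range k).Nonempty then
    fun mem t => (PMF.uniformOfFinset (Finset.range k) h).map fun i => some (i, mem, t)
  else timeout

/-- Iterate `body`, each iteration costing one step on top of its own cost, until it returns
`Sum.inr`; give up after `fuel` iterations. -/
def whileAux {σ ρ : Type} (body : σ → Prog (σ ⊕ ρ)) : ℕ → σ → Prog ρ
  | 0, _ => timeout
  | fuel + 1, s => do
    tick
    match ← body s with
    | .inl s' => whileAux body fuel s'
    | .inr r => pure r

/-- Give a program that takes an iteration (or recursion) bound the time available as that bound.
If every iteration costs at least one step, then the bound is no restriction. -/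
def withFuel {α : Type} (p : ℕ → Prog α) : Prog α := fun mem t => p t mem t

/-- Unbounded loop: iterate `body` from `s` until it returns `Sum.inr r`, the result of the loop.
Each iteration costs one step on top of the cost of `body`. -/
def whileLoop {σ ρ : Type} (s : σ) (body : σ → Prog (σ ⊕ ρ)) : Prog ρ :=
  withFuel fun fuel => whileAux body fuel s

/-- `k` iterations of a counting loop with counter `i, i + 1, …` and loop variable `s`. -/
def foldAux {σ : Type} (body : ℕ → σ → Prog σ) : ℕ → ℕ → σ → Prog σ
  | 0, _, s => do
    tick
    pure s
  | k + 1, i, s => do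
    tick
    let s' ← body i s
    foldAux body k (i + 1) s'

/-- Counting loop over `lo ≤ i < hi` with a loop variable. Each iteration costs one step on top of
the cost of `body`, and so does the final test. -/
def foldLoop {σ : Type} (lo hi : ℕ) (s : σ) (body : ℕ → σ → Prog σ) : Prog σ :=
  foldAux body (hi - lo) lo s

/-- Counting loop over `lo ≤ i < hi`. -/
def forLoop (lo hi : ℕ) (body : ℕ → Prog Unit) : Prog Unit :=
  foldLoop lo hi () fun i _ => body i

/-- Increment a cell. -/
def incr (a : Arr) (i : ℕ) : Prog Unit := do
  let x ← read a i
  write a i (x + 1)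

/-- Decrement a cell. -/
def decr (a : Arr) (i : ℕ) : Prog Unit := do
  let x ← read a i
  write a i (x - 1)

/-- The endpoint of edge `e` other than `v`. -/
def other (e v : ℕ) : Prog ℕ := do
  let a ← read .src e
  let b ← read .dst e
  pure (if a = v then b else a)

/-! ### Sets with constant time insertion, deletion and access by position

The elements `x` of the set number `s` are in the cells `base, …, base + size s - 1` of the array
`item`, and cell `base + x` of `pos` holds the position of `x`. -/

def setInsert (item pos size : Arr) (s base x : ℕ) : Prog Unit := do
  let k ← read size s
  write item (base + k) x
  write pos (base + x) k
  write size s (k + 1)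

/-- The last element takes the place of the deleted one. -/
def setDelete (item pos size : Arr) (s base x : ℕ) : Prog Unit := do
  let k ← read size s
  let p ← read pos (base + x)
  let y ← read item (base + (k - 1))
  write item (base + p) y
  write pos (base + y) p
  write size s (k - 1)

/-! ### The dictionary

It maps a pair of a vertex `v` and a color `γ` to the edge at `v` colored by `γ`. The index
`v * width + γ` is split as `k * block + j` with `j < block`; range `k` is linked to a block array
as long as it contains an entry. The value `0` means "no entry", and edge `e` is stored as
`e + 1`. -/

/-- `width = d + 1` for the maximum degree `d` of the input graph, and `block` is the size of a
range. -/
structure Dict where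
  width : ℕ
  block : ℕ

/-- Initialize an empty dictionary with universe `U = n (d + 1) + 1` and capacity `M = 2 m`, where
`block` is the least `b ≥ 1` with `b ^ 2 ≥ U / M`. -/
def dictInit (n m d : ℕ) : Prog Dict := do
  let univ := n * (d + 1) + 1
  let cap := 2 * m
  let b ← whileLoop 1 fun b =>
    pure (if b * b * cap < univ ∧ b < univ then Sum.inl (b + 1) else Sum.inr b)
  forLoop 0 (univ / b + 1) fun k => do
    write .dictA k 0
    write .dictC k 0
  forLoop 0 (cap * b) fun i => write .dictB i 0
  forLoop 0 cap fun i => write .dictE i i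
  write .dictTop 0 cap
  pure { width := d + 1, block := b }

def dictSearch (D : Dict) (v γ : ℕ) : Prog ℕ := do
  let key := v * D.width + γ
  let a ← read .dictA (key / D.block)
  if a = 0 then pure 0
  else read .dictB ((a - 1) * D.block + key % D.block)

def dictInsert (D : Dict) (v γ e : ℕ) : Prog Unit := do
  let key := v * D.width + γ
  let k := key / D.block
  let a ← read .dictA k
  if a = 0 then
    let top ← read .dictTop 0
    let B ← read .dictE (top - 1)
    write .dictTop 0 (top - 1)
    write .dictA k (B + 1)
    write .dictB (B * D.block + key % D.block) (e + 1)
  else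
    write .dictB ((a - 1) * D.block + key % D.block) (e + 1)
  incr .dictC k

def dictDelete (D : Dict) (v γ : ℕ) : Prog Unit := do
  let key := v * D.width + γ
  let k := key / D.block
  let a ← read .dictA k
  if a = 0 then pure ()
  else
    let x ← read .dictB ((a - 1) * D.block + key % D.block)
    if x = 0 then pure ()
    else
      write .dictB ((a - 1) * D.block + key % D.block) 0
      decr .dictC k
      let c ← read .dictC k
      if c = 0 then
        write .dictA k 0
        let top ← read .dictTop 0
        write .dictE top (a - 1)
        write .dictTop 0 (top + 1)
      else pure ()

/-! ### Coloring and uncoloring single edges -/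

/-- Color `γ` is now used at `v`, by edge `e`: update the dictionary and `μ(v)`, the set of the
colors in `{1, …, deg v + 1}` that are missing at `v`. -/
def useColor (D : Dict) (v γ e : ℕ) : Prog Unit := do
  dictInsert D v γ e
  let g ← read .deg v
  if γ ≤ g + 1 then
    let o ← read .off v
    setDelete .mu .muPos .muSize v o γ
  else pure ()

/-- Color `γ` is no longer used at `v`. -/
def freeColor (D : Dict) (v γ : ℕ) : Prog Unit := do
  dictDelete D v γ
  let g ← read .deg v
  if γ ≤ g + 1 then
    let o ← read .off v
    setInsert .mu .muPos .muSize v o γ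
  else pure ()

/-- Color the uncolored edge `e` by `γ`. -/
def colorEdge (D : Dict) (e γ : ℕ) : Prog Unit := do
  write .col e γ
  setDelete .unc .uncPos .uncSize 0 0 e
  let u ← read .src e
  let v ← read .dst e
  useColor D u γ e
  useColor D v γ e

/-- Uncolor the colored edge `e`. -/
def uncolorEdge (D : Dict) (e : ℕ) : Prog Unit := do
  let γ ← read .col e
  write .col e 0
  setInsert .unc .uncPos .uncSize 0 0 e
  let u ← read .src e
  let v ← read .dst e
  freeColor D u γ
  freeColor D v γ

/-! ### Random-Color-One -/

/-- Make-Primed-Fan: build a fan with center `v` and leaves `x₀, …, x_k`, where `v x₀` is the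
uncolored edge `e₀`; the edge `v xᵢ` is stored in cell `i` of `fan`. The result is `(k, β, j)`: the
color `β` primes the fan, with `j = 0` if `β` is missing at `v`, and else `v x_j` has color `β`. -/
def makePrimedFan (D : Dict) (v e₀ : ℕ) : Prog (ℕ × ℕ × ℕ) := do
  write .fan 0 e₀
  let r ← whileLoop 0 fun k => do
    let e ← read .fan k
    let x ← other e v
    let o ← read .off x
    let β ← read .mu o
    let f ← dictSearch D v β
    if f = 0 then pure (Sum.inr (k, β, 0))
    else
      let j ← read .mark (f - 1)
      if j = 0 then
        write .fan (k + 1) (f - 1)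
        write .mark (f - 1) (k + 1)
        pure (Sum.inl (k + 1))
      else pure (Sum.inr (k, β, j))
  forLoop 1 (r.1 + 1) fun i => do
    let e ← read .fan i
    write .mark e 0
  pure r

/-- Shift the fan from `x_j` and color `v x_j` by `β`. -/
def shiftAndColor (D : Dict) (j β : ℕ) : Prog Unit := do
  forLoop 1 (j + 1) fun i => do
    let e ← read .fan i
    let γ ← read .col e
    uncolorEdge D e
    let e' ← read .fan (i - 1)
    colorEdge D e' γ
  let e ← read .fan j
  colorEdge D e β

/-- Flip the `αβ`-path that starts at `v`, where `α` is missing at `v`. The result is the other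
endpoint. -/
def flipPath (D : Dict) (v α β : ℕ) : Prog ℕ := do
  let r ← whileLoop (v, β, 0) fun s : ℕ × ℕ × ℕ => do
    let x := s.1
    let γ := s.2.1
    let k := s.2.2
    let f ← dictSearch D x γ
    if f = 0 then pure (Sum.inr (x, k))
    else
      write .path k (f - 1)
      let y ← other (f - 1) x
      pure (Sum.inl (y, if γ = β then α else β, k + 1))
  forLoop 0 r.2 fun i => do
    let e ← read .path i
    uncolorEdge D e
  forLoop 0 r.2 fun i => do
    let e ← read .path i
    colorEdge D e (if i % 2 = 0 then α else β)
  pure r.1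

/-- Activate-c-Fan, for the fan with center `v`, color `α` and leaves `x₀, …, x_k` that is primed
by `β` as recorded by `j`. -/
def activateFan (D : Dict) (v α k β j : ℕ) : Prog Unit := do
  if j = 0 then shiftAndColor D k β
  else
    let w ← flipPath D v α β
    let e ← read .fan (j - 1)
    let x ← other e v
    if w = x then shiftAndColor D k β
    else shiftAndColor D (j - 1) β

/-- Random-Color-One, in a subgraph of maximum degree `d` with available colors `1, …, d + 1`. -/
def randomColorOne (D : Dict) (d : ℕ) : Prog Unit := do
  let l ← read .uncSize 0
  let i ← rand l
  let e₀ ← read .unc i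
  let s ← rand 2
  let v ← read (if s = 0 then .src else .dst) e₀
  let c ← foldLoop 1 (d + 2) 0 fun γ c => do
    let f ← dictSearch D v γ
    if f = 0 then
      write .cand c γ
      pure (c + 1)
    else pure c
  let a ← rand c
  let α ← read .cand a
  let r ← makePrimedFan D v e₀
  activateFan D v α r.1 r.2.1 r.2.2

/-! ### The recursive strategy

A subgraph is given by the edges in the cells `lo, …, hi - 1` of `ord`. -/

/-- Compute the degrees and the non-isolated vertices of the subgraph, and reserve `deg v + 2` cells
for each of these vertices. The result is the maximum degree and the number of non-isolated
vertices. -/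
def scan (lo hi : ℕ) : Prog (ℕ × ℕ) := do
  forLoop lo hi fun i => do
    let e ← read .ord i
    let u ← read .src e
    let v ← read .dst e
    write .deg u 0
    write .deg v 0
  let visit : ℕ → ℕ × ℕ → Prog (ℕ × ℕ) := fun v s => do
    let g ← read .deg v
    write .deg v (g + 1)
    if g = 0 then
      write .verts s.2 v
      pure (max s.1 1, s.2 + 1)
    else pure (max s.1 (g + 1), s.2)
  let r ← foldLoop lo hi (0, 0) fun i s => do
    let e ← read .ord i
    let u ← read .src e
    let v ← read .dst e
    let s' ← visit u s
    visit v s'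
  let _ ← foldLoop 0 r.2 0 fun j o => do
    let v ← read .verts j
    write .off v o
    let g ← read .deg v
    pure (o + g + 2)
  pure r

/-- Remove a maximal tour that starts at `v`. The edges removed are assigned alternately to the two
halves of the segment, edge number `p` (counted over all tours) to cell `lo + p / 2` or
`mid + p / 2`. The result is the number of edges removed so far. -/
def tour (lo mid v p : ℕ) : Prog ℕ :=
  whileLoop (v, p) fun s : ℕ × ℕ => do
    let x := s.1
    let p := s.2
    let r ← read .rem x
    if r = 0 then pure (Sum.inr p)
    else
      let q ← read .ptr x
      let e ← read .adj (q - 1)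
      write .ptr x (q - 1)
      let z ← read .used e
      if z = 0 then
        write .used e 1
        let y ← other e x
        decr .rem x
        decr .rem y
        write .ord (if p % 2 = 0 then lo + p / 2 else mid + p / 2) e
        pure (Sum.inl (y, p + 1))
      else pure (Sum.inl (x, p))

/-- Partition: split the segment into `[lo, mid)` and `[mid, hi)` by an Euler partition. Tours start
at the vertices of odd degree first; then only closed tours are left. Uses the result `nv` of the
last `scan`. -/
def eulerPartition (lo mid hi nv : ℕ) : Prog Unit := do
  forLoop 0 nv fun j => do
    let v ← read .verts j
    let o ← read .off v
    write .ptr v o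
    let g ← read .deg v
    write .rem v g
  let attach : ℕ → ℕ → Prog Unit := fun v e => do
    let q ← read .ptr v
    write .adj q e
    write .ptr v (q + 1)
  forLoop lo hi fun i => do
    let e ← read .ord i
    write .used e 0
    let u ← read .src e
    let v ← read .dst e
    attach u e
    attach v e
  let p ← foldLoop 0 nv 0 fun j p => do
    let v ← read .verts j
    let r ← read .rem v
    if r % 2 = 1 then tour lo mid v p else pure p
  let _ ← foldLoop 0 nv p fun j p => do
    let v ← read .verts j
    tour lo mid v p

/-- Prune: as long as more than `q` of the colors `1, …, K` are used, uncolor all edges of a least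
common one among the used colors. Then rename the remaining colors to `1, …, q`. -/
def prune (lo hi K q : ℕ) : Prog Unit := do
  forLoop 1 (K + 1) fun γ => write .cnt γ 0
  forLoop lo hi fun i => do
    let e ← read .ord i
    let γ ← read .col e
    incr .cnt γ
  whileLoop () fun _ => do
    -- loop variables: number of used colors, a least common one, and the size of its class
    let r ← foldLoop 1 (K + 1) (0, 0, 0) fun γ (s : ℕ × ℕ × ℕ) => do
      let c ← read .cnt γ
      if c = 0 then pure s
      else if s.1 = 0 ∨ c < s.2.2 then pure (s.1 + 1, γ, c)
      else pure (s.1 + 1, s.2.1, s.2.2)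
    if r.1 ≤ q then pure (Sum.inr ())
    else
      forLoop lo hi fun i => do
        let e ← read .ord i
        let γ ← read .col e
        if γ = r.2.1 then write .col e 0 else pure ()
      write .cnt r.2.1 0
      pure (Sum.inl ())
  let _ ← foldLoop 1 (K + 1) 0 fun γ t => do
    let c ← read .cnt γ
    if c = 0 then pure t
    else
      write .lab γ (t + 1)
      pure (t + 1)
  forLoop lo hi fun i => do
    let e ← read .ord i
    let γ ← read .col e
    if γ = 0 then pure ()
    else
      let γ' ← read .lab γ
      write .col e γ'

/-- Repair: set up the data structures for the subgraph, call Random-Color-One until no edge is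
uncolored, and empty the dictionary. -/
def repair (D : Dict) (lo hi : ℕ) : Prog Unit := do
  let r ← scan lo hi
  forLoop 0 r.2 fun j => do
    let v ← read .verts j
    let g ← read .deg v
    let o ← read .off v
    write .muSize v 0
    forLoop 1 (g + 2) fun γ => setInsert .mu .muPos .muSize v o γ
  write .uncSize 0 0
  forLoop lo hi fun i => do
    let e ← read .ord i
    write .mark e 0
    let γ ← read .col e
    if γ = 0 then setInsert .unc .uncPos .uncSize 0 0 e
    else
      let u ← read .src e
      let v ← read .dst e
      useColor D u γ e
      useColor D v γ e
  whileLoop () fun _ => do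
    let l ← read .uncSize 0
    if l = 0 then pure (Sum.inr ())
    else
      randomColorOne D r.1
      pure (Sum.inl ())
  forLoop lo hi fun i => do
    let e ← read .ord i
    let γ ← read .col e
    let u ← read .src e
    let v ← read .dst e
    dictDelete D u γ
    dictDelete D v γ

/-- Random-Euler-Color on a subgraph of maximum degree `d`: color its edges by `1, …, d + 1`. The
result is `d`. Each call costs one step on top of the cost of its body. -/
def eulerColor (D : Dict) : ℕ → ℕ → ℕ → Prog ℕ
  | 0, _, _ => timeout
  | fuel + 1, lo, hi => do
    tick
    let r ← scan lo hi
    if r.1 ≤ 1 then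
      forLoop lo hi fun i => do
        let e ← read .ord i
        write .col e 1
      pure r.1
    else
      let mid := lo + (hi - lo + 1) / 2
      eulerPartition lo mid hi r.2
      let d₁ ← eulerColor D fuel lo mid
      let d₂ ← eulerColor D fuel mid hi
      forLoop mid hi fun i => do
        let e ← read .ord i
        let γ ← read .col e
        write .col e (γ + (d₁ + 1))
      prune lo hi ((d₁ + 1) + (d₂ + 1)) (r.1 + 1)
      repair D lo hi
      pure r.1

/-- Random-Euler-Color on the graph with vertices `0, …, n - 1` and `m` edges that is stored in the
arrays `src` and `dst`. The coloring is written to `col`. -/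
def randomEulerColor (n m : ℕ) : Prog Unit := do
  forLoop 0 m fun i => write .ord i i
  let r ← scan 0 m
  let D ← dictInit n m r.1
  let _ ← withFuel fun fuel => eulerColor D fuel 0 m

end

/-! ### Inputs, outputs and running time -/

/-- The edge list in the arrays `src` and `dst` lists each of the edges of `G` exactly once, in any
order and with the endpoints in any order. The rest of the memory is arbitrary. -/
def Represents (mem : Mem) {n : ℕ} (m : ℕ) (G : SimpleGraph (Fin n)) : Prop :=
  ∃ edge : Fin m ≃ G.edgeSet, ∀ i : Fin m,
    Sym2.map Fin.val (edge i : Sym2 (Fin n)) = s(mem .src i, mem .dst i)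

/-- The array `col` holds a proper edge-coloring with colors `1, …, q` of the graph given by the
first `m` cells of `src` and `dst` (of the memory `inp`). -/
def IsEdgeColoring (inp : Mem) (m q : ℕ) (out : Mem) : Prop :=
  (∀ i < m, 1 ≤ out .col i ∧ out .col i ≤ q) ∧
  ∀ i < m, ∀ j < m, i ≠ j →
    (∃ v, v ∈ s(inp .src i, inp .dst i) ∧ v ∈ s(inp .src j, inp .dst j)) →
    out .col i ≠ out .col j

/-- The probability that the program, started on `mem`, halts within `T` steps. -/
noncomputable def haltProb {α : Type} (p : Prog α) (mem : Mem) (T : ℕ) : ENNReal :=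
  (p mem T).toOuterMeasure {o | o ≠ none}

end EdgeColoring

set_option linter.unusedSimpArgs false
set_option linter.unusedVariables false

open scoped ENNReal

/-! Correctness is Vizing's fan argument: after at most one flip of an alternating path, some fan
can be shifted, and one more edge is colored (`runs_activateFan`). The running time is governed by
the lengths of the flipped paths.

A path that starts at `v` with `α` missing at `v` can be traced back from any of its edges, once the
direction of travel and the other color are known: walking backwards is forced, and it stops where
`α` is missing. So the lengths of all alternating paths, over all `(v, α, β)`, add up to at most `2
|E| d` (`state_inj`, `sum_pathLen_le`). A vertex with `k` uncolored edges misses more than `k`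
colors (`card_uncolored_lt_missing`). Hence, with `l` uncolored edges, a random uncolored edge, a
random endpoint and a random missing `α` give a path of expected length at most `|E| d / l`
(`avg_le`), and of length at most `n` in any case. It matters that the fan, and with it `β`, does
not depend on `α`.

The Euler partition gives degrees at most `(d + 3) / 2` (`runs_eulerPartition`), so at most four
color classes are pruned, and at most `4 s / (d + 2)` of the `s` edges are left to repair. Summing
`min (s d / i) n` over them yields a cost per edge of order `1 + min (n / d) (√d n^(1/4))`
(`repairCost_le`). The two bounds meet at `d = √n`, with value `√n`, and fall off geometrically on
both sides as `d` is halved from level to level. The potential `x / (1 + x)` with `x = √d / n^(1/4)`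
turns this sum into a telescoping one (`min_le_sub`, `edgeCost_step`). The other costs are at most
of order `n^(1/4)` per edge and level, and `n^(1/4) log m` is `O(√n)` (`edgeCost_le`).

For the tail bound, `Spec` controls the exponential moment of the running time with parameter `lam`,
where `lam = 1 / (93 n)` in the end. A flip along a path of length at most `n` then contributes an
exponent of at most `1`, where `exp y ≤ 1 + 2 y`; so the moment of one call is controlled by its
expected cost. Moment bounds multiply under composition, whatever the dependence between the parts.
The whole run has moment at most `exp (lam * O(m √n))`, and Markov's inequality bounds the
probability of not halting within `T` steps by `exp (-(T - O(m √n)) / (93 n))`. Since `n ≤ 2 m`, a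
large constant in `T` makes this at most `exp (-√m)`. Outcomes that violate the postcondition have
infinite weight, so the same inequality proves that every halting run is correct. -/

namespace EdgeColoring

/-! ### Deterministic runs -/

/-- The memory after writing `x` into cell `i` of array `a`. -/
def Mem.upd (m : Mem) (a : Arr) (i x : ℕ) : Mem :=
  Function.update m a (Function.update (m a) i x)

@[simp] lemma Mem.upd_same (m : Mem) (a : Arr) (i x : ℕ) :
    m.upd a i x a = Function.update (m a) i x := by simp [Mem.upd]

@[simp] lemma Mem.upd_of_ne (m : Mem) {a b : Arr} (i x : ℕ) (h : b ≠ a) :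
    m.upd a i x b = m b := by simp [Mem.upd, h]

/-- Started on `m`, the program `p` makes no random choices and halts after at most `c` steps, with a
result and a final memory that satisfy `Q`. -/
def Runs {α : Type} (p : Prog α) (m : Mem) (c : ℕ) (Q : α → Mem → Prop) : Prop :=
  ∃ a m' k, k ≤ c ∧ Q a m' ∧
    ∀ t, p m t = if k ≤ t then PMF.pure (some (a, m', t - k)) else PMF.pure none

section basic

variable {α β σ ρ : Type}

lemma Prog.bind_apply (p : Prog α) (f : α → Prog β) (m : Mem) (t : ℕ) :
    (p >>= f) m t = (p m t).bind fun o =>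
      match o with
      | none => PMF.pure none
      | some (a, m', t') => f a m' t' := rfl

lemma Prog.pure_apply (a : α) (m : Mem) (t : ℕ) :
    (pure a : Prog α) m t = PMF.pure (some (a, m, t)) := rfl

instance : LawfulMonad Prog := LawfulMonad.mk' _
  (fun p => by
    funext m t
    change (p m t).bind _ = p m t
    conv_rhs => rw [← PMF.bind_pure (p m t)]
    congr 1; funext o; rcases o with _ | ⟨a, m', t'⟩ <;> rfl)
  (fun a f => by funext m t; simp [Prog.bind_apply, Prog.pure_apply])
  (fun p f g => by
    funext m t
    simp only [Prog.bind_apply, PMF.bind_bind]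
    congr 1; funext o; rcases o with _ | ⟨a, m', t'⟩ <;> simp)

lemma Runs.mono {p : Prog α} {m : Mem} {c c' : ℕ} {Q Q' : α → Mem → Prop} (h : Runs p m c Q)
    (hc : c ≤ c') (hQ : ∀ a m', Q a m' → Q' a m') : Runs p m c' Q' := by
  obtain ⟨a, m', k, hk, hq, hr⟩ := h
  exact ⟨a, m', k, hk.trans hc, hQ _ _ hq, hr⟩

/-- The declared bound `c₁`, not the actual number of steps, is deducted from the budget, so that
the budget of `f` is the same for all results admitted by `Q`. -/
lemma Runs.bind {p : Prog α} {f : α → Prog β} {m : Mem} {c c₁ : ℕ} {Q : α → Mem → Prop}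
    {R : β → Mem → Prop} (h : Runs p m c₁ Q) (hc : c₁ ≤ c)
    (hf : ∀ a m', Q a m' → Runs (f a) m' (c - c₁) R) : Runs (p >>= f) m c R := by
  obtain ⟨a, m', k, hk, hq, hr⟩ := h
  obtain ⟨b, m'', k', hk', hq', hr'⟩ := hf a m' hq
  refine ⟨b, m'', k + k', by omega, hq', fun t => ?_⟩
  rw [Prog.bind_apply, hr]
  by_cases h : k ≤ t
  · rw [if_pos h, PMF.pure_bind]
    simp only
    rw [hr']
    by_cases h' : k' ≤ t - k
    · rw [if_pos h', if_pos (by omega), Nat.sub_sub]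
    · rw [if_neg h', if_neg (by omega)]
  · rw [if_neg h, PMF.pure_bind, if_neg (by omega)]

@[simp] lemma runs_pure (a : α) (m : Mem) (c : ℕ) (Q : α → Mem → Prop) :
    Runs (pure a) m c Q ↔ Q a m := by
  constructor
  · rintro ⟨b, m', k, hk, hq, hr⟩
    have := hr k
    rw [if_pos le_rfl, Prog.pure_apply] at this
    have h2 := congrArg PMF.support this
    simp only [PMF.support_pure, Set.singleton_eq_singleton_iff, Option.some.injEq,
      Prod.mk.injEq] at h2
    rw [h2.1, h2.2.1]; exact hq
  · intro h
    exact ⟨a, m, 0, Nat.zero_le _, h, fun t => by simp [Prog.pure_apply]⟩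

lemma tick_bind_apply (f : Unit → Prog α) (m : Mem) (t : ℕ) :
    (tick >>= f) m t = if 1 ≤ t then f () m (t - 1) else PMF.pure none := by
  cases t <;> simp [Prog.bind_apply, tick]

lemma runs_iff_of_tick {p q : Prog α} {m m' : Mem} {c : ℕ} {Q : α → Mem → Prop}
    (h : ∀ t, p m t = if 1 ≤ t then q m' (t - 1) else PMF.pure none) :
    Runs p m c Q ↔ 1 ≤ c ∧ Runs q m' (c - 1) Q := by
  constructor
  · rintro ⟨b, m'', k, hk, hq, hr⟩
    simp only [h] at hr
    -- With no time at all `p` times out, while `k = 0` would make it halt.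
    have h0 : 1 ≤ k := by
      by_contra h
      have := hr 0
      rw [if_neg (by omega), if_pos (by omega)] at this
      have h2 := congrArg PMF.support this
      simp at h2
    refine ⟨by omega, b, m'', k - 1, by omega, hq, fun t => ?_⟩
    have := hr (t + 1)
    rw [if_pos (by omega), Nat.add_sub_cancel] at this
    rw [this]
    by_cases h : k ≤ t + 1
    · rw [if_pos h, if_pos (by omega)]; congr 4; omega
    · rw [if_neg h, if_neg (by omega)]
  · rintro ⟨hc, b, m'', k, hk, hq, hr⟩
    refine ⟨b, m'', k + 1, by omega, hq, fun t => ?_⟩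
    rw [h]
    by_cases h : 1 ≤ t
    · rw [if_pos h, hr]
      by_cases h : k ≤ t - 1
      · rw [if_pos h, if_pos (by omega)]; congr 4; omega
      · rw [if_neg h, if_neg (by omega)]
    · rw [if_neg h, if_neg (by omega)]

@[simp] lemma runs_tick_bind (f : Unit → Prog α) (m : Mem) (c : ℕ) (Q : α → Mem → Prop) :
    Runs (tick >>= f) m c Q ↔ 1 ≤ c ∧ Runs (f ()) m (c - 1) Q :=
  runs_iff_of_tick (tick_bind_apply f m)

lemma read_bind_apply (a : Arr) (i : ℕ) (f : ℕ → Prog α) (m : Mem) (t : ℕ) :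
    (read a i >>= f) m t = if 1 ≤ t then f (m a i) m (t - 1) else PMF.pure none := by
  have h : read a i m t = if 1 ≤ t then PMF.pure (some (m a i, m, t - 1)) else PMF.pure none :=
    tick_bind_apply (fun _ mem t => PMF.pure (some (mem a i, mem, t))) m t
  rw [Prog.bind_apply, h]
  split_ifs <;> simp

lemma write_bind_apply (a : Arr) (i x : ℕ) (f : Unit → Prog α) (m : Mem) (t : ℕ) :
    (write a i x >>= f) m t = if 1 ≤ t then f () (m.upd a i x) (t - 1) else PMF.pure none := by
  have h : write a i x m t =
      if 1 ≤ t then PMF.pure (some ((), m.upd a i x, t - 1)) else PMF.pure none :=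
    tick_bind_apply (fun _ mem t => PMF.pure (some ((), mem.upd a i x, t))) m t
  rw [Prog.bind_apply, h]
  split_ifs <;> simp

@[simp] lemma runs_read_bind (a : Arr) (i : ℕ) (f : ℕ → Prog α) (m : Mem) (c : ℕ)
    (Q : α → Mem → Prop) :
    Runs (read a i >>= f) m c Q ↔ 1 ≤ c ∧ Runs (f (m a i)) m (c - 1) Q :=
  runs_iff_of_tick (read_bind_apply a i f m)

@[simp] lemma runs_write_bind (a : Arr) (i x : ℕ) (f : Unit → Prog α) (m : Mem) (c : ℕ)
    (Q : α → Mem → Prop) :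
    Runs (write a i x >>= f) m c Q ↔ 1 ≤ c ∧ Runs (f ()) (m.upd a i x) (c - 1) Q :=
  runs_iff_of_tick (write_bind_apply a i x f m)

@[simp] lemma runs_read (a : Arr) (i : ℕ) (m : Mem) (c : ℕ) (Q : ℕ → Mem → Prop) :
    Runs (read a i) m c Q ↔ 1 ≤ c ∧ Q (m a i) m := by
  rw [← bind_pure (read a i), runs_read_bind, runs_pure]

@[simp] lemma runs_write (a : Arr) (i x : ℕ) (m : Mem) (c : ℕ) (Q : Unit → Mem → Prop) :
    Runs (write a i x) m c Q ↔ 1 ≤ c ∧ Q () (m.upd a i x) := by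
  rw [← bind_pure (write a i x), runs_write_bind, runs_pure]

@[simp] lemma runs_ite (p : Prop) [Decidable p] (x y : Prog α) (m : Mem) (c : ℕ)
    (Q : α → Mem → Prop) :
    Runs (if p then x else y) m c Q ↔ (p → Runs x m c Q) ∧ (¬p → Runs y m c Q) := by
  split_ifs with h <;> simp [h]

/-- The endpoint of `e` other than `v`. -/
def oth (src dst : ℕ → ℕ) (e v : ℕ) : ℕ := if src e = v then dst e else src e

@[simp] lemma runs_other_bind (e v : ℕ) (f : ℕ → Prog α) (m : Mem) (c : ℕ) (Q : α → Mem → Prop) :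
    Runs (other e v >>= f) m c Q ↔
      2 ≤ c ∧ Runs (f (oth (m .src) (m .dst) e v)) m (c - 2) Q := by
  simp only [other, bind_assoc, runs_read_bind, pure_bind, Nat.sub_sub, oth]
  constructor
  · rintro ⟨h, h', h''⟩; exact ⟨by omega, h''⟩
  · rintro ⟨h, h'⟩; exact ⟨by omega, by omega, h'⟩

@[simp] lemma runs_incr_bind (a : Arr) (i : ℕ) (f : Unit → Prog α) (m : Mem) (c : ℕ)
    (Q : α → Mem → Prop) :
    Runs (incr a i >>= f) m c Q ↔ 2 ≤ c ∧ Runs (f ()) (m.upd a i (m a i + 1)) (c - 2) Q := by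
  simp only [incr, bind_assoc, runs_read_bind, runs_write_bind, Nat.sub_sub]
  constructor
  · rintro ⟨h, h', h''⟩; exact ⟨by omega, h''⟩
  · rintro ⟨h, h'⟩; exact ⟨by omega, by omega, h'⟩

@[simp] lemma runs_incr (a : Arr) (i : ℕ) (m : Mem) (c : ℕ) (Q : Unit → Mem → Prop) :
    Runs (incr a i) m c Q ↔ 2 ≤ c ∧ Q () (m.upd a i (m a i + 1)) := by
  rw [← bind_pure (incr a i), runs_incr_bind, runs_pure]

@[simp] lemma runs_decr_bind (a : Arr) (i : ℕ) (f : Unit → Prog α) (m : Mem) (c : ℕ)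
    (Q : α → Mem → Prop) :
    Runs (decr a i >>= f) m c Q ↔ 2 ≤ c ∧ Runs (f ()) (m.upd a i (m a i - 1)) (c - 2) Q := by
  simp only [decr, bind_assoc, runs_read_bind, runs_write_bind, Nat.sub_sub]
  constructor
  · rintro ⟨h, h', h''⟩; exact ⟨by omega, h''⟩
  · rintro ⟨h, h'⟩; exact ⟨by omega, by omega, h'⟩

/-! ### Loops -/

/-- Counting loop with a potential: `I i s m k` says that `k` steps suffice for the rest. -/
lemma runs_foldAux_pot {body : ℕ → σ → Prog σ} {Q : σ → Mem → Prop}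
    (I : ℕ → σ → Mem → ℕ → Prop) (k : ℕ) : ∀ (i : ℕ) (s : σ) (m : Mem) (c : ℕ),
    (∀ j s m c, i ≤ j → j < i + k → I j s m c →
      ∃ c₁, Runs (body j s) m c₁ fun s' m' => ∃ c', c' + c₁ + 1 ≤ c ∧ I (j + 1) s' m' c') →
    (∀ s m c, I (i + k) s m c → 1 ≤ c ∧ Q s m) →
    I i s m c → Runs (foldAux body k i s) m c Q := by
  induction k with
  | zero =>
    intro i s m c _ hQ h
    rw [foldAux, runs_tick_bind, runs_pure]
    exact hQ s m c h
  | succ k ih =>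
    intro i s m c hb hQ h
    obtain ⟨c₁, h1⟩ := hb i s m c le_rfl (by omega) h
    have h0 : c₁ + 1 ≤ c := by
      obtain ⟨_, _, _, _, ⟨_, h, _⟩, _⟩ := h1
      omega
    simp only [foldAux, runs_tick_bind]
    refine ⟨by omega, h1.bind (by omega) ?_⟩
    rintro s' m' ⟨c', hc', hI⟩
    refine (ih (i + 1) s' m' c' (fun j s m c hj hj' => hb j s m c (by omega) (by omega))
      (fun s m c h => hQ s m c (by rwa [show i + (k + 1) = i + 1 + k by ring])) hI).mono
      (by omega) fun _ _ h => h

lemma runs_foldLoop_pot {lo hi : ℕ} {s : σ} {m : Mem} {c : ℕ} {body : ℕ → σ → Prog σ}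
    {Q : σ → Mem → Prop} (I : ℕ → σ → Mem → ℕ → Prop) (hlo : lo ≤ hi) (h0 : I lo s m c)
    (hb : ∀ j s m c, lo ≤ j → j < hi → I j s m c →
      ∃ c₁, Runs (body j s) m c₁ fun s' m' => ∃ c', c' + c₁ + 1 ≤ c ∧ I (j + 1) s' m' c')
    (hQ : ∀ s m c, I hi s m c → 1 ≤ c ∧ Q s m) : Runs (foldLoop lo hi s body) m c Q :=
  runs_foldAux_pot I (hi - lo) lo s m c
    (fun j s m c hj hj' => hb j s m c hj (by omega))
    (fun s m c h => hQ s m c (by rwa [Nat.add_sub_cancel' hlo] at h)) h0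

lemma runs_foldLoop {lo hi : ℕ} {s : σ} {m : Mem} (b : ℕ) {body : ℕ → σ → Prog σ}
    (I : ℕ → σ → Mem → Prop) (hlo : lo ≤ hi) (h0 : I lo s m)
    (hb : ∀ j s m, lo ≤ j → j < hi → I j s m → Runs (body j s) m b (I (j + 1))) :
    Runs (foldLoop lo hi s body) m ((hi - lo) * (b + 1) + 1) (I hi) := by
  refine runs_foldLoop_pot (fun i s m c => I i s m ∧ (hi - i) * (b + 1) + 1 = c) hlo ⟨h0, rfl⟩
    (fun j s m c hj hj' h => ⟨b, (hb j s m hj hj' h.1).mono le_rfl fun s' m' h' =>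
      ⟨(hi - (j + 1)) * (b + 1) + 1, ?_, h', rfl⟩⟩) (fun s m c h => ⟨by omega, h.1⟩)
  rw [← h.2, show hi - j = hi - (j + 1) + 1 by omega]
  ring_nf; omega

lemma runs_forLoop {lo hi : ℕ} {m : Mem} (b : ℕ) {body : ℕ → Prog Unit}
    (I : ℕ → Mem → Prop) (hlo : lo ≤ hi) (h0 : I lo m)
    (hb : ∀ j m, lo ≤ j → j < hi → I j m → Runs (body j) m b fun _ => I (j + 1)) :
    Runs (forLoop lo hi body) m ((hi - lo) * (b + 1) + 1) fun _ => I hi :=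
  runs_foldLoop b (fun i _ m => I i m) hlo h0 fun j _ m h1 h2 h3 => hb j m h1 h2 h3

/-- Unbounded loop with a potential: `I s m k` says that `k` steps suffice for the rest. -/
lemma runs_whileLoop_pot {body : σ → Prog (σ ⊕ ρ)} {Q : ρ → Mem → ℕ → Prop} (I : σ → Mem → ℕ → Prop)
    (hb : ∀ s m c, I s m c → ∃ c₁ < c, Runs (body s) m c₁ fun r m' =>
      match r with
      | .inl s' => ∃ c', c' + c₁ + 1 ≤ c ∧ I s' m' c'
      | .inr r => ∃ c', c' + c₁ + 1 ≤ c ∧ Q r m' c') {s : σ} {m : Mem} {c : ℕ} (h : I s m c) :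
    ∃ c₁, Runs (whileLoop s body) m c₁ fun r m' => ∃ c', c' + c₁ ≤ c ∧ Q r m' c' := by
  -- Stated for every `fuel ≥ t`, so that the induction can pass to the rest of the loop: each
  -- iteration spends at least its tick, hence the fuel cannot run out before the time does.
  have key : ∀ c s m, I s m c → ∃ a m' k, (∃ c', c' + k ≤ c ∧ Q a m' c') ∧ ∀ fuel t, t ≤ fuel →
      whileAux body fuel s m t =
        if k ≤ t then PMF.pure (some (a, m', t - k)) else PMF.pure none := by
    intro c
    induction c using Nat.strong_induction_on with
    | _ c ih =>
    intro s m h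
    obtain ⟨c₁, hc₁, r, m', k, hk, hq, hr⟩ := hb s m c h
    rcases r with s' | r
    · obtain ⟨c', hc', h'⟩ := hq
      obtain ⟨a, m'', k', ⟨c'', hk', hq'⟩, hr'⟩ := ih c' (by omega) s' m' h'
      refine ⟨a, m'', k + k' + 1, ⟨c'', by omega, hq'⟩, fun fuel t ht => ?_⟩
      rcases fuel with _ | fuel
      · rw [if_neg (by omega)]; rfl
      · rw [whileAux, tick_bind_apply]
        by_cases h1 : 1 ≤ t
        · rw [if_pos h1, Prog.bind_apply, hr]
          by_cases h2 : k ≤ t - 1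
          · rw [if_pos h2, PMF.pure_bind]
            simp only
            rw [hr' _ _ (by omega)]
            by_cases h3 : k' ≤ t - 1 - k
            · rw [if_pos h3, if_pos (by omega)]; congr 4; omega
            · rw [if_neg h3, if_neg (by omega)]
          · rw [if_neg h2, PMF.pure_bind, if_neg (by omega)]
        · rw [if_neg h1, if_neg (by omega)]
    · obtain ⟨c', hc', h'⟩ := hq
      refine ⟨r, m', k + 1, ⟨c', by omega, h'⟩, fun fuel t ht => ?_⟩
      rcases fuel with _ | fuel
      · rw [if_neg (by omega)]; rfl
      · rw [whileAux, tick_bind_apply]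
        by_cases h1 : 1 ≤ t
        · rw [if_pos h1, Prog.bind_apply, hr]
          by_cases h2 : k ≤ t - 1
          · rw [if_pos h2, PMF.pure_bind, if_pos (by omega)]
            simp only [Prog.pure_apply]; congr 4; omega
          · rw [if_neg h2, PMF.pure_bind, if_neg (by omega)]
        · rw [if_neg h1, if_neg (by omega)]
  obtain ⟨a, m', k, hq, hr⟩ := key c s m h
  exact ⟨k, a, m', k, le_rfl, hq, fun t => hr t t le_rfl⟩

lemma runs_whileLoop {body : σ → Prog (σ ⊕ ρ)} {Q : ρ → Mem → Prop} (I : σ → Mem → ℕ → Prop)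
    (hb : ∀ s m c, I s m c → ∃ c₁ < c, Runs (body s) m c₁ fun r m' =>
      match r with
      | .inl s' => ∃ c', c' + c₁ + 1 ≤ c ∧ I s' m' c'
      | .inr r => Q r m') {s : σ} {m : Mem} {c : ℕ} (h : I s m c) :
    Runs (whileLoop s body) m c Q := by
  obtain ⟨c₁, a, m', k, hk, ⟨c', hc', hq⟩, hr⟩ := runs_whileLoop_pot (Q := fun r m _ => Q r m) I
    (fun s m c h => by
      obtain ⟨c₁, hc₁, hr⟩ := hb s m c h
      refine ⟨c₁, hc₁, hr.mono le_rfl ?_⟩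
      rintro (s' | r) m' h'
      · exact h'
      · exact ⟨0, by omega, h'⟩) h
  exact ⟨a, m', k, by omega, hq, hr⟩

end basic

/-! ### Exponential moments of running times -/

section spec

variable {α β σ ρ : Type}

/-- The expectation of `w` under `μ`. -/
noncomputable def ev (μ : PMF α) (w : α → ℝ≥0∞) : ℝ≥0∞ := ∑' o, μ o * w o

lemma ev_bind (μ : PMF α) (g : α → PMF β) (w : β → ℝ≥0∞) :
    ev (μ.bind g) w = ev μ fun a => ev (g a) w := by
  simp only [ev, PMF.bind_apply, ← ENNReal.tsum_mul_right, ← ENNReal.tsum_mul_left]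
  rw [ENNReal.tsum_comm]
  simp only [mul_assoc]

@[simp] lemma ev_pure (a : α) (w : α → ℝ≥0∞) : ev (PMF.pure a) w = w a := by
  rw [ev, tsum_eq_single a fun b hb => by simp [PMF.pure_apply, hb]]
  simp

lemma ev_const_mul (μ : PMF α) (c : ℝ≥0∞) (w : α → ℝ≥0∞) :
    ev μ (fun a => c * w a) = c * ev μ w := by
  simp only [ev, ← ENNReal.tsum_mul_left]
  exact tsum_congr fun a => by ring

lemma ev_mono {μ : PMF α} {w w' : α → ℝ≥0∞} (h : ∀ a ∈ μ.support, w a ≤ w' a) :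
    ev μ w ≤ ev μ w' := by
  refine ENNReal.tsum_le_tsum fun a => ?_
  by_cases ha : μ a = 0
  · simp [ha]
  · exact mul_le_mul_right (h a ((PMF.mem_support_iff _ _).2 ha)) _

lemma le_ev (μ : PMF α) (w : α → ℝ≥0∞) (a : α) : μ a * w a ≤ ev μ w :=
  ENNReal.le_tsum a

open Classical in
/-- The weight of an outcome: running out of time weighs `1`, halting with `t` steps left over
weighs `exp (-lam * t)`, and halting in violation of `Q` is forbidden. -/
noncomputable def wt (lam : ℝ) (Q : α → Mem → Prop) : Option (α × Mem × ℕ) → ℝ≥0∞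
  | none => 1
  | some (a, m, t) => if Q a m then ENNReal.ofReal (Real.exp (-lam * t)) else ⊤

/-- The expected weight of the outcome of a run with `T` steps available is at most
`M * exp (-lam * T)`. -/
def SpecAt (lam : ℝ) (μ : PMF (Option (α × Mem × ℕ))) (T : ℕ) (M : ℝ) (Q : α → Mem → Prop) :
    Prop :=
  ev μ (wt lam Q) ≤ ENNReal.ofReal (M * Real.exp (-lam * T)) ∧
    ∀ a m' t, some (a, m', t) ∈ μ.support → t ≤ T

/-- Started on `m`, the program `p` satisfies `Q` whenever it halts, and the exponential moment of its
running time with parameter `lam` is at most `M`. -/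
def Spec (lam : ℝ) (p : Prog α) (m : Mem) (M : ℝ) (Q : α → Mem → Prop) : Prop :=
  1 ≤ M ∧ ∀ T, SpecAt lam (p m T) T M Q

variable {lam : ℝ}

lemma SpecAt.mono {μ : PMF (Option (α × Mem × ℕ))} {T : ℕ} {M M' : ℝ} {Q Q' : α → Mem → Prop}
    (h : SpecAt lam μ T M Q) (hM : M ≤ M') (hQ : ∀ a m', Q a m' → Q' a m') :
    SpecAt lam μ T M' Q' := by
  refine ⟨le_trans (ev_mono fun o _ => ?_) (h.1.trans ?_), h.2⟩
  · rcases o with _ | ⟨a, m, t⟩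
    · exact le_rfl
    · by_cases hq : Q a m
      · simp [wt, hq, hQ _ _ hq]
      · simp [wt, hq]
  · exact ENNReal.ofReal_le_ofReal (mul_le_mul_of_nonneg_right hM (Real.exp_pos _).le)

lemma Spec.mono {p : Prog α} {m : Mem} {M M' : ℝ} {Q Q' : α → Mem → Prop}
    (h : Spec lam p m M Q) (hM : M ≤ M') (hQ : ∀ a m', Q a m' → Q' a m') :
    Spec lam p m M' Q' :=
  ⟨h.1.trans hM, fun T => (h.2 T).mono hM hQ⟩

/-- A violating outcome has weight `⊤`, so a finite expected weight keeps it out of the support.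
Partial correctness is thus part of the moment bound. -/
lemma SpecAt.post {μ : PMF (Option (α × Mem × ℕ))} {T : ℕ} {M : ℝ} {Q : α → Mem → Prop}
    (h : SpecAt lam μ T M Q) {a : α} {m : Mem} {t : ℕ} (hs : some (a, m, t) ∈ μ.support) :
    Q a m := by
  by_contra hq
  have h1 := (le_ev μ (wt lam Q) (some (a, m, t))).trans h.1
  rw [wt, if_neg hq, ENNReal.mul_top ((PMF.mem_support_iff _ _).1 hs)] at h1
  exact ENNReal.ofReal_ne_top (top_le_iff.1 h1)

/-- Markov's inequality: the outcome `none` contributes its probability times the weight `1`. -/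
lemma SpecAt.prob_none {μ : PMF (Option (α × Mem × ℕ))} {T : ℕ} {M : ℝ} {Q : α → Mem → Prop}
    (h : SpecAt lam μ T M Q) : μ none ≤ ENNReal.ofReal (M * Real.exp (-lam * T)) := by
  simpa [wt] using (le_ev μ (wt lam Q) none).trans h.1

lemma SpecAt.none {T : ℕ} {M : ℝ} {Q : α → Mem → Prop} (h : 1 ≤ M * Real.exp (-lam * T)) :
    SpecAt lam (PMF.pure (none : Option (α × Mem × ℕ))) T M Q := by
  refine ⟨?_, by simp⟩
  rw [ev_pure, wt]
  simpa using h

/-- If the first part leaves `t` steps, the rest weighs at most `M' * exp (-lam * t)`, which is `M'`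
times the weight of the intermediate outcome. A timeout of the first part keeps its weight `1`,
whence `1 ≤ M'`. The second part is only run with `t ≤ T`, which the recursion needs for its depth
bound. -/
lemma SpecAt.bind {p : Prog α} {f : α → Prog β} {m : Mem} {T : ℕ} {M M' : ℝ}
    {Q : α → Mem → Prop} {R : β → Mem → Prop} (h : SpecAt lam (p m T) T M Q)
    (hM' : 1 ≤ M') (hf : ∀ a m' t, t ≤ T → Q a m' → SpecAt lam (f a m' t) t M' R) :
    SpecAt lam ((p >>= f) m T) T (M * M') R := by
  constructor
  · rw [Prog.bind_apply, ev_bind]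
    have h1 : ev (p m T) (fun o => ENNReal.ofReal M' * wt lam Q o) ≤
        ENNReal.ofReal (M * M' * Real.exp (-lam * T)) := by
      rw [ev_const_mul, show M * M' * Real.exp (-lam * T) = M' * (M * Real.exp (-lam * T)) by ring,
        ENNReal.ofReal_mul (by linarith)]
      exact mul_le_mul_right h.1 _
    refine (ev_mono fun o ho => ?_).trans h1
    rcases o with _ | ⟨a, m', t⟩
    · simp [wt, hM']
    · have hq := h.post ho
      refine (hf a m' t (h.2 _ _ _ ho) hq).1.trans ?_
      rw [wt, if_pos hq, ENNReal.ofReal_mul (by linarith)]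
  · intro b m'' t'' hs
    rw [Prog.bind_apply, PMF.mem_support_bind_iff] at hs
    obtain ⟨o, ho, hs⟩ := hs
    rcases o with _ | ⟨a, m', t⟩
    · simp at hs
    · exact ((hf a m' t (h.2 _ _ _ ho) (h.post ho)).2 _ _ _ hs).trans (h.2 _ _ _ ho)

lemma Spec.bind {p : Prog α} {f : α → Prog β} {m : Mem} {M M' : ℝ}
    {Q : α → Mem → Prop} {R : β → Mem → Prop} (h : Spec lam p m M Q)
    (hM' : 1 ≤ M') (hf : ∀ a m', Q a m' → Spec lam (f a) m' M' R) :
    Spec lam (p >>= f) m (M * M') R :=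
  ⟨one_le_mul_of_one_le_of_one_le h.1 hM',
    fun T => (h.2 T).bind hM' fun a m' t _ hq => (hf a m' hq).2 t⟩

lemma Runs.spec {p : Prog α} {m : Mem} {c : ℕ} {Q : α → Mem → Prop} (h : Runs p m c Q)
    (hl : 0 ≤ lam) : Spec lam p m (Real.exp (lam * c)) Q := by
  refine ⟨Real.one_le_exp (by positivity), fun T => ?_⟩
  obtain ⟨a, m', k, hk, hq, hr⟩ := h
  have hkc : (k : ℝ) ≤ c := by exact_mod_cast hk
  rw [hr]
  split_ifs with hT
  · constructor
    · rw [ev_pure, wt, if_pos hq, ← Real.exp_add]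
      refine ENNReal.ofReal_le_ofReal (Real.exp_le_exp.2 ?_)
      rw [Nat.cast_sub hT]
      nlinarith
    · simp only [PMF.support_pure, Set.mem_singleton_iff, Option.some.injEq, Prod.mk.injEq]
      rintro a m' t ⟨-, -, rfl⟩
      omega
  · apply SpecAt.none
    rw [← Real.exp_add]
    apply Real.one_le_exp
    have : (T : ℝ) ≤ k := by exact_mod_cast (by omega : T ≤ k)
    nlinarith

lemma SpecAt.tick_bind {f : Unit → Prog α} {m : Mem} {T : ℕ} {M : ℝ} {Q : α → Mem → Prop}
    (hl : 0 ≤ lam) (hM : 1 ≤ M) (h : 1 ≤ T → SpecAt lam (f () m (T - 1)) (T - 1) M Q) :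
    SpecAt lam ((tick >>= f) m T) T (Real.exp lam * M) Q := by
  rw [tick_bind_apply]
  split_ifs with hT
  · obtain ⟨h1, h2⟩ := h hT
    refine ⟨h1.trans_eq ?_, fun a m' t hs => (h2 a m' t hs).trans (by omega)⟩
    rw [Nat.cast_sub hT, mul_comm (Real.exp lam), mul_assoc, ← Real.exp_add]
    push_cast
    ring_nf
  · apply SpecAt.none
    rw [show T = 0 by omega]
    simpa using one_le_mul_of_one_le_of_one_le (Real.one_le_exp hl) hM

lemma rand_bind_apply {k : ℕ} (hk : 0 < k) (f : ℕ → Prog α) (m : Mem) (T : ℕ) :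
    (rand k >>= f) m T = if 1 ≤ T then
      (PMF.uniformOfFinset (Finset.range k) (Finset.nonempty_range_iff.2 hk.ne')).bind
        fun i => f i m (T - 1)
      else PMF.pure none := by
  have h : rand k m T = if 1 ≤ T then
      (PMF.uniformOfFinset (Finset.range k) (Finset.nonempty_range_iff.2 hk.ne')).map
        fun i => some (i, m, T - 1)
      else PMF.pure none := by
    refine (tick_bind_apply _ m T).trans ?_
    have e : (if h : (Finset.range k).Nonempty then
        fun mem t => (PMF.uniformOfFinset (Finset.range k) h).map fun i => some (i, mem, t)
        else timeout : Prog ℕ) = fun mem t => (PMF.uniformOfFinset (Finset.range k)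
          (Finset.nonempty_range_iff.2 hk.ne')).map fun i => some (i, mem, t) :=
      dif_pos (Finset.nonempty_range_iff.2 hk.ne')
    by_cases hT : 1 ≤ T
    · rw [if_pos hT, if_pos hT]; exact congrFun (congrFun e m) (T - 1)
    · rw [if_neg hT, if_neg hT]
  rw [Prog.bind_apply, h]
  split_ifs
  · rw [PMF.bind_map]; rfl
  · simp

/-- The bounds may depend on the drawn value, and their average enters. This is the only source of
expected path lengths. -/
lemma Spec.rand_bind {k : ℕ} (hk : 0 < k) {f : ℕ → Prog α} {m : Mem} {M : ℕ → ℝ}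
    {Q : α → Mem → Prop} (hl : 0 ≤ lam) (h : ∀ i < k, Spec lam (f i) m (M i) Q) :
    Spec lam (rand k >>= f) m (Real.exp lam * ((∑ i ∈ Finset.range k, M i) / k)) Q := by
  have hk' : (0 : ℝ) < k := by exact_mod_cast hk
  have hM : 1 ≤ (∑ i ∈ Finset.range k, M i) / k := by
    rw [le_div_iff₀ hk', one_mul]
    simpa using Finset.card_nsmul_le_sum (Finset.range k) M 1
      fun i hi => (h i (Finset.mem_range.1 hi)).1
  refine ⟨one_le_mul_of_one_le_of_one_le (Real.one_le_exp hl) hM, fun T => ?_⟩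
  rw [rand_bind_apply hk]
  split_ifs with hT
  · constructor
    · rw [ev_bind, ev, tsum_eq_sum (s := Finset.range k) fun i hi => by
        rw [PMF.uniformOfFinset_apply_of_notMem _ hi, zero_mul]]
      have h1 : ∀ i ∈ Finset.range k, (PMF.uniformOfFinset (Finset.range k)
          (Finset.nonempty_range_iff.2 hk.ne')) i * ev (f i m (T - 1)) (wt lam Q) ≤
          ENNReal.ofReal (M i / k * Real.exp (-lam * (T - 1 : ℕ))) := by
        intro i hi
        rw [PMF.uniformOfFinset_apply_of_mem _ hi, Finset.card_range]
        refine (mul_le_mul_right ((h i (Finset.mem_range.1 hi)).2 _).1 _).trans_eq ?_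
        rw [← ENNReal.ofReal_natCast, ← ENNReal.ofReal_inv_of_pos hk',
          ← ENNReal.ofReal_mul (by positivity)]
        congr 1; field_simp
      refine (Finset.sum_le_sum h1).trans ?_
      rw [← ENNReal.ofReal_sum_of_nonneg fun i hi => by
        have := (h i (Finset.mem_range.1 hi)).1
        positivity]
      apply ENNReal.ofReal_le_ofReal
      rw [← Finset.sum_mul, ← Finset.sum_div, Nat.cast_sub hT, mul_comm (Real.exp lam), mul_assoc,
        ← Real.exp_add]
      push_cast
      exact le_of_eq (by ring_nf)
    · intro a m' t hs
      rw [PMF.mem_support_bind_iff] at hs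
      obtain ⟨i, hi, hs⟩ := hs
      rw [PMF.mem_support_uniformOfFinset_iff, Finset.mem_range] at hi
      exact (((h i hi).2 _).2 _ _ _ hs).trans (by omega)
  · apply SpecAt.none
    rw [show T = 0 by omega]
    simpa using one_le_mul_of_one_le_of_one_le (Real.one_le_exp hl) hM

/-- An unbounded loop with a counter `l` that every iteration decreases by one. -/
lemma Spec.whileLoop {body : σ → Prog (σ ⊕ ρ)} {Q : ρ → Mem → Prop} (hl : 0 ≤ lam)
    (I : ℕ → σ → Mem → Prop) {B₀ : ℝ} {B : ℕ → ℝ}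
    (h0 : ∀ s m, I 0 s m → Spec lam (body s) m B₀ fun r m' => ∃ q, r = .inr q ∧ Q q m')
    {l : ℕ} {s : σ} {m : Mem} (h : I l s m) (hB₀ : 1 ≤ B₀) (hB : ∀ i < l, 1 ≤ B i)
    (hs : ∀ i s m, i < l → I (i + 1) s m →
      Spec lam (body s) m (B i) fun r m' => ∃ s', r = .inl s' ∧ I i s' m') :
    Spec lam (whileLoop s body) m (Real.exp lam * (B₀ * ∏ i ∈ Finset.range l, Real.exp lam * B i))
      Q := by
  have key : ∀ k ≤ l, 1 ≤ B₀ * ∏ i ∈ Finset.range k, Real.exp lam * B i ∧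
      ∀ s m, I k s m → ∀ fuel T, T ≤ fuel → SpecAt lam (whileAux body fuel s m T) T
      (Real.exp lam * (B₀ * ∏ i ∈ Finset.range k, Real.exp lam * B i)) Q := by
    intro k hk
    induction k with
    | zero =>
      simp only [Finset.range_zero, Finset.prod_empty, mul_one]
      refine ⟨hB₀, fun s m hI fuel T hT => ?_⟩
      rcases fuel with _ | fuel
      · apply SpecAt.none
        rw [show T = 0 by omega]
        simpa using one_le_mul_of_one_le_of_one_le (Real.one_le_exp hl) hB₀
      · rw [whileAux]
        refine SpecAt.tick_bind hl hB₀ fun _ => ?_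
        rw [← mul_one B₀]
        refine ((h0 s m hI).2 _).bind le_rfl ?_
        rintro _ m' t _ ⟨q, rfl, hq⟩
        have := ((runs_pure q m' 0 Q).2 hq).spec hl
        simpa using this.2 t
    | succ k ih =>
      obtain ⟨hM, ih⟩ := ih (by omega)
      have h1 := hB k (by omega)
      have h2 : B₀ * ∏ i ∈ Finset.range (k + 1), Real.exp lam * B i =
          B k * (Real.exp lam * (B₀ * ∏ i ∈ Finset.range k, Real.exp lam * B i)) := by
        rw [Finset.prod_range_succ]; ring
      have h3 := one_le_mul_of_one_le_of_one_le (Real.one_le_exp hl) hM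
      rw [h2]
      have h4 := one_le_mul_of_one_le_of_one_le h1 h3
      refine ⟨h4, fun s m hI fuel T hT => ?_⟩
      rcases fuel with _ | fuel
      · apply SpecAt.none
        rw [show T = 0 by omega]
        simpa using one_le_mul_of_one_le_of_one_le (Real.one_le_exp hl) h4
      · rw [whileAux]
        refine SpecAt.tick_bind hl h4 fun _ => ?_
        refine ((hs k s m (by omega) hI).2 _).bind h3 ?_
        rintro _ m' t ht ⟨s', rfl, hI'⟩
        exact ih s' m' hI' _ _ (by omega)
  exact ⟨one_le_mul_of_one_le_of_one_le (Real.one_le_exp hl) (key l le_rfl).1,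
    fun T => (key l le_rfl).2 s m h T T le_rfl⟩

end spec

/-! ### Sets -/

/-- The cells of `item` and `pos` from `base` on represent the set `S` of size `k`. -/
structure IsSet (item pos : ℕ → ℕ) (k base : ℕ) (S : Finset ℕ) : Prop where
  card : S.card = k
  pos_lt : ∀ x ∈ S, pos (base + x) < k
  item_pos : ∀ x ∈ S, item (base + pos (base + x)) = x
  item_mem : ∀ i < k, item (base + i) ∈ S
  pos_item : ∀ i < k, pos (base + item (base + i)) = i

namespace IsSet

variable {item pos item' pos' : ℕ → ℕ} {k base x : ℕ} {S : Finset ℕ}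

lemma congr (h : IsSet item pos k base S) {b : ℕ} (hS : ∀ x ∈ S, x < b) (hk : k ≤ b)
    (hi : ∀ i, base ≤ i → i < base + b → item' i = item i)
    (hp : ∀ i, base ≤ i → i < base + b → pos' i = pos i) : IsSet item' pos' k base S := by
  have hp' : ∀ x ∈ S, pos' (base + x) = pos (base + x) := fun x hx =>
    hp _ (by omega) (by have := hS x hx; omega)
  have hi' : ∀ i < k, item' (base + i) = item (base + i) := fun i hk' =>
    hi _ (by omega) (by omega)
  refine ⟨h.card, fun x hx => ?_, fun x hx => ?_, fun i hi => ?_, fun i hi => ?_⟩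
  · rw [hp' x hx]; exact h.pos_lt x hx
  · rw [hp' x hx, hi' _ (h.pos_lt x hx)]; exact h.item_pos x hx
  · rw [hi' i hi]; exact h.item_mem i hi
  · rw [hi' i hi, hp' _ (h.item_mem i hi)]; exact h.pos_item i hi

lemma empty : IsSet item pos 0 base ∅ := ⟨rfl, by simp, by simp, by simp, by simp⟩

lemma insert (h : IsSet item pos k base S) (hx : x ∉ S) :
    IsSet (Function.update item (base + k) x) (Function.update pos (base + x) k) (k + 1) base
      (insert x S) := by
  have hne : ∀ y ∈ S, y ≠ x := fun y hy e => hx (e ▸ hy)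
  refine ⟨by rw [Finset.card_insert_of_notMem hx, h.card], fun y hy => ?_, fun y hy => ?_,
    fun i hi => ?_, fun i hi => ?_⟩
  · rcases Finset.mem_insert.1 hy with rfl | hy
    · simp
    · have := h.pos_lt y hy
      simp [hne y hy]; omega
  · rcases Finset.mem_insert.1 hy with rfl | hy
    · simp
    · have := h.pos_lt y hy
      simp [hne y hy, this.ne, h.item_pos y hy]
  · rcases Nat.lt_succ_iff_lt_or_eq.1 hi with hi | rfl
    · simp [hi.ne, h.item_mem i hi]
    · simp
  · rcases Nat.lt_succ_iff_lt_or_eq.1 hi with hi | rfl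
    · simp [hi.ne, hne _ (h.item_mem i hi), h.pos_item i hi]
    · simp

lemma erase (h : IsSet item pos k base S) (hx : x ∈ S) :
    IsSet (Function.update item (base + pos (base + x)) (item (base + (k - 1))))
      (Function.update pos (base + item (base + (k - 1))) (pos (base + x))) (k - 1) base
      (S.erase x) := by
  have hp := h.pos_lt x hx
  have hlast : k - 1 < k := by omega
  have inj : ∀ i < k, ∀ j < k, item (base + i) = item (base + j) → i = j := fun i hi j hj e => by
    rw [← h.pos_item i hi, e, h.pos_item j hj]
  have hpi := h.item_pos x hx
  refine ⟨by rw [Finset.card_erase_of_mem hx, h.card], fun y hy => ?_, fun y hy => ?_,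
    fun i hi => ?_, fun i hi => ?_⟩
  · obtain ⟨hyx, hy⟩ := Finset.mem_erase.1 hy
    have h1 := h.pos_lt y hy
    have h2 := h.item_pos y hy
    by_cases hyl : y = item (base + (k - 1))
    · rw [← hyl]
      simp only [Function.update_self]
      have : pos (base + x) ≠ k - 1 := fun e => hyx (by rw [hyl, ← e, hpi])
      omega
    · rw [Function.update_of_ne (by omega)]
      have : pos (base + y) ≠ k - 1 := fun e => hyl (by rw [← h2, e])
      omega
  · obtain ⟨hyx, hy⟩ := Finset.mem_erase.1 hy
    by_cases hyl : y = item (base + (k - 1))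
    · rw [← hyl]; simp
    · have h2 := h.item_pos y hy
      rw [Function.update_of_ne (by omega : base + y ≠ base + item (base + (k - 1)))]
      rw [Function.update_of_ne, h2]
      intro e
      exact hyx (by rw [← h2, e, hpi])
  · rw [Finset.mem_erase]
    by_cases e : i = pos (base + x)
    · subst e
      simp only [Function.update_self]
      refine ⟨fun e => ?_, h.item_mem _ hlast⟩
      have := inj _ hlast _ hp (by rw [e, hpi])
      omega
    · rw [Function.update_of_ne (by omega)]
      refine ⟨fun e' => e ?_, h.item_mem _ (by omega)⟩
      exact inj _ (by omega) _ hp (by rw [e', hpi])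
  · by_cases e : i = pos (base + x)
    · subst e; simp
    · rw [Function.update_of_ne (by omega : base + i ≠ _), Function.update_of_ne,
        h.pos_item i (by omega)]
      intro e'
      have := inj i (by omega) (k - 1) hlast (by omega)
      omega

end IsSet

/-! ### The dictionary -/

lemma mul_add_inj {b q r q' r' : ℕ} (hr : r < b) (hr' : r' < b) (h : q * b + r = q' * b + r') :
    q = q' ∧ r = r' := by
  have h1 : (q * b + r) / b = q := by
    rw [mul_comm, Nat.mul_add_div (by omega), Nat.div_eq_of_lt hr, add_zero]
  have h2 : (q' * b + r') / b = q' := by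
    rw [mul_comm, Nat.mul_add_div (by omega), Nat.div_eq_of_lt hr', add_zero]
  have h3 : q = q' := by rw [← h1, h, h2]
  subst h3
  exact ⟨rfl, by omega⟩

/-- The value of `f` at `(k, j)` is changed to `x`. -/
def upd2 (f : ℕ → ℕ → ℕ) (k j x : ℕ) : ℕ → ℕ → ℕ :=
  fun k' j' => if k' = k ∧ j' = j then x else f k' j'

@[simp] lemma upd2_same (f : ℕ → ℕ → ℕ) (k j x : ℕ) : upd2 f k j x k j = x := by simp [upd2]

lemma upd2_of_ne (f : ℕ → ℕ → ℕ) {k j k' j' : ℕ} (x : ℕ) (h : ¬(k' = k ∧ j' = j)) :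
    upd2 f k j x k' j' = f k' j' := by simp [upd2, h]

/-- The arrays of the dictionary, with ranges `0, …, N - 1` of size `b` and `cap` blocks, represent
the table `f`, where `f k j` is the entry number `j` of range `k`. -/
structure DictRep (b cap N : ℕ) (A C B E : ℕ → ℕ) (top : ℕ) (f : ℕ → ℕ → ℕ) : Prop where
  free : ∀ k < N, A k = 0 → ∀ j < b, f k j = 0
  cnt : ∀ k < N, C k = ((Finset.range b).filter fun j => f k j ≠ 0).card
  pos : ∀ k < N, A k ≠ 0 → C k ≠ 0
  val : ∀ k < N, A k ≠ 0 → ∀ j < b, B ((A k - 1) * b + j) = f k j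
  inj : ∀ k < N, ∀ k' < N, A k ≠ 0 → A k = A k' → k = k'
  unused_inj : ∀ i < top, ∀ i' < top, E i = E i' → i = i'
  unused_ne : ∀ i < top, ∀ k < N, A k ≠ E i + 1
  unused_zero : ∀ i < top, ∀ j < b, B (E i * b + j) = 0
  top_eq : top + ((Finset.range N).filter fun k => A k ≠ 0).card = cap

namespace DictRep

variable {b cap N : ℕ} {A C B E : ℕ → ℕ} {top : ℕ} {f : ℕ → ℕ → ℕ}

/-- Every linked range holds at least one entry, so fewer than `cap` entries leave some block
unused. A capacity of two entries per edge therefore suffices. -/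
lemma top_pos (h : DictRep b cap N A C B E top f) (hc : ∑ k ∈ Finset.range N, C k < cap) :
    0 < top := by
  have h1 : ((Finset.range N).filter fun k => A k ≠ 0).card ≤ ∑ k ∈ Finset.range N, C k := by
    rw [Finset.card_filter]
    refine Finset.sum_le_sum fun k hk => ?_
    split_ifs with h0
    · have := h.pos k (Finset.mem_range.1 hk) h0; omega
    · exact Nat.zero_le _
  have := h.top_eq
  omega

lemma card_upd2_of_zero {k j x : ℕ} (hj : j < b) (h0 : f k j = 0) (hx : x ≠ 0) :
    ((Finset.range b).filter fun i => upd2 f k j x k i ≠ 0).card =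
      ((Finset.range b).filter fun i => f k i ≠ 0).card + 1 := by
  rw [← Finset.card_insert_of_notMem (a := j) (by simp [h0])]
  congr 1
  ext i
  simp only [upd2, Finset.mem_filter, Finset.mem_insert, Finset.mem_range, true_and]
  by_cases e : i = j
  · simp [e, hj, hx]
  · simp [e]

lemma card_upd2_zero {k j : ℕ} (hj : j < b) (h0 : f k j ≠ 0) :
    ((Finset.range b).filter fun i => upd2 f k j 0 k i ≠ 0).card =
      ((Finset.range b).filter fun i => f k i ≠ 0).card - 1 := by
  rw [← Finset.card_erase_of_mem (a := j) (by simp [h0, hj])]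
  congr 1
  ext i
  simp only [upd2, Finset.mem_filter, Finset.mem_erase, Finset.mem_range, true_and]
  by_cases e : i = j
  · simp [e]
  · simp [e]

lemma insert_old (h : DictRep b cap N A C B E top f) {k j x : ℕ} (hk : k < N) (hj : j < b)
    (h0 : f k j = 0) (hx : x ≠ 0) (hA : A k ≠ 0) :
    DictRep b cap N A (Function.update C k (C k + 1))
      (Function.update B ((A k - 1) * b + j) x) E top (upd2 f k j x) := by
  refine ⟨fun k' hk' hA' j' hj' => ?_, fun k' hk' => ?_, fun k' hk' hA' => ?_,
    fun k' hk' hA' j' hj' => ?_, h.inj, h.unused_inj, h.unused_ne, fun i hi j' hj' => ?_,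
    h.top_eq⟩
  · have : k' ≠ k := fun e => hA (e ▸ hA')
    rw [upd2_of_ne _ _ (by tauto)]; exact h.free k' hk' hA' j' hj'
  · by_cases e : k' = k
    · subst e
      rw [card_upd2_of_zero hj h0 hx, Function.update_self, h.cnt _ hk]
    · simp only [upd2, e, false_and, if_false, Function.update_of_ne e, ne_eq,
        h.cnt k' hk']
  · by_cases e : k' = k
    · subst e; simp
    · rw [Function.update_of_ne e]; exact h.pos k' hk' hA'
  · by_cases e : k' = k ∧ j' = j
    · obtain ⟨rfl, rfl⟩ := e; simp
    · rw [upd2_of_ne _ _ e, Function.update_of_ne, h.val k' hk' hA' j' hj']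
      intro e'
      obtain ⟨e1, e2⟩ := mul_add_inj hj' hj e'
      exact e ⟨h.inj _ hk' _ hk hA' (by omega), e2⟩
  · rw [Function.update_of_ne, h.unused_zero i hi j' hj']
    intro e'
    have := h.unused_ne i hi k hk
    have := (mul_add_inj hj' hj e').1
    omega

/-- A fresh block needs no clearing, because unused blocks are kept filled with zeros. -/
lemma insert_new (h : DictRep b cap N A C B E top f) {k j x : ℕ} (hk : k < N) (hj : j < b)
    (hx : x ≠ 0) (hA : A k = 0) (ht : 0 < top) :
    DictRep b cap N (Function.update A k (E (top - 1) + 1)) (Function.update C k (C k + 1))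
      (Function.update B (E (top - 1) * b + j) x) E (top - 1) (upd2 f k j x) := by
  have hlt : top - 1 < top := by omega
  have h0 : f k j = 0 := h.free k hk hA j hj
  refine ⟨fun k' hk' hA' j' hj' => ?_, fun k' hk' => ?_, fun k' hk' hA' => ?_,
    fun k' hk' hA' j' hj' => ?_, fun k' hk' k'' hk'' hA' e => ?_,
    fun i hi i' hi' e => h.unused_inj i (by omega) i' (by omega) e, fun i hi k' hk' => ?_,
    fun i hi j' hj' => ?_, ?_⟩
  · have hne : k' ≠ k := fun e => by simp [e] at hA'
    rw [Function.update_of_ne hne] at hA'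
    rw [upd2_of_ne _ _ (by tauto)]; exact h.free k' hk' hA' j' hj'
  · by_cases e : k' = k
    · subst e
      rw [card_upd2_of_zero hj h0 hx, Function.update_self, h.cnt _ hk]
    · simp only [upd2, e, false_and, if_false, Function.update_of_ne e, ne_eq,
        h.cnt k' hk']
  · by_cases e : k' = k
    · subst e; simp
    · rw [Function.update_of_ne e] at hA' ⊢; exact h.pos k' hk' hA'
  · by_cases e : k' = k
    · subst e
      simp only [Function.update_self, Nat.add_sub_cancel]
      by_cases e : j' = j
      · subst e; simp
      · rw [upd2_of_ne _ _ (by tauto), Function.update_of_ne (by omega), h.unused_zero _ hlt _ hj',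
          h.free _ hk hA _ hj']
    · rw [Function.update_of_ne e] at hA' ⊢
      rw [upd2_of_ne _ _ (by tauto), Function.update_of_ne, h.val k' hk' hA' j' hj']
      intro e'
      have := h.unused_ne _ hlt k' hk'
      have := (mul_add_inj hj' hj e').1
      omega
  · by_cases e1 : k' = k <;> by_cases e2 : k'' = k
    · rw [e1, e2]
    · subst e1
      rw [Function.update_self, Function.update_of_ne e2] at e
      exact absurd e.symm (h.unused_ne _ hlt _ hk'')
    · subst e2
      rw [Function.update_self, Function.update_of_ne e1] at e
      exact absurd e (h.unused_ne _ hlt _ hk')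
    · rw [Function.update_of_ne e1] at e hA'
      rw [Function.update_of_ne e2] at e
      exact h.inj _ hk' _ hk'' hA' e
  · by_cases e : k' = k
    · subst e
      simp only [Function.update_self, ne_eq, Nat.add_right_cancel_iff]
      intro e
      have := h.unused_inj _ hlt _ (by omega) e
      omega
    · rw [Function.update_of_ne e]; exact h.unused_ne i (by omega) k' hk'
  · rw [Function.update_of_ne, h.unused_zero i (by omega) j' hj']
    intro e'
    have := h.unused_inj _ hlt _ (by omega) (mul_add_inj hj' hj e').1.symm
    omega
  · have h1 := h.top_eq
    have h2 : ((Finset.range N).filter fun k' => Function.update A k (E (top - 1) + 1) k' ≠ 0) =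
        insert k ((Finset.range N).filter fun k' => A k' ≠ 0) := by
      ext k'
      simp only [Finset.mem_filter, Finset.mem_insert, Finset.mem_range]
      by_cases e : k' = k
      · subst e; simp [hk]
      · simp [e]
    rw [h2, Finset.card_insert_of_notMem (by simp [hA])]
    omega

lemma delete_keep (h : DictRep b cap N A C B E top f) {k j : ℕ} (hk : k < N) (hj : j < b)
    (h0 : f k j ≠ 0) (hC : C k - 1 ≠ 0) :
    DictRep b cap N A (Function.update C k (C k - 1))
      (Function.update B ((A k - 1) * b + j) 0) E top (upd2 f k j 0) := by
  have hA : A k ≠ 0 := fun e => h0 (h.free k hk e j hj)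
  refine ⟨fun k' hk' hA' j' hj' => ?_, fun k' hk' => ?_, fun k' hk' hA' => ?_,
    fun k' hk' hA' j' hj' => ?_, h.inj, h.unused_inj, h.unused_ne, fun i hi j' hj' => ?_,
    h.top_eq⟩
  · have : k' ≠ k := fun e => hA (e ▸ hA')
    rw [upd2_of_ne _ _ (by tauto)]; exact h.free k' hk' hA' j' hj'
  · by_cases e : k' = k
    · subst e
      rw [card_upd2_zero hj h0, Function.update_self, h.cnt _ hk]
    · simp only [upd2, e, false_and, if_false, Function.update_of_ne e, ne_eq,
        h.cnt k' hk']
  · by_cases e : k' = k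
    · subst e; simpa using hC
    · rw [Function.update_of_ne e]; exact h.pos k' hk' hA'
  · by_cases e : k' = k ∧ j' = j
    · obtain ⟨rfl, rfl⟩ := e; simp
    · rw [upd2_of_ne _ _ e, Function.update_of_ne, h.val k' hk' hA' j' hj']
      intro e'
      obtain ⟨e1, e2⟩ := mul_add_inj hj' hj e'
      exact e ⟨h.inj _ hk' _ hk hA' (by omega), e2⟩
  · rw [Function.update_apply, h.unused_zero i hi j' hj', ite_self]

/-- A counter that reaches zero certifies that the deleted entry was the last one of its range, so
the block goes back to the unused ones filled with zeros. -/
lemma delete_last (h : DictRep b cap N A C B E top f) {k j : ℕ} (hk : k < N) (hj : j < b)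
    (h0 : f k j ≠ 0) (hC : C k - 1 = 0) :
    DictRep b cap N (Function.update A k 0) (Function.update C k (C k - 1))
      (Function.update B ((A k - 1) * b + j) 0) (Function.update E top (A k - 1)) (top + 1)
      (upd2 f k j 0) := by
  have hA : A k ≠ 0 := fun e => h0 (h.free k hk e j hj)
  have hz : ∀ j' < b, upd2 f k j 0 k j' = 0 := by
    have := card_upd2_zero hj h0
    rw [← h.cnt k hk, hC, Finset.card_eq_zero, Finset.filter_eq_empty_iff] at this
    intro j' hj'
    simpa using this (Finset.mem_range.2 hj')
  have hBz : ∀ j' < b, Function.update B ((A k - 1) * b + j) 0 ((A k - 1) * b + j') = 0 := by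
    intro j' hj'
    by_cases e : j' = j
    · subst e; simp
    · rw [Function.update_of_ne (by omega), h.val k hk hA j' hj', ← hz j' hj',
        upd2_of_ne _ _ (by tauto)]
  refine ⟨fun k' hk' hA' j' hj' => ?_, fun k' hk' => ?_, fun k' hk' hA' => ?_,
    fun k' hk' hA' j' hj' => ?_, fun k' hk' k'' hk'' hA' e => ?_,
    fun i hi i' hi' e => ?_, fun i hi k' hk' => ?_,
    fun i hi j' hj' => ?_, ?_⟩
  · by_cases e : k' = k
    · subst e; exact hz j' hj'
    · rw [Function.update_of_ne e] at hA'
      rw [upd2_of_ne _ _ (by tauto)]; exact h.free k' hk' hA' j' hj'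
  · by_cases e : k' = k
    · subst e
      rw [card_upd2_zero hj h0, Function.update_self, h.cnt _ hk]
    · simp only [upd2, e, false_and, if_false, Function.update_of_ne e, ne_eq,
        h.cnt k' hk']
  · have e : k' ≠ k := fun e => by simp [e] at hA'
    rw [Function.update_of_ne e] at hA' ⊢; exact h.pos k' hk' hA'
  · have e : k' ≠ k := fun e => by simp [e] at hA'
    rw [Function.update_of_ne e] at hA' ⊢
    rw [upd2_of_ne _ _ (by tauto), Function.update_of_ne, h.val k' hk' hA' j' hj']
    intro e'
    exact e (h.inj _ hk' _ hk hA' (by have := (mul_add_inj hj' hj e').1; omega))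
  · have e1 : k' ≠ k := fun e => by simp [e] at hA'
    rw [Function.update_of_ne e1] at hA' e
    have e2 : k'' ≠ k := fun e' => by rw [e', Function.update_self] at e; exact hA' e
    rw [Function.update_of_ne e2] at e
    exact h.inj _ hk' _ hk'' hA' e
  · by_cases e1 : i = top <;> by_cases e2 : i' = top
    · rw [e1, e2]
    · subst e1
      rw [Function.update_self, Function.update_of_ne e2] at e
      have := h.unused_ne i' (by omega) k hk
      omega
    · subst e2
      rw [Function.update_self, Function.update_of_ne e1] at e
      have := h.unused_ne i (by omega) k hk
      omega
    · rw [Function.update_of_ne e1, Function.update_of_ne e2] at e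
      exact h.unused_inj _ (by omega) _ (by omega) e
  · by_cases e : k' = k
    · subst e; simp
    · rw [Function.update_of_ne e]
      by_cases e1 : i = top
      · subst e1
        rw [Function.update_self]
        intro e'
        exact e (h.inj _ hk' _ hk (by omega) (by omega))
      · rw [Function.update_of_ne e1]
        exact h.unused_ne i (by omega) k' hk'
  · by_cases e1 : i = top
    · subst e1
      rw [Function.update_self]; exact hBz j' hj'
    · rw [Function.update_of_ne e1, Function.update_apply, h.unused_zero i (by omega) j' hj',
        ite_self]
  · have h1 := h.top_eq
    have h2 : ((Finset.range N).filter fun k' => Function.update A k 0 k' ≠ 0) =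
        ((Finset.range N).filter fun k' => A k' ≠ 0).erase k := by
      ext k'
      simp only [Finset.mem_filter, Finset.mem_erase, Finset.mem_range]
      by_cases e : k' = k
      · subst e; simp
      · simp [e]
    have h3 : k ∈ (Finset.range N).filter fun k' => A k' ≠ 0 := by simp [hk, hA]
    have h4 := Finset.card_pos.2 ⟨k, h3⟩
    rw [h2, Finset.card_erase_of_mem h3]
    omega

end DictRep

/-! ### The dictionary as a part of the memory -/

lemma sum_update_range {N k x : ℕ} (C : ℕ → ℕ) (hk : k < N) :
    ∑ i ∈ Finset.range N, Function.update C k x i + C k = ∑ i ∈ Finset.range N, C i + x := by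
  rw [Finset.sum_update_of_mem (Finset.mem_range.2 hk),
    ← Finset.add_sum_erase _ _ (Finset.mem_range.2 hk), Finset.sdiff_singleton_eq_erase]
  omega

/-- All arrays outside of `S` are the same. -/
def Frame (S : List Arr) (m m' : Mem) : Prop := ∀ a, a ∉ S → m' a = m a

lemma Frame.refl (S : List Arr) (m : Mem) : Frame S m m := fun _ _ => rfl

lemma Frame.trans {S : List Arr} {m m' m'' : Mem} (h : Frame S m m') (h' : Frame S m' m'') :
    Frame S m m'' := fun a ha => (h' a ha).trans (h a ha)

lemma Frame.mono {S S' : List Arr} {m m' : Mem} (h : Frame S m m') (hs : S ⊆ S') :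
    Frame S' m m' := fun a ha => h a fun h' => ha (hs h')

lemma Frame.upd {S : List Arr} {m m' : Mem} (h : Frame S m m') {a : Arr} (ha : a ∈ S) (i x : ℕ) :
    Frame S m (m'.upd a i x) := fun b hb => by
  rw [Mem.upd_of_ne _ _ _ (by rintro rfl; exact hb ha)]; exact h b hb

/-- Parameters of the dictionary: it has `N` ranges and `cap` blocks, and serves a graph with
vertices `0, …, n - 1` and the colors `1, …, D.width`. -/
structure DictSize (D : Dict) (n N : ℕ) : Prop where
  block_pos : 0 < D.block
  keys : n * D.width < N * D.block

/-- The dictionary stored in the memory represents the table `tbl` on vertices and colors, and has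
`cnt` entries. -/
def DictHas (D : Dict) (n cap N : ℕ) (m : Mem) (tbl : ℕ → ℕ → ℕ) (cnt : ℕ) : Prop :=
  ∃ f, DictRep D.block cap N (m .dictA) (m .dictC) (m .dictB) (m .dictE) (m .dictTop 0) f ∧
    (∀ v < n, ∀ γ, 1 ≤ γ → γ ≤ D.width →
      f ((v * D.width + γ) / D.block) ((v * D.width + γ) % D.block) = tbl v γ) ∧
    ∑ k ∈ Finset.range N, m .dictC k = cnt

/-- The arrays of the dictionary. -/
abbrev dictArrs : List Arr := [.dictA, .dictC, .dictB, .dictE, .dictTop]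

section dict

variable {D : Dict} {n cap N : ℕ} {m m' : Mem} {tbl : ℕ → ℕ → ℕ} {cnt v γ e : ℕ}

lemma DictSize.range_lt (hD : DictSize D n N) (hv : v < n) (hγ : γ ≤ D.width) :
    (v * D.width + γ) / D.block < N := by
  rw [Nat.div_lt_iff_lt_mul hD.block_pos]
  have := hD.keys
  have : (v + 1) * D.width ≤ n * D.width := Nat.mul_le_mul_right _ hv
  rw [add_mul] at this
  omega

lemma DictSize.mod_lt (hD : DictSize D n N) (k : ℕ) : k % D.block < D.block :=
  Nat.mod_lt _ hD.block_pos

/-- Colors start at `1`, so `γ - 1` is a digit in base `W`, and the key determines the pair. -/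
lemma key_inj {W v γ v' γ' b : ℕ} (h1 : 1 ≤ γ) (h2 : γ ≤ W) (h1' : 1 ≤ γ')
    (h2' : γ' ≤ W)
    (h : (v * W + γ) / b = (v' * W + γ') / b ∧ (v * W + γ) % b = (v' * W + γ') % b) :
    v = v' ∧ γ = γ' := by
  have h3 : v * W + γ = v' * W + γ' := by
    rw [← Nat.div_add_mod (v * W + γ) b, h.1, h.2, Nat.div_add_mod]
  have := mul_add_inj (b := W) (q := v) (q' := v') (r := γ - 1) (r' := γ' - 1) (by omega) (by omega)
    (by omega)
  omega

lemma DictHas.congr (h : DictHas D n cap N m tbl cnt) (hA : m' .dictA = m .dictA)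
    (hC : m' .dictC = m .dictC) (hB : m' .dictB = m .dictB) (hE : m' .dictE = m .dictE)
    (hT : m' .dictTop = m .dictTop) : DictHas D n cap N m' tbl cnt := by
  rw [DictHas, hA, hC, hB, hE, hT]; exact h

/-- With no entries, no range can be linked, whatever the table was supposed to be. Code that
empties the dictionary thus only has to count its deletions. -/
lemma DictHas.empty (h : DictHas D n cap N m tbl 0) (hD : DictSize D n N) :
    DictHas D n cap N m (fun _ _ => 0) 0 := by
  obtain ⟨f, hf, -, hc⟩ := h
  refine ⟨f, hf, fun v hv γ h1 h2 => ?_, hc⟩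
  have hk := hD.range_lt hv h2
  refine hf.free _ hk ?_ _ (hD.mod_lt _)
  by_contra hA
  exact hf.pos _ hk hA ((Finset.sum_eq_zero_iff.1 hc) _ (Finset.mem_range.2 hk))

lemma runs_dictSearch (h : DictHas D n cap N m tbl cnt) (hD : DictSize D n N) (hv : v < n)
    (h1 : 1 ≤ γ) (h2 : γ ≤ D.width) :
    Runs (dictSearch D v γ) m 2 fun a m' => a = tbl v γ ∧ m' = m := by
  obtain ⟨f, hf, ht, -⟩ := h
  have hk := hD.range_lt hv h2
  have hj := hD.mod_lt (v * D.width + γ)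
  simp only [dictSearch, runs_read_bind, runs_ite, runs_pure, runs_read, and_true]
  refine ⟨by norm_num, fun h0 => ?_, fun h0 => ⟨by norm_num, ?_⟩⟩
  · rw [← ht v hv γ h1 h2, hf.free _ hk h0 _ hj]
  · rw [← ht v hv γ h1 h2, hf.val _ hk h0 _ hj]

lemma runs_dictInsert (h : DictHas D n cap N m tbl cnt) (hD : DictSize D n N) (hv : v < n)
    (h1 : 1 ≤ γ) (h2 : γ ≤ D.width) (h0 : tbl v γ = 0) (hc : cnt < cap) :
    Runs (dictInsert D v γ e) m 8 fun _ m' =>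
      DictHas D n cap N m' (upd2 tbl v γ (e + 1)) (cnt + 1) ∧ Frame dictArrs m m' := by
  obtain ⟨f, hf, ht, hs⟩ := h
  have hk := hD.range_lt hv h2
  have hj := hD.mod_lt (v * D.width + γ)
  have ht' : ∀ v' < n, ∀ γ', 1 ≤ γ' → γ' ≤ D.width →
      upd2 f ((v * D.width + γ) / D.block) ((v * D.width + γ) % D.block) (e + 1)
        ((v' * D.width + γ') / D.block) ((v' * D.width + γ') % D.block) =
      upd2 tbl v γ (e + 1) v' γ' := by
    intro v' hv' γ' h1' h2'
    by_cases hE : v' = v ∧ γ' = γ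
    · obtain ⟨rfl, rfl⟩ := hE; simp
    · rw [upd2_of_ne _ _ hE, upd2_of_ne, ht v' hv' γ' h1' h2']
      exact fun hE' => hE (key_inj h1' h2' h1 h2 hE')
  have hs' := sum_update_range (x := m .dictC ((v * D.width + γ) / D.block) + 1) (m .dictC) hk
  simp only [dictInsert, runs_read_bind, runs_ite, runs_write_bind, runs_incr]
  refine ⟨by norm_num, fun hA => ⟨by norm_num, by norm_num, by norm_num, by norm_num, by norm_num,
    by norm_num, ⟨_, ?_, ht', ?_⟩, ?_⟩, fun hA => ⟨by norm_num, by norm_num, ⟨_, ?_, ht', ?_⟩, ?_⟩⟩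
  · simpa using hf.insert_new hk hj (Nat.succ_ne_zero e) hA (hf.top_pos (hs ▸ hc))
  · simp; omega
  · refine Frame.upd (Frame.upd (Frame.upd (Frame.upd (Frame.refl _ _) ?_ _ _) ?_ _ _) ?_ _ _) ?_ _ _
      <;> simp
  · simpa using hf.insert_old hk hj (by rw [ht v hv γ h1 h2, h0]) (Nat.succ_ne_zero e) hA
  · simp; omega
  · refine Frame.upd (Frame.upd (Frame.refl _ _) ?_ _ _) ?_ _ _ <;> simp

lemma runs_dictDelete (h : DictHas D n cap N m tbl cnt) (hD : DictSize D n N) (hv : v < n)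
    (h1 : 1 ≤ γ) (h2 : γ ≤ D.width) (h0 : tbl v γ ≠ 0) :
    Runs (dictDelete D v γ) m 10 fun _ m' => 1 ≤ cnt ∧
      DictHas D n cap N m' (upd2 tbl v γ 0) (cnt - 1) ∧ Frame dictArrs m m' := by
  obtain ⟨f, hf, ht, hs⟩ := h
  have hk := hD.range_lt hv h2
  have hj := hD.mod_lt (v * D.width + γ)
  have hf0 : f ((v * D.width + γ) / D.block) ((v * D.width + γ) % D.block) ≠ 0 := by
    rwa [ht v hv γ h1 h2]
  have hA : m .dictA ((v * D.width + γ) / D.block) ≠ 0 := fun hA => hf0 (hf.free _ hk hA _ hj)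
  have hx := hf.val _ hk hA _ hj
  have hC := hf.pos _ hk hA
  have ht' : ∀ v' < n, ∀ γ', 1 ≤ γ' → γ' ≤ D.width →
      upd2 f ((v * D.width + γ) / D.block) ((v * D.width + γ) % D.block) 0
        ((v' * D.width + γ') / D.block) ((v' * D.width + γ') % D.block) =
      upd2 tbl v γ 0 v' γ' := by
    intro v' hv' γ' h1' h2'
    by_cases hE : v' = v ∧ γ' = γ
    · obtain ⟨rfl, rfl⟩ := hE; simp
    · rw [upd2_of_ne _ _ hE, upd2_of_ne, ht v' hv' γ' h1' h2']
      exact fun hE' => hE (key_inj h1' h2' h1 h2 hE')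
  have hs' := sum_update_range (x := m .dictC ((v * D.width + γ) / D.block) - 1) (m .dictC) hk
  simp only [dictDelete, runs_read_bind, runs_ite, runs_write_bind, runs_decr_bind, runs_pure,
    runs_write, Mem.upd_same, Mem.upd_of_ne, ne_eq, reduceCtorEq, not_false_eq_true,
    Function.update_self]
  refine ⟨by norm_num, fun h => absurd h hA, fun _ => ⟨by norm_num, fun h => absurd (hx ▸ h) hf0,
    fun _ => ⟨by norm_num, by norm_num, by norm_num, fun hC' => ⟨by norm_num, by norm_num,
      by norm_num, by norm_num, by omega, ⟨_, ?_, ht', ?_⟩, ?_⟩,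
      fun hC' => ⟨by omega, ⟨_, ?_, ht', ?_⟩, ?_⟩⟩⟩⟩
  · simpa using hf.delete_last hk hj hf0 hC'
  · simp; omega
  · refine Frame.upd (Frame.upd (Frame.upd (Frame.upd (Frame.upd (Frame.refl _ _) ?_ _ _) ?_ _ _) ?_ _ _) ?_ _ _) ?_ _ _
      <;> simp
  · simpa using hf.delete_keep hk hj hf0 hC'
  · simp; omega
  · refine Frame.upd (Frame.upd (Frame.refl _ _) ?_ _ _) ?_ _ _ <;> simp

end dict

/-! ### Partial colorings and their representation -/

/-- The vertex `v` is an endpoint of the edge `e`. -/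
def Inc (src dst : ℕ → ℕ) (v e : ℕ) : Prop := src e = v ∨ dst e = v

instance (src dst : ℕ → ℕ) (v e : ℕ) : Decidable (Inc src dst v e) :=
  inferInstanceAs (Decidable (_ ∨ _))

/-- A subgraph with edges `E` that is being colored with the colors `1, …, d + 1`, together with the
layout of its data structures. -/
structure Ctx where
  D : Dict
  n : ℕ
  cap : ℕ
  N : ℕ
  d : ℕ
  src : ℕ → ℕ
  dst : ℕ → ℕ
  E : Finset ℕ
  off : ℕ → ℕ
  colOut : ℕ → ℕ

/-- The degree of `v` in the graph with edges `E`. -/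
def degIn (src dst : ℕ → ℕ) (E : Finset ℕ) (v : ℕ) : ℕ := (E.filter (Inc src dst v)).card

/-- The edges in `E` form a simple graph on the vertices `0, …, n - 1`. -/
structure SimpleEdges (n : ℕ) (src dst : ℕ → ℕ) (E : Finset ℕ) : Prop where
  lt : ∀ e ∈ E, ∀ v, Inc src dst v e → v < n
  ne : ∀ e ∈ E, src e ≠ dst e
  eq : ∀ e ∈ E, ∀ e' ∈ E, ∀ u v, u ≠ v → Inc src dst u e → Inc src dst v e → Inc src dst u e' →
    Inc src dst v e' → e = e'

lemma SimpleEdges.subset {n : ℕ} {src dst : ℕ → ℕ} {E E' : Finset ℕ}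
    (h : SimpleEdges n src dst E) (hs : E' ⊆ E) : SimpleEdges n src dst E' :=
  ⟨fun e he => h.lt e (hs he), fun e he => h.ne e (hs he),
    fun e he e' he' => h.eq e (hs he) e' (hs he')⟩

namespace Ctx

variable (X : Ctx)

abbrev Inc (v e : ℕ) : Prop := EdgeColoring.Inc X.src X.dst v e

abbrev deg (v : ℕ) : ℕ := degIn X.src X.dst X.E v

structure Valid : Prop where
  size : DictSize X.D X.n X.N
  width : X.d + 1 ≤ X.D.width
  cap : 2 * X.E.card ≤ X.cap
  graph : SimpleEdges X.n X.src X.dst X.E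
  deg_le : ∀ v, X.deg v ≤ X.d
  off : ∀ u v, X.deg u ≠ 0 → X.deg v ≠ 0 → u ≠ v →
    X.off u + X.deg u + 2 ≤ X.off v ∨ X.off v + X.deg v + 2 ≤ X.off u

variable {X}

lemma deg_ne_zero {e v : ℕ} (he : e ∈ X.E) (hv : X.Inc v e) : X.deg v ≠ 0 :=
  Finset.card_ne_zero_of_mem (Finset.mem_filter.2 ⟨he, hv⟩)

/-- The color `γ` is missing at `v` in the partial coloring `c`. -/
def Miss (X : Ctx) (c : ℕ → ℕ) (v γ : ℕ) : Prop := ∀ e, X.Inc v e → c e ≠ γ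

/-- The table `tbl` contains the colored edge with a given color at a given vertex. -/
def Rel (X : Ctx) (c : ℕ → ℕ) (tbl : ℕ → ℕ → ℕ) : Prop :=
  ∀ v γ e, 1 ≤ γ → (tbl v γ = e + 1 ↔ X.Inc v e ∧ c e = γ)

lemma Rel.zero_iff {c : ℕ → ℕ} {tbl : ℕ → ℕ → ℕ} (h : X.Rel c tbl) {v γ : ℕ} (hγ : 1 ≤ γ) :
    tbl v γ = 0 ↔ X.Miss c v γ := by
  constructor
  · intro h0 e he hc
    have := (h v γ e hγ).2 ⟨he, hc⟩
    omega
  · intro hm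
    by_contra h0
    obtain ⟨e, he⟩ := Nat.exists_eq_succ_of_ne_zero h0
    obtain ⟨h1, h2⟩ := (h v γ e hγ).1 he
    exact hm e h1 h2

/-- A partial coloring is proper. -/
def Proper (X : Ctx) (c : ℕ → ℕ) : Prop :=
  ∀ e e' v, X.Inc v e → X.Inc v e' → c e = c e' → c e ≠ 0 → e = e'

lemma Rel.proper {c : ℕ → ℕ} {tbl : ℕ → ℕ → ℕ} (h : X.Rel c tbl) : X.Proper c := by
  intro e e' v he he' hc h0
  have h1 := (h v (c e) e (by omega)).2 ⟨he, rfl⟩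
  have h2 := (h v (c e) e' (by omega)).2 ⟨he', hc.symm⟩
  omega

lemma Rel.color {c : ℕ → ℕ} {tbl : ℕ → ℕ → ℕ} (h : X.Rel c tbl) {e γ : ℕ} (he : c e = 0)
    (hγ : 1 ≤ γ) (hm : ∀ v, X.Inc v e → tbl v γ = 0) :
    X.Rel (Function.update c e γ)
      (upd2 (upd2 tbl (X.src e) γ (e + 1)) (X.dst e) γ (e + 1)) := by
  intro v γ' e' hγ'
  have h1 := h v γ' e' hγ'
  have h2 := hm v
  simp only [upd2, Function.update_apply, EdgeColoring.Inc] at *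
  grind

lemma Rel.uncolor {c : ℕ → ℕ} {tbl : ℕ → ℕ → ℕ} (h : X.Rel c tbl) {e γ : ℕ} (he : c e = γ)
    (hγ : 1 ≤ γ) :
    X.Rel (Function.update c e 0) (upd2 (upd2 tbl (X.src e) γ 0) (X.dst e) γ 0) := by
  intro v γ' e' hγ'
  have h1 := h v γ' e' hγ'
  have h2 := h v γ e hγ
  simp only [upd2, Function.update_apply, EdgeColoring.Inc] at *
  grind

/-- The sets `μ(v)` consist of the small colors that are missing according to `tbl`. -/
def MuHas (X : Ctx) (m : Mem) (tbl : ℕ → ℕ → ℕ) : Prop :=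
  ∀ v, X.deg v ≠ 0 → IsSet (m .mu) (m .muPos) (m .muSize v) (X.off v)
    ((Finset.Icc 1 (X.deg v + 1)).filter fun γ => tbl v γ = 0)

/-- The dictionary and the sets `μ(v)` represent `tbl`. -/
structure State (X : Ctx) (m : Mem) (tbl : ℕ → ℕ → ℕ) (cnt : ℕ) : Prop where
  src : m .src = X.src
  dst : m .dst = X.dst
  deg : ∀ v, X.deg v ≠ 0 → m .deg v = X.deg v
  off : ∀ v, X.deg v ≠ 0 → m .off v = X.off v
  dict : DictHas X.D X.n X.cap X.N m tbl cnt
  mu : X.MuHas m tbl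

/-- The arrays changed by `useColor` and `freeColor`. -/
abbrev stateArrs : List Arr := dictArrs ++ [.mu, .muPos, .muSize]

lemma State.frame {m m' : Mem} {tbl : ℕ → ℕ → ℕ} {cnt : ℕ} (h : X.State m tbl cnt)
    {S : List Arr} (hf : Frame S m m')
    (hS : ∀ a ∈ stateArrs ++ [.src, .dst, .deg, .off], a ∉ S := by decide) :
    X.State m' tbl cnt := by
  have hf' : ∀ a ∈ stateArrs ++ [.src, .dst, .deg, .off], m' a = m a := fun a ha => hf a (hS a ha)
  refine ⟨?_, ?_, ?_, ?_, h.dict.congr ?_ ?_ ?_ ?_ ?_, ?_⟩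
  · rw [hf' _ (by decide), h.src]
  · rw [hf' _ (by decide), h.dst]
  · rw [hf' _ (by decide)]; exact h.deg
  · rw [hf' _ (by decide)]; exact h.off
  all_goals try exact hf' _ (by decide)
  rw [MuHas, hf' _ (by decide), hf' .muPos (by decide), hf' .muSize (by decide)]; exact h.mu

lemma filter_upd2 {tbl : ℕ → ℕ → ℕ} {S : Finset ℕ} {v γ x : ℕ} (hx : x ≠ 0) :
    (S.filter fun γ' => upd2 tbl v γ x v γ' = 0) = (S.filter fun γ' => tbl v γ' = 0).erase γ := by
  ext γ'
  simp only [upd2, Finset.mem_filter, Finset.mem_erase, true_and]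
  by_cases h : γ' = γ <;> simp [h, hx]

lemma filter_upd2_zero {tbl : ℕ → ℕ → ℕ} {S : Finset ℕ} {v γ : ℕ} (hγ : γ ∈ S) :
    (S.filter fun γ' => upd2 tbl v γ 0 v γ' = 0) =
      insert γ (S.filter fun γ' => tbl v γ' = 0) := by
  ext γ'
  simp only [upd2, Finset.mem_filter, Finset.mem_insert, true_and]
  by_cases h : γ' = γ <;> simp [h, hγ]

lemma filter_upd2_of_notMem {tbl : ℕ → ℕ → ℕ} {S : Finset ℕ} {v v' γ x : ℕ}
    (h : ¬(v' = v ∧ γ ∈ S)) :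
    (S.filter fun γ' => upd2 tbl v γ x v' γ' = 0) = S.filter fun γ' => tbl v' γ' = 0 := by
  refine Finset.filter_congr fun γ' hγ' => ?_
  rw [upd2_of_ne]
  rintro ⟨rfl, rfl⟩
  exact h ⟨rfl, hγ'⟩

section

variable {m : Mem} {tbl : ℕ → ℕ → ℕ} {cnt v γ : ℕ}

/-- The elements of the set of `v'` and their positions are at most `deg v' + 1`, so the set lives
in its `deg v' + 2` reserved cells and is not affected by writes into those of `v`. -/
lemma MuHas.other (h : X.MuHas m tbl) (hX : X.Valid) (hv : X.deg v ≠ 0) {item pos : ℕ → ℕ}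
    (hi : ∀ i, (i < X.off v ∨ X.off v + X.deg v + 2 ≤ i) → item i = m .mu i)
    (hp : ∀ i, (i < X.off v ∨ X.off v + X.deg v + 2 ≤ i) → pos i = m .muPos i) {v' : ℕ}
    (hv' : X.deg v' ≠ 0) (hne : v' ≠ v) :
    IsSet item pos (m .muSize v') (X.off v')
      ((Finset.Icc 1 (X.deg v' + 1)).filter fun γ => tbl v' γ = 0) := by
  have h1 := h v' hv'
  have h2 := hX.off v' v hv' hv hne
  have h3 := h1.card
  have h4 := Finset.card_filter_le (Finset.Icc 1 (X.deg v' + 1)) fun γ => tbl v' γ = 0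
  rw [h3, Nat.card_Icc] at h4
  refine h1.congr (b := X.deg v' + 2) (fun x hx => ?_) (by omega) (fun i h h' => hi i (by omega))
    fun i h h' => hp i (by omega)
  have := Finset.mem_Icc.1 (Finset.mem_filter.1 hx).1
  omega

lemma runs_useColor (h : X.State m tbl cnt) (hX : X.Valid) (hn : v < X.n) (hv : X.deg v ≠ 0)
    (h1 : 1 ≤ γ) (h2 : γ ≤ X.d + 1) (h0 : tbl v γ = 0) (hc : cnt < X.cap) (e : ℕ) :
    Runs (useColor X.D v γ e) m 16 fun _ m' =>
      X.State m' (upd2 tbl v γ (e + 1)) (cnt + 1) ∧ Frame stateArrs m m' := by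
  rw [useColor]
  refine (runs_dictInsert h.dict hX.size hn h1 (h2.trans hX.width) h0 hc).bind (by norm_num) ?_
  rintro - m₁ ⟨hd, hf⟩
  have hdeg : m₁ .deg = m .deg := hf _ (by decide)
  have hoff : m₁ .off = m .off := hf _ (by decide)
  have hmu : m₁ .mu = m .mu := hf _ (by decide)
  have hmup : m₁ .muPos = m .muPos := hf _ (by decide)
  have hmus : m₁ .muSize = m .muSize := hf _ (by decide)
  have hsrc : m₁ .src = m .src := hf _ (by decide)
  have hdst : m₁ .dst = m .dst := hf _ (by decide)
  have hf' : Frame stateArrs m m₁ := hf.mono (by decide)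
  have hset := h.mu v hv
  simp only [runs_read_bind, runs_ite, runs_pure, setDelete, runs_write_bind, runs_write,
    Mem.upd_same, Mem.upd_of_ne, ne_eq, reduceCtorEq, not_false_eq_true, hdeg, hoff, h.deg v hv,
    h.off v hv, hmu, hmup, hmus]
  refine ⟨by norm_num, fun hg => ⟨by norm_num, by norm_num, by norm_num, by norm_num, by norm_num,
    by norm_num, by norm_num, ⟨?_, ?_, ?_, ?_, ?_, ?_⟩, ?_⟩, fun hg => ⟨⟨?_, ?_, ?_, ?_, hd, ?_⟩,
    hf'⟩⟩
  · simp [hsrc, h.src]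
  · simp [hdst, h.dst]
  · simpa [hdeg] using h.deg
  · simpa [hoff] using h.off
  · refine hd.congr ?_ ?_ ?_ ?_ ?_ <;> simp
  · have hγm : γ ∈ (Finset.Icc 1 (X.deg v + 1)).filter fun γ => tbl v γ = 0 := by
      simp [h1, h0, hg]
    have hp := hset.pos_lt γ hγm
    have hk := hset.card
    have h4 := Finset.card_filter_le (Finset.Icc 1 (X.deg v + 1)) fun γ => tbl v γ = 0
    have hl := hset.item_mem (m .muSize v - 1) (by omega)
    rw [Finset.mem_filter, Finset.mem_Icc] at hl
    rw [Nat.card_Icc] at h4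
    intro v' hv'
    by_cases e' : v' = v
    · subst e'
      rw [filter_upd2 (Nat.succ_ne_zero e)]
      simpa [hmu, hmup, hmus] using hset.erase hγm
    · rw [filter_upd2_of_notMem (by tauto)]
      simp only [Mem.upd_same, Mem.upd_of_ne, ne_eq, reduceCtorEq, not_false_eq_true,
        Function.update_of_ne e', hmus]
      refine h.mu.other hX hv (fun i hi => ?_) (fun i hi => ?_) hv' e'
      · rw [Function.update_of_ne (by omega), hmu]
      · rw [Function.update_of_ne (by omega), hmup]
  · exact ((hf'.upd (by decide) _ _).upd (by decide) _ _).upd (by decide) _ _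
  · rw [hsrc, h.src]
  · rw [hdst, h.dst]
  · rw [hdeg]; exact h.deg
  · rw [hoff]; exact h.off
  · intro v' hv'
    rw [filter_upd2_of_notMem (by rintro ⟨rfl, h⟩; exact hg (Finset.mem_Icc.1 h).2), hmu, hmup,
      hmus]
    exact h.mu v' hv'

lemma runs_freeColor (h : X.State m tbl cnt) (hX : X.Valid) (hn : v < X.n) (hv : X.deg v ≠ 0)
    (h1 : 1 ≤ γ) (h2 : γ ≤ X.d + 1) (h0 : tbl v γ ≠ 0) :
    Runs (freeColor X.D v γ) m 16 fun _ m' =>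
      1 ≤ cnt ∧ X.State m' (upd2 tbl v γ 0) (cnt - 1) ∧ Frame stateArrs m m' := by
  rw [freeColor]
  refine (runs_dictDelete h.dict hX.size hn h1 (h2.trans hX.width) h0).bind (by norm_num) ?_
  rintro - m₁ ⟨hcnt, hd, hf⟩
  have hdeg : m₁ .deg = m .deg := hf _ (by decide)
  have hoff : m₁ .off = m .off := hf _ (by decide)
  have hmu : m₁ .mu = m .mu := hf _ (by decide)
  have hmup : m₁ .muPos = m .muPos := hf _ (by decide)
  have hmus : m₁ .muSize = m .muSize := hf _ (by decide)
  have hsrc : m₁ .src = m .src := hf _ (by decide)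
  have hdst : m₁ .dst = m .dst := hf _ (by decide)
  have hf' : Frame stateArrs m m₁ := hf.mono (by decide)
  have hset := h.mu v hv
  simp only [runs_read_bind, runs_ite, runs_pure, setInsert, runs_write_bind, runs_write,
    Mem.upd_same, Mem.upd_of_ne, ne_eq, reduceCtorEq, not_false_eq_true, hdeg, hoff, h.deg v hv,
    h.off v hv, hmu, hmup, hmus]
  refine ⟨by norm_num, fun hg => ⟨by norm_num, by norm_num, by norm_num, by norm_num, by norm_num,
    hcnt, ⟨?_, ?_, ?_, ?_, ?_, ?_⟩, ?_⟩, fun hg => ⟨hcnt, ⟨?_, ?_, ?_, ?_, hd, ?_⟩, hf'⟩⟩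
  · simp [hsrc, h.src]
  · simp [hdst, h.dst]
  · simpa [hdeg] using h.deg
  · simpa [hoff] using h.off
  · refine hd.congr ?_ ?_ ?_ ?_ ?_ <;> simp
  · have hγm : γ ∉ (Finset.Icc 1 (X.deg v + 1)).filter fun γ => tbl v γ = 0 := by
      simp [h0]
    have hk := hset.card
    have h4 : ((Finset.Icc 1 (X.deg v + 1)).filter fun γ => tbl v γ = 0).card <
        (Finset.Icc 1 (X.deg v + 1)).card :=
      Finset.card_lt_card (Finset.filter_ssubset.2 ⟨γ, by simp [h1, hg], h0⟩)
    rw [Nat.card_Icc] at h4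
    intro v' hv'
    by_cases e' : v' = v
    · subst e'
      rw [filter_upd2_zero (by simp [h1, hg])]
      simpa [hmu, hmup, hmus] using hset.insert hγm
    · rw [filter_upd2_of_notMem (by tauto)]
      simp only [Mem.upd_same, Mem.upd_of_ne, ne_eq, reduceCtorEq, not_false_eq_true,
        Function.update_of_ne e', hmus]
      refine h.mu.other hX hv (fun i hi => ?_) (fun i hi => ?_) hv' e'
      · rw [Function.update_of_ne (by omega), hmu]
      · rw [Function.update_of_ne (by omega), hmup]
  · exact ((hf'.upd (by decide) _ _).upd (by decide) _ _).upd (by decide) _ _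
  · rw [hsrc, h.src]
  · rw [hdst, h.dst]
  · rw [hdeg]; exact h.deg
  · rw [hoff]; exact h.off
  · intro v' hv'
    rw [filter_upd2_of_notMem (by rintro ⟨rfl, h⟩; exact hg (Finset.mem_Icc.1 h).2), hmu, hmup,
      hmus]
    exact h.mu v' hv'

end

/-- The colored edges of a partial coloring. -/
def colored (X : Ctx) (c : ℕ → ℕ) : Finset ℕ := X.E.filter fun e => c e ≠ 0

/-- The uncolored edges of a partial coloring. -/
def uncolored (X : Ctx) (c : ℕ → ℕ) : Finset ℕ := X.E.filter fun e => c e = 0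

lemma card_colored_add (X : Ctx) (c : ℕ → ℕ) :
    (X.colored c).card + (X.uncolored c).card = X.E.card := by
  rw [add_comm]; exact Finset.card_filter_add_card_filter_not _

lemma colored_update {c : ℕ → ℕ} {e γ : ℕ} (he : e ∈ X.E) (hγ : γ ≠ 0) :
    X.colored (Function.update c e γ) = insert e (X.colored c) := by
  ext e'
  simp only [colored, Finset.mem_filter, Finset.mem_insert]
  by_cases h : e' = e
  · subst h; simp [he, hγ]
  · simp [h]

lemma uncolored_update {c : ℕ → ℕ} {e γ : ℕ} (hγ : γ ≠ 0) :
    X.uncolored (Function.update c e γ) = (X.uncolored c).erase e := by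
  ext e'
  simp only [uncolored, Finset.mem_filter, Finset.mem_erase]
  by_cases h : e' = e
  · subst h; simp [hγ]
  · simp [h]

lemma colored_update_zero {c : ℕ → ℕ} {e : ℕ} :
    X.colored (Function.update c e 0) = (X.colored c).erase e := by
  ext e'
  simp only [colored, Finset.mem_filter, Finset.mem_erase]
  by_cases h : e' = e
  · subst h; simp
  · simp [h]

lemma uncolored_update_zero {c : ℕ → ℕ} {e : ℕ} (he : e ∈ X.E) :
    X.uncolored (Function.update c e 0) = insert e (X.uncolored c) := by
  ext e'
  simp only [uncolored, Finset.mem_filter, Finset.mem_insert]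
  by_cases h : e' = e
  · subst h; simp [he]
  · simp [h]

/-- The dictionary and the sets `μ(v)` represent the partial coloring `c`. -/
structure Core (X : Ctx) (m : Mem) (c : ℕ → ℕ) : Prop where
  zero : ∀ e, e ∉ X.E → c e = 0
  le : ∀ e, c e ≤ X.d + 1
  tbl : ∃ tbl, X.Rel c tbl ∧ X.State m tbl (2 * (X.colored c).card)

lemma Core.proper {m : Mem} {c : ℕ → ℕ} (h : X.Core m c) : X.Proper c :=
  let ⟨_, h, _⟩ := h.tbl; h.proper

lemma Core.src {m : Mem} {c : ℕ → ℕ} (h : X.Core m c) : m .src = X.src :=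
  let ⟨_, _, h⟩ := h.tbl; h.src

lemma Core.dst {m : Mem} {c : ℕ → ℕ} (h : X.Core m c) : m .dst = X.dst :=
  let ⟨_, _, h⟩ := h.tbl; h.dst

lemma Core.frame {m m' : Mem} {c : ℕ → ℕ} (h : X.Core m c) {S : List Arr} (hf : Frame S m m')
    (hS : ∀ a ∈ stateArrs ++ [.src, .dst, .deg, .off], a ∉ S := by decide) : X.Core m' c :=
  ⟨h.zero, h.le, let ⟨tbl, h1, h2⟩ := h.tbl; ⟨tbl, h1, h2.frame hf hS⟩⟩

/-- All data structures represent the partial coloring `c`. -/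
structure Inv (X : Ctx) (m : Mem) (c : ℕ → ℕ) : Prop where
  core : X.Core m c
  col : ∀ e ∈ X.E, m .col e = c e
  colOut : ∀ e, e ∉ X.E → m .col e = X.colOut e
  unc : IsSet (m .unc) (m .uncPos) (m .uncSize 0) 0 (X.uncolored c)

/-- The arrays that represent a partial coloring. -/
abbrev invArrs : List Arr := stateArrs ++ [.col, .unc, .uncPos, .uncSize]

lemma Inv.frame {m m' : Mem} {c : ℕ → ℕ} (h : X.Inv m c) {S : List Arr} (hf : Frame S m m')
    (hS : ∀ a ∈ invArrs ++ [.src, .dst, .deg, .off], a ∉ S := by decide) :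
    X.Inv m' c := by
  have hf' : ∀ a ∈ invArrs ++ [.src, .dst, .deg, .off], m' a = m a := fun a ha => hf a (hS a ha)
  refine ⟨h.core.frame hf fun a ha => hS a ?_, ?_, ?_, ?_⟩
  · revert a; decide
  · rw [hf' _ (by decide)]; exact h.col
  · rw [hf' _ (by decide)]; exact h.colOut
  · rw [hf' _ (by decide), hf' .uncPos (by decide), hf' .uncSize (by decide)]; exact h.unc

/-! ### Coloring and uncoloring one edge -/

lemma runs_useColor_both {m : Mem} {c : ℕ → ℕ} {e γ : ℕ} (h : X.Core m c) (hX : X.Valid)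
    (he : e ∈ X.E) (h0 : c e = 0) (h1 : 1 ≤ γ) (h2 : γ ≤ X.d + 1)
    (hm : ∀ v, X.Inc v e → X.Miss c v γ) :
    Runs (do useColor X.D (X.src e) γ e; useColor X.D (X.dst e) γ e) m 32 fun _ m' =>
      X.Core m' (Function.update c e γ) ∧ Frame stateArrs m m' := by
  obtain ⟨tbl, hr, hs⟩ := h.tbl
  have hi1 : X.Inc (X.src e) e := Or.inl rfl
  have hi2 : X.Inc (X.dst e) e := Or.inr rfl
  have hne := hX.graph.ne e he
  have hcard := X.card_colored_add c
  -- The edge `e` itself is still uncolored, so the dictionary has room for two more entries.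
  have hunc : 0 < (X.uncolored c).card := Finset.card_pos.2 ⟨e, by simp [uncolored, he, h0]⟩
  have hcap := hX.cap
  refine (runs_useColor hs hX (hX.graph.lt e he _ hi1) (deg_ne_zero he hi1) h1 h2
    ((hr.zero_iff h1).2 (hm _ hi1)) (by omega) e).bind (by norm_num) ?_
  rintro - m₁ ⟨hs₁, hf₁⟩
  refine (runs_useColor hs₁ hX (hX.graph.lt e he _ hi2) (deg_ne_zero he hi2) h1 h2
    ?_ (by omega) e).mono (by norm_num) ?_
  · rw [upd2_of_ne _ _ (by tauto)]; exact (hr.zero_iff h1).2 (hm _ hi2)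
  rintro - m₂ ⟨hs₂, hf₂⟩
  refine ⟨⟨fun e' he' => ?_, fun e' => ?_, _,
    hr.color h0 h1 (fun v hv => (hr.zero_iff h1).2 (hm v hv)), ?_⟩, hf₁.trans hf₂⟩
  · rw [Function.update_of_ne (by rintro rfl; exact he' he)]; exact h.zero e' he'
  · rw [Function.update_apply]; split_ifs
    · exact h2
    · exact h.le e'
  · rw [colored_update he (by omega), Finset.card_insert_of_notMem (by simp [colored, h0])]
    exact hs₂

lemma runs_colorEdge {m : Mem} {c : ℕ → ℕ} {e γ : ℕ} (h : X.Inv m c) (hX : X.Valid)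
    (he : e ∈ X.E) (h0 : c e = 0) (h1 : 1 ≤ γ) (h2 : γ ≤ X.d + 1)
    (hm : ∀ v, X.Inc v e → X.Miss c v γ) :
    Runs (colorEdge X.D e γ) m 41 fun _ m' =>
      X.Inv m' (Function.update c e γ) ∧ Frame invArrs m m' := by
  rw [colorEdge]
  simp only [setDelete, bind_assoc, runs_write_bind, runs_read_bind, Mem.upd_same, Mem.upd_of_ne,
    ne_eq, reduceCtorEq, not_false_eq_true, zero_add, h.core.src, h.core.dst]
  refine ⟨by norm_num, by norm_num, by norm_num, by norm_num, by norm_num, by norm_num, by norm_num,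
    by norm_num, by norm_num, ?_⟩
  have hS : Frame [.col, .unc, .uncPos, .uncSize] m
      (((((m.upd .col e γ).upd .unc (m .uncPos e) (m .unc (m .uncSize 0 - 1))).upd .uncPos
        (m .unc (m .uncSize 0 - 1)) (m .uncPos e)).upd .uncSize 0 (m .uncSize 0 - 1))) :=
    ((((Frame.refl _ _).upd (by decide) _ _).upd (by decide) _ _).upd (by decide) _ _).upd
      (by decide) _ _
  refine (runs_useColor_both (h.core.frame hS) hX he h0 h1 h2 hm).mono (by norm_num) ?_
  rintro - m' ⟨hc, hf⟩
  have hset := h.unc.erase (x := e) (by simp [uncolored, he, h0])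
  simp only [zero_add] at hset
  refine ⟨⟨hc, fun e' he' => ?_, fun e' he' => ?_, ?_⟩, (hS.mono (by decide)).trans
    (hf.mono (by decide))⟩
  · rw [hf _ (by decide)]
    by_cases heq : e' = e
    · subst heq; simp
    · simp [heq, h.col e' he']
  · have heq : e' ≠ e := by rintro rfl; exact he' he
    rw [hf _ (by decide)]
    simp [heq, h.colOut e' he']
  · rw [hf _ (by decide), hf .uncPos (by decide), hf .uncSize (by decide),
      uncolored_update (by omega)]
    simpa using hset

lemma runs_uncolorEdge {m : Mem} {c : ℕ → ℕ} {e : ℕ} (h : X.Inv m c) (hX : X.Valid)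
    (he : e ∈ X.E) (h0 : c e ≠ 0) :
    Runs (uncolorEdge X.D e) m 40 fun _ m' =>
      X.Inv m' (Function.update c e 0) ∧ Frame invArrs m m' := by
  rw [uncolorEdge]
  simp only [setInsert, bind_assoc, runs_write_bind, runs_read_bind, Mem.upd_same, Mem.upd_of_ne,
    ne_eq, reduceCtorEq, not_false_eq_true, zero_add, h.core.src, h.core.dst, h.col e he]
  refine ⟨by norm_num, by norm_num, by norm_num, by norm_num, by norm_num, by norm_num, by norm_num,
    by norm_num, ?_⟩
  have hS : Frame [.col, .unc, .uncPos, .uncSize] m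
      (((((m.upd .col e 0).upd .unc (m .uncSize 0) e).upd .uncPos e (m .uncSize 0)).upd
        .uncSize 0 (m .uncSize 0 + 1))) :=
    ((((Frame.refl _ _).upd (by decide) _ _).upd (by decide) _ _).upd (by decide) _ _).upd
      (by decide) _ _
  obtain ⟨tbl, hr, hs⟩ := (h.core.frame hS).tbl
  have hi1 : X.Inc (X.src e) e := Or.inl rfl
  have hi2 : X.Inc (X.dst e) e := Or.inr rfl
  have hne := hX.graph.ne e he
  have h1 : 1 ≤ c e := by omega
  have h2 := h.core.le e
  refine (runs_freeColor hs hX (hX.graph.lt e he _ hi1) (deg_ne_zero he hi1) h1 h2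
    (by rw [(hr _ _ e h1).2 ⟨hi1, rfl⟩]; omega)).bind (by norm_num) ?_
  rintro - m₁ ⟨hc₁, hs₁, hf₁⟩
  refine (runs_freeColor hs₁ hX (hX.graph.lt e he _ hi2) (deg_ne_zero he hi2) h1 h2
    ?_).mono (by norm_num) ?_
  · rw [upd2_of_ne _ _ (by tauto), (hr _ _ e h1).2 ⟨hi2, rfl⟩]; omega
  rintro - m₂ ⟨hc₂, hs₂, hf₂⟩
  have hf := hf₁.trans hf₂
  have hset := h.unc.insert (x := e) (by simp [uncolored, he, h0])
  simp only [zero_add] at hset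
  refine ⟨⟨⟨fun e' he' => ?_, fun e' => ?_, _, hr.uncolor rfl h1, ?_⟩, fun e' he' => ?_,
    fun e' he' => ?_, ?_⟩, (hS.mono (by decide)).trans (hf.mono (by decide))⟩
  · rw [Function.update_of_ne (by rintro rfl; exact he' he)]; exact h.core.zero e' he'
  · rw [Function.update_apply]; split_ifs
    · omega
    · exact h.core.le e'
  · rw [colored_update_zero, Finset.card_erase_of_mem (by simp [colored, h0, he])]
    convert hs₂ using 1
    omega
  · rw [hf _ (by decide)]
    by_cases heq : e' = e
    · subst heq; simp
    · simp [heq, h.col e' he']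
  · have heq : e' ≠ e := by rintro rfl; exact he' he
    rw [hf _ (by decide)]
    simp [heq, h.colOut e' he']
  · rw [hf _ (by decide), hf .uncPos (by decide), hf .uncSize (by decide),
      uncolored_update_zero he]
    simpa using hset

end Ctx

namespace Ctx

variable {X : Ctx}

/-! ### Fans and alternating paths -/

/-- The endpoint of `e` other than `v`. -/
abbrev oth (X : Ctx) (e v : ℕ) : ℕ := EdgeColoring.oth X.src X.dst e v

lemma inc_oth {e v : ℕ} (h : X.Inc v e) : X.Inc (X.oth e v) e := by
  simp only [EdgeColoring.Inc, oth, EdgeColoring.oth] at *; grind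

lemma Inc.eq_or {e v u : ℕ} (h : X.Inc v e) (hu : X.Inc u e) : u = v ∨ u = X.oth e v := by
  simp only [EdgeColoring.Inc, oth, EdgeColoring.oth] at *; grind

lemma oth_ne (hX : X.Valid) {e v : ℕ} (he : e ∈ X.E) (h : X.Inc v e) : X.oth e v ≠ v := by
  have := hX.graph.ne e he
  simp only [EdgeColoring.Inc, oth, EdgeColoring.oth] at *; grind

lemma oth_oth (hX : X.Valid) {e v : ℕ} (he : e ∈ X.E) (h : X.Inc v e) :
    X.oth e (X.oth e v) = v := by
  have := hX.graph.ne e he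
  simp only [EdgeColoring.Inc, oth, EdgeColoring.oth] at *; grind

lemma eq_of_oth_eq (hX : X.Valid) {e e' v : ℕ} (he : e ∈ X.E) (he' : e' ∈ X.E) (h : X.Inc v e)
    (h' : X.Inc v e') (ho : X.oth e v = X.oth e' v) : e = e' :=
  hX.graph.eq e he e' he' _ _ (oth_ne hX he h) (inc_oth h) h (ho ▸ inc_oth h') h'

lemma Miss.update {c : ℕ → ℕ} {u δ e γ : ℕ} (h : X.Miss c u δ) (hγ : X.Inc u e → γ ≠ δ) :
    X.Miss (Function.update c e γ) u δ := by
  intro e' he'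
  rw [Function.update_apply]
  split_ifs with h'
  · exact hγ (h' ▸ he')
  · exact h e' he'

/-- A fan with center `v`; its leaves are the endpoints of the edges `fan 0, …, fan k`. -/
structure Fan (X : Ctx) (c : ℕ → ℕ) (v : ℕ) (fan : ℕ → ℕ) (k : ℕ) : Prop where
  mem : ∀ i ≤ k, fan i ∈ X.E
  inc : ∀ i ≤ k, X.Inc v (fan i)
  inj : ∀ i ≤ k, ∀ j ≤ k, fan i = fan j → i = j
  zero : c (fan 0) = 0
  ne_zero : ∀ i < k, c (fan (i + 1)) ≠ 0
  miss : ∀ i < k, X.Miss c (X.oth (fan i) v) (c (fan (i + 1)))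

lemma Fan.take {c : ℕ → ℕ} {v : ℕ} {fan : ℕ → ℕ} {k j : ℕ} (h : X.Fan c v fan k) (hj : j ≤ k) :
    X.Fan c v fan j :=
  ⟨fun i hi => h.mem i (by omega), fun i hi => h.inc i (by omega),
    fun i hi i' hi' => h.inj i (by omega) i' (by omega), h.zero,
    fun i hi => h.ne_zero i (by omega), fun i hi => h.miss i (by omega)⟩

/-- The fan consists of distinct edges at `v`; this bounds both the construction of a fan and its
shift by `O(d)` steps. -/
lemma Fan.card_le {c : ℕ → ℕ} {v : ℕ} {fan : ℕ → ℕ} {k : ℕ} (h : X.Fan c v fan k) :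
    k + 1 ≤ X.deg v := by
  have := Finset.card_le_card_of_injOn (s := Finset.range (k + 1))
    (t := X.E.filter (X.Inc v)) fan
    (fun i hi => by
      have hi : i ≤ k := by simpa [Nat.lt_succ_iff] using hi
      simpa using ⟨h.mem i hi, h.inc i hi⟩)
    (fun i hi j hj e => h.inj i (by simpa [Nat.lt_succ_iff] using hi) j
      (by simpa [Nat.lt_succ_iff] using hj) e)
  rwa [Finset.card_range] at this

lemma Fan.leaf_inj (hX : X.Valid) {c : ℕ → ℕ} {v : ℕ} {fan : ℕ → ℕ} {k : ℕ}
    (h : X.Fan c v fan k) {i j : ℕ} (hi : i ≤ k) (hj : j ≤ k)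
    (he : X.oth (fan i) v = X.oth (fan j) v) : i = j :=
  h.inj i hi j hj (eq_of_oth_eq hX (h.mem i hi) (h.mem j hj) (h.inc i hi) (h.inc j hj) he)

/-- The color of edge number `i` of a path that is colored alternately by `β` and `α`. -/
def altCol (α β i : ℕ) : ℕ := if i % 2 = 0 then β else α

lemma altCol_succ (α β i : ℕ) : altCol α β (i + 1) = altCol β α i := by
  unfold altCol; split_ifs <;> first | rfl | omega

lemma altCol_eq_or (α β i : ℕ) : altCol α β i = α ∨ altCol α β i = β := by
  unfold altCol; split_ifs <;> simp

/-- A path from `v` with vertices `x 0, …, x k` and edges `p 0, …, p (k - 1)` that are colored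
alternately by `β` and `α`. -/
structure PrePath (X : Ctx) (c : ℕ → ℕ) (v α β : ℕ) (p x : ℕ → ℕ) (k : ℕ) : Prop where
  zero : x 0 = v
  inc : ∀ i < k, X.Inc (x i) (p i)
  succ : ∀ i < k, x (i + 1) = X.oth (p i) (x i)
  col : ∀ i < k, c (p i) = altCol α β i

/-- A path as in `PrePath` that cannot be extended. -/
structure AltPath (X : Ctx) (c : ℕ → ℕ) (v α β : ℕ) (p x : ℕ → ℕ) (k : ℕ) : Prop
    extends X.PrePath c v α β p x k where
  last : X.Miss c (x k) (altCol α β k)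

/-- What has to hold for the `αβ`-path from `v` to be well-behaved. -/
structure PathData (X : Ctx) (c : ℕ → ℕ) (v α β : ℕ) : Prop where
  valid : X.Valid
  proper : X.Proper c
  zero : ∀ e, e ∉ X.E → c e = 0
  ne : α ≠ β
  α_pos : 1 ≤ α
  β_pos : 1 ≤ β
  miss : X.Miss c v α

/-! ### Structure of the `αβ`-path from a vertex that misses `α` -/

section path

variable {c : ℕ → ℕ} {v α β : ℕ} {p x p' x' : ℕ → ℕ} {k k' : ℕ}

lemma PathData.altCol_pos (h : X.PathData c v α β) (i : ℕ) : altCol α β i ≠ 0 := by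
  have := h.α_pos; have := h.β_pos
  rcases altCol_eq_or α β i with h | h <;> omega

lemma PathData.mem (h : X.PathData c v α β) (hp : X.PrePath c v α β p x k) {i : ℕ} (hi : i < k) :
    p i ∈ X.E := by
  by_contra he
  exact h.altCol_pos i (by rw [← hp.col i hi, h.zero _ he])

lemma PathData.altCol_eq (h : X.PathData c v α β) {i j : ℕ}
    (he : altCol α β i = altCol α β j) : i % 2 = j % 2 := by
  have := h.ne
  unfold altCol at he
  split_ifs at he <;> omega

lemma PathData.altCol_pred (h : X.PathData c v α β) {i j : ℕ}
    (he : altCol α β i ≠ altCol α β (j + 1)) : altCol α β i = altCol α β j := by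
  unfold altCol at *
  split_ifs at * <;> first | rfl | omega

lemma PrePath.inc_succ (hp : X.PrePath c v α β p x k) {i : ℕ} (hi : i < k) :
    X.Inc (x (i + 1)) (p i) := by rw [hp.succ i hi]; exact inc_oth (hp.inc i hi)

lemma PrePath.eq_or (hp : X.PrePath c v α β p x k) {i u : ℕ} (hi : i < k) (hu : X.Inc u (p i)) :
    u = x i ∨ u = x (i + 1) := by rw [hp.succ i hi]; exact Inc.eq_or (hp.inc i hi) hu

/-- Consider a first return, along the edge `p j` to `x i`. By properness `p j` is the edge by which
the path leaves or enters `x i`, and then `x j` coincides with an earlier vertex, or the parity of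
the colors is violated. At `x 0 = v` only the color `β` can occur. An immediate return would be a
loop. -/
lemma PathData.vertex_ne (h : X.PathData c v α β) (hp : X.PrePath c v α β p x k) :
    ∀ j ≤ k, ∀ i < j, x i ≠ x j := by
  intro j
  induction j using Nat.strong_induction_on with
  | _ j ih =>
  intro hj i hi he
  obtain ⟨j, rfl⟩ : ∃ j', j = j' + 1 := ⟨j - 1, by omega⟩
  have ih' : ∀ a ≤ j, ∀ b ≤ j, x a = x b → a = b := by
    intro a ha b hb e
    rcases lt_trichotomy a b with h | h | h
    · exact absurd e (ih b (by omega) (by omega) a h)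
    · exact h
    · exact absurd e.symm (ih a (by omega) (by omega) b h)
  have hjk : j < k := by omega
  have hinc := hp.inc_succ hjk
  rw [← he] at hinc
  rcases Nat.lt_succ_iff_lt_or_eq.1 hi with hij | rfl
  · by_cases hcol : altCol α β j = altCol α β i
    · have hpe : p j = p i := h.proper _ _ _ hinc (hp.inc i (by omega))
        (by rw [hp.col j hjk, hp.col i (by omega), hcol])
        (by rw [hp.col j hjk]; exact h.altCol_pos j)
      rcases hp.eq_or (i := i) (by omega) (hpe ▸ hp.inc j hjk) with e | e
      · have := ih' _ le_rfl _ hij.le e; omega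
      · have := ih' _ le_rfl _ (by omega) e
        have := h.altCol_eq hcol
        omega
    · rcases i with _ | i
      · have : altCol α β j = α := (altCol_eq_or α β j).resolve_right hcol
        rw [hp.zero] at hinc
        exact h.miss _ hinc (by rw [hp.col j hjk, this])
      · have hcol' := h.altCol_pred hcol
        have hpe : p j = p i := h.proper _ _ _ hinc (hp.inc_succ (by omega))
          (by rw [hp.col j hjk, hp.col i (by omega), hcol'])
          (by rw [hp.col j hjk]; exact h.altCol_pos j)
        rcases hp.eq_or (i := i) (by omega) (hpe ▸ hp.inc j hjk) with e | e
        · have := ih' _ le_rfl _ (by omega) e; omega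
        · have := ih' _ le_rfl _ (by omega) e; omega
  · rw [hp.succ i hjk] at he
    exact oth_ne h.valid (h.mem hp hjk) (hp.inc i hjk) he.symm

lemma PathData.vertex_inj (h : X.PathData c v α β) (hp : X.PrePath c v α β p x k) {i j : ℕ}
    (hi : i ≤ k) (hj : j ≤ k) (he : x i = x j) : i = j := by
  rcases lt_trichotomy i j with h' | h' | h'
  · exact absurd he (h.vertex_ne hp j hj i h')
  · exact h'
  · exact absurd he.symm (h.vertex_ne hp i hi j h')

lemma PathData.edge_inj (h : X.PathData c v α β) (hp : X.PrePath c v α β p x k) {i j : ℕ}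
    (hi : i < k) (hj : j < k) (he : p i = p j) : i = j := by
  have hc : altCol α β i = altCol α β j := by rw [← hp.col i hi, he, hp.col j hj]
  have := h.altCol_eq hc
  rcases hp.eq_or hi (he ▸ hp.inc j hj) with e | e
  · exact (h.vertex_inj hp (by omega) (by omega) e).symm
  · have := h.vertex_inj hp (by omega) (by omega) e
    omega

lemma PathData.length_le (h : X.PathData c v α β) (hp : X.PrePath c v α β p x k) : k ≤ X.n := by
  have := Finset.card_le_card_of_injOn (s := Finset.range k) (t := Finset.range X.n) x
    (fun i hi => by
      have hi : i < k := by simpa using hi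
      simpa using h.valid.graph.lt _ (h.mem hp hi) _ (hp.inc i hi))
    (fun i hi j hj e => h.vertex_inj hp (by simpa using (Finset.mem_coe.1 hi |> Finset.mem_range.1).le)
      (by simpa using (Finset.mem_coe.1 hj |> Finset.mem_range.1).le) e)
  simpa using this

lemma PrePath.snoc (hp : X.PrePath c v α β p x k) {e : ℕ} (he : X.Inc (x k) e)
    (hc : c e = altCol α β k) : X.PrePath c v α β (Function.update p k e)
      (Function.update x (k + 1) (X.oth e (x k))) (k + 1) := by
  refine ⟨by simp [hp.zero], fun i hi => ?_, fun i hi => ?_, fun i hi => ?_⟩ <;>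
    rcases Nat.lt_succ_iff_lt_or_eq.1 hi with hi | rfl
  · rw [Function.update_of_ne hi.ne, Function.update_of_ne (by omega)]; exact hp.inc i hi
  · rw [Function.update_self, Function.update_of_ne (by omega)]; exact he
  · rw [Function.update_of_ne (by omega), Function.update_of_ne hi.ne,
      Function.update_of_ne (by omega)]
    exact hp.succ i hi
  · rw [Function.update_self, Function.update_self, Function.update_of_ne (by omega)]
  · rw [Function.update_of_ne hi.ne]; exact hp.col i hi
  · rw [Function.update_self]; exact hc

/-- A path that could always be extended would reach `n + 1` edges and so repeat a vertex. -/
lemma PathData.exists_altPath (h : X.PathData c v α β) : ∃ p x k, X.AltPath c v α β p x k := by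
  by_contra hno
  have key : ∀ k, ∃ p x, X.PrePath c v α β p x k := by
    intro k
    induction k with
    | zero => exact ⟨fun _ => 0, fun _ => v, rfl, by simp, by simp, by simp⟩
    | succ k ih =>
      obtain ⟨p, x, hp⟩ := ih
      by_cases hm : X.Miss c (x k) (altCol α β k)
      · exact absurd ⟨p, x, k, hp, hm⟩ hno
      · simp only [Miss, not_forall, not_not] at hm
        obtain ⟨e, he, hc⟩ := hm
        exact ⟨_, _, hp.snoc he hc⟩
  obtain ⟨p, x, hp⟩ := key (X.n + 1)
  have := h.length_le hp
  omega

/-- By properness a vertex and a color leave at most one way to continue, so two paths agree as long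
as both last. This makes `pathLen` independent of the chosen path. -/
lemma PathData.vertex_eq (h : X.PathData c v α β) (hp : X.PrePath c v α β p x k)
    (hp' : X.PrePath c v α β p' x' k') : ∀ i, i ≤ k → i ≤ k' → x i = x' i := by
  intro i
  induction i with
  | zero => intro _ _; rw [hp.zero, hp'.zero]
  | succ i ih =>
    intro h1 h2
    have hx := ih (by omega) (by omega)
    have hpe : p i = p' i := h.proper _ _ _ (hp.inc i (by omega)) (hx ▸ hp'.inc i (by omega))
      (by rw [hp.col i (by omega), hp'.col i (by omega)])
      (by rw [hp.col i (by omega)]; exact h.altCol_pos i)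
    rw [hp.succ i (by omega), hp'.succ i (by omega), hx, hpe]

lemma PathData.length_unique (h : X.PathData c v α β) (hp : X.AltPath c v α β p x k)
    (hp' : X.AltPath c v α β p' x' k') : k = k' := by
  have hx := h.vertex_eq hp.toPrePath hp'.toPrePath
  rcases lt_trichotomy k k' with hk | hk | hk
  · refine absurd (hp'.col k hk) (hp.last _ ?_)
    rw [hx k le_rfl hk.le]; exact hp'.inc k hk
  · exact hk
  · refine absurd (hp.col k' hk) (hp'.last _ ?_)
    rw [← hx k' hk.le le_rfl]; exact hp.inc k' hk

open Classical in
/-- The length of the `αβ`-path from `v`. -/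
noncomputable def pathLen (X : Ctx) (c : ℕ → ℕ) (v α β : ℕ) : ℕ :=
  if h : ∃ k p x, X.AltPath c v α β p x k then h.choose else 0

lemma PathData.pathLen_eq (h : X.PathData c v α β) (hp : X.AltPath c v α β p x k) :
    X.pathLen c v α β = k := by
  have he : ∃ k p x, X.AltPath c v α β p x k := ⟨k, p, x, hp⟩
  rw [pathLen, dif_pos he]
  obtain ⟨p', x', hp'⟩ := he.choose_spec
  exact h.length_unique hp' hp

/-- The coloring after interchanging `α` and `β` on the path. -/
noncomputable def flip (c : ℕ → ℕ) (α β : ℕ) (p : ℕ → ℕ) (k : ℕ) : ℕ → ℕ := fun e =>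
  open Classical in if ∃ i < k, p i = e then (if c e = α then β else α) else c e

lemma PathData.flip_path (h : X.PathData c v α β) (hp : X.PrePath c v α β p x k) {i : ℕ}
    (hi : i < k) : flip c α β p k (p i) = altCol β α i := by
  have := h.ne
  rw [flip, if_pos ⟨i, hi, rfl⟩, hp.col i hi]
  unfold altCol
  split_ifs <;> first | rfl | omega

lemma flip_of_not {e : ℕ} (he : ¬∃ i < k, p i = e) : flip c α β p k e = c e := by
  rw [flip, if_neg he]

/-- Every edge of color `α` or `β` at a vertex of the path belongs to the path. -/
lemma PathData.closed (h : X.PathData c v α β) (hp : X.AltPath c v α β p x k) {e a : ℕ}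
    (ha : a ≤ k) (he : X.Inc (x a) e) (hc : c e = α ∨ c e = β) : ∃ i < k, p i = e := by
  have hpos : c e ≠ 0 := by have := h.α_pos; have := h.β_pos; omega
  have hc' : c e = altCol α β a ∨ c e = altCol β α a := by
    unfold altCol; split_ifs <;> tauto
  rcases hc' with hc' | hc'
  · rcases ha.lt_or_eq with ha | rfl
    · exact ⟨a, ha, h.proper _ _ _ (hp.inc a ha) he (by rw [hp.col a ha, hc'])
        (by rw [hp.col a ha]; exact h.altCol_pos a)⟩
    · exact absurd hc' (hp.last e he)
  · rcases a with _ | a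
    · rw [hp.zero] at he
      exact absurd hc' (h.miss e he)
    · rw [altCol_succ] at hc'
      exact ⟨a, by omega, h.proper _ _ _ (hp.inc_succ (by omega)) he (by rw [hp.col a ha, hc'])
        (by rw [hp.col a ha]; exact h.altCol_pos a)⟩

lemma PathData.on_path (h : X.PathData c v α β) (hp : X.AltPath c v α β p x k) {e u : ℕ}
    (he : ∃ i < k, p i = e) (hu : X.Inc u e) : ∃ a ≤ k, u = x a := by
  obtain ⟨i, hi, rfl⟩ := he
  rcases hp.eq_or hi hu with h | h
  · exact ⟨i, hi.le, h⟩
  · exact ⟨i + 1, hi, h⟩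

lemma PathData.col_path (h : X.PathData c v α β) (hp : X.AltPath c v α β p x k) {e : ℕ}
    (he : ∃ i < k, p i = e) : c e = α ∨ c e = β := by
  obtain ⟨i, hi, rfl⟩ := he
  rw [hp.col i hi]; exact altCol_eq_or α β i

/-- On the path the flip is a bijection of the two colors, so a conflict could only arise between an
edge of the path and one off the path. By `closed`, no edge off the path that meets it has color `α`
or `β`. -/
lemma PathData.flip_proper (h : X.PathData c v α β) (hp : X.AltPath c v α β p x k) :
    X.Proper (flip c α β p k) := by
  have key : ∀ e e' u, X.Inc u e → X.Inc u e' → (∃ i < k, p i = e) → (¬∃ i < k, p i = e') →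
      flip c α β p k e ≠ flip c α β p k e' := by
    intro e e' u hu hu' he he' hE
    obtain ⟨a, ha, rfl⟩ := h.on_path hp he hu
    refine he' (h.closed hp ha hu' ?_)
    rw [flip_of_not he'] at hE
    obtain ⟨i, hi, rfl⟩ := he
    rw [← hE, h.flip_path hp.toPrePath hi]
    exact (altCol_eq_or β α i).symm
  intro e e' u hu hu' hE h0
  by_cases he : ∃ i < k, p i = e <;> by_cases he' : ∃ i < k, p i = e'
  · refine h.proper e e' u hu hu' ?_ ?_
    · have h1 := h.col_path hp he
      have h2 := h.col_path hp he'
      have := h.ne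
      rw [flip, flip, if_pos he, if_pos he'] at hE
      split_ifs at hE <;> omega
    · have h1 := h.col_path hp he
      have := h.α_pos; have := h.β_pos
      omega
  · exact absurd hE (key e e' u hu hu' he he')
  · exact absurd hE.symm (key e' e u hu' hu he' he)
  · rw [flip_of_not he, flip_of_not he'] at hE
    rw [flip_of_not he] at h0
    exact h.proper e e' u hu hu' hE h0

lemma PathData.flip_eq_zero (h : X.PathData c v α β) (hp : X.AltPath c v α β p x k) (e : ℕ) :
    flip c α β p k e = 0 ↔ c e = 0 := by
  by_cases he : ∃ i < k, p i = e
  · have h1 := h.col_path hp he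
    have := h.α_pos; have := h.β_pos
    rw [flip, if_pos he]
    split_ifs <;> omega
  · rw [flip_of_not he]

lemma PathData.flip_of_ne (h : X.PathData c v α β) (hp : X.AltPath c v α β p x k) {e : ℕ}
    (h1 : c e ≠ α) (h2 : c e ≠ β) : flip c α β p k e = c e :=
  flip_of_not fun he => by have := h.col_path hp he; tauto

lemma PathData.miss_flip_start (h : X.PathData c v α β) (hp : X.AltPath c v α β p x k) :
    X.Miss (flip c α β p k) v β := by
  intro e he hc
  have hne := h.ne
  by_cases hpe : ∃ i < k, p i = e
  · rw [flip, if_pos hpe] at hc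
    split_ifs at hc with h'
    · exact h.miss e he h'
    · exact hne hc
  · rw [flip_of_not hpe] at hc
    exact hpe (h.closed hp (Nat.zero_le k) (hp.zero.symm ▸ he) (Or.inr hc))

lemma PathData.miss_flip_end (h : X.PathData c v α β) (hp : X.AltPath c v α β p x k)
    (hm : X.Miss c (x k) β) : X.Miss (flip c α β p k) (x k) α := by
  intro e he hc
  have hne := h.ne
  by_cases hpe : ∃ i < k, p i = e
  · have := h.col_path hp hpe
    have := hm e he
    rw [flip, if_pos hpe] at hc
    split_ifs at hc with h'
    · exact hne hc.symm
    · tauto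
  · rw [flip_of_not hpe] at hc
    exact hpe (h.closed hp le_rfl he (Or.inl hc))

lemma PathData.miss_flip_of_ne (h : X.PathData c v α β) (hp : X.AltPath c v α β p x k) {u δ : ℕ}
    (h1 : δ ≠ α) (h2 : δ ≠ β) (hm : X.Miss c u δ) : X.Miss (flip c α β p k) u δ := by
  intro e he hc
  by_cases hpe : ∃ i < k, p i = e
  · rw [flip, if_pos hpe] at hc
    split_ifs at hc <;> tauto
  · rw [flip_of_not hpe] at hc
    exact hm e he hc

/-- An inner vertex of the path sees both colors, so a vertex other than the two ends that misses
`β` is not on the path at all. -/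
lemma PathData.miss_flip_other (h : X.PathData c v α β) (hp : X.AltPath c v α β p x k) {u : ℕ}
    (h1 : u ≠ v) (h2 : u ≠ x k) (hm : X.Miss c u β) : X.Miss (flip c α β p k) u β := by
  have hu : ∀ a ≤ k, u ≠ x a := by
    rintro a ha rfl
    have ha0 : a ≠ 0 := by rintro rfl; exact h1 hp.zero
    have hak : a ≠ k := by rintro rfl; exact h2 rfl
    obtain ⟨a, rfl⟩ := Nat.exists_eq_succ_of_ne_zero ha0
    have e1 := hm _ (hp.inc (a + 1) (by omega))
    have e2 := hm _ (hp.inc_succ (i := a) (by omega))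
    rw [hp.col _ (by omega)] at e1 e2
    unfold altCol at e1 e2
    split_ifs at e1 e2 <;> omega
  intro e he hc
  by_cases hpe : ∃ i < k, p i = e
  · obtain ⟨a, ha, rfl⟩ := h.on_path hp hpe he
    exact hu a ha rfl
  · rw [flip_of_not hpe] at hc
    exact hm e he hc

end path

end Ctx

namespace Ctx

variable {X : Ctx}

/-! ### Shifting a fan, flipping a path -/

/-- Before iteration `i` the uncolored edge is `fan (i - 1)`, and the edges from `fan i` on have
their old colors. An edge is uncolored before its color passes to its predecessor, so the partial
coloring is proper at every moment. An iteration takes `3 + 40 + 41 = 84` steps: three reads, one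
uncoloring, one coloring. -/
lemma runs_shiftAndColor {m : Mem} {c : ℕ → ℕ} {v j β : ℕ} (h : X.Inv m c) (hX : X.Valid)
    (hfan : X.Fan c v (m .fan) j) (h1 : 1 ≤ β) (h2 : β ≤ X.d + 1) (hv : X.Miss c v β)
    (hj : X.Miss c (X.oth (m .fan j) v) β) :
    Runs (shiftAndColor X.D j β) m (85 * j + 43) fun _ m' =>
      Frame invArrs m m' ∧ ∃ c', X.Inv m' c' ∧
        (X.uncolored c').card + 1 = (X.uncolored c).card := by
  rw [shiftAndColor]
  refine ((runs_forLoop (lo := 1) (hi := j + 1) 84 (fun i m' => Frame invArrs m m' ∧ ∃ c', X.Inv m' c' ∧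
    c' (m .fan (i - 1)) = 0 ∧ (∀ a, i ≤ a → a ≤ j → c' (m .fan a) = c (m .fan a)) ∧
    (∀ a, i ≤ a + 1 → a < j → X.Miss c' (X.oth (m .fan a) v) (c (m .fan (a + 1)))) ∧
    X.Miss c' (X.oth (m .fan j) v) β ∧ X.Miss c' v β ∧
    (X.uncolored c').card = (X.uncolored c).card) (by omega)
    ⟨Frame.refl _ _, c, h, hfan.zero, fun _ _ _ => rfl, fun a _ ha => hfan.miss a ha, hj, hv, rfl⟩
    ?_).bind (by omega) ?_).mono le_rfl fun _ _ h => h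
  · rintro i m₁ hi1 hij ⟨hf, c₁, hI, hz, hs, hm, hmj, hmv, hcard⟩
    obtain ⟨i, rfl⟩ : ∃ i', i = i' + 1 := ⟨i - 1, by omega⟩
    simp only [Nat.add_sub_cancel] at hz
    have hfr : m₁ .fan = m .fan := hf _ (by decide)
    have hE := hfan.mem (i + 1) (by omega)
    have hE' := hfan.mem i (by omega)
    have hinc := hfan.inc (i + 1) (by omega)
    have hinc' := hfan.inc i (by omega)
    have hne : m .fan i ≠ m .fan (i + 1) := fun e => by
      have := hfan.inj i (by omega) (i + 1) (by omega) e; omega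
    have hc0 := hfan.ne_zero i (by omega)
    have hcc := hs (i + 1) le_rfl (by omega)
    have hle := h.core.le (m .fan (i + 1))
    simp only [runs_read_bind, hfr, hI.col _ hE, Nat.add_sub_cancel]
    refine ⟨by norm_num, by norm_num, (runs_uncolorEdge hI hX hE (by rwa [hcc])).bind
      (by norm_num) ?_⟩
    rintro - m₂ ⟨hI₂, hf₂⟩
    have hfr₂ : m₂ .fan = m .fan := (hf₂ _ (by decide)).trans hfr
    simp only [runs_read_bind, hfr₂]
    rw [hcc]
    refine ⟨by norm_num, (runs_colorEdge hI₂ hX hE' ?_ (by omega) hle ?_).mono (by norm_num) ?_⟩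
    · rw [Function.update_of_ne hne, hz]
    · intro u hu
      rcases Inc.eq_or hinc' hu with rfl | rfl
      · intro e he hc
        by_cases hee : e = m .fan (i + 1)
        · subst hee; rw [Function.update_self] at hc; exact hc0 hc.symm
        · rw [Function.update_of_ne hee] at hc
          exact hee (hI.core.proper e _ u he hinc (hc.trans hcc.symm) (by omega))
      · exact (hm i le_rfl (by omega)).update fun _ => hc0.symm
    rintro - m₃ ⟨hI₃, hf₃⟩
    have hupd : ∀ u δ, δ ≠ 0 → X.Miss c₁ u δ →
        (X.Inc u (m .fan i) → c (m .fan (i + 1)) ≠ δ) →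
        X.Miss (Function.update (Function.update c₁ (m .fan (i + 1)) 0) (m .fan i)
          (c (m .fan (i + 1)))) u δ :=
      fun u δ hδ hmu hne => (hmu.update fun _ => hδ.symm).update hne
    have hleaf : ∀ a, i + 1 ≤ a → a ≤ j → ¬X.Inc (X.oth (m .fan a) v) (m .fan i) := by
      intro a ha haj hi
      rcases Inc.eq_or hinc' hi with e | e
      · exact oth_ne hX (hfan.mem a haj) (hfan.inc a haj) e
      · have := hfan.leaf_inj hX haj (by omega) e; omega
    refine ⟨hf.trans (hf₂.trans hf₃), _, hI₃, ?_, fun a ha haj => ?_, fun a ha haj => ?_, ?_, ?_, ?_⟩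
    · rw [Function.update_of_ne hne.symm, Function.update_self]
    · rw [Function.update_of_ne, Function.update_of_ne]
      · exact hs a (by omega) haj
      · intro e; have := hfan.inj a haj (i + 1) (by omega) e; omega
      · intro e; have := hfan.inj a haj i (by omega) e; omega
    · exact hupd _ _ (hfan.ne_zero a haj) (hm a (by omega) haj) fun h =>
        absurd h (hleaf a (by omega) haj.le)
    · exact hupd _ _ (by omega) hmj fun h => absurd h (hleaf j (by omega) le_rfl)
    · exact hupd _ _ (by omega) hmv fun _ e => hmv _ hinc (hcc.trans e)
    · have hmem : m .fan (i + 1) ∉ X.uncolored c₁ := by simp [uncolored, hcc, hc0]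
      have hmem' : m .fan i ∈ X.uncolored c₁ := by simp [uncolored, hE', hz]
      rw [uncolored_update hc0, uncolored_update_zero hE, Finset.card_erase_of_mem
        (Finset.mem_insert_of_mem hmem'), Finset.card_insert_of_notMem hmem, hcard]
      omega
  · rintro - m₁ ⟨hf, c₁, hI, hz, hs, hm, hmj, hmv, hcard⟩
    simp only [Nat.add_sub_cancel] at hz
    have hfr : m₁ .fan = m .fan := hf _ (by decide)
    have hE := hfan.mem j le_rfl
    simp only [runs_read_bind, hfr]
    refine ⟨by omega, (runs_colorEdge hI hX hE hz h1 h2 fun u hu => ?_).mono (by omega) ?_⟩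
    · rcases Inc.eq_or (hfan.inc j le_rfl) hu with rfl | rfl
      · exact hmv
      · exact hmj
    rintro - m₂ ⟨hI₂, hf₂⟩
    refine ⟨hf.trans hf₂, _, hI₂, ?_⟩
    have hmem : m .fan j ∈ X.uncolored c₁ := by simp [uncolored, hE, hz]
    have := Finset.card_pos.2 ⟨_, hmem⟩
    rw [uncolored_update (by omega), Finset.card_erase_of_mem hmem, ← hcard]
    omega

lemma Core.pathData {m : Mem} {c : ℕ → ℕ} (h : X.Core m c) (hX : X.Valid) {v α β : ℕ}
    (hne : α ≠ β) (hα : 1 ≤ α) (hβ : 1 ≤ β) (hm : X.Miss c v α) : X.PathData c v α β :=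
  ⟨hX, h.proper, h.zero, hne, hα, hβ, hm⟩

lemma Core.runs_search {m : Mem} {c : ℕ → ℕ} (h : X.Core m c) (hX : X.Valid) {v γ : ℕ}
    (hv : v < X.n) (h1 : 1 ≤ γ) (h2 : γ ≤ X.d + 1) :
    Runs (dictSearch X.D v γ) m 2 fun a m' => m' = m ∧
      ((a = 0 ∧ X.Miss c v γ) ∨ ∃ e, a = e + 1 ∧ X.Inc v e ∧ c e = γ) := by
  obtain ⟨tbl, hr, hs⟩ := h.tbl
  refine (runs_dictSearch hs.dict hX.size hv h1 (h2.trans hX.width)).mono le_rfl ?_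
  rintro a m' ⟨rfl, rfl⟩
  refine ⟨rfl, ?_⟩
  rcases Nat.eq_zero_or_eq_succ_pred (tbl v γ) with h0 | h0
  · exact Or.inl ⟨h0, (hr.zero_iff h1).1 h0⟩
  · exact Or.inr ⟨_, h0, (hr v γ _ h1).1 h0⟩

/-- The data structures can only represent proper colorings, and recoloring the path edge by edge
would create conflicts; so the whole path is uncolored before it is colored again. The constant is
`93 = 8 + 42 + 43`, for tracing, uncoloring and recoloring an edge. -/
lemma runs_flipPath {m : Mem} {c : ℕ → ℕ} {v α β : ℕ} {p x : ℕ → ℕ} {k : ℕ} (h : X.Inv m c)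
    (hd : X.PathData c v α β) (hv : v < X.n) (hα : α ≤ X.d + 1) (hβ : β ≤ X.d + 1)
    (hp : X.AltPath c v α β p x k) :
    Runs (flipPath X.D v α β) m (93 * k + 12) fun w m' =>
      w = x k ∧ X.Inv m' (flip c α β p k) ∧ Frame (.path :: invArrs) m m' := by
  have hX := hd.valid
  have hcol : ∀ i, 1 ≤ altCol α β i ∧ altCol α β i ≤ X.d + 1 := fun i => by
    have := hd.α_pos; have := hd.β_pos
    rcases altCol_eq_or α β i with h | h <;> omega
  have hxn : ∀ i ≤ k, x i < X.n := by
    intro i hi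
    rcases i with _ | i
    · rw [hp.zero]; exact hv
    · exact hX.graph.lt _ (hd.mem hp.toPrePath hi) _ (hp.inc_succ hi)
  rw [flipPath]
  refine Runs.bind (c₁ := 8 * k + 4) (Q := fun r m' => r = (x k, k) ∧ Frame [.path] m m' ∧
    ∀ a < k, m' .path a = p a) (runs_whileLoop (fun s m' c' => ∃ i ≤ k,
      s = (x i, altCol α β i, i) ∧ Frame [.path] m m' ∧ (∀ a < i, m' .path a = p a) ∧
      c' = 8 * (k - i) + 4) ?_ ⟨0, Nat.zero_le k, by simp [hp.zero, altCol], Frame.refl _ _,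
        by simp, by simp⟩) (by omega) ?_
  · rintro s m₁ c₁ ⟨i, hi, rfl, hf, hpath, rfl⟩
    refine ⟨if i = k then 3 else 7, by split_ifs <;> omega, ?_⟩
    have hcore := h.core.frame hf
    have hii := hcol i
    refine ((hcore.runs_search hX (hxn i hi) (hcol i).1 (hcol i).2)).bind
      (by split_ifs <;> omega) ?_
    rintro f m₂ ⟨rfl, hcase⟩
    rcases hi.lt_or_eq with hi | rfl
    · have hf : f = p i + 1 := by
        rcases hcase with ⟨-, hm⟩ | ⟨e, rfl, he, hc⟩
        · exact absurd (hp.col i hi) (hm _ (hp.inc i hi))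
        · rw [hd.proper e (p i) _ he (hp.inc i hi) (by rw [hc, hp.col i hi]) (by omega)]
      subst hf
      rw [if_neg (Nat.succ_ne_zero _), if_neg hi.ne]
      simp only [runs_write_bind, runs_other_bind, runs_pure, Nat.add_sub_cancel]
      refine ⟨by norm_num, by norm_num, 8 * (k - (i + 1)) + 4, by omega, i + 1, hi, ?_,
        hf.upd (by decide) _ _, fun a ha => ?_, rfl⟩
      · have hne := hd.ne
        simp only [Mem.upd_of_ne, ne_eq, reduceCtorEq, not_false_eq_true, hcore.src, hcore.dst,
          hp.succ i hi, Prod.mk.injEq, true_and, and_true]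
        unfold altCol
        split_ifs <;> first | rfl | omega
      · rw [Mem.upd_same, Function.update_apply]
        split_ifs with hai
        · rw [hai]
        · exact hpath a (by omega)
    · have hf : f = 0 := by
        rcases hcase with ⟨h, -⟩ | ⟨e, rfl, he, hc⟩
        · exact h
        · exact absurd hc (hp.last e he)
      subst hf
      simp only [if_true, runs_pure]
      exact ⟨trivial, hf, hpath⟩
  rintro r m₁ ⟨rfl, hf, hpath⟩
  have hI := h.frame hf
  refine Runs.bind (c₁ := 42 * k + 1) ((runs_forLoop 41 (fun i m' => Frame invArrs m₁ m' ∧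
    ∃ c', X.Inv m' c' ∧ ∀ e, c' e = if ∃ a < i, p a = e then 0 else c e) (by omega)
    ⟨Frame.refl _ _, c, hI, by simp⟩ ?_).mono (by simp; omega) fun _ _ h => h) (by omega) ?_
  · rintro i m₂ - hi ⟨hf₂, c₂, hI₂, hc₂⟩
    have hE := hd.mem hp.toPrePath hi
    have hne : ∀ a < i, p a ≠ p i := fun a ha e => by
      have := hd.edge_inj hp.toPrePath (by omega) hi e; omega
    simp only [runs_read_bind, hf₂ .path (by decide), hpath i hi]
    refine ⟨by norm_num, (runs_uncolorEdge hI₂ hX hE ?_).mono (by norm_num) ?_⟩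
    · rw [hc₂, if_neg (by rintro ⟨a, ha, e⟩; exact hne a ha e), hp.col i hi]
      have := hcol i; omega
    · rintro - m₃ ⟨hI₃, hf₃⟩
      refine ⟨hf₂.trans hf₃, _, hI₃, fun e => ?_⟩
      rw [Function.update_apply, hc₂]
      by_cases he : e = p i
      · subst he
        rw [if_pos rfl, if_pos ⟨i, by omega, rfl⟩]
      · have : (∃ a < i + 1, p a = e) ↔ ∃ a < i, p a = e := by
          constructor
          · rintro ⟨a, ha, rfl⟩
            exact ⟨a, lt_of_le_of_ne (by omega) (by rintro rfl; exact he rfl), rfl⟩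
          · rintro ⟨a, ha, rfl⟩; exact ⟨a, by omega, rfl⟩
        rw [if_neg he]; simp only [this]
  rintro - m₂ ⟨hf₂, c₂, hI₂, hc₂⟩
  have hproper := hd.flip_proper hp
  refine Runs.bind (c₁ := 43 * k + 1) ((runs_forLoop 42 (fun i m' => Frame invArrs m₁ m' ∧
    ∃ c', X.Inv m' c' ∧ ∀ e, c' e = if (∃ a < k, p a = e) ∧ ¬∃ a < i, p a = e then 0
      else flip c α β p k e) (by omega)
    ⟨hf₂, c₂, hI₂, fun e => ?_⟩ ?_).mono (by simp; omega) fun _ _ h => h) (by omega) ?_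
  · rw [hc₂]
    split_ifs with h1 h2 h2
    · rfl
    · simp [h1] at h2
    · simp [h1] at h2
    · rw [flip_of_not h1]
  · rintro i m₃ - hi ⟨hf₃, c₃, hI₃, hc₃⟩
    have hE := hd.mem hp.toPrePath hi
    have hne : ¬∃ a < i, p a = p i := fun ⟨a, ha, e⟩ => by
      have := hd.edge_inj hp.toPrePath (by omega) hi e; omega
    have hfi := hd.flip_path hp.toPrePath hi
    have hcoli : (if i % 2 = 0 then α else β) = altCol β α i := rfl
    have hαpos := hd.α_pos
    have hβpos := hd.β_pos
    have hor := altCol_eq_or β α i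
    simp only [runs_read_bind, hf₃ .path (by decide), hpath i hi, hcoli]
    refine ⟨by norm_num, (runs_colorEdge hI₃ hX hE ?_ (by omega) (by omega) ?_).mono
      (by norm_num) ?_⟩
    · rw [hc₃, if_pos ⟨⟨i, hi, rfl⟩, hne⟩]
    · intro u hu e he hc
      rw [hc₃] at hc
      split_ifs at hc with hcond
      · omega
      · have := hproper e (p i) u he hu (by rw [hc, hfi]) (by omega)
        subst this
        exact hcond ⟨⟨i, hi, rfl⟩, hne⟩
    · rintro - m₄ ⟨hI₄, hf₄⟩
      refine ⟨hf₃.trans hf₄, _, hI₄, fun e => ?_⟩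
      rw [Function.update_apply, hc₃]
      by_cases he : e = p i
      · subst he
        rw [if_pos rfl, if_neg (fun h => h.2 ⟨i, by omega, rfl⟩), hfi]
      · have : (∃ a < i + 1, p a = e) ↔ ∃ a < i, p a = e := by
          constructor
          · rintro ⟨a, ha, rfl⟩
            exact ⟨a, lt_of_le_of_ne (by omega) (by rintro rfl; exact he rfl), rfl⟩
          · rintro ⟨a, ha, rfl⟩; exact ⟨a, by omega, rfl⟩
        rw [if_neg he]; simp only [this]
  rintro - m₃ ⟨hf₃, c₃, hI₃, hc₃⟩
  rw [runs_pure]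
  have : c₃ = flip c α β p k := by
    funext e
    rw [hc₃, if_neg (fun h => h.2 h.1)]
  exact ⟨rfl, this ▸ hI₃, (hf.mono (by decide)).trans (hf₃.mono (by decide))⟩

end Ctx

namespace Ctx

variable {X : Ctx}

/-! ### Building and activating a fan -/

/-- Pigeonhole: `deg v` edges cannot use `deg v + 1` colors. This is why the sets `μ(v)` may be
limited to small colors, which keeps their total size linear in the number of edges. -/
lemma exists_small_zero {c : ℕ → ℕ} {tbl : ℕ → ℕ → ℕ} (hr : X.Rel c tbl)
    (hz : ∀ e, e ∉ X.E → c e = 0) (v : ℕ) :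
    ((Finset.Icc 1 (X.deg v + 1)).filter fun γ => tbl v γ = 0).Nonempty := by
  by_contra hne
  rw [Finset.not_nonempty_iff_eq_empty, Finset.filter_eq_empty_iff] at hne
  have := Finset.card_le_card_of_injOn (s := Finset.Icc 1 (X.deg v + 1))
    (t := X.E.filter (X.Inc v)) (fun γ => tbl v γ - 1)
    (fun γ hγ => by
      have hγ' : γ ∈ Finset.Icc 1 (X.deg v + 1) := by simpa using hγ
      have h0 := hne hγ'
      have h1 := (Finset.mem_Icc.1 hγ').1
      obtain ⟨h2, h3⟩ := (hr v γ (tbl v γ - 1) h1).1 (by omega)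
      simp only [Finset.coe_filter, Set.mem_ofPred_eq]
      refine ⟨by_contra fun he => ?_, h2⟩
      have := hz _ he
      omega)
    (fun γ hγ γ' hγ' e => by
      have hγ : γ ∈ Finset.Icc 1 (X.deg v + 1) := by simpa using hγ
      have hγ' : γ' ∈ Finset.Icc 1 (X.deg v + 1) := by simpa using hγ'
      have h0 := hne hγ
      have h0' := hne hγ'
      have h1 := (Finset.mem_Icc.1 hγ).1
      have h1' := (Finset.mem_Icc.1 hγ').1
      have h2 := ((hr v γ (tbl v γ - 1) h1).1 (by omega)).2
      have h2' := ((hr v γ' (tbl v γ' - 1) h1').1 (by omega)).2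
      simp only at e
      rw [← h2, ← h2', e])
  rw [Nat.card_Icc, Nat.add_sub_cancel] at this
  exact absurd this (Nat.not_succ_le_self _)

lemma Core.first_missing {m : Mem} {c : ℕ → ℕ} (h : X.Core m c) (hX : X.Valid) {v : ℕ}
    (hv : X.deg v ≠ 0) : 1 ≤ m .mu (m .off v) ∧ m .mu (m .off v) ≤ X.d + 1 ∧
      X.Miss c v (m .mu (m .off v)) := by
  obtain ⟨tbl, hr, hs⟩ := h.tbl
  have hset := hs.mu v hv
  have := Finset.card_pos.2 (exists_small_zero hr h.zero v)
  rw [hset.card] at this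
  have hmem := hset.item_mem 0 this
  rw [add_zero, Finset.mem_filter, Finset.mem_Icc] at hmem
  have := hX.deg_le v
  rw [hs.off v hv]
  exact ⟨hmem.1.1, by omega, (hr.zero_iff hmem.1.1).1 hmem.2⟩

/-- The color `β` primes the fan, as recorded by `j`. -/
structure Primed (X : Ctx) (c : ℕ → ℕ) (v : ℕ) (fan : ℕ → ℕ) (k β j : ℕ) : Prop where
  isFan : X.Fan c v fan k
  pos : 1 ≤ β
  le : β ≤ X.d + 1
  miss : X.Miss c (X.oth (fan k) v) β
  center : j = 0 ∧ X.Miss c v β ∨ 1 ≤ j ∧ j ≤ k ∧ c (fan j) = β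

/-- While the fan grows, `mark` is the inverse of `fan` on the positions `1, …, k`, so a repeated
color is recognized in constant time. Each new leaf uses up one of at most `d` edges at `v`, which
gives the potential. The last loop erases the marks again. -/
lemma runs_makePrimedFan {m : Mem} {c : ℕ → ℕ} {v e₀ : ℕ} (h : X.Core m c) (hX : X.Valid)
    (hmark : ∀ e ∈ X.E, m .mark e = 0) (he₀ : e₀ ∈ X.E) (hv : X.Inc v e₀) (h0 : c e₀ = 0) :
    Runs (makePrimedFan X.D v e₀) m (16 * X.d + 16) fun r m' =>
      X.Primed c v (m' .fan) r.1 r.2.1 r.2.2 ∧ (∀ e ∈ X.E, m' .mark e = 0) ∧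
      Frame [.fan, .mark] m m' := by
  have hvn := hX.graph.lt _ he₀ _ hv
  have hdeg := hX.deg_le v
  rw [makePrimedFan, runs_write_bind]
  refine ⟨by omega, Runs.bind (c₁ := 13 * X.d + 11) (Q := fun r m' =>
    X.Primed c v (m' .fan) r.1 r.2.1 r.2.2 ∧ (∀ i, 1 ≤ i → i ≤ r.1 → m' .mark (m' .fan i) = i) ∧
    (∀ e ∈ X.E, m' .mark e ≠ 0 → ∃ i, 1 ≤ i ∧ i ≤ r.1 ∧ m' .fan i = e) ∧
    Frame [.fan, .mark] m m')
    (runs_whileLoop (fun k m' c' => X.Fan c v (m' .fan) k ∧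
      (∀ i, 1 ≤ i → i ≤ k → m' .mark (m' .fan i) = i) ∧
      (∀ e ∈ X.E, m' .mark e ≠ 0 → ∃ i, 1 ≤ i ∧ i ≤ k ∧ m' .fan i = e) ∧
      Frame [.fan, .mark] m m' ∧ c' = 13 * (X.d - k) + 11) ?_
      ⟨⟨?_, ?_, ?_, ?_, ?_, ?_⟩, ?_, ?_, (Frame.refl _ _).upd (by decide) _ _, rfl⟩) (by omega) ?_⟩
  · rintro k m₁ c' ⟨hfan, hm1, hm2, hf, rfl⟩
    have hcore := h.frame hf
    have hcard := hfan.card_le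
    have hE := hfan.mem k le_rfl
    have hinc := hfan.inc k le_rfl
    refine ⟨10, by omega, ?_⟩
    obtain ⟨hβ1, hβ2, hβm⟩ := hcore.first_missing hX (deg_ne_zero hE (inc_oth hinc))
    simp only [runs_read_bind, runs_other_bind, hcore.src, hcore.dst]
    refine ⟨by norm_num, by norm_num, by norm_num, by norm_num,
      (hcore.runs_search hX hvn hβ1 hβ2).bind (by norm_num) ?_⟩
    rintro f m₂ ⟨rfl, ⟨rfl, hm⟩ | ⟨e, rfl, he, hc⟩⟩
    · simp only [if_true, runs_pure]
      exact ⟨⟨hfan, hβ1, hβ2, hβm, Or.inl ⟨rfl, hm⟩⟩, hm1, hm2, hf⟩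
    · have heE : e ∈ X.E := by
        by_contra h'
        have := hcore.zero e h'
        omega
      rw [if_neg (Nat.succ_ne_zero e)]
      simp only [Nat.add_sub_cancel, runs_read_bind, runs_ite, runs_write_bind, runs_pure]
      refine ⟨by norm_num, fun hme => ?_, fun hme => ?_⟩
      · have hne : ∀ i ≤ k, m₂ .fan i ≠ e := by
          intro i hi he'
          rcases i with _ | i
          · have := hfan.zero
            rw [he'] at this; omega
          · have := hm1 (i + 1) (by omega) hi
            rw [he'] at this; omega
        have hfan' : X.Fan c v (Function.update (m₂ .fan) (k + 1) e) (k + 1) := by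
          have hup : ∀ i ≤ k, Function.update (m₂ .fan) (k + 1) e i = m₂ .fan i := fun i hi =>
            Function.update_of_ne (by omega) _ _
          refine ⟨fun i hi => ?_, fun i hi => ?_, fun i hi j hj e' => ?_, ?_, fun i hi => ?_,
            fun i hi => ?_⟩
          · rcases Nat.le_succ_iff.1 hi with hi | rfl
            · rw [hup i hi]; exact hfan.mem i hi
            · rwa [Function.update_self]
          · rcases Nat.le_succ_iff.1 hi with hi | rfl
            · rw [hup i hi]; exact hfan.inc i hi
            · rwa [Function.update_self]
          · rcases Nat.le_succ_iff.1 hi with hi | rfl <;> rcases Nat.le_succ_iff.1 hj with hj | rfl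
            · rw [hup i hi, hup j hj] at e'; exact hfan.inj i hi j hj e'
            · rw [hup i hi, Function.update_self] at e'; exact absurd e' (hne i hi)
            · rw [hup j hj, Function.update_self] at e'; exact absurd e'.symm (hne j hj)
            · rfl
          · rw [hup 0 (Nat.zero_le k)]; exact hfan.zero
          · rcases Nat.lt_succ_iff_lt_or_eq.1 hi with hi | rfl
            · rw [hup _ hi]; exact hfan.ne_zero i hi
            · rw [Function.update_self, hc]; omega
          · rcases Nat.lt_succ_iff_lt_or_eq.1 hi with hi | rfl
            · rw [hup _ hi, hup _ hi.le]; exact hfan.miss i hi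
            · rw [Function.update_self, hup _ le_rfl, hc]; exact hβm
        have hcard' := hfan'.card_le
        refine ⟨by norm_num, by norm_num, 13 * (X.d - (k + 1)) + 11, by omega, ?_, ?_, ?_,
          (hf.upd (by decide) _ _).upd (by decide) _ _, rfl⟩
        · simpa using hfan'
        · intro i hi1 hik
          simp only [Mem.upd_same, Mem.upd_of_ne, ne_eq, reduceCtorEq, not_false_eq_true]
          rcases Nat.le_succ_iff.1 hik with hi | rfl
          · rw [Function.update_of_ne (by omega : i ≠ k + 1), Function.update_of_ne (hne i hi)]
            exact hm1 i hi1 hi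
          · simp
        · intro e' he' hme'
          simp only [Mem.upd_same, Mem.upd_of_ne, ne_eq, reduceCtorEq, not_false_eq_true] at hme' ⊢
          by_cases hee : e' = e
          · exact ⟨k + 1, by omega, le_rfl, by simp [hee]⟩
          · rw [Function.update_of_ne hee] at hme'
            obtain ⟨i, h1, h2, h3⟩ := hm2 e' he' hme'
            exact ⟨i, h1, by omega, by rw [Function.update_of_ne (by omega), h3]⟩
      · obtain ⟨i, h1, h2, h3⟩ := hm2 e heE hme
        have h4 := hm1 i h1 h2
        rw [h3] at h4
        refine ⟨⟨hfan, hβ1, hβ2, hβm, Or.inr ⟨by omega, by omega, ?_⟩⟩, hm1, hm2, hf⟩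
        rw [h4, h3, hc]
  · simpa using he₀
  · simpa using hv
  · intro i hi j hj _; omega
  · simpa using h0
  · intro i hi; omega
  · intro i hi; omega
  · intro i hi hi'; omega
  · intro e he hme
    simp [hmark e he] at hme
  · rintro ⟨k, β, j⟩ m₁ ⟨hpr, hm1, hm2, hf⟩
    have hcard := hpr.isFan.card_le
    refine Runs.bind (c₁ := 3 * k + 1) ((runs_forLoop (lo := 1) (hi := k + 1) 2 (fun i m' =>
      Frame [.mark] m₁ m' ∧ ∀ e ∈ X.E, m' .mark e ≠ 0 → ∃ a, i ≤ a ∧ a ≤ k ∧ m₁ .fan a = e)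
      (by omega) ⟨Frame.refl _ _, hm2⟩ ?_).mono (by simp; omega) fun _ _ h => h)
      (by omega) ?_
    · rintro i m₂ hi1 hi2 ⟨hf₂, hm⟩
      simp only [runs_read_bind, runs_write]
      refine ⟨by norm_num, by norm_num, hf₂.upd (by decide) _ _, fun e he hme => ?_⟩
      rw [hf₂ .fan (by decide), Mem.upd_same] at hme
      by_cases hee : e = m₁ .fan i
      · simp [hee] at hme
      · rw [Function.update_of_ne hee] at hme
        obtain ⟨a, h1, h2, h3⟩ := hm e he hme
        exact ⟨a, by_contra fun h' => hee (by rw [← h3, show a = i by omega]), h2, h3⟩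
    · rintro - m₂ ⟨hf₂, hm⟩
      rw [runs_pure]
      refine ⟨by rw [hf₂ .fan (by decide)]; exact hpr, fun e he => ?_,
        hf.trans (hf₂.mono (by decide))⟩
      by_contra hme
      obtain ⟨a, h1, h2, -⟩ := hm e he hme
      omega

/-- If `β` is not missing at `v`, it is the color of `v x_j`, and both `x_{j-1}` and `x_k` miss `β`.
The flip makes `β` missing at `v`, and as the path has only one other end `w`, at least one of the
two leaves still misses `β`. If `w = x_{j-1}`, then `x_{j-1}` now misses `α`, which is the new color
of `v x_j`, so the whole fan survives and can be shifted from `x_k`. Otherwise the fan up to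
`x_{j-1}`, which avoids `v x_j`, is used. -/
lemma runs_activateFan {m : Mem} {c : ℕ → ℕ} {v α k β j : ℕ} (h : X.Inv m c) (hX : X.Valid)
    (hpr : X.Primed c v (m .fan) k β j) (hα1 : 1 ≤ α) (hα2 : α ≤ X.d + 1)
    (hα : X.Miss c v α) :
    Runs (activateFan X.D v α k β j) m
      (85 * X.d + 60 + if j = 0 then 0 else 93 * X.pathLen c v α β) fun _ m' =>
      Frame (.path :: invArrs) m m' ∧ ∃ c', X.Inv m' c' ∧
        (X.uncolored c').card + 1 = (X.uncolored c).card := by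
  have hfan := hpr.isFan
  have hcard := hfan.card_le
  have hdeg := hX.deg_le v
  have hkd : 85 * k + 43 ≤ 85 * X.d + 43 := by omega
  have hvn := hX.graph.lt _ (hfan.mem 0 (Nat.zero_le k)) _ (hfan.inc 0 (Nat.zero_le k))
  rw [activateFan, runs_ite]
  refine ⟨fun hj => ?_, fun hj => ?_⟩
  · have hm := (hpr.center.resolve_right (by omega)).2
    refine (runs_shiftAndColor h hX hfan hpr.pos hpr.le hm hpr.miss).mono (by omega) ?_
    rintro - m' ⟨hf, h'⟩
    exact ⟨hf.mono (by decide), h'⟩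
  · obtain ⟨hj1, hjk, hcj⟩ := hpr.center.resolve_left (by omega)
    have hne : α ≠ β := fun e => hα _ (hfan.inc j hjk) (by rw [hcj, e])
    have hd := h.core.pathData hX hne hα1 hpr.pos hα
    obtain ⟨p, x, K, hp⟩ := hd.exists_altPath
    rw [if_neg hj, hd.pathLen_eq hp]
    refine (runs_flipPath h hd hvn hα2 hpr.le hp).bind (by omega) ?_
    rintro w m₁ ⟨rfl, hI, hf⟩
    have hfr : m₁ .fan = m .fan := hf _ (by decide)
    -- The only edge of the fan that the flip can recolor is `v x_j`: `α` is missing at `v`, and `β`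
    -- occurs there once.
    have hcol : ∀ i < k, i + 1 ≠ j → c (m .fan (i + 1)) ≠ α ∧ c (m .fan (i + 1)) ≠ β := by
      intro i hi hij
      refine ⟨hα _ (hfan.inc (i + 1) hi), fun e => hij ?_⟩
      exact hfan.inj _ hi _ hjk (h.core.proper _ _ v (hfan.inc (i + 1) hi) (hfan.inc j hjk)
        (by rw [e, hcj]) (hfan.ne_zero i hi))
    have hmissj : X.Miss c (X.oth (m .fan (j - 1)) v) β := by
      have := hfan.miss (j - 1) (by omega)
      rwa [Nat.sub_add_cancel hj1, hcj] at this
    have hfan' : ∀ K', K' ≤ k → (x K = X.oth (m .fan (j - 1)) v ∨ K' < j) →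
        X.Fan (flip c α β p K) v (m .fan) K' := by
      intro K' hK' hor
      have hfan' := hfan.take hK'
      refine ⟨hfan'.mem, hfan'.inc, hfan'.inj, (hd.flip_eq_zero hp _).2 hfan.zero,
        fun i hi => fun h0 => hfan'.ne_zero i hi ((hd.flip_eq_zero hp _).1 h0), fun i hi => ?_⟩
      by_cases hij : i + 1 = j
      · have hw := hor.resolve_right (by omega)
        have hfj : flip c α β p K (m .fan j) = α := by
          have hinc := hfan.inc j hjk
          rw [← hp.zero] at hinc
          rw [flip, if_pos (hd.closed hp (Nat.zero_le K) hinc (Or.inr hcj)), if_neg]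
          rw [hcj]; exact hne.symm
        rw [hij, hfj, show i = j - 1 by omega, ← hw]
        exact hd.miss_flip_end hp (hw ▸ hmissj)
      · obtain ⟨h1, h2⟩ := hcol i (by omega) hij
        rw [hd.flip_of_ne hp h1 h2]
        exact hd.miss_flip_of_ne hp h1 h2 (hfan'.miss i hi)
    have hunc : X.uncolored (flip c α β p K) = X.uncolored c := by
      ext e; simp [uncolored, hd.flip_eq_zero hp]
    simp only [runs_read_bind, runs_other_bind, runs_ite, hfr, hI.core.src, hI.core.dst]
    refine ⟨by omega, by omega, fun hw => ?_, fun hw => ?_⟩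
    · refine (runs_shiftAndColor hI hX (j := k) (v := v) (hfr ▸ hfan' k le_rfl (Or.inl hw)) hpr.pos
        hpr.le (hd.miss_flip_start hp) ?_).mono (by omega) ?_
      · rw [hfr]
        refine hd.miss_flip_other hp (oth_ne hX (hfan.mem k le_rfl) (hfan.inc k le_rfl)) ?_ hpr.miss
        rw [hw]
        intro e
        have := hfan.leaf_inj hX le_rfl (by omega : j - 1 ≤ k) e
        omega
      · rintro - m' ⟨hf', h'⟩
        rw [hunc] at h'
        exact ⟨hf.trans (hf'.mono (by decide)), h'⟩
    · refine (runs_shiftAndColor hI hX (j := j - 1) (v := v)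
        (hfr ▸ hfan' (j - 1) (by omega) (Or.inr (by omega))) hpr.pos
        hpr.le (hd.miss_flip_start hp) ?_).mono (by omega) ?_
      · rw [hfr]
        exact hd.miss_flip_other hp (oth_ne hX (hfan.mem _ (by omega)) (hfan.inc _ (by omega)))
          (fun e => hw e.symm) hmissj
      · rintro - m' ⟨hf', h'⟩
        rw [hunc] at h'
        exact ⟨hf.trans (hf'.mono (by decide)), h'⟩

end Ctx

namespace Ctx

variable {X : Ctx}

/-! ### The total length of alternating paths -/

open Classical in
/-- The colors missing at `v`. -/
noncomputable def missing (X : Ctx) (c : ℕ → ℕ) (v : ℕ) : Finset ℕ :=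
  (Finset.Icc 1 (X.d + 1)).filter fun γ => X.Miss c v γ

open Classical in
/-- The triples `(v, α, β)` that determine an alternating path from `v`. -/
noncomputable def starts (X : Ctx) (c : ℕ → ℕ) : Finset (ℕ × ℕ × ℕ) :=
  (Finset.range X.n ×ˢ Finset.Icc 1 (X.d + 1) ×ˢ Finset.Icc 1 (X.d + 1)).filter fun t =>
    t.2.1 ≠ t.2.2 ∧ X.Miss c t.1 t.2.1

lemma mem_starts {c : ℕ → ℕ} {v α β : ℕ} : (v, α, β) ∈ X.starts c ↔
    v < X.n ∧ (1 ≤ α ∧ α ≤ X.d + 1) ∧ (1 ≤ β ∧ β ≤ X.d + 1) ∧ α ≠ β ∧ X.Miss c v α := by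
  simp [starts, and_assoc]

/-- Alternating paths from different vertices or with different colors do not pass through the same
edge in the same direction with the same second color. -/
lemma state_inj {c : ℕ → ℕ} {v α β v' α' β' : ℕ} {p x p' x' : ℕ → ℕ} {k k' : ℕ}
    (h : X.PathData c v α β) (h' : X.PathData c v' α' β') (hp : X.PrePath c v α β p x k)
    (hp' : X.PrePath c v' α' β' p' x' k') : ∀ i i', i < k → i' < k' → x i = x' i' →
      altCol α β i = altCol α' β' i' → altCol β α i = altCol β' α' i' →
      v = v' ∧ α = α' ∧ β = β' ∧ i = i' := by
  intro i
  induction i with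
  | zero =>
    intro i' hi hi' hx h1 h2
    rcases i' with _ | i'
    · rw [hp.zero, hp'.zero] at hx
      exact ⟨hx, h2, h1, rfl⟩
    -- A path that passes through `v` with these two colors would have entered `v` by an edge of
    -- color `α`, which is missing there.
    · have := hp'.inc_succ (i := i') (by omega)
      rw [← hx, hp.zero] at this
      refine absurd ?_ (h.miss _ this)
      rw [hp'.col _ (by omega), ← altCol_succ, ← h2]; rfl
  | succ i ih =>
    intro i' hi hi' hx h1 h2
    rcases i' with _ | i'
    · have := hp.inc_succ (i := i) (by omega)
      rw [hx, hp'.zero] at this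
      refine absurd ?_ (h'.miss _ this)
      rw [hp.col _ (by omega), ← altCol_succ, h2]; rfl
    · have e1 := hp.inc_succ (i := i) (by omega)
      have e2 := hp'.inc_succ (i := i') (by omega)
      rw [altCol_succ, altCol_succ] at h1 h2
      have hpe : p i = p' i' := h.proper _ _ _ e1 (hx ▸ e2)
        (by rw [hp.col _ (by omega), hp'.col _ (by omega), h2])
        (by rw [hp.col _ (by omega)]; exact h.altCol_pos i)
      -- Both paths entered the common vertex by the same edge, so they also came from the same
      -- vertex.
      have hxx : x i = x' i' := by
        have e3 := oth_oth h.valid (h.mem hp (by omega : i < k)) (hp.inc i (by omega))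
        have e4 := oth_oth h'.valid (h'.mem hp' (by omega : i' < k')) (hp'.inc i' (by omega))
        rw [← hp.succ i (by omega)] at e3
        rw [← hp'.succ i' (by omega)] at e4
        rw [← e3, ← e4, hx, hpe]
      obtain ⟨r1, r2, r3, r4⟩ := ih i' (by omega) (by omega) hxx h2 h1
      exact ⟨r1, r2, r3, by omega⟩

lemma pathData_of_mem {m : Mem} {c : ℕ → ℕ} (h : X.Core m c) (hX : X.Valid)
    {t : ℕ × ℕ × ℕ} (ht : t ∈ X.starts c) : X.PathData c t.1 t.2.1 t.2.2 := by
  obtain ⟨v, α, β⟩ := t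
  obtain ⟨-, h1, h2, h3, h4⟩ := mem_starts.1 ht
  exact h.pathData hX h3 h1.1 h2.1 h4

/-- Double counting. Each edge of each path is recorded together with the direction in which it is
traversed and with the other color of the path. By `state_inj` no record occurs twice, and a colored
edge admits two directions and `d` other colors. -/
lemma sum_pathLen_le {m : Mem} {c : ℕ → ℕ} (h : X.Core m c) (hX : X.Valid) :
    ∑ t ∈ X.starts c, X.pathLen c t.1 t.2.1 t.2.2 ≤ 2 * (X.E.card * X.d) := by
  have hd := fun t (ht : t ∈ X.starts c) => pathData_of_mem h hX ht
  have hex : ∀ t : ℕ × ℕ × ℕ, ∃ q : (ℕ → ℕ) × (ℕ → ℕ), t ∈ X.starts c →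
      X.AltPath c t.1 t.2.1 t.2.2 q.1 q.2 (X.pathLen c t.1 t.2.1 t.2.2) := by
    intro t
    by_cases ht : t ∈ X.starts c
    · obtain ⟨p, x, k, hp⟩ := (hd t ht).exists_altPath
      refine ⟨(p, x), fun _ => ?_⟩
      rw [(hd t ht).pathLen_eq hp]; exact hp
    · exact ⟨(id, id), fun h => absurd h ht⟩
  choose q hq using hex
  let S := (X.starts c).sigma fun t => Finset.range (X.pathLen c t.1 t.2.1 t.2.2)
  let T : Finset (Σ _ : ℕ × Bool, ℕ) := (X.E ×ˢ (Finset.univ : Finset Bool)).sigma fun e =>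
    (Finset.Icc 1 (X.d + 1)).erase (c e.1)
  let g : (Σ _ : ℕ × ℕ × ℕ, ℕ) → (Σ _ : ℕ × Bool, ℕ) := fun s =>
    ⟨((q s.1).1 s.2, decide (X.src ((q s.1).1 s.2) = (q s.1).2 s.2)), altCol s.1.2.2 s.1.2.1 s.2⟩
  have hS : S.card = ∑ t ∈ X.starts c, X.pathLen c t.1 t.2.1 t.2.2 := by
    simp [S, Finset.card_sigma]
  have hgT : ∀ s ∈ S, g s ∈ T ∧ c (g s).1.1 ≠ 0 := by
    rintro ⟨⟨v, α, β⟩, i⟩ hs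
    obtain ⟨ht, hi⟩ := Finset.mem_sigma.1 hs
    have hi := Finset.mem_range.1 hi
    have hp := hq _ ht
    have hdt := hd _ ht
    have hE := hdt.mem hp.toPrePath hi
    have hc := hp.col i hi
    obtain ⟨-, h1, h2, h3, -⟩ := mem_starts.1 ht
    have hne := hdt.altCol_pos i
    simp only [T, g, Finset.mem_sigma, Finset.mem_product, Finset.mem_univ, and_true,
      Finset.mem_erase, Finset.mem_Icc] at hc hE ⊢
    refine ⟨⟨hE, ?_, ?_⟩, by rw [hc]; exact hne⟩
    · rw [hc]; unfold altCol; split_ifs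
      · exact h3
      · exact h3.symm
    · unfold altCol; split_ifs <;> omega
  have hinj : Set.InjOn g S := by
    rintro ⟨⟨v, α, β⟩, i⟩ hs ⟨⟨v', α', β'⟩, i'⟩ hs' hE
    obtain ⟨ht, hi⟩ := Finset.mem_sigma.1 (Finset.mem_coe.1 hs)
    obtain ⟨ht', hi'⟩ := Finset.mem_sigma.1 (Finset.mem_coe.1 hs')
    have hi := Finset.mem_range.1 hi
    have hi' := Finset.mem_range.1 hi'
    have hp := hq _ ht
    have hp' := hq _ ht'
    simp only [g, Sigma.mk.injEq, Prod.mk.injEq, heq_eq_eq, decide_eq_decide] at hE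
    obtain ⟨⟨h1, h2⟩, h3⟩ := hE
    have hx : (q (v, α, β)).2 i = (q (v', α', β')).2 i' := by
      have e1 := hp.inc i hi
      have e2 := hp'.inc i' hi'
      rw [← h1] at e2 h2
      simp only [EdgeColoring.Inc] at e1 e2
      grind
    obtain ⟨r1, r2, r3, r4⟩ := state_inj (hd _ ht) (hd _ ht') hp.toPrePath hp'.toPrePath i i' hi hi'
      hx (by rw [← hp.col i hi, h1, hp'.col i' hi']) h3
    simp only at r1 r2 r3
    subst r1 r2 r3 r4; rfl
  rw [← hS]
  -- The restriction to colored edges matters for the count: only there does erasing the own color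
  -- leave `d` of the `d + 1` colors.
  let T' := T.filter fun s => c s.1.1 ≠ 0
  have h1 : S.card ≤ T'.card := Finset.card_le_card_of_injOn g
    (fun s hs => Finset.mem_coe.2 (Finset.mem_filter.2 (hgT s hs))) hinj
  have h2 : T'.card ≤ ∑ _e ∈ X.E ×ˢ (Finset.univ : Finset Bool), X.d := by
    have : T' ⊆ ((X.E ×ˢ (Finset.univ : Finset Bool)).filter fun e => c e.1 ≠ 0).sigma fun e =>
        (Finset.Icc 1 (X.d + 1)).erase (c e.1) := by
      intro s hs
      simp only [T', T, Finset.mem_filter, Finset.mem_sigma] at hs ⊢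
      tauto
    refine (Finset.card_le_card this).trans ?_
    rw [Finset.card_sigma]
    refine (Finset.sum_le_sum (g := fun _ => X.d) fun e he => ?_).trans
      (Finset.sum_le_sum_of_subset (Finset.filter_subset _ _))
    have hle := h.le e.1
    have h0 := (Finset.mem_filter.1 he).2
    rw [Finset.card_erase_of_mem (by simp; omega), Nat.card_Icc]
    omega
  refine h1.trans (h2.trans (le_of_eq ?_))
  simp; ring

/-! ### Uncolored edges and missing colors -/

/-- Different used colors at `v` belong to different colored edges, so at most `deg v` minus the
number of uncolored edges at `v` of the `d + 1` colors are used, and `deg v ≤ d`. -/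
lemma card_uncolored_lt_missing {m : Mem} {c : ℕ → ℕ} (h : X.Core m c) (hX : X.Valid) (v : ℕ) :
    ((X.uncolored c).filter (X.Inc v)).card < (X.missing c v).card := by
  classical
  have h1 : ((Finset.Icc 1 (X.d + 1)).filter fun γ => ¬X.Miss c v γ).card ≤
      ((X.E.filter (X.Inc v)).filter fun e => ¬c e = 0).card := by
    have hex : ∀ γ, ∃ e, ¬X.Miss c v γ → X.Inc v e ∧ c e = γ := by
      intro γ
      by_cases hm : X.Miss c v γ
      · exact ⟨0, fun h => absurd hm h⟩
      · simp only [Miss, not_forall, not_not] at hm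
        obtain ⟨e, he, hc⟩ := hm
        exact ⟨e, fun _ => ⟨he, hc⟩⟩
    choose f hf using hex
    refine Finset.card_le_card_of_injOn f (fun γ hγ => ?_) fun γ hγ γ' hγ' e => ?_
    · obtain ⟨h1, h2⟩ := Finset.mem_filter.1 (Finset.mem_coe.1 hγ)
      obtain ⟨h3, h4⟩ := hf γ h2
      have h5 := (Finset.mem_Icc.1 h1).1
      refine Finset.mem_coe.2 (Finset.mem_filter.2 ⟨Finset.mem_filter.2 ⟨?_, h3⟩, by omega⟩)
      by_contra h'
      have := h.zero _ h'
      omega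
    · rw [← (hf γ (Finset.mem_filter.1 (Finset.mem_coe.1 hγ)).2).2, e,
        (hf γ' (Finset.mem_filter.1 (Finset.mem_coe.1 hγ')).2).2]
  have h2 := Finset.card_filter_add_card_filter_not (s := Finset.Icc 1 (X.d + 1))
    (p := fun γ => X.Miss c v γ)
  have h3 := Finset.card_filter_add_card_filter_not (s := X.E.filter (X.Inc v))
    (p := fun e => c e = 0)
  have h4 : (X.E.filter (X.Inc v)).card ≤ X.d := hX.deg_le v
  rw [Nat.card_Icc, Nat.add_sub_cancel] at h2
  have h5 : (X.uncolored c).filter (X.Inc v) = (X.E.filter (X.Inc v)).filter fun e => c e = 0 := by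
    rw [uncolored, Finset.filter_comm]
  have h6 : X.missing c v = (Finset.Icc 1 (X.d + 1)).filter fun γ => X.Miss c v γ := by
    rw [missing]
  rw [h5, h6]
  omega

/-- The vertex chosen by *Random-Color-One* from the edge `e`. -/
def pick (X : Ctx) (e s : ℕ) : ℕ := if s = 0 then X.src e else X.dst e

lemma inc_pick (e s : ℕ) : X.Inc (X.pick e s) e := by
  unfold pick; split_ifs
  · exact Or.inl rfl
  · exact Or.inr rfl

/-- The sum of the lengths of all alternating paths that start at `v`. -/
noncomputable def lenFrom (X : Ctx) (c : ℕ → ℕ) (v : ℕ) : ℕ :=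
  ∑ α ∈ X.missing c v, ∑ β ∈ (Finset.Icc 1 (X.d + 1)).erase α, X.pathLen c v α β

lemma sum_lenFrom_le {m : Mem} {c : ℕ → ℕ} (h : X.Core m c) (hX : X.Valid) :
    ∑ v ∈ Finset.range X.n, X.lenFrom c v ≤ 2 * (X.E.card * X.d) := by
  classical
  refine le_trans (le_of_eq ?_) (sum_pathLen_le h hX)
  simp only [lenFrom, missing, starts]
  simp only [Finset.sum_filter, Finset.sum_product]
  refine Finset.sum_congr rfl fun v _ => Finset.sum_congr rfl fun α hα => ?_
  split_ifs with hm
  · rw [← Finset.filter_ne, Finset.sum_filter]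
    refine Finset.sum_congr rfl fun β _ => ?_
    simp only [hm, and_true]
  · simp [hm]

/-- On average over the choices of an uncolored edge and of one of its endpoints, the expected length
of the alternating path is at most `d |E| / l`. -/
lemma avg_le {m : Mem} {c : ℕ → ℕ} (h : X.Inv m c) (hX : X.Valid) (A : ℕ → ℕ → ℝ)
    (hA : ∀ i < m .uncSize 0, ∀ s < 2, A i s ≤
      X.lenFrom c (X.pick (m .unc i) s) / (X.missing c (X.pick (m .unc i) s)).card) :
    ∑ i ∈ Finset.range (m .uncSize 0), ∑ s ∈ Finset.range 2, A i s ≤ 2 * (X.E.card * X.d) := by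
  classical
  have hmem : ∀ i < m .uncSize 0, m .unc i ∈ X.uncolored c := fun i hi => by
    simpa using h.unc.item_mem i hi
  have hE : ∀ i < m .uncSize 0, m .unc i ∈ X.E := fun i hi => (Finset.mem_filter.1 (hmem i hi)).1
  let P := Finset.range (m .uncSize 0) ×ˢ Finset.range 2
  let w : ℕ × ℕ → ℕ := fun q => X.pick (m .unc q.1) q.2
  rw [← Finset.sum_product' (Finset.range (m .uncSize 0)) (Finset.range 2) A]
  have h1 : ∑ q ∈ P, A q.1 q.2 ≤ ∑ q ∈ P, (X.lenFrom c (w q) : ℝ) / (X.missing c (w q)).card := by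
    refine Finset.sum_le_sum fun q hq => ?_
    simp only [P, Finset.mem_product, Finset.mem_range] at hq
    exact hA q.1 hq.1 q.2 hq.2
  have hmaps : ∀ q ∈ P, w q ∈ Finset.range X.n := by
    intro q hq
    simp only [P, Finset.mem_product, Finset.mem_range] at hq ⊢
    exact hX.graph.lt _ (hE _ hq.1) _ (inc_pick _ _)
  refine h1.trans ?_
  -- The choices are grouped by the chosen vertex `v`. It is chosen once for each of its uncolored
  -- edges, hence less often than it has missing colors, which cancels the denominator and leaves
  -- `lenFrom c v`.
  rw [← Finset.sum_fiberwise_of_maps_to hmaps]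
  have h2 : ∀ v ∈ Finset.range X.n, ∑ q ∈ P with w q = v,
      (X.lenFrom c (w q) : ℝ) / (X.missing c (w q)).card ≤ X.lenFrom c v := by
    intro v _
    have hpos := card_uncolored_lt_missing h.core hX v
    have hfib : (P.filter fun q => w q = v).card ≤ ((X.uncolored c).filter (X.Inc v)).card := by
      refine Finset.card_le_card_of_injOn (fun q => m .unc q.1) (fun q hq => ?_)
        fun q hq q' hq' e => ?_
      · simp only [P, Finset.coe_filter, Set.mem_ofPred_eq, Finset.mem_product,
          Finset.mem_range] at hq
        refine Finset.mem_coe.2 (Finset.mem_filter.2 ⟨hmem _ hq.1.1, ?_⟩)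
        rw [← hq.2]; exact inc_pick _ _
      · simp only [P, Finset.coe_filter, Set.mem_ofPred_eq, Finset.mem_product,
          Finset.mem_range] at hq hq'
        have e1 : q.1 = q'.1 := by
          have r1 := h.unc.pos_item q.1 hq.1.1
          have r2 := h.unc.pos_item q'.1 hq'.1.1
          simp only [zero_add] at r1 r2 e
          rw [← r1, e, r2]
        have hne := hX.graph.ne _ (hE _ hq.1.1)
        have e2 : q.2 = q'.2 := by
          have r := hq.2.trans hq'.2.symm
          simp only [w, pick, ← e1] at r
          split_ifs at r <;> omega
        exact Prod.ext e1 e2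
    rw [Finset.sum_congr rfl (g := fun _ => (X.lenFrom c v : ℝ) / (X.missing c v).card)
      fun q hq => by rw [(Finset.mem_filter.1 hq).2], Finset.sum_const, nsmul_eq_mul]
    have hM : (0 : ℝ) < (X.missing c v).card := by exact_mod_cast (by omega)
    rw [mul_div_assoc', div_le_iff₀ hM, mul_comm]
    exact mul_le_mul_of_nonneg_left (by exact_mod_cast (by omega)) (by positivity)
  refine (Finset.sum_le_sum h2).trans ?_
  exact_mod_cast sum_lenFrom_le h.core hX

end Ctx

/-! ### Mixing deterministic steps and random draws -/

lemma Runs.bind_spec {α β : Type} {lam : ℝ} {p : Prog α} {f : α → Prog β} {m : Mem} {c : ℕ} {M : ℝ}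
    {Q : α → Mem → Prop} {R : β → Mem → Prop} (hl : 0 ≤ lam) (h : Runs p m c Q) (hM : 1 ≤ M)
    (hf : ∀ a m', Q a m' → Spec lam (f a) m' M R) :
    Spec lam (p >>= f) m (Real.exp (lam * c) * M) R :=
  (h.spec hl).bind hM hf

lemma Spec.read_bind {β : Type} {lam : ℝ} {a : Arr} {i : ℕ} {f : ℕ → Prog β} {m : Mem} {M : ℝ}
    {R : β → Mem → Prop} (hl : 0 ≤ lam) (h : Spec lam (f (m a i)) m M R) :
    Spec lam (read a i >>= f) m (Real.exp lam * M) R := by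
  have h1 : Runs (read a i) m 1 fun x m' => x = m a i ∧ m' = m := by simp
  have := h1.bind_spec (f := f) hl h.1 (by rintro x m' ⟨rfl, rfl⟩; exact h)
  simpa using this

/-- For bounded exponents the exponential moment is linear in the cost, so averaging over random
choices only involves expectations. -/
lemma exp_le_one_add_two_mul {y : ℝ} (h0 : 0 ≤ y) (h1 : y ≤ 1) : Real.exp y ≤ 1 + 2 * y := by
  have := Real.abs_exp_sub_one_sub_id_le (x := y) (by rw [abs_of_nonneg h0]; exact h1)
  have := (abs_le.1 this).2
  nlinarith

namespace Ctx

variable {X : Ctx}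

/-! ### Random-Color-One -/

/-- The part of *Random-Color-One* after the choice of the edge `e₀` and its endpoint `v`. -/
noncomputable def colorOneTail (D : Dict) (d e₀ v : ℕ) : Prog Unit := do
  let c ← foldLoop 1 (d + 2) 0 fun γ c => do
    let f ← dictSearch D v γ
    if f = 0 then
      write .cand c γ
      pure (c + 1)
    else pure c
  let a ← rand c
  let α ← read .cand a
  let r ← makePrimedFan D v e₀
  activateFan D v α r.1 r.2.1 r.2.2

lemma randomColorOne_eq (D : Dict) (d : ℕ) : randomColorOne D d = (do
    let l ← read .uncSize 0
    let i ← rand l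
    let e₀ ← read .unc i
    let s ← rand 2
    let v ← read (if s = 0 then .src else .dst) e₀
    colorOneTail D d e₀ v) := rfl

/-- The arrays changed by *Random-Color-One*. -/
abbrev oneArrs : List Arr := [.cand, .fan, .mark, .path] ++ invArrs

lemma runs_candidates {m : Mem} {c : ℕ → ℕ} (h : X.Core m c) (hX : X.Valid) {v : ℕ}
    (hv : v < X.n) :
    Runs (foldLoop 1 (X.d + 2) 0 fun γ c => do
        let f ← dictSearch X.D v γ
        if f = 0 then
          write .cand c γ
          pure (c + 1)
        else pure c) m ((X.d + 1) * 4 + 1) fun k m' =>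
      k = (X.missing c v).card ∧ (Finset.range k).image (m' .cand) = X.missing c v ∧
        Frame [.cand] m m' := by
  classical
  refine (runs_foldLoop (lo := 1) (hi := X.d + 2) 3 (fun γ k m' => Frame [.cand] m m' ∧
    k = ((Finset.Ico 1 γ).filter fun γ => X.Miss c v γ).card ∧
    (Finset.range k).image (m' .cand) = (Finset.Ico 1 γ).filter fun γ => X.Miss c v γ)
    (by omega) ⟨Frame.refl _ _, by simp, by simp⟩ ?_).mono (by simp) ?_
  · rintro γ k m₁ hγ1 hγ2 ⟨hf, hk, himg⟩
    have hcore := h.frame hf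
    refine (hcore.runs_search hX hv hγ1 (by omega)).bind (by norm_num) ?_
    rintro f m₂ ⟨rfl, hcase⟩
    have hins : Finset.Ico 1 (γ + 1) = insert γ (Finset.Ico 1 γ) := by ext; simp; omega
    rw [hins]
    rcases hcase with ⟨rfl, hm⟩ | ⟨e, rfl, he, hc⟩
    · rw [Finset.filter_insert, if_pos hm]
      simp only [if_true, runs_write_bind, runs_pure]
      have hnot : γ ∉ (Finset.Ico 1 γ).filter fun γ => X.Miss c v γ := by simp
      refine ⟨by norm_num, hf.upd (by decide) _ _, ?_, ?_⟩
      · rw [Finset.card_insert_of_notMem hnot, ← hk]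
      · rw [Finset.range_add_one, Finset.image_insert, Mem.upd_same, Function.update_self, ← himg]
        congr 1
        refine Finset.image_congr fun i hi => ?_
        exact Function.update_of_ne (by have := Finset.mem_range.1 (Finset.mem_coe.1 hi); omega) _ _
    · have hm : ¬X.Miss c v γ := fun hm => hm e he hc
      rw [Finset.filter_insert, if_neg hm]
      simp only [Nat.succ_ne_zero, if_false, runs_pure]
      exact ⟨hf, hk, himg⟩
  · rintro k m' ⟨hf, hk, himg⟩
    have : (Finset.Ico 1 (X.d + 2)).filter (fun γ => X.Miss c v γ) = X.missing c v := by
      rw [missing]; rfl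
    rw [this] at hk himg
    exact ⟨hk, himg, hf⟩

/-- The state between two calls of *Random-Color-One*: `l` edges are uncolored. -/
def Ready (X : Ctx) (l : ℕ) (m : Mem) : Prop :=
  (∀ e ∈ X.E, m .mark e = 0) ∧ ∃ c, X.Inv m c ∧ (X.uncolored c).card = l

set_option maxHeartbeats 800000 in
-- The fan is built after `α` is drawn but does not depend on it, so `β` and `j` are fixed before
-- the average over `α` is taken. `A` is the average of the path length over the missing colors `α`.
-- As `β` is one particular color other than `α` whenever a path is flipped, `A` is bounded by the
-- average in which all `β` are summed.
lemma spec_colorOneTail {lam : ℝ} (hl : 0 ≤ lam) {m : Mem} {c : ℕ → ℕ} {l : ℕ} (h : X.Inv m c)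
    (hX : X.Valid) (hlam : lam * (93 * X.n) ≤ 1) (hmark : ∀ e ∈ X.E, m .mark e = 0) {e₀ v : ℕ}
    (he₀ : e₀ ∈ X.E) (hv : X.Inc v e₀) (h0 : c e₀ = 0) (hcard : (X.uncolored c).card = l + 1) :
    ∃ A : ℝ, 0 ≤ A ∧ A ≤ X.n ∧ A ≤ X.lenFrom c v / (X.missing c v).card ∧
      Spec lam (colorOneTail X.D X.d e₀ v) m
        (Real.exp (lam * (105 * (X.d + 1))) * (1 + 186 * lam * A))
        fun _ m' => X.Ready l m' ∧ Frame oneArrs m m' := by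
  have hvn := hX.graph.lt _ he₀ _ hv
  obtain ⟨k, m₁, t₁, ht₁, ⟨rfl, himg, hf₁⟩, hr₁⟩ := runs_candidates h.core hX hvn
  have hr₁' : Runs (foldLoop 1 (X.d + 2) 0 fun γ c => do
        let f ← dictSearch X.D v γ
        if f = 0 then
          write .cand c γ
          pure (c + 1)
        else pure c) m ((X.d + 1) * 4 + 1)
        fun k' m' => k' = (X.missing c v).card ∧ m' = m₁ := ⟨_, _, t₁, ht₁, ⟨rfl, rfl⟩, hr₁⟩
  have hmark₁ : ∀ e ∈ X.E, m₁ .mark e = 0 := by rw [hf₁ .mark (by decide)]; exact hmark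
  have hI₁ := h.frame hf₁
  -- The run of `makePrimedFan` is opened here, before the draw of `α`, to give names to its
  -- outcome: the draw changes no memory.
  obtain ⟨⟨k, β, j⟩, m₂, t₂, ht₂, ⟨hpr, hmark₂, hf₂⟩, hr₂⟩ :=
    runs_makePrimedFan hI₁.core hX hmark₁ he₀ hv h0
  have hr₂' : Runs (makePrimedFan X.D v e₀) m₁ (16 * X.d + 16)
    fun r m' => r = (k, β, j) ∧ m' = m₂ := ⟨_, _, t₂, ht₂, ⟨rfl, rfl⟩, hr₂⟩
  simp only at hpr
  have hI₂ := hI₁.frame hf₂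
  have hMpos : 0 < (X.missing c v).card := (Nat.zero_le _).trans_lt
    (card_uncolored_lt_missing h.core hX v)
  have hMpos' : (0 : ℝ) < (X.missing c v).card := by exact_mod_cast hMpos
  have hmissing : ∀ α ∈ X.missing c v, 1 ≤ α ∧ α ≤ X.d + 1 ∧ X.Miss c v α := by
    intro α hα
    simp only [missing, Finset.mem_filter, Finset.mem_Icc] at hα
    exact ⟨hα.1.1, hα.1.2, hα.2⟩
  obtain ⟨L, hL⟩ : ∃ L : ℕ → ℕ, ∀ α, L α = if j = 0 then 0 else X.pathLen c v α β :=
    ⟨_, fun _ => rfl⟩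
  have hLn : ∀ α ∈ X.missing c v, j ≠ 0 → α ≠ β ∧ X.pathLen c v α β ≤ X.n := by
    intro α hα hj
    obtain ⟨h1, h2, h3⟩ := hmissing α hα
    obtain ⟨hj1, hjk, hcj⟩ := hpr.center.resolve_left (by omega)
    have hne : α ≠ β := fun e => h3 _ (hpr.isFan.inc j hjk) (by rw [hcj, e])
    have hd := h.core.pathData hX hne h1 hpr.pos h3
    obtain ⟨p, x, K, hp⟩ := hd.exists_altPath
    refine ⟨hne, ?_⟩
    rw [hd.pathLen_eq hp]
    exact hd.length_le hp.toPrePath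
  have hLn' : ∀ α ∈ X.missing c v, L α ≤ X.n := by
    intro α hα
    simp only [hL]
    split_ifs with hj
    · exact Nat.zero_le _
    · exact (hLn α hα hj).2
  obtain ⟨A, hA⟩ : ∃ A : ℝ, A = (∑ α ∈ X.missing c v, (L α : ℝ)) / (X.missing c v).card := ⟨_, rfl⟩
  have hA0 : 0 ≤ A := by rw [hA]; positivity
  refine ⟨A, hA0, ?_, ?_, ?_⟩
  · rw [hA, div_le_iff₀ hMpos', mul_comm, ← nsmul_eq_mul]
    exact Finset.sum_le_card_nsmul _ _ _ fun α hα => by exact_mod_cast hLn' α hα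
  · rw [hA]
    refine div_le_div_of_nonneg_right ?_ hMpos'.le
    rw [lenFrom]
    push_cast
    refine Finset.sum_le_sum fun α hα => ?_
    simp only [hL]
    split_ifs with hj
    · simp only [Nat.cast_zero]; positivity
    · exact Finset.single_le_sum (f := fun β => (X.pathLen c v α β : ℝ))
        (fun _ _ => by positivity)
        (by simp only [Finset.mem_erase, Finset.mem_Icc]
            exact ⟨(hLn α hα hj).1.symm, hpr.pos, hpr.le⟩)
  have himg_inj : Set.InjOn (m₁ .cand) (Finset.range (X.missing c v).card) :=
    Finset.injOn_of_card_image_eq (by rw [himg, Finset.card_range])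
  have hcand : ∀ a < (X.missing c v).card, m₁ .cand a ∈ X.missing c v := fun a ha => by
    rw [← himg]; exact Finset.mem_image_of_mem _ (Finset.mem_range.2 ha)
  have hspec : ∀ a < (X.missing c v).card, Spec lam (do
      let α ← read .cand a
      let r ← makePrimedFan X.D v e₀
      activateFan X.D v α r.1 r.2.1 r.2.2) m₁
      (Real.exp (lam * (101 * X.d + 77)) * (1 + 186 * lam * L (m₁ .cand a)))
      fun _ m' => X.Ready l m' ∧ Frame oneArrs m m' := by
    intro a ha
    obtain ⟨h1, h2, h3⟩ := hmissing _ (hcand a ha)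
    have hrun : Runs (do
        let α ← read .cand a
        let r ← makePrimedFan X.D v e₀
        activateFan X.D v α r.1 r.2.1 r.2.2) m₁ (101 * X.d + 77 + 93 * L (m₁ .cand a))
        fun _ m' => X.Ready l m' ∧ Frame oneArrs m m' := by
      rw [runs_read_bind]
      refine ⟨by omega, hr₂'.bind (by omega) ?_⟩
      rintro r m' ⟨rfl, rfl⟩
      refine (runs_activateFan hI₂ hX hpr h1 h2 h3).mono ?_ ?_
      · simp only [hL]; split_ifs <;> omega
      · rintro - m₃ ⟨hf₃, c', hI₃, hc'⟩
        refine ⟨⟨?_, c', hI₃, by omega⟩, ((hf₁.mono (by decide)).trans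
          (hf₂.mono (by decide))).trans (hf₃.mono (by decide))⟩
        rw [hf₃ .mark (by decide)]; exact hmark₂
    have hLa : (L (m₁ .cand a) : ℝ) ≤ X.n := by exact_mod_cast hLn' _ (hcand a ha)
    refine (hrun.spec hl).mono ?_ fun _ _ h => h
    push_cast
    rw [mul_add, Real.exp_add]
    refine mul_le_mul_of_nonneg_left ?_ (Real.exp_pos _).le
    -- The path has at most `n` edges, so `hlam` keeps the exponent within `[0, 1]`.
    have := exp_le_one_add_two_mul (y := lam * (93 * L (m₁ .cand a))) (by positivity) (by nlinarith)
    linarith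
  have htail := hr₁'.bind_spec (f := fun k => do
      let a ← rand k
      let α ← read .cand a
      let r ← makePrimedFan X.D v e₀
      activateFan X.D v α r.1 r.2.1 r.2.2) hl (Spec.rand_bind hMpos hl hspec).1 (by
      rintro k m' ⟨rfl, rfl⟩
      exact Spec.rand_bind hMpos hl hspec)
  refine htail.mono ?_ fun _ _ h => h
  rw [← Finset.mul_sum, Finset.sum_add_distrib, ← Finset.mul_sum, Finset.sum_const,
    Finset.card_range, nsmul_eq_mul, mul_one]
  have hsum : ∑ a ∈ Finset.range (X.missing c v).card, (L (m₁ .cand a) : ℝ) =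
      ∑ α ∈ X.missing c v, (L α : ℝ) := by
    conv_rhs => rw [← himg]
    rw [Finset.sum_image himg_inj]
  have hdiv : (((X.missing c v).card : ℝ) + 186 * lam * ∑ α ∈ X.missing c v, (L α : ℝ)) /
      (X.missing c v).card = 1 + 186 * lam * A := by
    rw [hA, add_div, div_self hMpos'.ne', mul_div_assoc]
  rw [hsum, mul_div_assoc, hdiv, ← mul_assoc, ← mul_assoc, ← Real.exp_add, ← Real.exp_add]
  refine mul_le_mul_of_nonneg_right (Real.exp_le_exp.2 ?_) (by positivity)
  push_cast
  have : 0 ≤ lam * X.d := by positivity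
  nlinarith

/-- The averaged bound `1 + 186 lam A` is turned back into an exponential by `1 + y ≤ exp y`, so
that the costs of successive calls add up in the exponent. The five reads and draws before the tail
account for `110 = 105 + 5`. -/
lemma spec_randomColorOne {lam : ℝ} (hl : 0 ≤ lam) {m : Mem} {l : ℕ} (h : X.Ready (l + 1) m)
    (hX : X.Valid) (hlam : lam * (93 * X.n) ≤ 1) :
    Spec lam (randomColorOne X.D X.d) m
      (Real.exp (lam * (110 * (X.d + 1) + 186 * min ((X.E.card : ℝ) * X.d / (l + 1)) X.n)))
      fun _ m' => X.Ready l m' ∧ Frame oneArrs m m' := by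
  obtain ⟨hmark, c, hI, hcard⟩ := h
  have hsize : m .uncSize 0 = l + 1 := by rw [← hI.unc.card, hcard]
  have hmem : ∀ i < l + 1, m .unc i ∈ X.E ∧ c (m .unc i) = 0 := fun i hi => by
    have := hI.unc.item_mem i (by omega)
    simpa [uncolored] using this
  have htail : ∀ i s, ∃ A : ℝ, i < l + 1 → 0 ≤ A ∧ A ≤ X.n ∧
      A ≤ X.lenFrom c (X.pick (m .unc i) s) / (X.missing c (X.pick (m .unc i) s)).card ∧
      Spec lam (colorOneTail X.D X.d (m .unc i) (X.pick (m .unc i) s)) m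
        (Real.exp (lam * (105 * (X.d + 1))) * (1 + 186 * lam * A))
        fun _ m' => X.Ready l m' ∧ Frame oneArrs m m' := by
    intro i s
    by_cases hi : i < l + 1
    · obtain ⟨A, hA⟩ := spec_colorOneTail hl hI hX hlam hmark (hmem i hi).1 (inc_pick _ s)
        (hmem i hi).2 hcard
      exact ⟨A, fun _ => hA⟩
    · exact ⟨0, fun h => absurd h hi⟩
  choose A hA using htail
  have hs : ∀ i < l + 1, ∀ s < 2, Spec lam (do
      let v ← read (if s = 0 then .src else .dst) (m .unc i)
      colorOneTail X.D X.d (m .unc i) v) m (Real.exp lam *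
        (Real.exp (lam * (105 * (X.d + 1))) * (1 + 186 * lam * A i s)))
        fun _ m' => X.Ready l m' ∧ Frame oneArrs m m' := by
    intro i hi s _
    refine Spec.read_bind hl ?_
    have : m (if s = 0 then .src else .dst) (m .unc i) = X.pick (m .unc i) s := by
      unfold pick; split_ifs
      · rw [hI.core.src]
      · rw [hI.core.dst]
    rw [this]
    exact (hA i s hi).2.2.2
  have hi := fun i (hi : i < l + 1) => Spec.read_bind (a := .unc) (i := i) hl
    (f := fun e₀ => do
      let s ← rand 2
      let v ← read (if s = 0 then .src else .dst) e₀
      colorOneTail X.D X.d e₀ v) (Spec.rand_bind two_pos hl (hs i hi))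
  have hfull := Spec.read_bind (a := .uncSize) (i := 0) (m := m) hl
    (f := fun l => do
      let i ← rand l
      let e₀ ← read .unc i
      let s ← rand 2
      let v ← read (if s = 0 then .src else .dst) e₀
      colorOneTail X.D X.d e₀ v) (by
        rw [hsize]; exact Spec.rand_bind (Nat.succ_pos l) hl hi)
  rw [randomColorOne_eq]
  refine hfull.mono ?_ fun _ _ h => h
  have havg : ∑ i ∈ Finset.range (l + 1), ∑ s ∈ Finset.range 2, A i s ≤
      2 * (X.E.card * X.d) := by
    rw [← hsize]
    exact avg_le hI hX A fun i hi s _ => (hA i s (by omega)).2.2.1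
  have hn : ∑ i ∈ Finset.range (l + 1), ∑ s ∈ Finset.range 2, A i s ≤ 2 * (l + 1) * X.n := by
    refine (Finset.sum_le_sum (g := fun _ => 2 * (X.n : ℝ)) fun i hi =>
      (Finset.sum_le_sum (g := fun _ => (X.n : ℝ)) fun s _ =>
        (hA i s (Finset.mem_range.1 hi)).2.1).trans (by simp)).trans ?_
    simp only [Finset.sum_const, Finset.card_range, nsmul_eq_mul]
    push_cast
    linarith
  set W := ∑ i ∈ Finset.range (l + 1), ∑ s ∈ Finset.range 2, A i s with hW
  have hl1 : (0 : ℝ) < (l : ℝ) + 1 := by positivity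
  have hcalc : (∑ i ∈ Finset.range (l + 1), Real.exp lam * (Real.exp lam *
      ((∑ s ∈ Finset.range 2, Real.exp lam *
        (Real.exp (lam * (105 * (X.d + 1))) * (1 + 186 * lam * A i s))) / (2 : ℕ)))) /
        ((l + 1 : ℕ) : ℝ) = Real.exp lam * Real.exp lam * Real.exp lam *
          Real.exp (lam * (105 * (X.d + 1))) * (1 + 186 * lam * (W / (2 * (l + 1)))) := by
    simp only [← Finset.mul_sum, Finset.sum_add_distrib, ← Finset.sum_div]
    rw [← hW]
    simp only [Finset.sum_const, Finset.card_range, nsmul_eq_mul]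
    push_cast
    field_simp
  rw [hcalc]
  -- `W` is a sum over `2 (l + 1)` equally likely choices of an edge and an endpoint.
  have hmin : W / (2 * (l + 1)) ≤ min (X.E.card * X.d / ((l : ℝ) + 1)) X.n := by
    refine le_min ?_ ?_
    · rw [div_le_div_iff₀ (by positivity) hl1]
      nlinarith
    · rw [div_le_iff₀ (by positivity)]
      linarith
  set B := min (X.E.card * X.d / ((l : ℝ) + 1)) (X.n : ℝ)
  have hexp : 1 + 186 * lam * (W / (2 * (l + 1))) ≤ Real.exp (lam * (186 * B)) := by
    have h1 := Real.add_one_le_exp (lam * (186 * B))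
    have h2 := mul_le_mul_of_nonneg_left hmin hl
    linarith
  have h5 := Real.exp_pos lam
  calc _ ≤ Real.exp lam * (Real.exp lam * (Real.exp lam * Real.exp lam * Real.exp lam *
          Real.exp (lam * (105 * (X.d + 1))) * Real.exp (lam * (186 * B)))) := by gcongr
    _ ≤ _ := by
      simp only [← Real.exp_add]
      rw [Real.exp_le_exp]
      have : 0 ≤ lam * X.d := by positivity
      nlinarith

end Ctx

/-! ### Segments and degrees -/

/-- The edges in the cells `lo, …, i - 1` of `ord`. -/
def segTo (ord : ℕ → ℕ) (lo i : ℕ) : Finset ℕ := (Finset.Ico lo i).image ord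

lemma segTo_succ (ord : ℕ → ℕ) {lo i : ℕ} (h : lo ≤ i) :
    segTo ord lo (i + 1) = insert (ord i) (segTo ord lo i) := by
  rw [segTo, ← Finset.insert_Ico_right_eq_Ico_add_one h, Finset.image_insert, segTo]

@[simp] lemma segTo_self (ord : ℕ → ℕ) (lo : ℕ) : segTo ord lo lo = ∅ := by simp [segTo]

/-- The cells `lo, …, hi - 1` of `ord` list the edges in `E`, each of them once. -/
structure Seg (ord : ℕ → ℕ) (lo hi : ℕ) (E : Finset ℕ) : Prop where
  le : lo ≤ hi
  eq : segTo ord lo hi = E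
  card : E.card = hi - lo

namespace Seg

variable {ord : ℕ → ℕ} {lo hi : ℕ} {E : Finset ℕ}

lemma inj (h : Seg ord lo hi E) : Set.InjOn ord (Finset.Ico lo hi) :=
  Finset.injOn_of_card_image_eq (by
    have := h.card; rw [← h.eq] at this; rw [Nat.card_Ico]; exact this)

lemma mem (h : Seg ord lo hi E) {i : ℕ} (h1 : lo ≤ i) (h2 : i < hi) : ord i ∈ E := by
  rw [← h.eq]; exact Finset.mem_image_of_mem _ (Finset.mem_Ico.2 ⟨h1, h2⟩)

lemma subset (h : Seg ord lo hi E) {i : ℕ} (h2 : i ≤ hi) : segTo ord lo i ⊆ E := by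
  rw [← h.eq]; exact Finset.image_subset_image (Finset.Ico_subset_Ico_right h2)

lemma notMem (h : Seg ord lo hi E) {i : ℕ} (h1 : lo ≤ i) (h2 : i < hi) :
    ord i ∉ segTo ord lo i := by
  intro hm
  obtain ⟨j, hj, he⟩ := Finset.mem_image.1 hm
  rw [Finset.mem_Ico] at hj
  have := h.inj (Finset.mem_coe.2 (Finset.mem_Ico.2 ⟨hj.1, by omega⟩))
    (Finset.mem_coe.2 (Finset.mem_Ico.2 ⟨h1, h2⟩)) he
  omega

end Seg

section degrees

variable {src dst : ℕ → ℕ}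

lemma degIn_insert {P : Finset ℕ} {e : ℕ} (he : e ∉ P) (v : ℕ) :
    degIn src dst (insert e P) v = degIn src dst P v + if Inc src dst v e then 1 else 0 := by
  unfold degIn
  rw [Finset.filter_insert]
  split_ifs
  · rw [Finset.card_insert_of_notMem (by simp [he])]
  · rfl

@[simp] lemma degIn_empty (v : ℕ) : degIn src dst ∅ v = 0 := by simp [degIn]

lemma degIn_mono {P P' : Finset ℕ} (h : P ⊆ P') (v : ℕ) :
    degIn src dst P v ≤ degIn src dst P' v :=
  Finset.card_le_card (Finset.filter_subset_filter _ h)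

lemma degIn_union {P P' : Finset ℕ} (h : Disjoint P P') (v : ℕ) :
    degIn src dst (P ∪ P') v = degIn src dst P v + degIn src dst P' v := by
  unfold degIn
  rw [Finset.filter_union, Finset.card_union_of_disjoint (Finset.disjoint_filter_filter h)]

lemma degIn_le_card (P : Finset ℕ) (v : ℕ) : degIn src dst P v ≤ P.card :=
  Finset.card_filter_le _ _

lemma degIn_ne_zero {P : Finset ℕ} {e v : ℕ} (he : e ∈ P) (hv : Inc src dst v e) :
    degIn src dst P v ≠ 0 :=
  Finset.card_ne_zero_of_mem (Finset.mem_filter.2 ⟨he, hv⟩)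

lemma exists_of_degIn_ne_zero {P : Finset ℕ} {v : ℕ} (h : degIn src dst P v ≠ 0) :
    ∃ e ∈ P, Inc src dst v e := by
  obtain ⟨e, he⟩ := Finset.card_ne_zero.1 h
  exact ⟨e, (Finset.mem_filter.1 he).1, (Finset.mem_filter.1 he).2⟩

/-- The maximum degree of the graph with edges `E` is `d`. -/
def IsMaxDeg (src dst : ℕ → ℕ) (E : Finset ℕ) (d : ℕ) : Prop :=
  (∀ v, degIn src dst E v ≤ d) ∧ ∃ v, degIn src dst E v = d

lemma IsMaxDeg.unique {E : Finset ℕ} {d d' : ℕ} (h : IsMaxDeg src dst E d)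
    (h' : IsMaxDeg src dst E d') : d = d' := by
  obtain ⟨v, hv⟩ := h.2
  obtain ⟨v', hv'⟩ := h'.2
  exact le_antisymm (hv ▸ h'.1 v) (hv' ▸ h.1 v')

end degrees

/-- The degrees and the non-isolated vertices of the graph with edges `E` are stored, together with
offsets that reserve `deg v + 2` cells for each of these vertices. -/
structure Scanned (src dst : ℕ → ℕ) (E : Finset ℕ) (m : Mem) (nv : ℕ) : Prop where
  deg : ∀ v, degIn src dst E v ≠ 0 → m .deg v = degIn src dst E v
  mem : ∀ v, degIn src dst E v ≠ 0 ↔ ∃ j < nv, m .verts j = v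
  inj : ∀ i < nv, ∀ j < nv, m .verts i = m .verts j → i = j
  off : ∀ u v, degIn src dst E u ≠ 0 → degIn src dst E v ≠ 0 → u ≠ v →
    m .off u + degIn src dst E u + 2 ≤ m .off v ∨ m .off v + degIn src dst E v + 2 ≤ m .off u
  le : nv ≤ 2 * E.card

/-- While the degrees are computed: `g` gives the degrees so far. -/
structure Visited (S : Set ℕ) (g : ℕ → ℕ) (t : ℕ) (s : ℕ × ℕ) (m : Mem) : Prop where
  deg : ∀ v ∈ S, m .deg v = g v
  mem : ∀ v, g v ≠ 0 ↔ ∃ j < s.2, m .verts j = v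
  inj : ∀ i < s.2, ∀ j < s.2, m .verts i = m .verts j → i = j
  le : ∀ v, g v ≤ s.1
  max : ∃ v, g v = s.1
  num : s.2 ≤ t

lemma runs_visit {S : Set ℕ} {g : ℕ → ℕ} {t : ℕ} {s : ℕ × ℕ} {m m₀ : Mem} (h : Visited S g t s m)
    (hf : Frame [.deg, .verts] m₀ m) {v : ℕ} (hv : v ∈ S) :
    Runs (do
      let g ← read .deg v
      write .deg v (g + 1)
      if g = 0 then
        write .verts s.2 v
        pure (max s.1 1, s.2 + 1)
      else pure (max s.1 (g + 1), s.2)) m 3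
      fun s' m' => Visited S (Function.update g v (g v + 1)) (t + 1) s' m' ∧
        Frame [.deg, .verts] m₀ m' := by
  have hnum := h.num
  have hle : ∀ k, k = g v + 1 → ∀ u, Function.update g v (g v + 1) u ≤ max s.1 k := by
    intro k hk u
    rw [Function.update_apply]
    split_ifs
    · exact hk ▸ le_max_right _ _
    · exact (h.le u).trans (le_max_left _ _)
  have hmax : ∀ k, k = g v + 1 → ∃ u, Function.update g v (g v + 1) u = max s.1 k := by
    intro k hk
    rcases le_total s.1 k with hsk | hsk
    · exact ⟨v, by rw [Function.update_self, max_eq_right hsk, hk]⟩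
    · obtain ⟨u, hu⟩ := h.max
      refine ⟨u, ?_⟩
      rw [max_eq_left hsk, Function.update_of_ne, hu]
      rintro rfl
      omega
  simp only [runs_read_bind, runs_write_bind, runs_ite, runs_pure, h.deg v hv]
  refine ⟨by norm_num, by norm_num, fun h0 => ⟨by norm_num, ⟨?_, ?_, ?_, hle _ (by omega),
    hmax _ (by omega), by simp only; omega⟩, (hf.upd (by decide) _ _).upd (by decide) _ _⟩,
    fun h0 => ⟨⟨?_, ?_, ?_, hle _ rfl, hmax _ rfl, by simp only; omega⟩, hf.upd (by decide) _ _⟩⟩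
  · intro u hu
    have := h.deg u hu
    by_cases huv : u = v
    · subst huv; simp
    · simp [huv, this]
  · have hnot : ∀ j < s.2, m .verts j ≠ v := fun j hj e => (h.mem v).2 ⟨j, hj, e⟩ h0
    intro u
    by_cases huv : u = v
    · subst huv
      simp only [Function.update_self]
      exact ⟨fun _ => ⟨s.2, by omega, by simp⟩, fun _ => by omega⟩
    · rw [Function.update_of_ne huv, h.mem u]
      constructor
      · rintro ⟨j, hj, e⟩
        exact ⟨j, by simp only; omega, by simp [hj.ne, e]⟩
      · rintro ⟨j, hj, e⟩
        have hjs : j ≠ s.2 := by rintro rfl; simp at e; exact huv e.symm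
        exact ⟨j, by simp only at hj; omega, by simpa [hjs] using e⟩
  · have hnot : ∀ j < s.2, m .verts j ≠ v := fun j hj e => (h.mem v).2 ⟨j, hj, e⟩ h0
    intro i hi j hj e
    simp only [Mem.upd_same, Mem.upd_of_ne, ne_eq, reduceCtorEq, not_false_eq_true] at e hi hj
    by_cases hi' : i = s.2 <;> by_cases hj' : j = s.2
    · omega
    · rw [hi', Function.update_self, Function.update_of_ne hj'] at e
      exact absurd e.symm (hnot j (by omega))
    · rw [hj', Function.update_self, Function.update_of_ne hi'] at e
      exact absurd e (hnot i (by omega))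
    · rw [Function.update_of_ne hi', Function.update_of_ne hj'] at e
      exact h.inj i (by omega) j (by omega) e
  · intro u hu
    have := h.deg u hu
    by_cases huv : u = v
    · subst huv; simp
    · simp [huv, this]
  · intro u
    simp only [Mem.upd_of_ne, ne_eq, reduceCtorEq, not_false_eq_true]
    rw [← h.mem u]
    by_cases huv : u = v
    · subst huv; simp [h0]
    · simp [huv]
  · simpa using h.inj

/-- Only the cells of endpoints of edges in `E` are cleared and counted, so the cost is linear in
the number of edges and independent of `n`. Nothing is known about the stored degrees of isolated
vertices. -/
lemma runs_scan {m : Mem} {lo hi n : ℕ} {E : Finset ℕ} (hs : Seg (m .ord) lo hi E)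
    (hE : SimpleEdges n (m .src) (m .dst) E) :
    Runs (scan lo hi) m (30 * E.card + 3) fun r m' =>
      IsMaxDeg (m .src) (m .dst) E r.1 ∧ Scanned (m .src) (m .dst) E m' r.2 ∧
        Frame [.deg, .verts, .off] m m' := by
  have hcard := hs.card
  unfold scan
  refine Runs.bind (c₁ := 6 * E.card + 1) ((runs_forLoop 5 (fun i m' => Frame [.deg] m m' ∧
    ∀ e ∈ segTo (m .ord) lo i, ∀ v, Inc (m .src) (m .dst) v e → m' .deg v = 0) hs.le
    ⟨Frame.refl _ _, by simp⟩ ?_).mono (by rw [hcard]; omega) fun _ _ h => h) (by omega) ?_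
  · rintro i m₁ h1 h2 ⟨hf, hz⟩
    simp only [runs_read_bind, runs_write_bind, runs_write, hf .ord (by decide),
      hf .src (by decide), hf .dst (by decide)]
    refine ⟨by norm_num, by norm_num, by norm_num, by norm_num, by norm_num,
      (hf.upd (by decide) _ _).upd (by decide) _ _, fun e he v hv => ?_⟩
    rw [segTo_succ _ h1, Finset.mem_insert] at he
    simp only [Mem.upd_same, Function.update_apply]
    split_ifs with h3 h4
    · rfl
    · rfl
    · rcases he with rfl | he
      · rcases hv with hv | hv
        · exact absurd hv.symm h4
        · exact absurd hv.symm h3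
      · exact hz e he v hv
  rintro - m₁ ⟨hf₁, hz⟩
  rw [hs.eq] at hz
  refine Runs.bind (c₁ := 10 * E.card + 1) ((runs_foldLoop 9 (fun i s m' =>
    Visited {v | degIn (m .src) (m .dst) E v ≠ 0}
      (degIn (m .src) (m .dst) (segTo (m .ord) lo i)) (2 * (i - lo)) s m' ∧
    Frame [.deg, .verts] m m') hs.le
    ⟨⟨?_, ?_, ?_, ?_, ?_, ?_⟩, hf₁.mono (by decide)⟩ ?_).mono (by rw [hcard]; omega)
    fun _ _ h => h) (by omega) ?_
  · intro v hv
    obtain ⟨e, he, hv⟩ := exists_of_degIn_ne_zero hv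
    simpa using hz e he v hv
  · simp
  · intro i hi; simp at hi
  · simp
  · exact ⟨0, by simp⟩
  · simp
  · rintro i s m₂ h1 h2 ⟨hv, hf⟩
    have he := hs.mem h1 h2
    have hne := hE.ne _ he
    simp only [runs_read_bind, hf .ord (by decide), hf .src (by decide), hf .dst (by decide)]
    refine ⟨by norm_num, by norm_num, by norm_num, (runs_visit hv hf
      (degIn_ne_zero he (Or.inl rfl))).bind (by norm_num) ?_⟩
    rintro s' m₃ ⟨hv', hf'⟩
    refine (runs_visit hv' hf' (degIn_ne_zero he (Or.inr rfl))).mono (by norm_num) ?_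
    rintro s'' m₄ ⟨hv'', hf''⟩
    refine ⟨?_, hf''⟩
    rw [show 2 * (i + 1 - lo) = 2 * (i - lo) + 1 + 1 by omega, segTo_succ _ h1]
    convert hv'' using 1
    funext v
    rw [degIn_insert (hs.notMem h1 h2)]
    simp only [Inc, Function.update_apply]
    grind
  rintro ⟨d, nv⟩ m₂ ⟨hv, hf₂⟩
  rw [hs.eq, ← hcard] at hv
  have hnum := hv.num
  simp only at hnum
  refine Runs.bind (c₁ := 4 * nv + 1) ((runs_foldLoop 3 (fun j o m' => Frame [.off] m₂ m' ∧
    (∀ i < j, m' .off (m₂ .verts i) + degIn (m .src) (m .dst) E (m₂ .verts i) + 2 ≤ o) ∧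
    ∀ i < j, ∀ i' < i, m' .off (m₂ .verts i') + degIn (m .src) (m .dst) E (m₂ .verts i') + 2 ≤
      m' .off (m₂ .verts i)) (Nat.zero_le _) ⟨Frame.refl _ _, by simp, by simp⟩ ?_).mono
    (by simp only; omega) fun _ _ h => h) (by omega) ?_
  · rintro j o m₃ - hj ⟨hf, ho, hd⟩
    have hj' : degIn (m .src) (m .dst) E (m₂ .verts j) ≠ 0 := (hv.mem _).2 ⟨j, hj, rfl⟩
    simp only [runs_read_bind, runs_write_bind, runs_pure, hf .verts (by decide),
      Mem.upd_of_ne, ne_eq, reduceCtorEq, not_false_eq_true, hf .deg (by decide), hv.deg _ hj']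
    have hne : ∀ i < j, m₂ .verts i ≠ m₂ .verts j := fun i hi e => by
      have := hv.inj i (by simp only at *; omega) j hj e; omega
    refine ⟨by norm_num, by norm_num, by norm_num, hf.upd (by decide) _ _, fun i hi => ?_,
      fun i hi i' hi' => ?_⟩
    · rcases Nat.lt_succ_iff_lt_or_eq.1 hi with hi | rfl
      · have := ho i hi
        simp [hne i hi]; omega
      · simp
    · rcases Nat.lt_succ_iff_lt_or_eq.1 hi with hi | rfl
      · have := hd i hi i' hi'
        simpa [hne i hi, hne i' (by omega)] using this
      · have := ho i' hi'
        simpa [hne i' hi'] using this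
  · rintro o m₃ ⟨hf₃, -, hd⟩
    rw [runs_pure]
    have hvt : m₃ .verts = m₂ .verts := hf₃ _ (by decide)
    refine ⟨⟨hv.le, hv.max⟩, ⟨?_, ?_, ?_, fun u v hu hv' huv => ?_, hnum⟩,
      (hf₂.mono (by decide)).trans (hf₃.mono (by decide))⟩
    · rw [hf₃ .deg (by decide)]; exact hv.deg
    · rw [hvt]; exact hv.mem
    · rw [hvt]; exact hv.inj
    · obtain ⟨i, hi, rfl⟩ := (hv.mem u).1 hu
      obtain ⟨j, hj, rfl⟩ := (hv.mem v).1 hv'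
      rcases lt_trichotomy i j with h | rfl | h
      · exact Or.inl (hd j hj i h)
      · exact absurd rfl huv
      · exact Or.inr (hd i hi j h)

/-! ### Euler partitions -/

section

variable {src dst : ℕ → ℕ}

lemma sum_degIn_le (P V : Finset ℕ) : ∑ v ∈ V, degIn src dst P v ≤ 2 * P.card := by
  refine (Finset.sum_card_bipartiteAbove_eq_sum_card_bipartiteBelow (s := V) (t := P)
    (Inc src dst)).trans_le ?_
  rw [mul_comm, ← smul_eq_mul]
  refine Finset.sum_le_card_nsmul _ _ _ fun e _ => ?_
  refine (Finset.card_le_card (t := {src e, dst e}) fun v hv => ?_).trans Finset.card_le_two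
  rcases (Finset.mem_filter.1 hv).2 with h | h <;> simp [← h]

lemma degIn_erase {P : Finset ℕ} {e : ℕ} (he : e ∈ P) (v : ℕ) :
    degIn src dst P v = degIn src dst (P.erase e) v + if Inc src dst v e then 1 else 0 := by
  rw [← degIn_insert (Finset.notMem_erase e P), Finset.insert_erase he]

lemma inc_iff_oth {x e : ℕ} (h : Inc src dst x e) (u : ℕ) :
    Inc src dst u e ↔ u = x ∨ u = oth src dst e x := by
  unfold Inc at *
  unfold oth
  split_ifs <;> grind

lemma oth_ne {x e : ℕ} (h : Inc src dst x e) (hne : src e ≠ dst e) : oth src dst e x ≠ x := by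
  unfold Inc at *
  unfold oth
  split_ifs <;> grind

lemma ite_inc {x e : ℕ} (h : Inc src dst x e) (hne : src e ≠ dst e) (u : ℕ) :
    (if Inc src dst u e then 1 else 0) =
      (if u = x then 1 else 0) + if u = oth src dst e x then 1 else 0 := by
  have := oth_ne h hne
  simp only [inc_iff_oth h]
  by_cases h1 : u = x <;> by_cases h2 : u = oth src dst e x <;> simp_all

lemma segTo_update {ord : ℕ → ℕ} {lo i k : ℕ} (x : ℕ) (h : k < lo ∨ i ≤ k) :
    segTo (Function.update ord k x) lo i = segTo ord lo i := by
  refine Finset.image_congr fun j hj => ?_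
  rw [Finset.mem_coe, Finset.mem_Ico] at hj
  exact Function.update_of_ne (by omega) _ _

/-- The difference of the degrees of `u` in the two halves, after `p` edges were assigned. -/
def bal (src dst : ℕ → ℕ) (lo mid : ℕ) (ord : ℕ → ℕ) (p u : ℕ) : ℤ :=
  degIn src dst (segTo ord lo (lo + (p + 1) / 2)) u - degIn src dst (segTo ord mid (mid + p / 2)) u

end

/-- The incidence lists while they are built: `g` gives their lengths, and `A v e` says that `e` is
in the list of `v`. -/
structure Attached (V : Finset ℕ) (off : ℕ → ℕ) (g : ℕ → ℕ) (A : ℕ → ℕ → Prop) (m : Mem) :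
    Prop where
  ptr : ∀ v ∈ V, m .ptr v = off v + g v
  mem : ∀ v e, A v e → ∃ k < g v, m .adj (off v + k) = e
  back : ∀ v ∈ V, ∀ k < g v, A v (m .adj (off v + k))

lemma runs_attach {V : Finset ℕ} {off g dg : ℕ → ℕ} {A : ℕ → ℕ → Prop} {m : Mem}
    (h : Attached V off g A m)
    (hoff : ∀ u ∈ V, ∀ v ∈ V, u ≠ v → off u + dg u + 2 ≤ off v ∨ off v + dg v + 2 ≤ off u)
    (hg : ∀ v, g v ≤ dg v) (hA : ∀ v e, A v e → v ∈ V) {v : ℕ} (hv : v ∈ V) (hgv : g v < dg v)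
    (e : ℕ) :
    Runs (do
      let q ← read .ptr v
      write .adj q e
      write .ptr v (q + 1)) m 3 fun _ m' =>
      Attached V off (Function.update g v (g v + 1)) (fun u f => A u f ∨ u = v ∧ f = e) m' ∧
        Frame [.ptr, .adj] m m' := by
  simp only [runs_read_bind, runs_write_bind, runs_write, h.ptr v hv]
  have key : ∀ u ∈ V, ∀ k < g u, off u + k ≠ off v + g v := by
    intro u hu k hk
    by_cases huv : u = v
    · subst huv; omega
    · have := hoff u hu v hv huv
      have := hg u
      omega
  refine ⟨by norm_num, by norm_num, by norm_num, ⟨fun u hu => ?_, fun u f hf => ?_,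
    fun u hu k hk => ?_⟩, ((Frame.refl _ _).upd (by decide) _ _).upd (by decide) _ _⟩
  · by_cases huv : u = v
    · subst huv; simp; omega
    · simp [huv, h.ptr u hu]
  · rcases hf with hf | ⟨rfl, rfl⟩
    · obtain ⟨k, hk, he⟩ := h.mem u f hf
      refine ⟨k, ?_, ?_⟩
      · rw [Function.update_apply]; split_ifs with h1
        · subst h1; omega
        · exact hk
      · simpa [Function.update_of_ne (key u (hA u f hf) k hk)] using he
    · exact ⟨g u, by simp, by simp⟩
  · simp only [Mem.upd_same, Mem.upd_of_ne, ne_eq, reduceCtorEq, not_false_eq_true]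
    by_cases hk' : u = v ∧ k = g v
    · obtain ⟨rfl, rfl⟩ := hk'
      simp
    · have hku : k < g u := by
        rw [Function.update_apply] at hk
        split_ifs at hk with h1
        · subst h1; grind
        · exact hk
      rw [Function.update_of_ne (key u hu k hku)]
      exact Or.inl (h.back u hu k hku)

/-- The state of the partition after `p` edges were assigned, where `m₀` is the initial memory, `V`
the set of the non-isolated vertices and `R` the set of the remaining edges. -/
structure EulerState (m₀ : Mem) (E V : Finset ℕ) (lo mid hi : ℕ) (R : Finset ℕ) (p : ℕ) (m : Mem) :
    Prop where
  frame : Frame [.ptr, .rem, .adj, .used, .ord] m₀ m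
  out : ∀ i, i < lo ∨ hi ≤ i → m .ord i = m₀ .ord i
  disj : Disjoint (segTo (m .ord) lo (lo + (p + 1) / 2) ∪ segTo (m .ord) mid (mid + p / 2)) R
  union : segTo (m .ord) lo (lo + (p + 1) / 2) ∪ segTo (m .ord) mid (mid + p / 2) ∪ R = E
  card₁ : (segTo (m .ord) lo (lo + (p + 1) / 2)).card = (p + 1) / 2
  card₂ : (segTo (m .ord) mid (mid + p / 2)).card = p / 2
  card : p + R.card = E.card
  used : ∀ e ∈ E, m .used e = 0 ↔ e ∈ R
  rem : ∀ v ∈ V, m .rem v = degIn (m₀ .src) (m₀ .dst) R v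
  mem : ∀ v, ∀ e ∈ R, Inc (m₀ .src) (m₀ .dst) v e →
    ∃ i, m₀ .off v ≤ i ∧ i < m .ptr v ∧ m .adj i = e
  back : ∀ v ∈ V, ∀ i, m₀ .off v ≤ i → i < m .ptr v →
    m .adj i ∈ E ∧ Inc (m₀ .src) (m₀ .dst) v (m .adj i)

/-- The total length of the incidence lists. -/
def listLen (V : Finset ℕ) (off ptr : ℕ → ℕ) : ℕ := ∑ v ∈ V, (ptr v - off v)

lemma listLen_update {V : Finset ℕ} {off ptr : ℕ → ℕ} {x : ℕ} (hx : x ∈ V) (h : off x < ptr x) :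
    listLen V off (Function.update ptr x (ptr x - 1)) + 1 = listLen V off ptr := by
  unfold listLen
  rw [← Finset.add_sum_erase V _ hx, ← Finset.add_sum_erase V (fun v => ptr v - off v) hx,
    Finset.sum_congr (s₁ := V.erase x) (g := fun v => ptr v - off v) rfl fun v hv => by
      rw [Function.update_of_ne (Finset.ne_of_mem_erase hv)], Function.update_self]
  omega

namespace EulerState

variable {m₀ m : Mem} {E V R : Finset ℕ} {lo mid hi n p : ℕ}

lemma sub (h : EulerState m₀ E V lo mid hi R p m) : R ⊆ E := by
  rw [← h.union]; exact Finset.subset_union_right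

lemma skip (h : EulerState m₀ E V lo mid hi R p m) {x : ℕ} (h0 : m .adj (m .ptr x - 1) ∉ R) :
    EulerState m₀ E V lo mid hi R p (m.upd .ptr x (m .ptr x - 1)) := by
  refine ⟨h.frame.upd (by decide) _ _, h.out, h.disj, h.union, h.card₁, h.card₂, h.card, h.used,
    h.rem, fun v e he hv => ?_, fun v hv i h1 h2 => h.back v hv i h1 ?_⟩
  · obtain ⟨i, h1, h2, h3⟩ := h.mem v e he hv
    refine ⟨i, h1, ?_, by simpa using h3⟩
    by_cases hvx : v = x
    · subst hvx
      have : i ≠ m .ptr v - 1 := by rintro rfl; rw [h3] at h0; exact h0 he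
      simp; omega
    · simpa [hvx] using h2
  · rw [Mem.upd_same, Function.update_apply] at h2
    split_ifs at h2 with h3
    · subst h3; omega
    · exact h2

/-- A step from `x` to `y` changes the balance of both by `(-1) ^ p`. As the sign alternates,
entering a vertex and leaving it again cancel, and only the two ends of a tour are affected in
total. -/
lemma step (h : EulerState m₀ E V lo mid hi R p m) (hE : SimpleEdges n (m₀ .src) (m₀ .dst) E)
    (hV : ∀ v, v ∈ V ↔ degIn (m₀ .src) (m₀ .dst) E v ≠ 0) (hmid : mid = lo + (hi - lo + 1) / 2)
    (hcard : E.card = hi - lo) {x y e : ℕ} (hxe : Inc (m₀ .src) (m₀ .dst) x e)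
    (hy : y = oth (m₀ .src) (m₀ .dst) e x) (he : e = m .adj (m .ptr x - 1)) (heR : e ∈ R)
    {m' : Mem} (hf : Frame [.ptr, .rem, .used, .ord] m m')
    (hptr : m' .ptr = Function.update (m .ptr) x (m .ptr x - 1))
    (hrem : m' .rem = Function.update (Function.update (m .rem) x (m .rem x - 1)) y (m .rem y - 1))
    (hused : m' .used = Function.update (m .used) e 1)
    (hord : m' .ord =
      Function.update (m .ord) (if p % 2 = 0 then lo + p / 2 else mid + p / 2) e) :
    EulerState m₀ E V lo mid hi (R.erase e) (p + 1) m' ∧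
      (∀ u, bal (m₀ .src) (m₀ .dst) lo mid (m' .ord) (p + 1) u =
        bal (m₀ .src) (m₀ .dst) lo mid (m .ord) p u +
          ((if u = x then (-1) ^ p else 0) + if u = y then (-1) ^ p else 0)) ∧
      ∀ u, degIn (m₀ .src) (m₀ .dst) R u = degIn (m₀ .src) (m₀ .dst) (R.erase e) u +
        ((if u = x then 1 else 0) + if u = y then 1 else 0) := by
  have hyx : y ≠ x := hy ▸ oth_ne hxe (hE.ne e (h.sub heR))
  have hdeg : ∀ u, degIn (m₀ .src) (m₀ .dst) R u = degIn (m₀ .src) (m₀ .dst) (R.erase e) u +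
        ((if u = x then 1 else 0) + if u = y then 1 else 0) := fun u => by
    rw [degIn_erase heR, ite_inc hxe (hE.ne e (h.sub heR)), hy]
  have hpos := Finset.card_pos.2 ⟨e, heR⟩
  have hc := h.card
  have he₁ : e ∉ segTo (m .ord) lo (lo + (p + 1) / 2) := fun h' =>
    Finset.disjoint_left.1 h.disj (Finset.mem_union_left _ h') heR
  have he₂ : e ∉ segTo (m .ord) mid (mid + p / 2) := fun h' =>
    Finset.disjoint_left.1 h.disj (Finset.mem_union_right _ h') heR
  -- For even `p` the first half grows and for odd `p` the second one; after `p` edges they have `(p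
  -- + 1) / 2` and `p / 2` elements.
  have hins : (-1 : ℤ) ^ p = 1 ∧
      segTo (m' .ord) lo (lo + (p + 1 + 1) / 2) = insert e (segTo (m .ord) lo (lo + (p + 1) / 2)) ∧
      segTo (m' .ord) mid (mid + (p + 1) / 2) = segTo (m .ord) mid (mid + p / 2) ∧
      (p + 1 + 1) / 2 = (p + 1) / 2 + 1 ∧ (p + 1) / 2 = p / 2 ∨ (-1 : ℤ) ^ p = -1 ∧
      segTo (m' .ord) mid (mid + (p + 1) / 2) = insert e (segTo (m .ord) mid (mid + p / 2)) ∧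
      segTo (m' .ord) lo (lo + (p + 1 + 1) / 2) = segTo (m .ord) lo (lo + (p + 1) / 2) ∧
      (p + 1 + 1) / 2 = (p + 1) / 2 ∧ (p + 1) / 2 = p / 2 + 1 := by
    rw [hord]
    rcases Nat.even_or_odd p with hp | hp
    · have hp' : p % 2 = 0 := Nat.even_iff.1 hp
      refine Or.inl ⟨hp.neg_one_pow, ?_, ?_, by omega, by omega⟩
      · rw [if_pos hp', show lo + (p + 1 + 1) / 2 = lo + (p + 1) / 2 + 1 by omega,
          segTo_succ _ (by omega), segTo_update _ (by omega),
          show lo + (p + 1) / 2 = lo + p / 2 by omega, Function.update_self]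
      · rw [if_pos hp', segTo_update _ (by omega), show (p + 1) / 2 = p / 2 by omega]
    · have hp' : p % 2 = 1 := Nat.odd_iff.1 hp
      refine Or.inr ⟨hp.neg_one_pow, ?_, ?_, by omega, by omega⟩
      · rw [if_neg (by omega), show mid + (p + 1) / 2 = mid + p / 2 + 1 by omega,
          segTo_succ _ (by omega), segTo_update _ (by omega), Function.update_self]
      · rw [if_neg (by omega), segTo_update _ (by omega),
          show (p + 1 + 1) / 2 = (p + 1) / 2 by omega]
  refine ⟨⟨h.frame.trans (hf.mono (by decide)), fun i hi' => ?_, ?_, ?_, ?_, ?_, ?_, fun f hf' => ?_,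
    fun v hv => ?_, fun v f hf' hv => ?_, fun v hv i h1 h2 => ?_⟩, fun u => ?_, hdeg⟩
  · rw [hord, Function.update_of_ne, h.out i hi']
    split_ifs <;> omega
  · have := h.disj
    rw [Finset.disjoint_left] at this ⊢
    rcases hins with ⟨-, h1, h2, -⟩ | ⟨-, h1, h2, -⟩ <;> rw [h1, h2] <;> intro f <;>
      simp only [Finset.mem_union, Finset.mem_insert, Finset.mem_erase] at this ⊢ <;>
      have := @this f <;> tauto
  · have := h.union
    rw [← this]
    ext f
    rcases hins with ⟨-, h1, h2, -⟩ | ⟨-, h1, h2, -⟩ <;> rw [h1, h2] <;>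
      simp only [Finset.mem_union, Finset.mem_insert, Finset.mem_erase] <;>
      by_cases hfe : f = e <;> simp [hfe, heR]
  · rcases hins with ⟨-, h1, h2, h3, h4⟩ | ⟨-, h1, h2, h3, h4⟩
    · rw [h1, Finset.card_insert_of_notMem he₁, h.card₁, h3]
    · rw [h2, h.card₁, h3]
  · rcases hins with ⟨-, h1, h2, h3, h4⟩ | ⟨-, h1, h2, h3, h4⟩
    · rw [h2, h.card₂, h4]
    · rw [h1, Finset.card_insert_of_notMem he₂, h.card₂, h4]
  · rw [Finset.card_erase_of_mem heR]; omega
  · rw [hused, Finset.mem_erase, Function.update_apply]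
    split_ifs with h1
    · simp [h1]
    · simp [h1, h.used f hf']
  · have h1 := hdeg v
    rw [hrem, Function.update_apply, Function.update_apply]
    split_ifs with h2 h3
    · subst h2
      rw [h.rem _ hv, h1]; simp [hyx]
    · subst h3
      rw [h.rem _ hv, h1]; simp [h2]
    · rw [h.rem _ hv, h1]; simp [h2, h3]
  · obtain ⟨hne, hfR⟩ := Finset.mem_erase.1 hf'
    obtain ⟨i, h1, h2, h3⟩ := h.mem v f hfR hv
    refine ⟨i, h1, ?_, by rw [hf .adj (by decide)]; exact h3⟩
    rw [hptr, Function.update_apply]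
    split_ifs with hvx
    · subst hvx
      have : i ≠ m .ptr v - 1 := by rintro rfl; exact hne (h3 ▸ he.symm)
      omega
    · exact h2
  · rw [hf .adj (by decide)]
    refine h.back v hv i h1 ?_
    rw [hptr, Function.update_apply] at h2
    split_ifs at h2 with h3
    · subst h3; omega
    · exact h2
  · unfold bal
    have hi := ite_inc hxe (hE.ne e (h.sub heR)) u
    rw [← hy] at hi
    rcases hins with ⟨h0, h1, h2, -⟩ | ⟨h0, h1, h2, -⟩ <;> rw [h1, h2, h0]
    · rw [degIn_insert he₁, hi]
      push_cast
      split_ifs <;> ring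
    · rw [degIn_insert he₂, hi]
      push_cast
      split_ifs <;> ring

/-- The balances telescope along the tour, and so do the parities of the remaining degrees: only the
start `v` and the final vertex `x` matter. Every iteration but the last consumes an entry of an
incidence list, possibly one of an edge already used from its other end; hence the potential of `14`
steps per entry. -/
lemma runs_tour (h : EulerState m₀ E V lo mid hi R p m)
    (hE : SimpleEdges n (m₀ .src) (m₀ .dst) E)
    (hV : ∀ v, v ∈ V ↔ degIn (m₀ .src) (m₀ .dst) E v ≠ 0) (hmid : mid = lo + (hi - lo + 1) / 2)
    (hcard : E.card = hi - lo) {v : ℕ} (hv : v ∈ V) :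
    ∃ c₁, Runs (tour lo mid v p) m c₁ fun p' m' =>
      c₁ + 14 * listLen V (m₀ .off) (m' .ptr) ≤ 14 * listLen V (m₀ .off) (m .ptr) + 2 ∧
      ∃ R' x, EulerState m₀ E V lo mid hi R' p' m' ∧ R' ⊆ R ∧ degIn (m₀ .src) (m₀ .dst) R' x = 0 ∧
        (∀ u, bal (m₀ .src) (m₀ .dst) lo mid (m' .ord) p' u =
          bal (m₀ .src) (m₀ .dst) lo mid (m .ord) p u +
            ((if u = v then (-1) ^ p else 0) - if u = x then (-1) ^ p' else 0)) ∧
        ∀ u, (degIn (m₀ .src) (m₀ .dst) R' u + degIn (m₀ .src) (m₀ .dst) R u +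
          ((if u = v then 1 else 0) + if u = x then 1 else 0)) % 2 = 0 := by
  have key := runs_whileLoop_pot (ρ := ℕ) (s := (v, p)) (m := m)
    (c := 14 * listLen V (m₀ .off) (m .ptr) + 2)
    (Q := fun p' m' c => c = 14 * listLen V (m₀ .off) (m' .ptr) ∧
      ∃ R' x, EulerState m₀ E V lo mid hi R' p' m' ∧ R' ⊆ R ∧ degIn (m₀ .src) (m₀ .dst) R' x = 0 ∧
        (∀ u, bal (m₀ .src) (m₀ .dst) lo mid (m' .ord) p' u =
          bal (m₀ .src) (m₀ .dst) lo mid (m .ord) p u +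
            ((if u = v then (-1) ^ p else 0) - if u = x then (-1) ^ p' else 0)) ∧
        ∀ u, (degIn (m₀ .src) (m₀ .dst) R' u + degIn (m₀ .src) (m₀ .dst) R u +
          ((if u = v then 1 else 0) + if u = x then 1 else 0)) % 2 = 0)
    (body := fun s : ℕ × ℕ => do
      let x := s.1
      let p := s.2
      let r ← read .rem x
      if r = 0 then pure (Sum.inr p)
      else
        let q ← read .ptr x
        let e ← read .adj (q - 1)
        write .ptr x (q - 1)
        let z ← read .used e
        if z = 0 then
          write .used e 1
          let y ← other e x
          decr .rem x
          decr .rem y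
          write .ord (if p % 2 = 0 then lo + p / 2 else mid + p / 2) e
          pure (Sum.inl (y, p + 1))
        else pure (Sum.inl (x, p)))
    (fun s m' c => c = 14 * listLen V (m₀ .off) (m' .ptr) + 2 ∧ s.1 ∈ V ∧
      ∃ R', EulerState m₀ E V lo mid hi R' s.2 m' ∧ R' ⊆ R ∧
        (∀ u, bal (m₀ .src) (m₀ .dst) lo mid (m' .ord) s.2 u =
          bal (m₀ .src) (m₀ .dst) lo mid (m .ord) p u +
            ((if u = v then (-1) ^ p else 0) - if u = s.1 then (-1) ^ s.2 else 0)) ∧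
        ∀ u, (degIn (m₀ .src) (m₀ .dst) R' u + degIn (m₀ .src) (m₀ .dst) R u +
          ((if u = v then 1 else 0) + if u = s.1 then 1 else 0)) % 2 = 0) ?_
    ⟨rfl, hv, R, h, subset_rfl, fun u => by simp, fun u => by simp only; omega⟩
  · obtain ⟨c₁, hr⟩ := key
    refine ⟨c₁, hr.mono le_rfl ?_⟩
    rintro p' m' ⟨c', hc', rfl, h'⟩
    exact ⟨by omega, h'⟩
  rintro ⟨x, p'⟩ m' c ⟨rfl, hx, R', h', hR, hbal, hpar⟩
  simp only at hx h' hbal hpar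
  have hrem := h'.rem x hx
  by_cases h0 : m' .rem x = 0
  · refine ⟨1, by omega, ?_⟩
    simp only [runs_read_bind, h0, if_true, runs_pure]
    exact ⟨by norm_num, _, by omega, rfl, R', x, h', hR, by rw [← hrem, h0], hbal, hpar⟩
  -- A remaining edge at `x` is still in the unread part of the list of `x`, so there is an entry to
  -- consume, though not necessarily that of this edge.
  · obtain ⟨e', he', hxe'⟩ := exists_of_degIn_ne_zero (hrem ▸ h0)
    obtain ⟨i, hi1, hi2, -⟩ := h'.mem x e' he' hxe'
    obtain ⟨heE, hxe⟩ := h'.back x hx (m' .ptr x - 1) (by omega) (by omega)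
    have hlen := listLen_update hx (show m₀ .off x < m' .ptr x by omega)
    refine ⟨13, by omega, ?_⟩
    simp only [runs_read_bind, runs_write_bind, runs_ite, runs_pure, runs_other_bind,
      runs_decr_bind, Mem.upd_same, Mem.upd_of_ne, ne_eq, reduceCtorEq, not_false_eq_true, h0,
      false_imp_iff, true_imp_iff, true_and]
    refine ⟨by norm_num, by norm_num, by norm_num, by norm_num, by norm_num, fun hz => ?_,
      fun hz => ?_⟩
    · have heR := (h'.used _ heE).1 hz
      have hsrc := h'.frame .src (by decide)
      have hdst := h'.frame .dst (by decide)
      rw [hsrc, hdst]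
      obtain ⟨e, he⟩ : ∃ e, e = m' .adj (m' .ptr x - 1) := ⟨_, rfl⟩
      rw [← he] at hxe heR heE ⊢
      obtain ⟨y, hy⟩ : ∃ y, y = oth (m₀ .src) (m₀ .dst) e x := ⟨_, rfl⟩
      rw [← hy]
      have hyx : y ≠ x := hy ▸ oth_ne hxe (hE.ne e heE)
      have hst := h'.step hE hV hmid hcard hxe hy he heR (m' := (((((m'.upd .ptr x
        (m' .ptr x - 1)).upd .used e 1).upd .rem x (m' .rem x - 1)).upd .rem y
        (Function.update (m' .rem) x (m' .rem x - 1) y - 1)).upd .ord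
        (if p' % 2 = 0 then lo + p' / 2 else mid + p' / 2) e))
        (((((((Frame.refl _ _).upd (by decide) _ _).upd (by decide) _ _).upd (by decide) _ _).upd
          (by decide) _ _).upd (by decide) _ _)) (by simp) (by simp [hyx]) (by simp) (by simp)
      refine ⟨by norm_num, by norm_num, by norm_num, by norm_num, by norm_num, _, ?_, rfl, ?_,
        R'.erase e, hst.1, (Finset.erase_subset _ _).trans hR, fun u => ?_, fun u => ?_⟩
      · omega
      · exact (hV y).2 (degIn_ne_zero heE ((inc_iff_oth hxe y).2 (Or.inr hy)))
      · refine (hst.2.1 u).trans ?_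
        rw [hbal u, pow_succ]
        split_ifs <;> ring
      · have h1 := hst.2.2 u
        have h2 := hpar u
        rw [h1] at h2
        revert h2
        generalize (if u = x then 1 else 0) = a
        generalize (if u = y then 1 else 0) = b
        generalize (if u = v then 1 else 0) = c
        omega
    · have heR := fun h1 => hz ((h'.used _ heE).2 h1)
      refine ⟨_, ?_, rfl, hx, R', h'.skip heR, hR, hbal, hpar⟩
      omega

end EulerState

/-- A tour from a vertex of odd remaining degree ends at another such vertex, and afterwards both
remaining degrees are even. So in the first phase a vertex is an end of at most one tour, and its
balance is at most `1` in absolute value. Afterwards all remaining degrees are even and every tour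
is closed; a closed tour of odd length changes the balance of its start by `2`. In the second phase
one tour starts from each vertex, so all balances stay within `3`, whence the `3` in the bound on
the degrees. -/
lemma runs_eulerPartition {m : Mem} {lo mid hi n nv : ℕ} {E : Finset ℕ}
    (hs : Seg (m .ord) lo hi E) (hE : SimpleEdges n (m .src) (m .dst) E)
    (hsc : Scanned (m .src) (m .dst) E m nv) (hmid : mid = lo + (hi - lo + 1) / 2) :
    Runs (eulerPartition lo mid hi nv) m (97 * E.card + 4) fun _ m' =>
      ∃ E₁ E₂, Seg (m' .ord) lo mid E₁ ∧ Seg (m' .ord) mid hi E₂ ∧ E₁ ∪ E₂ = E ∧ Disjoint E₁ E₂ ∧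
        (∀ v, 2 * degIn (m .src) (m .dst) E₁ v ≤ degIn (m .src) (m .dst) E v + 3 ∧
          2 * degIn (m .src) (m .dst) E₂ v ≤ degIn (m .src) (m .dst) E v + 3) ∧
        Frame [.ptr, .rem, .adj, .used, .ord] m m' ∧
        ∀ i, i < lo ∨ hi ≤ i → m' .ord i = m .ord i := by
  obtain ⟨V, hVd⟩ : ∃ V : Finset ℕ, V = (Finset.range nv).image (m .verts) := ⟨_, rfl⟩
  have hV : ∀ v, v ∈ V ↔ degIn (m .src) (m .dst) E v ≠ 0 := fun v => by
    rw [hsc.mem, hVd]; simp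
  have hvV : ∀ j < nv, m .verts j ∈ V := fun j hj => (hV _).2 ((hsc.mem _).2 ⟨j, hj, rfl⟩)
  have hcard := hs.card
  have hnv := hsc.le
  unfold eulerPartition
  refine Runs.bind (c₁ := 12 * E.card + 1) ((runs_forLoop 5 (lo := 0) (hi := nv)
    (fun j m' => Frame [.ptr, .rem] m m' ∧
      ∀ i < j, m' .ptr (m .verts i) = m .off (m .verts i) ∧
        m' .rem (m .verts i) = degIn (m .src) (m .dst) E (m .verts i)) (Nat.zero_le _)
    ⟨Frame.refl _ _, by simp⟩ ?_).mono (by omega) fun _ _ h => h) (by omega) ?_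
  · rintro j m₁ - hj ⟨hf, hr⟩
    simp only [runs_read_bind, runs_write_bind, runs_write, hf .verts (by decide),
      hf .off (by decide), Mem.upd_of_ne, ne_eq, reduceCtorEq, not_false_eq_true,
      hf .deg (by decide), hsc.deg _ ((hV _).1 (hvV j hj))]
    refine ⟨by norm_num, by norm_num, by norm_num, by norm_num, by norm_num,
      (hf.upd (by decide) _ _).upd (by decide) _ _, fun i hi => ?_⟩
    by_cases hij : m .verts i = m .verts j
    · simp [hij]
    · have : i ≠ j := by rintro rfl; exact hij rfl
      simpa [hij] using hr i (by omega)
  rintro - m₁ ⟨hf₁, hr₁⟩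
  refine Runs.bind (c₁ := 11 * E.card + 1) ((runs_forLoop 10 (fun i m' =>
    Attached V (m .off) (degIn (m .src) (m .dst) (segTo (m .ord) lo i))
      (fun v e => e ∈ segTo (m .ord) lo i ∧ Inc (m .src) (m .dst) v e) m' ∧
    Frame [.ptr, .rem, .adj, .used] m m' ∧ (∀ v ∈ V, m' .rem v = degIn (m .src) (m .dst) E v) ∧
    ∀ e ∈ segTo (m .ord) lo i, m' .used e = 0) hs.le
    ⟨⟨fun v hv => ?_, by simp, by simp⟩, hf₁.mono (by decide), fun v hv => ?_, by simp⟩ ?_).mono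
    (by rw [hcard]; omega) fun _ _ h => h) (by omega) ?_
  · obtain ⟨j, hj, rfl⟩ := (hsc.mem v).1 ((hV v).1 hv)
    simpa using (hr₁ j hj).1
  · obtain ⟨j, hj, rfl⟩ := (hsc.mem v).1 ((hV v).1 hv)
    exact (hr₁ j hj).2
  · rintro i m₂ h1 h2 ⟨hatt, hf, hrem, hused⟩
    have he := hs.mem h1 h2
    have hne := hE.ne _ he
    have hnot := hs.notMem h1 h2
    have hsub := hs.subset (i := i + 1) h2
    have hoff : ∀ u ∈ V, ∀ v ∈ V, u ≠ v →
      m .off u + degIn (m .src) (m .dst) E u + 2 ≤ m .off v ∨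
        m .off v + degIn (m .src) (m .dst) E v + 2 ≤ m .off u :=
      fun u hu v hv huv => hsc.off u v ((hV u).1 hu) ((hV v).1 hv) huv
    have hdeg : ∀ v, degIn (m .src) (m .dst) (segTo (m .ord) lo i) v +
        (if Inc (m .src) (m .dst) v (m .ord i) then 1 else 0) ≤ degIn (m .src) (m .dst) E v :=
      fun v => by rw [← degIn_insert hnot, ← segTo_succ _ h1]; exact degIn_mono hsub v
    have hsV : m .src (m .ord i) ∈ V := (hV _).2 (degIn_ne_zero he (Or.inl rfl))
    have hdV : m .dst (m .ord i) ∈ V := (hV _).2 (degIn_ne_zero he (Or.inr rfl))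
    have hds := hdeg (m .src (m .ord i))
    have hdd := hdeg (m .dst (m .ord i))
    rw [if_pos (show Inc _ _ _ _ from Or.inl rfl)] at hds
    rw [if_pos (show Inc _ _ _ _ from Or.inr rfl)] at hdd
    simp only [runs_read_bind, runs_write_bind, Mem.upd_of_ne, ne_eq, reduceCtorEq,
      not_false_eq_true, hf .ord (by decide), hf .src (by decide), hf .dst (by decide)]
    have hatt' : Attached V (m .off) (degIn (m .src) (m .dst) (segTo (m .ord) lo i))
        (fun v e => e ∈ segTo (m .ord) lo i ∧ Inc (m .src) (m .dst) v e)
        (m₂.upd .used (m .ord i) 0) := ⟨hatt.ptr, hatt.mem, hatt.back⟩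
    refine ⟨by norm_num, by norm_num, by norm_num, by norm_num, (runs_attach hatt' hoff
      (fun v => (Nat.le_add_right _ _).trans (hdeg v))
      (fun v e h => (hV v).2 (degIn_ne_zero (hs.subset h2.le h.1) h.2)) hsV (by omega) _).bind
        (by norm_num) ?_⟩
    rintro - m₃ ⟨hatt₃, hf₃⟩
    refine (runs_attach hatt₃ hoff (fun v => ?_) (fun v e h => ?_) hdV ?_ (m .ord i)).mono
      (by norm_num) ?_
    · rw [Function.update_apply]
      split_ifs with h3
      · rw [h3]; omega
      · exact (Nat.le_add_right _ _).trans (hdeg v)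
    · rcases h with h | ⟨rfl, -⟩
      · exact (hV v).2 (degIn_ne_zero (hs.subset h2.le h.1) h.2)
      · exact hsV
    · rw [Function.update_of_ne hne.symm]; omega
    rintro - m₄ ⟨hatt₄, hf₄⟩
    have hf₂₄ := hf₃.trans hf₄
    refine ⟨?_, (hf.upd (by decide) _ _).trans (hf₂₄.mono (by decide)), fun v hv => ?_,
      fun e he' => ?_⟩
    · convert hatt₄ using 1
      · funext v
        rw [segTo_succ _ h1, degIn_insert hnot]
        simp only [Inc, Function.update_apply]
        grind
      · funext v e
        rw [segTo_succ _ h1, Finset.mem_insert]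
        simp only [Inc]
        grind
    · rw [hf₂₄ .rem (by decide)]; exact hrem v hv
    · rw [hf₂₄ .used (by decide), Mem.upd_same, Function.update_apply]
      split_ifs with h3
      · rfl
      · rw [segTo_succ _ h1, Finset.mem_insert] at he'
        exact hused e (he'.resolve_left h3)
  rintro - m₂ ⟨hatt, hf₂, hrem, hused⟩
  rw [hs.eq] at hatt hused
  have hlen : listLen V (m .off) (m₂ .ptr) ≤ 2 * E.card := by
    refine le_trans (le_of_eq (Finset.sum_congr rfl fun v hv => ?_))
      (sum_degIn_le (src := m .src) (dst := m .dst) E V)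
    rw [hatt.ptr v hv]; omega
  have hst₂ : EulerState m E V lo mid hi E 0 m₂ := by
    refine ⟨hf₂.mono (by decide), fun i _ => by rw [hf₂ .ord (by decide)], by simp, by simp,
      by simp, by simp, by simp, fun e he => by simp [hused e he, he], hrem, fun v e he hv => ?_,
      fun v hv i h1 h2 => ?_⟩
    · obtain ⟨k, hk, hk'⟩ := hatt.mem v e ⟨he, hv⟩
      exact ⟨m .off v + k, by omega,
        by rw [hatt.ptr v ((hV v).2 (degIn_ne_zero he hv))]; omega, hk'⟩
    · rw [hatt.ptr v hv] at h2
      obtain ⟨k, rfl⟩ := Nat.exists_eq_add_of_le h1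
      exact hatt.back v hv k (by omega)
  refine Runs.bind (c₁ := 38 * E.card + 1) ((runs_foldLoop_pot
    (Q := fun p m' => listLen V (m .off) (m' .ptr) ≤ 2 * E.card ∧
      ∃ R, EulerState m E V lo mid hi R p m' ∧
      (∀ u, -1 ≤ bal (m .src) (m .dst) lo mid (m' .ord) p u ∧
        bal (m .src) (m .dst) lo mid (m' .ord) p u ≤ 1) ∧
      ∀ u, degIn (m .src) (m .dst) R u % 2 = 0)
    (c := 5 * nv + 14 * listLen V (m .off) (m₂ .ptr) + 1)
    (fun j p m' c => c = 5 * (nv - j) + 14 * listLen V (m .off) (m' .ptr) + 1 ∧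
      listLen V (m .off) (m' .ptr) ≤ 2 * E.card ∧
      ∃ R, EulerState m E V lo mid hi R p m' ∧
      (∀ u, -1 ≤ bal (m .src) (m .dst) lo mid (m' .ord) p u ∧
        bal (m .src) (m .dst) lo mid (m' .ord) p u ≤ 1) ∧
      -- A vertex of odd remaining degree has not been an end of a tour yet, so its balance is still
      -- zero.
      (∀ u, degIn (m .src) (m .dst) R u % 2 = 1 →
        bal (m .src) (m .dst) lo mid (m' .ord) p u = 0) ∧
      ∀ i < j, degIn (m .src) (m .dst) R (m .verts i) % 2 = 0) (Nat.zero_le _)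
    ⟨rfl, hlen, E, hst₂, fun u => by simp [bal], fun u _ => by simp [bal], by simp⟩ ?_ ?_).mono
    (by omega) fun _ _ h => h) (by omega) ?_
  · rintro j p m₃ c - hj ⟨rfl, hl, R, hst, hb, hb0, hev⟩
    have hvj := hvV j hj
    simp only [runs_read_bind, hst.frame .verts (by decide), hst.rem _ hvj, runs_ite, runs_pure]
    by_cases hodd : degIn (m .src) (m .dst) R (m .verts j) % 2 = 1
    · obtain ⟨c₁, hr⟩ := hst.runs_tour hE hV hmid hcard hvj
      refine ⟨c₁ + 2, by omega, by omega, fun _ => hr.mono (by omega) ?_, fun h => absurd hodd h⟩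
      rintro p' m₄ ⟨hc, R', x, hst', hR, hx, hb', hpar⟩
      have hpx := hpar x
      have hpv := hpar (m .verts j)
      have hbv := hb0 _ hodd
      -- A closed tour would preserve the odd parity of the remaining degree of its start, but the
      -- tour ends where that degree is zero.
      have hxv : x ≠ m .verts j := by
        rintro rfl
        rw [hx] at hpx
        simp only [if_true] at hpx
        omega
      rw [hx, if_neg hxv, if_pos rfl] at hpx
      rw [if_pos rfl, if_neg hxv.symm] at hpv
      have hbx := hb0 x (by omega)
      refine ⟨_, ?_, rfl, by omega, R', hst', fun u => ?_, fun u hu => ?_, fun i hi => ?_⟩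
      · omega
      · have := hb u
        have h2 := neg_one_pow_eq_or ℤ p
        have h3 := neg_one_pow_eq_or ℤ p'
        rw [hb' u]
        by_cases h4 : u = m .verts j
        · subst h4; rw [hbv, if_pos rfl, if_neg hxv.symm]; omega
        · rw [if_neg h4]
          by_cases h5 : u = x
          · subst h5; rw [hbx, if_pos rfl]; omega
          · rw [if_neg h5]; omega
      · have hpu := hpar u
        rw [hb' u]
        by_cases h4 : u = m .verts j
        · subst h4; omega
        · rw [if_neg h4] at hpu ⊢
          by_cases h5 : u = x
          · subst h5; omega
          · rw [if_neg h5] at hpu ⊢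
            rw [hb0 u (by omega)]; simp
      · have hpu := hpar (m .verts i)
        by_cases h4 : m .verts i = m .verts j
        · rw [h4]; omega
        · have hij : i ≠ j := by rintro rfl; exact h4 rfl
          have := hev i (by omega)
          rw [if_neg h4] at hpu
          by_cases h5 : m .verts i = x
          · rw [h5, hx]
          · rw [if_neg h5] at hpu; omega
    · refine ⟨2, by omega, by omega, fun h => absurd h hodd, fun _ => ⟨_, ?_, rfl, hl, R, hst, hb,
        hb0, fun i hi => ?_⟩⟩
      · omega
      · rcases Nat.lt_succ_iff_lt_or_eq.1 hi with hi | rfl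
        · exact hev i hi
        · omega
  · rintro p m₃ c ⟨rfl, hl, R, hst, hb, -, hev⟩
    refine ⟨by omega, hl, R, hst, hb, fun u => ?_⟩
    by_cases hu : degIn (m .src) (m .dst) E u = 0
    · have := degIn_mono (src := m .src) (dst := m .dst) hst.sub u
      omega
    · obtain ⟨i, hi, rfl⟩ := (hsc.mem u).1 hu
      exact hev i hi
  rintro p m₃ ⟨hl₃, R₃, hst₃, hb₃, hev₃⟩
  refine Runs.bind (c₁ := 36 * E.card + 1) ((runs_foldLoop_pot
    (Q := fun p m' => ∃ R, EulerState m E V lo mid hi R p m' ∧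
      (∀ u, -3 ≤ bal (m .src) (m .dst) lo mid (m' .ord) p u ∧
        bal (m .src) (m .dst) lo mid (m' .ord) p u ≤ 3) ∧
      ∀ i < nv, degIn (m .src) (m .dst) R (m .verts i) = 0)
    (c := 4 * nv + 14 * listLen V (m .off) (m₃ .ptr) + 1)
    (fun j p m' c => c = 4 * (nv - j) + 14 * listLen V (m .off) (m' .ptr) + 1 ∧
      ∃ R, EulerState m E V lo mid hi R p m' ∧
      (∀ u, -3 ≤ bal (m .src) (m .dst) lo mid (m' .ord) p u ∧
        bal (m .src) (m .dst) lo mid (m' .ord) p u ≤ 3) ∧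
      (∀ u, (∀ i < j, m .verts i ≠ u) → -1 ≤ bal (m .src) (m .dst) lo mid (m' .ord) p u ∧
        bal (m .src) (m .dst) lo mid (m' .ord) p u ≤ 1) ∧
      (∀ u, degIn (m .src) (m .dst) R u % 2 = 0) ∧
      ∀ i < j, degIn (m .src) (m .dst) R (m .verts i) = 0) (Nat.zero_le _)
    ⟨rfl, R₃, hst₃, fun u => by have := hb₃ u; omega, fun u _ => hb₃ u, hev₃, by simp⟩
    ?_ ?_).mono (by omega) fun _ _ h => h) (by omega) ?_
  · rintro j p m₄ c - hj ⟨rfl, R, hst, hb, hb1, hev, hz⟩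
    have hvj := hvV j hj
    obtain ⟨c₁, hr⟩ := hst.runs_tour hE hV hmid hcard hvj
    simp only [runs_read_bind, hst.frame .verts (by decide)]
    refine ⟨c₁ + 1, by omega, hr.mono (by omega) ?_⟩
    rintro p' m₅ ⟨hc, R', x, hst', hR, hx, hb', hpar⟩
    -- Ending elsewhere would flip the parity at `x`, from even to odd, while the remaining degree
    -- of `x` is zero.
    have hxv : x = m .verts j := by
      by_contra hxv
      have h1 := hpar x
      have h2 := hev x
      rw [hx, if_neg hxv, if_pos rfl] at h1
      omega
    subst hxv
    refine ⟨_, ?_, rfl, R', hst', fun u => ?_, fun u hu => ?_, fun u => ?_, fun i hi => ?_⟩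
    · omega
    · rw [hb' u]
      have h2 := neg_one_pow_eq_or ℤ p
      have h3 := neg_one_pow_eq_or ℤ p'
      by_cases h4 : u = m .verts j
      · have := hb1 u fun i hi h5 => by
          have := hsc.inj i (by omega) j hj (h5.trans h4)
          omega
        rw [if_pos h4, if_pos h4]
        omega
      · have := hb u
        rw [if_neg h4, if_neg h4]
        omega
    · have h4 : u ≠ m .verts j := (hu j (by omega)).symm
      have := hb1 u fun i hi => hu i (by omega)
      rw [hb' u, if_neg h4, if_neg h4]
      omega
    · have h1 := hpar u
      have h2 := hev u
      by_cases h4 : u = m .verts j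
      · rw [h4, hx]
      · rw [if_neg h4] at h1; omega
    · rcases Nat.lt_succ_iff_lt_or_eq.1 hi with hi | rfl
      · have := degIn_mono (src := m .src) (dst := m .dst) hR (m .verts i)
        have := hz i hi
        omega
      · exact hx
  · rintro p m₄ c ⟨rfl, R, hst, hb, -, -, hz⟩
    exact ⟨by omega, R, hst, hb, hz⟩
  rintro p₄ m₄ ⟨R, hst, hb, hz⟩
  have hR : R = ∅ := by
    refine Finset.eq_empty_of_forall_notMem fun e he => ?_
    have h1 := degIn_ne_zero (src := m .src) (dst := m .dst) he (Or.inl rfl)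
    obtain ⟨i, hi, h2⟩ := (hsc.mem _).1 (degIn_ne_zero (hst.sub he) (Or.inl rfl))
    rw [← h2] at h1
    exact h1 (hz i hi)
  subst hR
  have hp := hst.card
  rw [Finset.card_empty] at hp
  have hle := hs.le
  have h1 := hst.card₁
  have h2 := hst.card₂
  have h3 := hst.union
  simp only [bal] at hb
  rw [show lo + (p₄ + 1) / 2 = mid by omega] at h1 h3 hb
  rw [show mid + p₄ / 2 = hi by omega] at h2 h3 hb
  rw [Finset.union_empty] at h3
  have hdisj : Disjoint (segTo (m₄ .ord) lo mid) (segTo (m₄ .ord) mid hi) := by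
    rw [← Finset.card_union_eq_card_add_card, h3]; omega
  rw [runs_pure]
  refine ⟨_, _, ⟨by omega, rfl, by omega⟩, ⟨by omega, rfl, by omega⟩, h3, hdisj, fun v => ?_,
    hst.frame, hst.out⟩
  have h4 := degIn_union (src := m .src) (dst := m .dst) hdisj v
  rw [h3] at h4
  have := hb v
  omega

/-! ### Pruning -/

/-- The number of colors in `{1, …, γ - 1}` that are used. -/
def usedTo (cnt : ℕ → ℕ) (γ : ℕ) : ℕ := ((Finset.Ico 1 γ).filter (cnt · ≠ 0)).card

lemma usedTo_succ (cnt : ℕ → ℕ) {γ : ℕ} (h : 1 ≤ γ) :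
    usedTo cnt (γ + 1) = usedTo cnt γ + if cnt γ = 0 then 0 else 1 := by
  unfold usedTo
  rw [← Finset.insert_Ico_right_eq_Ico_add_one h, Finset.filter_insert]
  by_cases h0 : cnt γ = 0
  · rw [if_neg (not_not.2 h0), if_pos h0, add_zero]
  · rw [if_pos h0, if_neg h0, Finset.card_insert_of_notMem (by simp)]

@[simp] lemma usedTo_one (cnt : ℕ → ℕ) : usedTo cnt 1 = 0 := by simp [usedTo]

lemma usedTo_mono (cnt : ℕ → ℕ) {γ γ' : ℕ} (h : γ ≤ γ') : usedTo cnt γ ≤ usedTo cnt γ' :=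
  Finset.card_le_card (Finset.filter_subset_filter _ (Finset.Ico_subset_Ico_right h))

lemma usedTo_le (cnt : ℕ → ℕ) (γ : ℕ) : usedTo cnt γ ≤ γ - 1 :=
  (Finset.card_filter_le _ _).trans (Nat.card_Ico 1 γ).le

lemma usedTo_update {cnt : ℕ → ℕ} {g γ : ℕ} (h1 : 1 ≤ g) (h2 : g < γ) (h : cnt g ≠ 0) :
    usedTo (Function.update cnt g 0) γ + 1 = usedTo cnt γ := by
  unfold usedTo
  rw [show (Finset.Ico 1 γ).filter (Function.update cnt g 0 · ≠ 0) =
    ((Finset.Ico 1 γ).filter (cnt · ≠ 0)).erase g from ?_, Finset.card_erase_add_one]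
  · simp [h1, h2, h]
  · ext x
    simp only [Finset.mem_filter, Finset.mem_erase, Function.update_apply]
    by_cases hx : x = g <;> simp [hx]

/-- The number of edges in `E` of color `γ`. -/
def classSize (E : Finset ℕ) (c : ℕ → ℕ) (γ : ℕ) : ℕ := (E.filter (c · = γ)).card

lemma classSize_ne_zero {E : Finset ℕ} {c : ℕ → ℕ} {e : ℕ} (h : e ∈ E) :
    classSize E c (c e) ≠ 0 := Finset.card_ne_zero_of_mem (Finset.mem_filter.2 ⟨h, rfl⟩)

lemma classSize_insert {P : Finset ℕ} {c : ℕ → ℕ} {e : ℕ} (he : e ∉ P) :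
    classSize (insert e P) c = Function.update (classSize P c) (c e) (classSize P c (c e) + 1) := by
  funext γ
  unfold classSize
  rw [Finset.filter_insert, Function.update_apply]
  by_cases h : c e = γ
  · subst h
    rw [if_pos rfl, if_pos rfl, Finset.card_insert_of_notMem (by simp [he])]
  · rw [if_neg h, if_neg (Ne.symm h)]

lemma mul_usedTo_le {E : Finset ℕ} {c cnt : ℕ → ℕ} {K k : ℕ}
    (hcnt : ∀ γ, 1 ≤ γ → γ ≤ K → cnt γ = classSize E c γ)
    (hk : ∀ γ, 1 ≤ γ → γ ≤ K → cnt γ ≠ 0 → k ≤ cnt γ) : usedTo cnt (K + 1) * k ≤ E.card := by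
  unfold usedTo
  rw [← smul_eq_mul]
  refine (Finset.card_nsmul_le_sum _ cnt k fun γ hγ => ?_).trans ?_
  · simp only [Finset.mem_filter, Finset.mem_Ico] at hγ
    exact hk γ hγ.1.1 (by omega) hγ.2
  · rw [Finset.sum_congr rfl fun γ hγ => by
      simp only [Finset.mem_filter, Finset.mem_Ico] at hγ
      exact hcnt γ hγ.1.1 (by omega)]
    unfold classSize
    rw [Finset.sum_card_fiberwise_eq_card_filter]
    exact Finset.card_filter_le _ _

/-- The result of uncoloring color classes of total size at most `z`. -/
structure Thinned (E : Finset ℕ) (c c' : ℕ → ℕ) (z : ℕ) : Prop where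
  eq : ∀ e, c' e = c e ∨ e ∈ E ∧ c' e = 0
  zero : classSize E c' 0 ≤ z

lemma Thinned.remove {E : Finset ℕ} {c c' c'' : ℕ → ℕ} {z γ : ℕ} (h : Thinned E c c' z)
    (hc : ∀ e, c'' e = if e ∈ E ∧ c' e = γ then 0 else c' e) :
    Thinned E c c'' (z + classSize E c' γ) := by
  refine ⟨fun e => ?_, ?_⟩
  · rw [hc]
    have := h.eq e
    split_ifs with h1
    · exact Or.inr ⟨h1.1, rfl⟩
    · exact this
  · refine le_trans (le_trans (Finset.card_le_card (t := E.filter (c' · = 0) ∪ E.filter (c' · = γ))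
      fun e he => ?_) (Finset.card_union_le _ _)) (Nat.add_le_add_right h.zero _)
    simp only [Finset.mem_filter, Finset.mem_union, hc] at he ⊢
    split_ifs at he with h1
    · exact Or.inr h1
    · exact Or.inl he

lemma classSize_remove {E : Finset ℕ} {c' c'' : ℕ → ℕ} {γ g : ℕ}
    (hc : ∀ e, c'' e = if e ∈ E ∧ c' e = γ then 0 else c' e) (hg : g ≠ 0) :
    classSize E c'' g = Function.update (classSize E c') γ 0 g := by
  unfold classSize
  rw [Function.update_apply]
  split_ifs with h
  · subst h
    refine Finset.card_eq_zero.2 (Finset.filter_eq_empty_iff.2 fun e he h => ?_)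
    rw [hc] at h
    split_ifs at h with h1
    · exact hg h.symm
    · exact h1 ⟨he, h⟩
  · congr 1
    refine Finset.filter_congr fun e he => ?_
    rw [hc]
    split_ifs with h1
    · exact ⟨fun h2 => absurd h2.symm hg, fun h2 => absurd (h2.symm.trans h1.2) h⟩
    · rfl

lemma runs_leastCommon {m : Mem} {K : ℕ} :
    Runs (foldLoop 1 (K + 1) (0, 0, 0) fun γ (s : ℕ × ℕ × ℕ) => do
      let c ← read .cnt γ
      if c = 0 then pure s
      else if s.1 = 0 ∨ c < s.2.2 then pure (s.1 + 1, γ, c)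
      else pure (s.1 + 1, s.2.1, s.2.2)) m (2 * K + 1) fun r m' => m' = m ∧
      r.1 = usedTo (m .cnt) (K + 1) ∧ (r.1 ≠ 0 → 1 ≤ r.2.1 ∧ r.2.1 ≤ K ∧
        m .cnt r.2.1 ≠ 0 ∧
        ∀ g, 1 ≤ g → g ≤ K → m .cnt g ≠ 0 → m .cnt r.2.1 ≤ m .cnt g) := by
  refine (runs_foldLoop 1 (lo := 1) (hi := K + 1) (fun γ (s : ℕ × ℕ × ℕ) m' => m' = m ∧
    s.1 = usedTo (m .cnt) γ ∧
    (s.1 ≠ 0 → 1 ≤ s.2.1 ∧ s.2.1 < γ ∧ m .cnt s.2.1 ≠ 0 ∧ m .cnt s.2.1 = s.2.2) ∧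
    ∀ g, 1 ≤ g → g < γ → m .cnt g ≠ 0 → s.1 ≠ 0 ∧ s.2.2 ≤ m .cnt g) (by omega)
    ⟨rfl, by simp, by simp, fun g h1 h2 => by omega⟩ ?_).mono (by omega) ?_
  · rintro γ ⟨u, g₀, k⟩ m' h1 h2 ⟨rfl, hu, hs, hg⟩
    simp only [runs_read_bind, runs_ite, runs_pure] at hu hs hg ⊢
    refine ⟨le_rfl, fun h0 => ⟨trivial, ?_, fun h => ?_, fun g hg1 hg2 hg0 => ?_⟩,
      fun h0 => ⟨fun hc => ⟨trivial, ?_, fun h => ?_, fun g hg1 hg2 hg0 => ?_⟩,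
        fun hc => ⟨trivial, ?_, fun h => ?_, fun g hg1 hg2 hg0 => ?_⟩⟩⟩
    · rw [usedTo_succ _ h1, hu, if_pos h0, add_zero]
    · have := hs h; exact ⟨this.1, by omega, this.2.2⟩
    · refine hg g hg1 ?_ hg0
      rcases Nat.lt_succ_iff_lt_or_eq.1 hg2 with h | rfl
      · exact h
      · exact absurd h0 hg0
    · rw [usedTo_succ _ h1, hu, if_neg h0]
    · exact ⟨h1, by omega, h0, trivial⟩
    · refine ⟨by omega, ?_⟩
      rcases Nat.lt_succ_iff_lt_or_eq.1 hg2 with h | rfl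
      · have := hg g hg1 h hg0
        omega
      · exact le_rfl
    · rw [usedTo_succ _ h1, hu, if_neg h0]
    · push Not at hc
      have := hs hc.1; exact ⟨this.1, by omega, this.2.2⟩
    · push Not at hc
      refine ⟨by omega, ?_⟩
      rcases Nat.lt_succ_iff_lt_or_eq.1 hg2 with h | rfl
      · exact (hg g hg1 h hg0).2
      · exact hc.2
  · rintro ⟨u, g₀, k⟩ m' ⟨rfl, hu, hs, hg⟩
    refine ⟨rfl, hu, fun h => ?_⟩
    have h' := hs h
    simp only at h' hg ⊢
    refine ⟨h'.1, by omega, h'.2.2.1, fun g h1 h2 h3 => ?_⟩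
    have := (hg g h1 (by omega) h3).2
    omega

lemma runs_uncolorClass {m : Mem} {lo hi γ : ℕ} {E : Finset ℕ} (hs : Seg (m .ord) lo hi E) :
    Runs (forLoop lo hi fun i => do
        let e ← read .ord i
        let g ← read .col e
        if g = γ then write .col e 0 else pure ()) m (4 * E.card + 1) fun _ m' =>
      Frame [.col] m m' ∧ ∀ e, m' .col e = if e ∈ E ∧ m .col e = γ then 0 else m .col e := by
  refine (runs_forLoop 3 (fun i m' => Frame [.col] m m' ∧
    ∀ e, m' .col e = if e ∈ segTo (m .ord) lo i ∧ m .col e = γ then 0 else m .col e) hs.le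
    ⟨Frame.refl _ _, by simp⟩ ?_).mono (by rw [hs.card]; omega) ?_
  · rintro i m₁ h1 h2 ⟨hf, hc⟩
    have hnot := hs.notMem h1 h2
    simp only [runs_read_bind, runs_ite, runs_write, runs_pure, hf .ord (by decide), hc, hnot,
      false_and, if_false]
    refine ⟨by norm_num, by norm_num, fun hg => ⟨by norm_num, hf.upd (by decide) _ _, fun e => ?_⟩,
      fun hg => ⟨hf, fun e => ?_⟩⟩
    · simp only [Mem.upd_same, Function.update_apply, segTo_succ _ h1, Finset.mem_insert, hc]
      by_cases h3 : e = m .ord i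
      · simp [h3, hg]
      · simp [h3]
    · simp only [segTo_succ _ h1, Finset.mem_insert, hc]
      by_cases h3 : e = m .ord i
      · subst h3; simp [hnot, hg]
      · simp [h3]
  · rintro - m₁ ⟨hf, hc⟩
    rw [hs.eq] at hc
    exact ⟨hf, hc⟩

/-- While more than `q` colors are used, a least common one has at most `|E| / (q + 1)` edges, and
at most `K - q` classes are removed. The bound is stated without division. The renaming may merge no
two classes, which is the second conclusion. -/
lemma runs_prune {m : Mem} {lo hi K q : ℕ} {E : Finset ℕ} (hs : Seg (m .ord) lo hi E)
    (hcol : ∀ e ∈ E, 1 ≤ m .col e ∧ m .col e ≤ K) :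
    Runs (prune lo hi K q) m ((K - q + 1) * (2 * K + 4 * E.card + 6) + 5 * K + 10 * E.card + 4)
      fun _ m' => (∀ e ∈ E, m' .col e ≤ q) ∧
        (∀ e ∈ E, ∀ e' ∈ E, m' .col e ≠ 0 → m' .col e = m' .col e' → m .col e = m .col e') ∧
        (∀ e, e ∉ E → m' .col e = m .col e) ∧
        classSize E (m' .col) 0 * (q + 1) ≤ (K - q) * E.card ∧ Frame [.cnt, .lab, .col] m m' := by
  have hcard := hs.card
  unfold prune
  refine Runs.bind (c₁ := 2 * K + 1) ((runs_forLoop 1 (lo := 1) (hi := K + 1)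
    (fun γ m' => Frame [.cnt] m m' ∧ ∀ g, 1 ≤ g → g < γ → m' .cnt g = 0) (by omega)
    ⟨Frame.refl _ _, fun g h1 h2 => by omega⟩ ?_).mono (by omega) fun _ _ h => h) (by omega) ?_
  · rintro γ m₁ h1 h2 ⟨hf, hz⟩
    rw [runs_write]
    refine ⟨le_rfl, hf.upd (by decide) _ _, fun g hg1 hg2 => ?_⟩
    rw [Mem.upd_same, Function.update_apply]
    split_ifs with h3
    · rfl
    · exact hz g hg1 (by omega)
  rintro - m₁ ⟨hf₁, hz₁⟩
  refine Runs.bind (c₁ := 5 * E.card + 1) ((runs_forLoop 4 (fun i m' => Frame [.cnt] m m' ∧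
    ∀ g, 1 ≤ g → g ≤ K → m' .cnt g = classSize (segTo (m .ord) lo i) (m .col) g) hs.le
    ⟨hf₁, fun g h1 h2 => by rw [hz₁ g h1 (by omega)]; simp [classSize]⟩ ?_).mono
    (by rw [hcard]; omega) fun _ _ h => h) (by omega) ?_
  · rintro i m₂ h1 h2 ⟨hf, hc⟩
    have he := hcol _ (hs.mem h1 h2)
    simp only [runs_read_bind, runs_incr, hf .ord (by decide), hf .col (by decide)]
    refine ⟨by norm_num, by norm_num, by norm_num, hf.upd (by decide) _ _, fun g hg1 hg2 => ?_⟩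
    rw [segTo_succ _ h1, classSize_insert (hs.notMem h1 h2), Mem.upd_same, hc _ he.1 he.2,
      Function.update_apply, Function.update_apply]
    split_ifs
    · rfl
    · exact hc g hg1 hg2
  rintro - m₂ ⟨hf₂, hc₂⟩
  rw [hs.eq] at hc₂
  have hU₂ := usedTo_le (m₂ .cnt) (K + 1)
  refine Runs.bind (c₁ := (K - q + 1) * (2 * K + 4 * E.card + 6)) (Q := fun _ m' =>
    (∃ z, z * (q + 1) ≤ (K - q) * E.card ∧ Thinned E (m .col) (m' .col) z) ∧
    Frame [.cnt, .col] m m' ∧ usedTo (m' .cnt) (K + 1) ≤ q ∧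
    ∀ g, 1 ≤ g → g ≤ K → m' .cnt g = classSize E (m' .col) g) ?_ (by omega) ?_
  · refine runs_whileLoop (fun _ m' c =>
      (∃ z, Thinned E (m .col) (m' .col) z ∧ z * (q + 1) ≤ (K - usedTo (m' .cnt) (K + 1)) * E.card ∧
        -- The coloring may use fewer than `q` colors from the start, but then nothing is removed;
        -- after a removal at least `q` colors are left, so at most `K - q` classes have been lost.
        (z = 0 ∨ q ≤ usedTo (m' .cnt) (K + 1))) ∧
      c = (usedTo (m' .cnt) (K + 1) - q + 1) * (2 * K + 4 * E.card + 6) ∧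
      Frame [.cnt, .col] m m' ∧
      ∀ g, 1 ≤ g → g ≤ K → m' .cnt g = classSize E (m' .col) g) ?_ (c :=
        (usedTo (m₂ .cnt) (K + 1) - q + 1) * (2 * K + 4 * E.card + 6))
      ⟨⟨0, ⟨fun e => Or.inl (by rw [hf₂ .col (by decide)]), ?_⟩, by simp, Or.inl rfl⟩, rfl,
        hf₂.mono (by decide), ?_⟩ |>.mono (Nat.mul_le_mul_right _ (by omega)) fun _ _ h => h
    · rintro - m₃ c ⟨⟨z, hz, hzq, hzU⟩, rfl, hf, hc⟩
      have hord := hf .ord (by decide)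
      have hU := usedTo_le (m₃ .cnt) (K + 1)
      refine ⟨2 * K + 4 * E.card + 4, by nlinarith, runs_leastCommon.bind (by omega) ?_⟩
      rintro ⟨u, γ, k⟩ m₄ ⟨rfl, hu, hγ⟩
      simp only at hu hγ ⊢
      simp only [runs_ite, runs_pure]
      refine ⟨fun huq => ⟨⟨z, ?_, hz⟩, hf, by omega, hc⟩, fun huq => ?_⟩
      · rcases hzU with rfl | h
        · simp
        · exact hzq.trans (Nat.mul_le_mul_right _ (by omega))
      obtain ⟨hγ1, hγK, hγ0, hmin⟩ := hγ (by omega)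
      refine (runs_uncolorClass (by rw [hord]; exact hs)).bind (by omega) ?_
      rintro - m₅ ⟨hf₅, hc₅⟩
      simp only [runs_write_bind, runs_pure]
      have hcnt₅ : m₅ .cnt = m₄ .cnt := hf₅ .cnt (by decide)
      have hupd := usedTo_update (γ := K + 1) hγ1 (by omega) hγ0
      refine ⟨by omega, _, ?_, ⟨z + m₄ .cnt γ, ?_, ?_, Or.inr ?_⟩, rfl,
        (hf.trans (hf₅.mono (by decide))).upd (by decide) _ _, fun g h1 h2 => ?_⟩
      · rw [Mem.upd_same, hcnt₅]
        obtain ⟨A, hA⟩ := Nat.exists_eq_add_of_le (show q + 1 ≤ u by omega)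
        rw [show usedTo (m₄ .cnt) (K + 1) - q + 1 = A + 2 by omega,
          show usedTo (Function.update (m₄ .cnt) γ 0) (K + 1) - q + 1 = A + 1 by omega]
        nlinarith
      · rw [hc γ hγ1 hγK, Mem.upd_of_ne _ _ _ (by decide)]
        exact hz.remove hc₅
      · have h3 := mul_usedTo_le hc hmin
        rw [Mem.upd_same, hcnt₅, show K - usedTo (Function.update (m₄ .cnt) γ 0) (K + 1) =
          K - usedTo (m₄ .cnt) (K + 1) + 1 by omega]
        have h4 : m₄ .cnt γ * (q + 1) ≤ E.card :=
          le_trans (by rw [mul_comm]; exact Nat.mul_le_mul_right _ (by omega)) h3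
        nlinarith
      · rw [Mem.upd_same, hcnt₅]; omega
      · rw [Mem.upd_same, hcnt₅, Mem.upd_of_ne _ _ _ (by decide), classSize_remove hc₅ (by omega),
          Function.update_apply, Function.update_apply]
        split_ifs
        · rfl
        · exact hc g h1 h2
    · refine (Finset.card_eq_zero.2 (Finset.filter_eq_empty_iff.2 fun e he h => ?_)).le
      rw [hf₂ .col (by decide)] at h
      have := hcol e he
      omega
    · rw [hf₂ .col (by decide)]; exact hc₂
  rintro - m₃ ⟨⟨z, hz, hth⟩, hf₃, hU₃, hc₃⟩
  have hcol₃ : ∀ e ∈ E, m₃ .col e ≠ 0 → m₃ .col e = m .col e ∧ 1 ≤ m₃ .col e ∧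
      m₃ .col e ≤ K ∧ m₃ .cnt (m₃ .col e) ≠ 0 := by
    intro e he h0
    have h1 := (hth.eq e).resolve_right fun h => h0 h.2
    have h2 := hcol e he
    have h3 := hc₃ (m₃ .col e) (by omega) (by omega)
    exact ⟨h1, by omega, by omega, h3 ▸ classSize_ne_zero he⟩
  refine Runs.bind (c₁ := 3 * K + 1) ((runs_foldLoop 2 (lo := 1) (hi := K + 1)
    (fun γ t m' => Frame [.lab] m₃ m' ∧ t = usedTo (m₃ .cnt) γ ∧
      ∀ g, 1 ≤ g → g < γ → m₃ .cnt g ≠ 0 → m' .lab g = usedTo (m₃ .cnt) (g + 1)) (by omega)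
    ⟨Frame.refl _ _, by simp, fun g h1 h2 => by omega⟩ ?_).mono (by omega) fun _ _ h => h)
    (by omega) ?_
  · rintro γ t m₄ h1 h2 ⟨hf, rfl, hlab⟩
    simp only [runs_read_bind, runs_write_bind, runs_ite, runs_pure, hf .cnt (by decide)]
    refine ⟨by norm_num, fun h0 => ⟨hf, ?_, fun g hg1 hg2 hg0 => ?_⟩,
      fun h0 => ⟨by norm_num, hf.upd (by decide) _ _, ?_, fun g hg1 hg2 hg0 => ?_⟩⟩
    · rw [usedTo_succ _ h1, if_pos h0, add_zero]
    · refine hlab g hg1 ?_ hg0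
      rcases Nat.lt_succ_iff_lt_or_eq.1 hg2 with h | rfl
      · exact h
      · exact absurd h0 hg0
    · rw [usedTo_succ _ h1, if_neg h0]
    · rw [Mem.upd_same, Function.update_apply]
      split_ifs with h3
      · rw [h3, usedTo_succ _ h1, if_neg h0]
      · exact hlab g hg1 (by omega) hg0
  rintro t m₄ ⟨hf₄, -, hlab⟩
  have hord₄ : m₄ .ord = m .ord := by rw [hf₄ .ord (by decide), hf₃ .ord (by decide)]
  have hcol₄ : m₄ .col = m₃ .col := hf₄ .col (by decide)
  have hzero₄ : ∀ e ∈ E, m₃ .col e ≠ 0 → 1 ≤ m₄ .lab (m₃ .col e) ∧ m₄ .lab (m₃ .col e) ≤ q := by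
    intro e he h0
    obtain ⟨-, h1, h2, h3⟩ := hcol₃ e he h0
    rw [hlab _ h1 (by omega) h3]
    refine ⟨?_, (usedTo_mono _ (by omega)).trans hU₃⟩
    rw [usedTo_succ _ h1, if_neg h3]; omega
  refine ((runs_forLoop 4 (fun i m' => Frame [.col] m₄ m' ∧ ∀ e, m' .col e =
    if e ∈ segTo (m .ord) lo i ∧ m₃ .col e ≠ 0 then m₄ .lab (m₃ .col e) else m₃ .col e) hs.le
    ⟨Frame.refl _ _, by simp [hcol₄]⟩ ?_).mono (by rw [hcard]; omega) ?_)
  · rintro i m₅ h1 h2 ⟨hf, hc⟩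
    have hnot := hs.notMem h1 h2
    simp only [runs_read_bind, runs_ite, runs_write, runs_pure, hf .ord (by decide), hord₄,
      hf .lab (by decide), hc, hnot, false_and, if_false]
    refine ⟨by norm_num, by norm_num, fun hg => ⟨hf, fun e => ?_⟩,
      fun hg => ⟨by norm_num, by norm_num, hf.upd (by decide) _ _, fun e => ?_⟩⟩
    · simp only [segTo_succ _ h1, Finset.mem_insert, hc]
      by_cases h3 : e = m .ord i
      · subst h3; simp [hg]
      · simp [h3]
    · simp only [Mem.upd_same, Function.update_apply, segTo_succ _ h1, Finset.mem_insert, hc]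
      by_cases h3 : e = m .ord i
      · simp [h3, hg]
      · simp [h3]
  rintro - m₅ ⟨hf₅, hc₅⟩
  rw [hs.eq] at hc₅
  have hne : ∀ e ∈ E, m₅ .col e ≠ 0 → m₃ .col e ≠ 0 := fun e he h h0 => h (by rw [hc₅]; simp [h0])
  refine ⟨fun e he => ?_, fun e he e' he' h0 h => ?_, fun e he => ?_, ?_,
    (hf₃.mono (by decide)).trans ((hf₄.mono (by decide)).trans (hf₅.mono (by decide)))⟩
  · rw [hc₅]
    split_ifs with h
    · exact (hzero₄ e he h.2).2
    · have : m₃ .col e = 0 := by tauto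
      omega
  · have h1 := hne e he h0
    have h2 := hne e' he' (h ▸ h0)
    obtain ⟨h3, h4, h5, h6⟩ := hcol₃ e he h1
    obtain ⟨h3', h4', h5', h6'⟩ := hcol₃ e' he' h2
    rw [hc₅, hc₅, if_pos ⟨he, h1⟩, if_pos ⟨he', h2⟩, hlab _ h4 (by omega) h6,
      hlab _ h4' (by omega) h6'] at h
    rw [← h3, ← h3']
    -- The new name of a color is the number of used colors up to it, which increases strictly along
    -- the used colors.
    have key : ∀ a b, 1 ≤ b → m₃ .cnt b ≠ 0 → usedTo (m₃ .cnt) (a + 1) = usedTo (m₃ .cnt) (b + 1) →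
        ¬ a < b := fun a b hb hb0 h hab => by
      have h7 := usedTo_mono (m₃ .cnt) (show a + 1 ≤ b by omega)
      rw [h, usedTo_succ _ hb, if_neg hb0] at h7
      omega
    have := key _ _ h4' h6' h
    have := key _ _ h4 h6 h.symm
    omega
  · rw [hc₅, if_neg fun h => he h.1]
    exact (hth.eq e).resolve_right fun h => he h.1
  · refine le_trans (Nat.mul_le_mul_right _ (le_trans (Finset.card_le_card fun e he => ?_)
      hth.zero)) hz
    rw [Finset.mem_filter] at he ⊢
    refine ⟨he.1, by_contra fun h => ?_⟩
    have h1 := hzero₄ e he.1 h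
    have h2 := he.2
    rw [hc₅, if_pos ⟨he.1, h⟩] at h2
    omega

/-! ### Repair -/

/-- The edges in `E` of the same color do not share an endpoint. -/
def ProperOn (src dst : ℕ → ℕ) (E : Finset ℕ) (c : ℕ → ℕ) : Prop :=
  ∀ e ∈ E, ∀ e' ∈ E, ∀ v, Inc src dst v e → Inc src dst v e' → c e = c e' → c e ≠ 0 → e = e'

/-- The arrays changed by the initialization of the sets `μ(v)`. -/
abbrev muArrs : List Arr := [.mu, .muPos, .muSize]

lemma runs_muInit_vertex {m : Mem} {v o g : ℕ} :
    Runs (do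
      write .muSize v 0
      forLoop 1 (g + 2) fun γ => setInsert .mu .muPos .muSize v o γ) m (5 * g + 7) fun _ m' =>
      Frame muArrs m m' ∧
      IsSet (m' .mu) (m' .muPos) (m' .muSize v) o (Finset.Icc 1 (g + 1)) ∧
      (∀ u, u ≠ v → m' .muSize u = m .muSize u) ∧
      ∀ i, i < o ∨ o + g + 2 ≤ i → m' .mu i = m .mu i ∧ m' .muPos i = m .muPos i := by
  rw [runs_write_bind]
  refine ⟨by omega, (runs_forLoop 4 (lo := 1) (hi := g + 2) (fun γ m' => Frame muArrs m m' ∧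
    IsSet (m' .mu) (m' .muPos) (m' .muSize v) o (Finset.Ico 1 γ) ∧
    (∀ u, u ≠ v → m' .muSize u = m .muSize u) ∧
    ∀ i, i < o ∨ o + g + 2 ≤ i → m' .mu i = m .mu i ∧ m' .muPos i = m .muPos i) (by omega)
    ⟨(Frame.refl _ _).upd (by decide) _ _, by simpa using IsSet.empty,
      fun u hu => by simp [hu], fun i _ => by simp⟩ ?_).mono (by omega) ?_⟩
  · rintro γ m₁ h1 h2 ⟨hf, hset, hsz, hout⟩
    have hk := hset.card
    rw [Nat.card_Ico] at hk
    simp only [setInsert, runs_read_bind, runs_write_bind, runs_write]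
    refine ⟨by norm_num, by norm_num, by norm_num, by norm_num, ((hf.upd (by decide) _ _).upd
      (by decide) _ _).upd (by decide) _ _, ?_, fun u hu => ?_, fun i hi => ?_⟩
    · rw [← Finset.insert_Ico_right_eq_Ico_add_one h1]
      simpa using hset.insert (x := γ) (by simp)
    · simpa [hu] using hsz u hu
    · have := hout i hi
      simp only [Mem.upd_same, Mem.upd_of_ne, ne_eq, reduceCtorEq, not_false_eq_true]
      rw [Function.update_of_ne (by omega), Function.update_of_ne (by omega)]
      exact this
  · rintro - m₁ ⟨hf, hset, hsz, hout⟩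
    refine ⟨hf, ?_, hsz, hout⟩
    rwa [show Finset.Icc 1 (g + 1) = Finset.Ico 1 (g + 2) from by ext; simp; omega]

lemma runs_muInit {m : Mem} {src dst : ℕ → ℕ} {E : Finset ℕ} {nv : ℕ}
    (h : Scanned src dst E m nv) :
    Runs (forLoop 0 nv fun j => do
      let v ← read .verts j
      let g ← read .deg v
      let o ← read .off v
      write .muSize v 0
      forLoop 1 (g + 2) fun γ => setInsert .mu .muPos .muSize v o γ) m (32 * E.card + 1)
      fun _ m' => Frame muArrs m m' ∧ ∀ v, degIn src dst E v ≠ 0 →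
        IsSet (m' .mu) (m' .muPos) (m' .muSize v) (m .off v)
          (Finset.Icc 1 (degIn src dst E v + 1)) := by
  have hj : ∀ j < nv, degIn src dst E (m .verts j) ≠ 0 := fun j hj => (h.mem _).2 ⟨j, hj, rfl⟩
  -- The degrees sum to at most `2 |E|`, and there are at most `2 |E|` non-isolated vertices: `5 * 2
  -- + 11 * 2 = 32`.
  have hsum : ∑ k ∈ Finset.range nv, (5 * degIn src dst E (m .verts k) + 11) ≤ 32 * E.card := by
    rw [Finset.sum_add_distrib, ← Finset.mul_sum, Finset.sum_const, Finset.card_range, smul_eq_mul]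
    have h1 := sum_degIn_le (src := src) (dst := dst) E ((Finset.range nv).image (m .verts))
    rw [Finset.sum_image fun i hi j hj => h.inj i (by simpa using hi) j (by simpa using hj)] at h1
    have := h.le
    omega
  refine (runs_foldLoop_pot (lo := 0) (hi := nv) (Q := fun _ m' => Frame muArrs m m' ∧
      ∀ i < nv, IsSet (m' .mu) (m' .muPos) (m' .muSize (m .verts i)) (m .off (m .verts i))
        (Finset.Icc 1 (degIn src dst E (m .verts i) + 1)))
    (fun j _ m' c => c = ∑ k ∈ Finset.Ico j nv, (5 * degIn src dst E (m .verts k) + 11) + 1 ∧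
      Frame muArrs m m' ∧
      ∀ i < j, IsSet (m' .mu) (m' .muPos) (m' .muSize (m .verts i)) (m .off (m .verts i))
        (Finset.Icc 1 (degIn src dst E (m .verts i) + 1))) (Nat.zero_le _)
    ⟨rfl, Frame.refl _ _, by simp⟩ ?_ ?_).mono ?_ ?_
  · rintro j - m₁ c - hjn ⟨rfl, hf, hset⟩
    simp only [runs_read_bind, hf .verts (by decide), hf .deg (by decide), hf .off (by decide),
      h.deg _ (hj j hjn)]
    refine ⟨5 * degIn src dst E (m .verts j) + 10, by omega, by omega, by omega,
      runs_muInit_vertex.mono (by omega) ?_⟩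
    rintro - m₂ ⟨hf₂, hs₂, hsz, hout⟩
    refine ⟨∑ k ∈ Finset.Ico (j + 1) nv, (5 * degIn src dst E (m .verts k) + 11) + 1, ?_, rfl,
      hf.trans hf₂, fun i hi => ?_⟩
    · rw [Finset.sum_eq_sum_Ico_succ_bot hjn]; omega
    · rcases Nat.lt_succ_iff_lt_or_eq.1 hi with hi | rfl
      · have hne : m .verts i ≠ m .verts j := fun e => by
          have := h.inj i (by omega) j hjn e; omega
        have hoff := h.off _ _ (hj i (by omega)) (hj j hjn) hne
        rw [hsz _ hne]
        refine (hset i hi).congr (b := degIn src dst E (m .verts i) + 2) (fun x hx => ?_) ?_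
          (fun k h1 h2 => (hout k (by omega)).1) fun k h1 h2 => (hout k (by omega)).2
        · rw [Finset.mem_Icc] at hx; omega
        · have := (hset i hi).card
          rw [Nat.card_Icc] at this; omega
      · exact hs₂
  · rintro - m₁ c ⟨rfl, hf, hset⟩
    exact ⟨by omega, hf, hset⟩
  · rw [Nat.Ico_zero_eq_range]; omega
  · rintro - m₁ ⟨hf, hset⟩
    refine ⟨hf, fun v hv => ?_⟩
    obtain ⟨i, hi, rfl⟩ := (h.mem v).1 hv
    exact hset i hi

namespace Ctx

variable {X : Ctx}

/-- The arrays changed by the setup loop of `repair`. -/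
abbrev setupArrs : List Arr := stateArrs ++ [.mark, .unc, .uncPos, .uncSize]

/-- Edges not reached yet count as uncolored, so after each iteration the dictionary represents a
proper partial coloring, and inserting the next edge is an ordinary coloring step. -/
lemma runs_setup {m : Mem} {lo hi : ℕ} (hX : X.Valid) (hs : Seg (m .ord) lo hi X.E)
    (hcore : X.Core m fun _ => 0) (hunc : m .uncSize 0 = 0)
    (hp : ProperOn X.src X.dst X.E (m .col)) (hle : ∀ e ∈ X.E, m .col e ≤ X.d + 1)
    (hout : ∀ e, e ∉ X.E → m .col e = X.colOut e) :
    Runs (forLoop lo hi fun i => do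
      let e ← read .ord i
      write .mark e 0
      let γ ← read .col e
      if γ = 0 then setInsert .unc .uncPos .uncSize 0 0 e
      else
        let u ← read .src e
        let v ← read .dst e
        useColor X.D u γ e
        useColor X.D v γ e) m (38 * X.E.card + 1) fun _ m' =>
      X.Ready (classSize X.E (m .col) 0) m' ∧ Frame setupArrs m m' := by
  refine (runs_forLoop 37 (fun i m' => Frame setupArrs m m' ∧
    X.Core m' (fun e => if e ∈ segTo (m .ord) lo i then m .col e else 0) ∧
    (∀ e ∈ segTo (m .ord) lo i, m' .mark e = 0) ∧
    IsSet (m' .unc) (m' .uncPos) (m' .uncSize 0) 0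
      ((segTo (m .ord) lo i).filter fun e => m .col e = 0)) hs.le
    ⟨Frame.refl _ _, by simpa using hcore, by simp, by simpa [hunc] using IsSet.empty⟩ ?_).mono
    (by rw [hs.card]; omega) ?_
  · rintro i m₁ h1 h2 ⟨hf, hc, hmark, hset⟩
    have he := hs.mem h1 h2
    have hnot := hs.notMem h1 h2
    obtain ⟨e, hee⟩ : ∃ e, e = m .ord i := ⟨_, rfl⟩
    rw [← hee] at he hnot
    have hmark' : ∀ f ∈ segTo (m .ord) lo (i + 1), Function.update (m₁ .mark) e 0 f = 0 := by
      intro f hf'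
      rw [Function.update_apply]
      split_ifs with h3
      · rfl
      · rw [segTo_succ _ h1, ← hee, Finset.mem_insert] at hf'
        exact hmark f (hf'.resolve_left h3)
    have hupd : (fun f => if f ∈ segTo (m .ord) lo (i + 1) then m .col f else 0) =
        Function.update (fun f => if f ∈ segTo (m .ord) lo i then m .col f else 0) e
          (m .col e) := by
      funext f
      rw [Function.update_apply]
      simp only [segTo_succ _ h1, ← hee, Finset.mem_insert]
      by_cases h3 : f = e
      · simp [h3]
      · simp [h3]
    simp only [runs_read_bind, runs_write_bind, runs_ite, hf .ord (by decide), ← hee,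
      Mem.upd_of_ne, ne_eq, reduceCtorEq, not_false_eq_true, hf .col (by decide)]
    refine ⟨by norm_num, by norm_num, by norm_num, fun h0 => ?_, fun h0 => ?_⟩
    · simp only [setInsert, runs_read_bind, runs_write_bind, runs_write]
      refine ⟨by norm_num, by norm_num, by norm_num, by norm_num,
        (((hf.upd (by decide) _ _).upd (by decide) _ _).upd (by decide) _ _).upd (by decide) _ _,
        ?_, by simpa using hmark', ?_⟩
      · rw [hupd, h0, Function.update_eq_self_iff.2 (by simp [hnot])]
        exact hc.frame (S := [.mark, .unc, .uncPos, .uncSize]) ((((((Frame.refl _ _).upd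
          (by decide) _ _).upd (by decide) _ _).upd (by decide) _ _).upd (by decide) _ _))
      · rw [segTo_succ _ h1, ← hee, Finset.filter_insert, if_pos h0]
        simpa using hset.insert (x := e) (by simp [hnot])
    · simp only [runs_read_bind, Mem.upd_of_ne, ne_eq, reduceCtorEq, not_false_eq_true, hc.src,
        hc.dst]
      refine ⟨by norm_num, by norm_num, (runs_useColor_both (hc.frame (S := [.mark])
        ((Frame.refl _ _).upd (by decide) _ _)) hX he (by simp [hnot]) (by omega) (hle e he)
        fun v hv f hvf hcf => ?_).mono (by norm_num) ?_⟩
      · split_ifs at hcf with h3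
        · exact hnot (hp f (hs.subset h2.le h3) e he v hvf hv hcf (hcf ▸ h0) ▸ h3)
        · exact h0 hcf.symm
      · rintro - m₂ ⟨hc₂, hf₂⟩
        refine ⟨(hf.upd (by decide) _ _).trans (hf₂.mono (by decide)), hupd ▸ hc₂, ?_, ?_⟩
        · rw [hf₂ .mark (by decide)]; simpa using hmark'
        · rw [segTo_succ _ h1, ← hee, Finset.filter_insert, if_neg h0, hf₂ .unc (by decide),
            hf₂ .uncPos (by decide), hf₂ .uncSize (by decide)]
          simpa using hset
  · rintro - m₁ ⟨hf, hc, hmark, hset⟩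
    rw [hs.eq] at hc hmark hset
    have hcol : m₁ .col = m .col := hf .col (by decide)
    have hu : X.uncolored (fun e => if e ∈ X.E then m .col e else 0) =
        X.E.filter fun e => m .col e = 0 :=
      Finset.filter_congr fun e he => by simp [he]
    refine ⟨⟨hmark, _, ⟨hc, fun e he => by simp [hcol, he], fun e he => by rw [hcol, hout e he],
      by rw [hu]; exact hset⟩, by rw [hu]; rfl⟩, hf⟩

/-- Deleting the two entries of each edge empties the dictionary in time linear in the subgraph,
which a new initialization would not achieve. The invariant only says that the entries of the edges
to come are still present; the number of entries, falling by two per edge, does the rest. -/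
lemma runs_clear {m : Mem} {lo hi : ℕ} {c : ℕ → ℕ} (hX : X.Valid) (hs : Seg (m .ord) lo hi X.E)
    (hI : X.Inv m c) (hc : ∀ e ∈ X.E, c e ≠ 0) :
    Runs (forLoop lo hi fun i => do
      let e ← read .ord i
      let γ ← read .col e
      let u ← read .src e
      let v ← read .dst e
      dictDelete X.D u γ
      dictDelete X.D v γ) m (25 * X.E.card + 1) fun _ m' =>
      DictHas X.D X.n X.cap X.N m' (fun _ _ => 0) 0 ∧ Frame dictArrs m m' := by
  obtain ⟨tbl, hr, hst⟩ := hI.core.tbl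
  have hall : X.colored c = X.E := Finset.filter_true_of_mem hc
  have hle := hI.core.le
  have hwid := hX.width
  have hproper := hI.core.proper
  refine (runs_forLoop 24 (fun i m' => Frame dictArrs m m' ∧ ∃ tbl,
    DictHas X.D X.n X.cap X.N m' tbl (2 * (hi - i)) ∧
    ∀ e ∈ X.E, e ∉ segTo (m .ord) lo i → ∀ v, X.Inc v e → tbl v (c e) ≠ 0) hs.le
    ⟨Frame.refl _ _, tbl, ?_, fun e he _ v hv => ?_⟩ ?_).mono
    (by rw [hs.card]; omega) ?_
  · rw [← hs.card, ← hall]; exact hst.dict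
  · rw [(hr v (c e) e (Nat.pos_of_ne_zero (hc e he))).2 ⟨hv, rfl⟩]; omega
  · rintro i m₁ h1 h2 ⟨hf, t, hd, ht⟩
    have he := hs.mem h1 h2
    have hnot := hs.notMem h1 h2
    obtain ⟨e, hee⟩ : ∃ e, e = m .ord i := ⟨_, rfl⟩
    rw [← hee] at he hnot
    have hne := hX.graph.ne e he
    have hpos := Nat.pos_of_ne_zero (hc e he)
    have hlee := hle e
    have hi1 : X.Inc (X.src e) e := Or.inl rfl
    have hi2 : X.Inc (X.dst e) e := Or.inr rfl
    simp only [runs_read_bind, hf .ord (by decide), hf .col (by decide), hf .src (by decide),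
      hf .dst (by decide), ← hee, hI.col e he, hI.core.src, hI.core.dst]
    refine ⟨by norm_num, by norm_num, by norm_num, by norm_num,
      (runs_dictDelete hd hX.size (hX.graph.lt e he _ hi1) hpos (by omega)
        (ht e he hnot _ hi1)).bind (by norm_num) ?_⟩
    rintro - m₂ ⟨-, hd₂, hf₂⟩
    refine (runs_dictDelete hd₂ hX.size (hX.graph.lt e he _ hi2) hpos (by omega) ?_).mono
      (by norm_num) ?_
    · rw [upd2_of_ne _ _ (by tauto)]; exact ht e he hnot _ hi2
    rintro - m₃ ⟨-, hd₃, hf₃⟩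
    refine ⟨hf.trans (hf₂.trans hf₃), _, by
      rwa [show 2 * (hi - i) - 1 - 1 = 2 * (hi - (i + 1)) by omega] at hd₃, fun f hf' hnf v hv => ?_⟩
    rw [segTo_succ _ h1, ← hee, Finset.mem_insert, not_or] at hnf
    -- As the coloring is proper, the entries of `e` are not shared with another edge.
    have key : ∀ u, X.Inc u e → ¬ (v = u ∧ c f = c e) := by
      rintro u hu ⟨rfl, hcf⟩
      exact hnf.1 (hproper f e v hv hu hcf (hc f hf'))
    rw [upd2_of_ne _ _ (key _ hi2), upd2_of_ne _ _ (key _ hi1)]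
    exact ht f hf' hnf.2 v hv
  · rintro - m₁ ⟨hf, t, hd, -⟩
    rw [Nat.sub_self, mul_zero] at hd
    exact ⟨hd.empty hX.size, hf⟩

/-- Each call lowers the number of uncolored edges by exactly one, so the exponents of the calls are
summed over these numbers. The tick of the loop and the read of the size make `112 = 110 + 2`. -/
lemma spec_colorAll {lam : ℝ} (hl : 0 ≤ lam) {m : Mem} {l : ℕ} (h : X.Ready l m) (hX : X.Valid)
    (hlam : lam * (93 * X.n) ≤ 1) :
    Spec lam (whileLoop () fun _ => do
      let l ← read .uncSize 0
      if l = 0 then pure (Sum.inr ())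
      else
        randomColorOne X.D X.d
        pure (Sum.inl ())) m
      (Real.exp (lam * (2 + ∑ i ∈ Finset.range l,
        (112 * ((X.d : ℝ) + 1) + 186 * min ((X.E.card : ℝ) * X.d / (i + 1)) X.n))))
      fun (_ : Unit) m' => X.Ready 0 m' ∧ Frame oneArrs m m' := by
  have hsize : ∀ i m', X.Ready i m' → m' .uncSize 0 = i := by
    rintro i m' ⟨-, c, hI, hc⟩
    rw [← hI.unc.card, hc]
  have hT : ∀ i : ℕ, 0 ≤ 110 * ((X.d : ℝ) + 1) +
      186 * min ((X.E.card : ℝ) * X.d / (i + 1)) X.n := fun i => by positivity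
  refine (Spec.whileLoop hl (fun l _ m' => X.Ready l m' ∧ Frame oneArrs m m')
    (B₀ := Real.exp (lam * 1)) (B := fun i => Real.exp (lam * (1 + (110 * ((X.d : ℝ) + 1) +
      186 * min ((X.E.card : ℝ) * X.d / (i + 1)) X.n)))) ?_
    ⟨h, Frame.refl _ _⟩ (Real.one_le_exp (by linarith))
    (fun i _ => Real.one_le_exp (mul_nonneg hl (by linarith [hT i]))) ?_).mono ?_ fun _ _ h => h
  · rintro - m' ⟨hr, hf⟩
    have : Runs (do
      let l ← read .uncSize 0
      if l = 0 then pure (Sum.inr ())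
      else
        randomColorOne X.D X.d
        pure (Sum.inl ())) m' 1 fun (r : Unit ⊕ Unit) m' =>
          ∃ q, r = .inr q ∧ X.Ready 0 m' ∧ Frame oneArrs m m' := by
      simp only [runs_read_bind, hsize 0 m' hr, if_true, runs_pure]
      exact ⟨le_rfl, (), trivial, hr, hf⟩
    simpa using this.spec hl
  · rintro i - m' hi ⟨hr, hf⟩
    rw [mul_add, mul_one, Real.exp_add]
    refine Spec.read_bind hl ?_
    rw [hsize _ m' hr, if_neg (Nat.succ_ne_zero i)]
    have := (spec_randomColorOne hl hr hX hlam).bind (M' := 1) (f := fun _ => pure (Sum.inl ()))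
      (R := fun (r : Unit ⊕ Unit) m' => ∃ s', r = .inl s' ∧ X.Ready i m' ∧ Frame oneArrs m m') le_rfl
      (by
        rintro - m'' ⟨hr', hf'⟩
        have h1 : Runs (pure (Sum.inl ()) : Prog (Unit ⊕ Unit)) m'' 0 fun r m' =>
            ∃ s', r = .inl s' ∧ X.Ready i m' ∧ Frame oneArrs m m' := by
          rw [runs_pure]
          exact ⟨(), rfl, hr', hf.trans hf'⟩
        simpa using h1.spec hl)
    rwa [mul_one] at this
  · simp_rw [← Real.exp_add]
    rw [← Real.exp_sum, ← Real.exp_add, ← Real.exp_add, mul_add lam 2, Finset.mul_sum]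
    refine Real.exp_le_exp.2 ?_
    have : ∑ i ∈ Finset.range l, (lam + lam * (1 + (110 * ((X.d : ℝ) + 1) +
        186 * min ((X.E.card : ℝ) * X.d / (i + 1)) X.n))) ≤
        ∑ i ∈ Finset.range l, lam * (112 * ((X.d : ℝ) + 1) +
          186 * min ((X.E.card : ℝ) * X.d / (i + 1)) X.n) := by
      refine Finset.sum_le_sum fun i _ => ?_
      have : 0 ≤ lam * X.d := by positivity
      linarith
    linarith

end Ctx

/-! ### Step budgets in the exponent, and the cost of a repair -/

lemma Spec.bind_exp {α β : Type} {lam A C : ℝ} {p : Prog α} {f : α → Prog β} {m : Mem}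
    {Q : α → Mem → Prop} {R : β → Mem → Prop} (hl : 0 ≤ lam)
    (h : Spec lam p m (Real.exp (lam * A)) Q) (hA : A ≤ C)
    (hf : ∀ a m', Q a m' → Spec lam (f a) m' (Real.exp (lam * (C - A))) R) :
    Spec lam (p >>= f) m (Real.exp (lam * C)) R := by
  have := h.bind (Real.one_le_exp (mul_nonneg hl (sub_nonneg.2 hA))) hf
  rwa [← Real.exp_add, ← mul_add, add_sub_cancel] at this

lemma Runs.bind_exp {α β : Type} {lam C : ℝ} {c : ℕ} {p : Prog α} {f : α → Prog β} {m : Mem}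
    {Q : α → Mem → Prop} {R : β → Mem → Prop} (hl : 0 ≤ lam) (h : Runs p m c Q) (hc : (c : ℝ) ≤ C)
    (hf : ∀ a m', Q a m' → Spec lam (f a) m' (Real.exp (lam * (C - c))) R) :
    Spec lam (p >>= f) m (Real.exp (lam * C)) R :=
  (h.spec hl).bind_exp hl hc hf

lemma Runs.spec_exp {α : Type} {lam C : ℝ} {c : ℕ} {p : Prog α} {m : Mem} {Q : α → Mem → Prop}
    (hl : 0 ≤ lam) (h : Runs p m c Q) (hc : (c : ℝ) ≤ C) : Spec lam p m (Real.exp (lam * C)) Q :=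
  (h.spec hl).mono (Real.exp_le_exp.2 (mul_le_mul_of_nonneg_left hc hl)) fun _ _ h => h

/-- The arrays changed by `repair`. -/
abbrev repairArrs : List Arr := [.deg, .verts, .off] ++ Ctx.oneArrs

/-- A bound for the expected cost of coloring `l` edges of a graph with `s` edges and maximum degree
`d`. -/
noncomputable def repairCost (n s d l : ℕ) : ℝ :=
  ∑ i ∈ Finset.range l, (112 * ((d : ℝ) + 1) + 186 * min ((s : ℝ) * d / (i + 1)) n)

lemma repairCost_nonneg (n s d l : ℕ) : 0 ≤ repairCost n s d l :=
  Finset.sum_nonneg fun i _ => by positivity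

lemma spec_repair {lam : ℝ} (hl : 0 ≤ lam) {m : Mem} {D : Dict} {n cap N d lo hi : ℕ}
    {E : Finset ℕ} (hlam : lam * (93 * n) ≤ 1) (hs : Seg (m .ord) lo hi E)
    (hE : SimpleEdges n (m .src) (m .dst) E) (hD : DictSize D n N) (hw : d + 1 ≤ D.width)
    (hcap : 2 * E.card ≤ cap) (hmax : IsMaxDeg (m .src) (m .dst) E d)
    (hp : ProperOn (m .src) (m .dst) E (m .col)) (hle : ∀ e ∈ E, m .col e ≤ d + 1)
    (hd : DictHas D n cap N m (fun _ _ => 0) 0) :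
    Spec lam (repair D lo hi) m
      (Real.exp (lam * (125 * E.card + 10 + repairCost n E.card d (classSize E (m .col) 0))))
      fun _ m' => ProperOn (m .src) (m .dst) E (m' .col) ∧
        (∀ e ∈ E, 1 ≤ m' .col e ∧ m' .col e ≤ d + 1) ∧ (∀ e, e ∉ E → m' .col e = m .col e) ∧
        DictHas D n cap N m' (fun _ _ => 0) 0 ∧ Frame repairArrs m m' := by
  have hR := repairCost_nonneg n E.card d (classSize E (m .col) 0)
  have hs0 : (0 : ℝ) ≤ E.card := by positivity
  unfold repair
  refine Runs.bind_exp hl (runs_scan hs hE) (by push_cast; linarith) ?_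
  rintro ⟨d', nv⟩ m₁ ⟨hmax', hsc, hf₁⟩
  obtain rfl : d' = d := hmax'.unique hmax
  refine Runs.bind_exp hl (runs_muInit hsc) (by push_cast; linarith) ?_
  rintro - m₂ ⟨hf₂, hmu⟩
  have hw1 : Runs (write .uncSize 0 0) m₂ 1 fun _ m' => m' = m₂.upd .uncSize 0 0 := by simp
  refine Runs.bind_exp hl hw1 (by push_cast; linarith) ?_
  rintro - m₃ hm₃
  have hf₃ : Frame [.uncSize] m₂ m₃ := hm₃ ▸ (Frame.refl _ _).upd (by decide) _ _
  obtain ⟨X, hXD⟩ : ∃ X : Ctx, X = ⟨D, n, cap, N, d', m .src, m .dst, E, m₁ .off, m .col⟩ :=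
    ⟨_, rfl⟩
  have hX : X.Valid := by
    subst hXD; exact ⟨hD, hw, hcap, hE, hmax.1, hsc.off⟩
  have hf₁₃ : Frame ([.deg, .verts, .off] ++ muArrs ++ [.uncSize]) m m₃ :=
    (hf₁.mono (by decide)).trans ((hf₂.mono (by decide)).trans (hf₃.mono (by decide)))
  have hcore : X.Core m₃ fun _ => 0 := by
    subst hXD
    refine ⟨fun _ _ => rfl, fun _ => Nat.zero_le _, fun _ _ => 0, fun v γ e hγ => ?_,
      hf₁₃ .src (by decide), hf₁₃ .dst (by decide), fun v hv => ?_, fun v hv => ?_, ?_,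
      fun v hv => ?_⟩
    · simp; omega
    · rw [hf₃ .deg (by decide), hf₂ .deg (by decide)]; exact hsc.deg v hv
    · rw [hf₃ .off (by decide), hf₂ .off (by decide)]
    · simp only [Ctx.colored, ne_eq, not_true_eq_false, Finset.filter_false, Finset.card_empty,
        mul_zero]
      exact hd.congr (hf₁₃ _ (by decide)) (hf₁₃ _ (by decide)) (hf₁₃ _ (by decide))
        (hf₁₃ _ (by decide)) (hf₁₃ _ (by decide))
    · rw [hf₃ .mu (by decide), hf₃ .muPos (by decide), hf₃ .muSize (by decide)]
      simpa using hmu v hv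
  have hord₃ : m₃ .ord = m .ord := hf₁₃ .ord (by decide)
  have hcol₃ : m₃ .col = m .col := hf₁₃ .col (by decide)
  have hXE : X.E = E := by subst hXD; rfl
  have hset := Ctx.runs_setup (m := m₃) (lo := lo) (hi := hi) hX (by rw [hord₃, hXE]; exact hs) hcore
    (by simp [hm₃]) (by rw [hcol₃]; subst hXD; exact hp) (by rw [hcol₃]; subst hXD; exact hle)
    (by rw [hcol₃]; subst hXD; exact fun _ _ => rfl)
  rw [hcol₃, hXE, show X.D = D by subst hXD; rfl] at hset
  refine Runs.bind_exp hl hset (by push_cast; linarith) ?_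
  rintro - m₄ ⟨hr₄, hf₄⟩
  have hall := Ctx.spec_colorAll hl hr₄ hX (by subst hXD; exact hlam)
  rw [show X.D = D by subst hXD; rfl, show X.d = d' by subst hXD; rfl, hXE,
    show X.n = n by subst hXD; rfl] at hall
  refine Spec.bind_exp hl hall ?_ ?_
  · unfold repairCost at hR ⊢
    push_cast; linarith
  rintro - m₅ ⟨⟨-, c, hI, hc⟩, hf₅⟩
  have hord₅ : m₅ .ord = m .ord := by
    rw [hf₅ .ord (by decide), hf₄ .ord (by decide), hord₃]
  have hne : ∀ e ∈ X.E, c e ≠ 0 := fun e he h0 =>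
    Finset.notMem_empty e (Finset.card_eq_zero.1 hc ▸ Finset.mem_filter.2 ⟨he, h0⟩)
  have hclr := Ctx.runs_clear (lo := lo) (hi := hi) hX (by rw [hord₅, hXE]; exact hs) hI hne
  rw [show X.D = D by subst hXD; rfl] at hclr
  refine Spec.mono (Runs.spec_exp hl hclr (C := 25 * E.card + 1) (by rw [hXE]; push_cast; rfl))
    (Real.exp_le_exp.2 (mul_le_mul_of_nonneg_left ?_ hl)) ?_
  · unfold repairCost
    push_cast
    linarith
  rintro - m₆ ⟨hd₆, hf₆⟩
  have hcol₆ : m₆ .col = m₅ .col := hf₆ .col (by decide)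
  have hproper := hI.core.proper
  have hcle := hI.core.le
  have hcol := hI.col
  have hcolOut := hI.colOut
  rw [hcol₆]
  subst hXD
  refine ⟨fun e he e' he' v hv hv' h h0 => ?_, fun e he => ?_, hcolOut, hd₆,
    (hf₁₃.mono (by decide)).trans ((hf₄.mono (by decide)).trans ((hf₅.mono (by decide)).trans
      (hf₆.mono (by decide))))⟩
  · rw [hcol e he, hcol e' he'] at h
    rw [hcol e he] at h0
    exact hproper e e' v hv hv' h h0
  · rw [hcol e he]
    exact ⟨Nat.pos_of_ne_zero (hne e he), hcle e⟩

/-! ### Bounds for the recursion -/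

/-- Interpolation between the two bounds: each term is at most `(a / (i + 1)) ^ (3/4) * n ^ (1/4)`,
and the sum of `(i + 1) ^ (-3/4)` over `i < L` is at most `4 L ^ (1/4)`. Fourth roots are passed as
variables to keep everything polynomial. -/
lemma sum_min_le {a n w t : ℝ} (ha : 0 ≤ a) (hw : 0 ≤ w) (ht : 0 ≤ t) (hw4 : w ^ 4 = n)
    (ht4 : t ^ 4 = a) (L : ℕ) :
    ∑ i ∈ Finset.range L, min (a / (i + 1)) n ≤ 4 * t ^ 3 * w * √√(L : ℝ) := by
  have hu4 : ∀ k : ℕ, √√(k : ℝ) ^ 4 = k := fun k => by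
    rw [show 4 = 2 * 2 from rfl, pow_mul, Real.sq_sqrt (Real.sqrt_nonneg _),
      Real.sq_sqrt (Nat.cast_nonneg _)]
  induction L with
  | zero => simp
  | succ k ih =>
    rw [Finset.sum_range_succ]
    obtain ⟨u, hu⟩ : ∃ u, u = √√(k : ℝ) := ⟨_, rfl⟩
    obtain ⟨v, hv⟩ : ∃ v, v = √√((k + 1 : ℕ) : ℝ) := ⟨_, rfl⟩
    have hu' := hu4 k
    have hv' := hu4 (k + 1)
    rw [← hu] at hu' ih
    rw [← hv] at hv' ⊢
    have hu0 : 0 ≤ u := hu ▸ Real.sqrt_nonneg _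
    have hv0 : 0 < v := hv ▸ Real.sqrt_pos.2 (Real.sqrt_pos.2 (by positivity))
    have huv : u ≤ v := by
      rw [hu, hv]; exact Real.sqrt_le_sqrt (Real.sqrt_le_sqrt (by push_cast; linarith))
    -- With `u` and `v` the fourth roots of `k` and `k + 1`, this is `1 = v ^ 4 - u ^ 4 ≤ 4 v ^ 3 (v
    -- - u)`.
    have h1 : 1 ≤ 4 * v ^ 3 * (v - u) := by
      have h2 : (v - u) * (v ^ 3 + v ^ 2 * u + v * u ^ 2 + u ^ 3) = 1 := by
        have : v ^ 4 - u ^ 4 = 1 := by rw [hu', hv']; push_cast; ring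
        linarith [this]
      have h3 : v ^ 3 + v ^ 2 * u + v * u ^ 2 + u ^ 3 ≤ 4 * v ^ 3 := by
        have e1 : v ^ 2 * u ≤ v ^ 2 * v := by gcongr
        have e2 : v * u ^ 2 ≤ v * v ^ 2 := by gcongr
        have e3 : u ^ 3 ≤ v ^ 3 := by gcongr
        nlinarith
      rw [← h2, mul_comm]
      exact mul_le_mul_of_nonneg_right h3 (sub_nonneg.2 huv)
    have h4 : min (a / (k + 1)) n ≤ (t / v) ^ 3 * w := by
      have h5 : a / (k + 1) = (t / v) ^ 4 := by
        rw [div_pow, ht4, hv']; push_cast; rfl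
      have h6 : 0 ≤ t / v := by positivity
      rw [h5, ← hw4]
      rcases le_total (t / v) w with h | h
      · refine (min_le_left _ _).trans ?_
        rw [pow_succ]; gcongr
      · refine (min_le_right _ _).trans ?_
        rw [pow_succ]; gcongr
    have h7 : (t / v) ^ 3 * w ≤ 4 * t ^ 3 * w * (v - u) := by
      rw [div_pow, div_mul_eq_mul_div, div_le_iff₀ (by positivity)]
      have : 0 ≤ t ^ 3 * w := by positivity
      nlinarith
    nlinarith

/-- The fourth root of `n`. -/
noncomputable def root4 (n : ℕ) : ℝ := √√(n : ℝ)

lemma root4_pow (n : ℕ) : root4 n ^ 4 = n := by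
  rw [root4, show 4 = 2 * 2 from rfl, pow_mul, Real.sq_sqrt (Real.sqrt_nonneg _),
    Real.sq_sqrt (Nat.cast_nonneg _)]

lemma root4_sq (n : ℕ) : root4 n ^ 2 = √(n : ℝ) := Real.sq_sqrt (Real.sqrt_nonneg _)

lemma one_le_root4 {n : ℕ} (hn : 1 ≤ n) : 1 ≤ root4 n := by
  rw [root4, Real.one_le_sqrt, Real.one_le_sqrt]; exact_mod_cast hn

/-- Besides the `112 * 4 = 448` steps per edge, the path lengths are estimated in two ways, using `L
≤ 4 s / d`: by `L n`, and by `sum_min_le` with `a = s d`, which gives the order `s √d n ^ (1/4)`. In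
terms of `x = √d / n ^ (1/4)` these are `√n / x ^ 2` and `√n x` per edge, equal at `d = √n`. -/
lemma repairCost_le {n s d L : ℕ} (hn : 1 ≤ n) (hd : 1 ≤ d) (hL : L * (d + 2) ≤ 4 * s) :
    repairCost n s d L ≤ s * (448 + 1116 * root4 n ^ 2 *
      min ((root4 n / √(d : ℝ)) ^ 2) (√(d : ℝ) / root4 n)) := by
  obtain ⟨w, hw⟩ : ∃ w, w = root4 n := ⟨_, rfl⟩
  obtain ⟨r, hr⟩ : ∃ r, r = √(d : ℝ) := ⟨_, rfl⟩
  have hw1 : 1 ≤ w := hw ▸ one_le_root4 hn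
  have hw4 : w ^ 4 = n := hw ▸ root4_pow n
  have hr2 : r ^ 2 = d := hr ▸ Real.sq_sqrt (Nat.cast_nonneg _)
  have hr0 : 0 < r := hr ▸ Real.sqrt_pos.2 (by exact_mod_cast hd)
  have hs0 : (0 : ℝ) ≤ s := Nat.cast_nonneg _
  have hLr : (L : ℝ) * (d + 2) ≤ 4 * s := by exact_mod_cast hL
  have hL0 : (0 : ℝ) ≤ L := Nat.cast_nonneg _
  rw [← hw, ← hr]
  have hS1 : ∑ i ∈ Finset.range L, min ((s : ℝ) * d / (i + 1)) n ≤ 4 * (w ^ 4 / r ^ 2) * s := by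
    refine (Finset.sum_le_sum fun i _ => min_le_right _ _).trans ?_
    rw [Finset.sum_const, Finset.card_range, nsmul_eq_mul, ← hw4, mul_div_assoc', div_mul_eq_mul_div,
      le_div_iff₀ (by positivity), hr2]
    have : 0 ≤ w ^ 4 := by positivity
    nlinarith
  have hS2 : ∑ i ∈ Finset.range L, min ((s : ℝ) * d / (i + 1)) n ≤ 6 * (r * w) * s := by
    obtain ⟨t, ht⟩ : ∃ t, t = √√((s : ℝ) * d) := ⟨_, rfl⟩
    have ht0 : 0 ≤ t := ht ▸ Real.sqrt_nonneg _
    have ht4 : t ^ 4 = s * d := by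
      rw [ht, show 4 = 2 * 2 from rfl, pow_mul, Real.sq_sqrt (Real.sqrt_nonneg _),
        Real.sq_sqrt (by positivity)]
    refine (sum_min_le (by positivity) (by linarith) ht0 hw4 ht4 L).trans ?_
    obtain ⟨u, hu⟩ : ∃ u, u = √√(L : ℝ) := ⟨_, rfl⟩
    have hu0 : 0 ≤ u := hu ▸ Real.sqrt_nonneg _
    have hu4 : u ^ 4 = L := by
      rw [hu, show 4 = 2 * 2 from rfl, pow_mul, Real.sq_sqrt (Real.sqrt_nonneg _),
        Real.sq_sqrt (Nat.cast_nonneg _)]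
    rw [← hu]
    -- The true constant is `4 ^ (1/4) = √2`; on fourth powers, `4 ≤ 81 / 16`.
    have key : t ^ 3 * u ≤ 3 / 2 * (s * r) := by
      refine le_of_pow_le_pow_left₀ (n := 4) (by norm_num) (by positivity) ?_
      have h1 : (t ^ 3 * u) ^ 4 = (s * d) ^ 3 * L := by rw [← ht4, ← hu4]; ring
      have h2 : (3 / 2 * (s * r)) ^ 4 = 81 / 16 * (s ^ 4 * (d : ℝ) ^ 2) := by rw [← hr2]; ring
      rw [h1, h2]
      have h3 : (L : ℝ) * d ≤ 4 * s := by nlinarith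
      have h4 : ((s : ℝ) * d) ^ 3 * L = (s ^ 3 * (d : ℝ) ^ 2) * (L * d) := by ring
      rw [h4]
      have h5 : (0 : ℝ) ≤ s ^ 3 * (d : ℝ) ^ 2 := by positivity
      have h6 : (0 : ℝ) ≤ s ^ 4 * (d : ℝ) ^ 2 := by positivity
      calc (s : ℝ) ^ 3 * (d : ℝ) ^ 2 * (L * d) ≤ (s ^ 3 * (d : ℝ) ^ 2) * (4 * s) :=
            mul_le_mul_of_nonneg_left h3 h5
        _ = 4 * (s ^ 4 * (d : ℝ) ^ 2) := by ring
        _ ≤ _ := by linarith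
    calc 4 * t ^ 3 * w * u = 4 * w * (t ^ 3 * u) := by ring
      _ ≤ 4 * w * (3 / 2 * (s * r)) := mul_le_mul_of_nonneg_left key (by linarith)
      _ = _ := by ring
  have hS : ∑ i ∈ Finset.range L, min ((s : ℝ) * d / (i + 1)) n ≤
      6 * w ^ 2 * min ((w / r) ^ 2) (r / w) * s := by
    rcases le_total ((w / r) ^ 2) (r / w) with h | h
    · rw [min_eq_left h]
      refine hS1.trans (mul_le_mul_of_nonneg_right ?_ hs0)
      have : w ^ 4 / r ^ 2 = w ^ 2 * (w / r) ^ 2 := by rw [div_pow]; ring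
      rw [this]
      have : 0 ≤ w ^ 2 * (w / r) ^ 2 := by positivity
      linarith
    · rw [min_eq_right h]
      refine hS2.trans (le_of_eq ?_)
      field_simp
  unfold repairCost
  rw [Finset.sum_add_distrib, ← Finset.mul_sum, ← Finset.mul_sum, Finset.sum_const, Finset.card_range, nsmul_eq_mul]
  have : (L : ℝ) * (d + 1) ≤ 4 * s := by nlinarith
  linarith

/-- When `y` is smaller than `x` by a constant factor, the increment of `x / (1 + x)` is at least a
constant times `x / (1 + x) ^ 2`, which is of order `min x (1 / x)` and dominates the left side. As
the potential is bounded by `1`, the left side sums to a constant along a geometric sequence. -/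
lemma min_le_sub {x y : ℝ} (hx : 0 < x) (hy : 0 ≤ y) (h : y ≤ 4 / 5 * x) :
    min ((1 / x) ^ 2) x ≤ 20 * (x / (1 + x) - y / (1 + y)) := by
  have h1 : x / (1 + x) - y / (1 + y) = (x - y) / ((1 + x) * (1 + y)) := by
    field_simp; ring
  have h2 : x / (5 * (1 + x) ^ 2) ≤ (x - y) / ((1 + x) * (1 + y)) := by
    rw [div_le_div_iff₀ (by positivity) (by positivity)]
    have : (1 + x) * (1 + y) ≤ (1 + x) ^ 2 := by nlinarith
    have : 0 < (1 + x) ^ 2 := by positivity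
    nlinarith
  have h3 : min ((1 / x) ^ 2) x ≤ 20 * (x / (5 * (1 + x) ^ 2)) := by
    rw [mul_div_assoc', le_div_iff₀ (by positivity)]
    rcases le_total x 1 with h | h
    · refine (mul_le_mul_of_nonneg_right (min_le_right _ _) (by positivity)).trans ?_
      nlinarith [mul_le_mul_of_nonneg_left (show (1 + x) ^ 2 ≤ 4 by nlinarith) hx.le]
    · refine (mul_le_mul_of_nonneg_right (min_le_left _ _) (by positivity)).trans ?_
      rw [div_pow, one_pow, div_mul_eq_mul_div, div_le_iff₀ (by positivity)]
      nlinarith [sq_nonneg (x - 1), mul_nonneg (sub_nonneg.2 h) (sq_nonneg x)]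
  rw [h1]
  linarith

/-- A bound for the expected cost per edge of the recursive strategy. -/
noncomputable def edgeCost (n s d : ℕ) : ℝ :=
  22320 * root4 n ^ 2 * (√(d : ℝ) / root4 n / (1 + √(d : ℝ) / root4 n)) +
    5400 * Nat.clog 2 s * (1 + root4 n) + 40

lemma forty_le_edgeCost (n s d : ℕ) : 40 ≤ edgeCost n s d := by
  have : 0 ≤ root4 n := Real.sqrt_nonneg _
  unfold edgeCost
  have : 0 ≤ 22320 * root4 n ^ 2 * (√(d : ℝ) / root4 n / (1 + √(d : ℝ) / root4 n)) := by positivity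
  have : 0 ≤ 5400 * Nat.clog 2 s * (1 + root4 n) := by positivity
  linarith

/-- The first summand of `edgeCost` pays for long paths (`22320 = 20 * 1116`). The logarithm drops
by one and releases `5400 (1 + n ^ (1/4))` per edge, enough for the `448 + 450` steps per edge and
for the paths in graphs of small degree (`4464 = 4 * 1116`). The factor of `edgeCost n s' d'` is the
full `s`, so that the two halves can be combined as a weighted average. -/
lemma edgeCost_step {n s s' d d' L : ℕ} (hn : 1 ≤ n) (hd : 2 ≤ d) (hs : 2 ≤ s)
    (hL : L * (d + 2) ≤ 4 * s) (hd' : 2 * d' ≤ d + 3) (hs' : s' ≤ (s + 1) / 2) :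
    repairCost n s d L + 450 * s + s * edgeCost n s' d' ≤ s * edgeCost n s d := by
  have hrep := repairCost_le hn (by omega : 1 ≤ d) hL
  have hclog : (Nat.clog 2 s' : ℝ) + 1 ≤ Nat.clog 2 s := by
    have h1 := Nat.clog_mono_right 2 hs'
    have h2 : Nat.clog 2 s = Nat.clog 2 ((s + 1) / 2) + 1 := by
      rw [Nat.clog_of_two_le (by norm_num) hs]
      rfl
    exact_mod_cast (by omega : Nat.clog 2 s' + 1 ≤ Nat.clog 2 s)
  have hs0 : (0 : ℝ) ≤ s := Nat.cast_nonneg _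
  obtain ⟨w, hw⟩ : ∃ w, w = root4 n := ⟨_, rfl⟩
  have hw1 : 1 ≤ w := hw ▸ one_le_root4 hn
  have hw0 : 0 < w := by linarith
  obtain ⟨x, hx⟩ : ∃ x, x = √(d : ℝ) / w := ⟨_, rfl⟩
  obtain ⟨y, hy⟩ : ∃ y, y = √(d' : ℝ) / w := ⟨_, rfl⟩
  have hrd : 0 < √(d : ℝ) := Real.sqrt_pos.2 (by exact_mod_cast (by omega : 0 < d))
  have hx0 : 0 < x := hx ▸ div_pos hrd hw0
  have hy0 : 0 ≤ y := hy ▸ div_nonneg (Real.sqrt_nonneg _) hw0.le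
  have hxi : w / √(d : ℝ) = 1 / x := by rw [hx, one_div_div]
  unfold edgeCost
  rw [← hw] at hrep ⊢
  rw [hxi, ← hx] at hrep
  rw [← hx, ← hy]
  have hdec : y / (1 + y) ≤ x / (1 + x) := by
    have hyx : y ≤ x := by
      rw [hx, hy]
      gcongr
      omega
    rw [div_le_div_iff₀ (by positivity) (by positivity)]
    nlinarith
  have hcl : 5400 * (Nat.clog 2 s' : ℝ) * (1 + w) + 5400 * (1 + w) ≤
      5400 * Nat.clog 2 s * (1 + w) := by nlinarith
  have key : 1116 * w ^ 2 * min ((1 / x) ^ 2) x ≤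
      22320 * w ^ 2 * (x / (1 + x) - y / (1 + y)) + 4464 * w := by
    have hw2 : 0 ≤ w ^ 2 := by positivity
    -- From here on `(d + 3) / 2 ≤ (16 / 25) d`, so `√d` shrinks by the factor `4 / 5`. For smaller
    -- `d` the additive `3` can spoil the decrease; but then `√d ≤ 4`, and the logarithmic summand
    -- pays.
    by_cases h15 : 15 ≤ d
    · have hyx : y ≤ 4 / 5 * x := by
        rw [hx, hy, ← mul_div_assoc]
        gcongr
        rw [Real.sqrt_le_left (by positivity), mul_pow, Real.sq_sqrt (Nat.cast_nonneg _)]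
        have h1 : 25 * (d' : ℝ) ≤ 16 * d := by exact_mod_cast (by omega : 25 * d' ≤ 16 * d)
        linarith
      have := min_le_sub hx0 hy0 hyx
      nlinarith
    · have h1 : w ^ 2 * min ((1 / x) ^ 2) x ≤ w * 4 := by
        refine (mul_le_mul_of_nonneg_left (min_le_right _ _) hw2).trans ?_
        rw [hx, pow_two, mul_assoc, mul_div_cancel₀ _ hw0.ne']
        refine mul_le_mul_of_nonneg_left ?_ hw0.le
        rw [Real.sqrt_le_left (by norm_num)]
        norm_num
        exact_mod_cast (by omega : d ≤ 16)
      have h2 : 0 ≤ w ^ 2 * (x / (1 + x) - y / (1 + y)) := mul_nonneg hw2 (sub_nonneg.2 hdec)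
      nlinarith
  have : (448 : ℝ) + 1116 * w ^ 2 * min ((1 / x) ^ 2) x + 450 +
      (22320 * w ^ 2 * (y / (1 + y)) + 5400 * Nat.clog 2 s' * (1 + w) + 40) ≤
      22320 * w ^ 2 * (x / (1 + x)) + 5400 * Nat.clog 2 s * (1 + w) + 40 := by
    nlinarith
  have := mul_le_mul_of_nonneg_left this hs0
  linarith

/-- With `w = n ^ (1/4)`, the inequality `log w ≤ w - 1` gives `log m ≤ 8 log w ≤ 8 (w - 1)`, so `w
log m` is `O(√n)`. The other summand is at most a multiple of `w ^ 2 = √n`, as `x / (1 + x) ≤ 1`. -/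
lemma edgeCost_le {n m d : ℕ} (hn : 1 ≤ n) (hm : m ≤ n ^ 2) (hm1 : 1 ≤ m) :
    edgeCost n m d ≤ 250000 * √(n : ℝ) := by
  obtain ⟨w, hw⟩ : ∃ w, w = root4 n := ⟨_, rfl⟩
  have hw1 : 1 ≤ w := hw ▸ one_le_root4 hn
  have hw4 : w ^ 4 = n := hw ▸ root4_pow n
  have hclog : (Nat.clog 2 m : ℝ) ≤ 13 * w := by
    have h1 : (Nat.clog 2 m : ℝ) ≤ Real.logb 2 m + 1 := by
      have := (Nat.ceil_lt_add_one (a := Real.logb 2 m)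
        (Real.logb_nonneg (by norm_num) (by exact_mod_cast hm1))).le
      rwa [show (2 : ℝ) = (2 : ℕ) by norm_num, Real.natCeil_logb_natCast] at this
    have h2 : Real.log m ≤ 8 * (w - 1) := by
      have h3 : Real.log m ≤ Real.log (w ^ 8) := by
        refine Real.log_le_log (by exact_mod_cast hm1) ?_
        rw [show w ^ 8 = (w ^ 4) ^ 2 by ring, hw4]
        exact_mod_cast hm
      rw [Real.log_pow] at h3
      have := Real.log_le_sub_one_of_pos (show 0 < w by linarith)
      push_cast at h3
      linarith
    have h4 : Real.logb 2 m ≤ 12 * (w - 1) := by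
      rw [Real.logb, div_le_iff₀ (Real.log_pos (by norm_num))]
      have := Real.log_two_gt_d9
      nlinarith
    linarith
  unfold edgeCost
  rw [← root4_sq n, ← hw]
  have hx : √(d : ℝ) / w / (1 + √(d : ℝ) / w) ≤ 1 := by
    have : 0 ≤ √(d : ℝ) / w := div_nonneg (Real.sqrt_nonneg _) (by linarith)
    rw [div_le_one (by positivity)]
    linarith
  have h1 : 22320 * w ^ 2 * (√(d : ℝ) / w / (1 + √(d : ℝ) / w)) ≤ 22320 * w ^ 2 :=
    mul_le_of_le_one_right (by positivity) hx
  have h2 : 5400 * (Nat.clog 2 m : ℝ) * (1 + w) ≤ 5400 * (13 * w) * (w + w) := by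
    gcongr
  nlinarith

/-! ### The recursive strategy -/

section

variable {α β : Type} {lam A C : ℝ} {c T : ℕ} {p : Prog α} {f : α → Prog β} {m : Mem}
  {Q : α → Mem → Prop} {R : β → Mem → Prop}

lemma SpecAt.bind_exp (hl : 0 ≤ lam) (h : SpecAt lam (p m T) T (Real.exp (lam * A)) Q) (hA : A ≤ C)
    (hf : ∀ a m' t, t ≤ T → Q a m' → SpecAt lam (f a m' t) t (Real.exp (lam * (C - A))) R) :
    SpecAt lam ((p >>= f) m T) T (Real.exp (lam * C)) R := by
  have := h.bind (Real.one_le_exp (mul_nonneg hl (sub_nonneg.2 hA))) hf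
  rwa [← Real.exp_add, ← mul_add, add_sub_cancel] at this

lemma Runs.bindAt_exp (hl : 0 ≤ lam) (h : Runs p m c Q) (hc : (c : ℝ) ≤ C)
    (hf : ∀ a m' t, t ≤ T → Q a m' → SpecAt lam (f a m' t) t (Real.exp (lam * (C - c))) R) :
    SpecAt lam ((p >>= f) m T) T (Real.exp (lam * C)) R :=
  ((h.spec hl).2 T).bind_exp hl hc hf

lemma Runs.specAt_exp (hl : 0 ≤ lam) (h : Runs p m c Q) (hc : (c : ℝ) ≤ C) :
    SpecAt lam (p m T) T (Real.exp (lam * C)) Q :=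
  (h.spec_exp hl hc).2 T

end

/-! ### Joining the colorings of the two halves, and the base case -/

section

variable {src dst : ℕ → ℕ}

lemma exists_isMaxDeg (src dst : ℕ → ℕ) (E : Finset ℕ) : ∃ d, IsMaxDeg src dst E d := by
  have hb : BddAbove (Set.range (degIn src dst E)) :=
    ⟨E.card, by rintro _ ⟨v, rfl⟩; exact degIn_le_card E v⟩
  obtain ⟨v, hv⟩ := Nat.sSup_mem (Set.range_nonempty _) hb
  exact ⟨_, fun u => le_csSup hb ⟨u, rfl⟩, v, hv⟩

lemma Seg.congr {ord ord' : ℕ → ℕ} {lo hi : ℕ} {E : Finset ℕ} (h : Seg ord lo hi E)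
    (he : ∀ i, lo ≤ i → i < hi → ord' i = ord i) : Seg ord' lo hi E := by
  refine ⟨h.le, ?_, h.card⟩
  rw [← h.eq]
  refine Finset.image_congr fun i hi' => ?_
  rw [Finset.mem_coe, Finset.mem_Ico] at hi'
  exact he i hi'.1 hi'.2

lemma Seg.append {ord : ℕ → ℕ} {lo mid hi : ℕ} {E₁ E₂ : Finset ℕ} (h₁ : Seg ord lo mid E₁)
    (h₂ : Seg ord mid hi E₂) (hd : Disjoint E₁ E₂) : Seg ord lo hi (E₁ ∪ E₂) := by
  have hl₁ := h₁.le
  have hl₂ := h₂.le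
  refine ⟨hl₁.trans hl₂, ?_, ?_⟩
  · rw [← h₁.eq, ← h₂.eq, segTo, segTo, segTo, ← Finset.image_union,
      Finset.Ico_union_Ico_eq_Ico hl₁ hl₂]
  · rw [Finset.card_union_of_disjoint hd, h₁.card, h₂.card]; omega

lemma runs_shiftColors {m : Mem} {lo hi k : ℕ} {E : Finset ℕ} (hs : Seg (m .ord) lo hi E) :
    Runs (forLoop lo hi fun i => do
      let e ← read .ord i
      let γ ← read .col e
      write .col e (γ + k)) m (4 * E.card + 1) fun _ m' => Frame [.col] m m' ∧
      ∀ e, m' .col e = if e ∈ E then m .col e + k else m .col e := by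
  refine (runs_forLoop 3 (fun i m' => Frame [.col] m m' ∧
    ∀ e, m' .col e = if e ∈ segTo (m .ord) lo i then m .col e + k else m .col e) hs.le
    ⟨Frame.refl _ _, by simp⟩ ?_).mono (by rw [hs.card]; omega) ?_
  · rintro i m₁ h1 h2 ⟨hf, hc⟩
    have hnot := hs.notMem h1 h2
    simp only [runs_read_bind, runs_write, hf .ord (by decide), hc, hnot, if_false]
    refine ⟨by norm_num, by norm_num, by norm_num, hf.upd (by decide) _ _, fun e => ?_⟩
    simp only [Mem.upd_same, Function.update_apply, segTo_succ _ h1, Finset.mem_insert, hc]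
    by_cases h3 : e = m .ord i <;> simp [h3]
  · rintro - m₁ ⟨hf, hc⟩
    rw [hs.eq] at hc
    exact ⟨hf, hc⟩

lemma runs_colorOnes {m : Mem} {lo hi : ℕ} {E : Finset ℕ} (hs : Seg (m .ord) lo hi E) :
    Runs (forLoop lo hi fun i => do
      let e ← read .ord i
      write .col e 1) m (3 * E.card + 1) fun _ m' => Frame [.col] m m' ∧
      ∀ e, m' .col e = if e ∈ E then 1 else m .col e := by
  refine (runs_forLoop 2 (fun i m' => Frame [.col] m m' ∧
    ∀ e, m' .col e = if e ∈ segTo (m .ord) lo i then 1 else m .col e) hs.le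
    ⟨Frame.refl _ _, by simp⟩ ?_).mono (by rw [hs.card]; omega) ?_
  · rintro i m₁ h1 h2 ⟨hf, hc⟩
    simp only [runs_read_bind, runs_write, hf .ord (by decide)]
    refine ⟨by norm_num, by norm_num, hf.upd (by decide) _ _, fun e => ?_⟩
    simp only [Mem.upd_same, Function.update_apply, segTo_succ _ h1, Finset.mem_insert, hc]
    by_cases h3 : e = m .ord i <;> simp [h3]
  · rintro - m₁ ⟨hf, hc⟩
    rw [hs.eq] at hc
    exact ⟨hf, hc⟩

lemma ProperOn.of_isMaxDeg_le_one {E : Finset ℕ} {d : ℕ} (h : IsMaxDeg src dst E d) (hd : d ≤ 1)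
    (c : ℕ → ℕ) : ProperOn src dst E c := by
  intro e he e' he' v hv hv' _ _
  by_contra hne
  have h1 : ({e, e'} : Finset ℕ) ⊆ E.filter (Inc src dst v) := by
    intro f hf
    rcases Finset.mem_insert.1 hf with rfl | hf
    · exact Finset.mem_filter.2 ⟨he, hv⟩
    · rw [Finset.mem_singleton.1 hf]; exact Finset.mem_filter.2 ⟨he', hv'⟩
  have h2 := Finset.card_le_card h1
  rw [Finset.card_pair hne] at h2
  have h3 := h.1 v
  unfold degIn at h3
  omega

lemma ProperOn.union {E₁ E₂ : Finset ℕ} {c₁ c₂ c : ℕ → ℕ} {k : ℕ} (hd : Disjoint E₁ E₂)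
    (h₁ : ProperOn src dst E₁ c₁) (h₂ : ProperOn src dst E₂ c₂)
    (hle₁ : ∀ e ∈ E₁, 1 ≤ c₁ e ∧ c₁ e ≤ k) (hle₂ : ∀ e ∈ E₂, 1 ≤ c₂ e)
    (hc₁ : ∀ e ∈ E₁, c e = c₁ e) (hc₂ : ∀ e ∈ E₂, c e = c₂ e + k) :
    ProperOn src dst (E₁ ∪ E₂) c := by
  intro e he e' he' v hv hv' hc h0
  rcases Finset.mem_union.1 he with he | he <;> rcases Finset.mem_union.1 he' with he' | he'
  · rw [hc₁ e he, hc₁ e' he'] at hc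
    exact h₁ e he e' he' v hv hv' hc (by have := hle₁ e he; omega)
  · have := hle₁ e he
    have := hle₂ e' he'
    have := hc₁ e he
    have := hc₂ e' he'
    omega
  · have := hle₁ e' he'
    have := hle₂ e he
    have := hc₁ e' he'
    have := hc₂ e he
    omega
  · rw [hc₂ e he, hc₂ e' he'] at hc
    exact h₂ e he e' he' v hv hv' (by omega) (by have := hle₂ e he; omega)

end

/-- The result of the recursive strategy on the edges `E`, started on `m`. -/
structure EulerColored (D : Dict) (n cap N : ℕ) (lo hi : ℕ) (E : Finset ℕ) (d : ℕ) (m m' : Mem) :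
    Prop where
  proper : ProperOn (m .src) (m .dst) E (m' .col)
  col : ∀ e ∈ E, 1 ≤ m' .col e ∧ m' .col e ≤ d + 1
  out : ∀ e, e ∉ E → m' .col e = m .col e
  seg : Seg (m' .ord) lo hi E
  ord : ∀ i, i < lo ∨ hi ≤ i → m' .ord i = m .ord i
  dict : DictHas D n cap N m' (fun _ _ => 0) 0
  src : m' .src = m .src
  dst : m' .dst = m .dst

set_option maxHeartbeats 1000000 in
-- Every call spends a step before it recurses, so `T ≤ fuel` persists and the bound on the depth
-- never matters; for this reason the claim is about a given `T`. The dictionary is empty on entry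
-- and on exit, so one dictionary serves all levels.
lemma spec_eulerColor {lam : ℝ} (hl : 0 ≤ lam) {D : Dict} {n cap N : ℕ} (hn : 1 ≤ n)
    (hlam : lam * (93 * n) ≤ 1) (hD : DictSize D n N) (fuel : ℕ) :
    ∀ {lo hi d T : ℕ} {m : Mem} {E : Finset ℕ}, T ≤ fuel → Seg (m .ord) lo hi E →
    SimpleEdges n (m .src) (m .dst) E → IsMaxDeg (m .src) (m .dst) E d → d + 1 ≤ D.width →
    2 * E.card ≤ cap → 1 ≤ E.card → DictHas D n cap N m (fun _ _ => 0) 0 →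
    SpecAt lam (eulerColor D fuel lo hi m T) T (Real.exp (lam * (E.card * edgeCost n E.card d)))
      fun a m' => a = d ∧ EulerColored D n cap N lo hi E d m m' := by
  induction fuel with
  | zero =>
    intro lo hi d T m E hT hs hE hmax hw hcap h1 hd
    obtain rfl : T = 0 := by omega
    have h40 := forty_le_edgeCost n E.card d
    refine SpecAt.none ?_
    simpa using Real.one_le_exp (mul_nonneg hl (mul_nonneg (Nat.cast_nonneg E.card)
      (by linarith : 0 ≤ edgeCost n E.card d)))
  | succ fuel ih =>
    intro lo hi d T m E hT hs hE hmax hw hcap h1 hd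
    have h40 := forty_le_edgeCost n E.card d
    have hs1 : (1 : ℝ) ≤ E.card := by exact_mod_cast h1
    obtain ⟨K, hK⟩ : ∃ K, K = E.card * edgeCost n E.card d := ⟨_, rfl⟩
    have hK40 : 40 * (E.card : ℝ) ≤ K := by rw [hK]; nlinarith
    rw [← hK, eulerColor]
    have htick : Real.exp (lam * K) = Real.exp lam * Real.exp (lam * (K - 1)) := by
      rw [← Real.exp_add]; ring_nf
    rw [htick]
    refine SpecAt.tick_bind hl (Real.one_le_exp (mul_nonneg hl (by linarith))) fun hT1 => ?_
    refine Runs.bindAt_exp hl (runs_scan hs hE) (by push_cast; linarith) ?_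
    rintro ⟨d', nv⟩ m₁ t₁ ht₁ ⟨hmax', hsc, hf₁⟩
    obtain rfl : d' = d := hmax'.unique hmax
    have hord₁ : m₁ .ord = m .ord := hf₁ .ord (by decide)
    have hsrc₁ : m₁ .src = m .src := hf₁ .src (by decide)
    have hdst₁ : m₁ .dst = m .dst := hf₁ .dst (by decide)
    have hcol₁ : m₁ .col = m .col := hf₁ .col (by decide)
    have hd₁ : DictHas D n cap N m₁ (fun _ _ => 0) 0 := hd.congr (hf₁ _ (by decide))
      (hf₁ _ (by decide)) (hf₁ _ (by decide)) (hf₁ _ (by decide)) (hf₁ _ (by decide))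
    simp only
    by_cases hd1 : d' ≤ 1
    · rw [if_pos hd1]
      refine Runs.bindAt_exp hl (runs_colorOnes (by rw [hord₁]; exact hs))
        (by push_cast; linarith) ?_
      rintro - m₂ t₂ - ⟨hf₂, hc₂⟩
      refine Runs.specAt_exp (c := 0) hl ?_ (by push_cast; linarith)
      rw [runs_pure]
      refine ⟨rfl, ProperOn.of_isMaxDeg_le_one hmax hd1 _, fun e he => ?_, fun e he => ?_, ?_,
        fun i _ => ?_, ?_, ?_, ?_⟩
      · rw [hc₂, if_pos he]; omega
      · rw [hc₂, if_neg he, hcol₁]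
      · rw [hf₂ .ord (by decide), hord₁]; exact hs
      · rw [hf₂ .ord (by decide), hord₁]
      · exact hd₁.congr (hf₂ _ (by decide)) (hf₂ _ (by decide)) (hf₂ _ (by decide))
          (hf₂ _ (by decide)) (hf₂ _ (by decide))
      · rw [hf₂ .src (by decide), hsrc₁]
      · rw [hf₂ .dst (by decide), hdst₁]
    rw [if_neg hd1]
    have hdE : d' ≤ E.card := by
      obtain ⟨v, hv⟩ := hmax.2
      rw [← hv]; exact degIn_le_card E v
    have hcardE := hs.card
    obtain ⟨mid, hmid⟩ : ∃ mid, mid = lo + (hi - lo + 1) / 2 := ⟨_, rfl⟩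
    rw [← hmid]
    -- the cost of the recursive calls and of the rest
    have hEE : 2 ≤ E.card := by omega
    -- By `edgeCost_step` each half costs at most `(K - 450 |E| - repair) / |E|` per edge, and the
    -- halves together have `|E|` edges. The `450 |E|` cover the rest: `30` for the scan, `97` for
    -- the partition, at most `4` for the shift of colors, `105` for pruning and `125` within the
    -- repair, plus constants, which are small because `|E| ≥ 2`.
    have hKrec : ∀ s₁ s₂ d₁ d₂ L : ℕ, s₁ + s₂ = E.card → s₁ ≤ (E.card + 1) / 2 →
        s₂ ≤ (E.card + 1) / 2 → 2 * d₁ ≤ d' + 3 → 2 * d₂ ≤ d' + 3 → L * (d' + 2) ≤ 4 * E.card →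
        s₁ * edgeCost n s₁ d₁ + s₂ * edgeCost n s₂ d₂ + 450 * E.card +
          repairCost n E.card d' L ≤ K := by
      intro s₁ s₂ d₁ d₂ L hsum h1 h2 h3 h4 hL
      have e1 := edgeCost_step hn (by omega : 2 ≤ d') hEE hL h3 h1
      have e2 := edgeCost_step hn (by omega : 2 ≤ d') hEE hL h4 h2
      rw [← hK] at e1 e2
      have hsr : (s₁ : ℝ) + s₂ = E.card := by exact_mod_cast hsum
      have hE0 : (0 : ℝ) < E.card := by linarith
      have k1 : edgeCost n s₁ d₁ ≤ (K - 450 * E.card - repairCost n E.card d' L) / E.card := by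
        rw [le_div_iff₀ hE0]; linarith
      have k2 : edgeCost n s₂ d₂ ≤ (K - 450 * E.card - repairCost n E.card d' L) / E.card := by
        rw [le_div_iff₀ hE0]; linarith
      have k3 := mul_le_mul_of_nonneg_left k1 (Nat.cast_nonneg (α := ℝ) s₁)
      have k4 := mul_le_mul_of_nonneg_left k2 (Nat.cast_nonneg (α := ℝ) s₂)
      have k5 : (s₁ : ℝ) * ((K - 450 * E.card - repairCost n E.card d' L) / E.card) +
          s₂ * ((K - 450 * E.card - repairCost n E.card d' L) / E.card) =
          K - 450 * E.card - repairCost n E.card d' L := by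
        rw [← add_mul, hsr, mul_div_cancel₀ _ hE0.ne']
      linarith
    have hs2 : (2 : ℝ) ≤ E.card := by exact_mod_cast hEE
    have hK450 : 450 * (E.card : ℝ) ≤ K := by
      have := hKrec ((E.card + 1) / 2) (E.card / 2) 0 0 0 (by omega) le_rfl (by omega) (by omega)
        (by omega) (by omega)
      have e1 := forty_le_edgeCost n ((E.card + 1) / 2) 0
      have e2 := forty_le_edgeCost n (E.card / 2) 0
      have e3 := repairCost_nonneg n E.card d' 0
      have e4 : (0 : ℝ) ≤ ((E.card + 1) / 2 : ℕ) * edgeCost n ((E.card + 1) / 2) 0 :=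
        mul_nonneg (Nat.cast_nonneg _) (by linarith)
      have e5 : (0 : ℝ) ≤ (E.card / 2 : ℕ) * edgeCost n (E.card / 2) 0 :=
        mul_nonneg (Nat.cast_nonneg _) (by linarith)
      linarith
    refine Runs.bindAt_exp hl (runs_eulerPartition (E := E) (n := n) (by rw [hord₁]; exact hs)
      (by rw [hsrc₁, hdst₁]; exact hE) (by rw [hsrc₁, hdst₁]; exact hsc) hmid)
      (by push_cast; linarith) ?_
    rintro - m₂ t₂ ht₂ ⟨E₁, E₂, hs₁, hs₂, hunion, hdisj, hdeg, hf₂, hout₂⟩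
    rw [hsrc₁, hdst₁] at hdeg
    have hsrc₂ : m₂ .src = m .src := by rw [hf₂ .src (by decide), hsrc₁]
    have hdst₂ : m₂ .dst = m .dst := by rw [hf₂ .dst (by decide), hdst₁]
    have hcol₂ : m₂ .col = m .col := by rw [hf₂ .col (by decide), hcol₁]
    have hd₂ : DictHas D n cap N m₂ (fun _ _ => 0) 0 := hd₁.congr (hf₂ _ (by decide))
      (hf₂ _ (by decide)) (hf₂ _ (by decide)) (hf₂ _ (by decide)) (hf₂ _ (by decide))
    have hc₁ := hs₁.card
    have hc₂ := hs₂.card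
    have hle₁ := hs₁.le
    have hle₂ := hs₂.le
    have hsub₁ : E₁ ⊆ E := hunion ▸ Finset.subset_union_left
    have hsub₂ : E₂ ⊆ E := hunion ▸ Finset.subset_union_right
    obtain ⟨d₁, hmax₁⟩ := exists_isMaxDeg (m .src) (m .dst) E₁
    obtain ⟨d₂, hmax₂⟩ := exists_isMaxDeg (m .src) (m .dst) E₂
    have hd₁' : 2 * d₁ ≤ d' + 3 := by
      obtain ⟨v, hv⟩ := hmax₁.2
      have := (hdeg v).1
      have := hmax.1 v
      omega
    have hd₂' : 2 * d₂ ≤ d' + 3 := by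
      obtain ⟨v, hv⟩ := hmax₂.2
      have := (hdeg v).2
      have := hmax.1 v
      omega
    have hd₁d : d₁ ≤ d' := by
      obtain ⟨v, hv⟩ := hmax₁.2
      rw [← hv]; exact (degIn_mono hsub₁ v).trans (hmax.1 v)
    have hd₂d : d₂ ≤ d' := by
      obtain ⟨v, hv⟩ := hmax₂.2
      rw [← hv]; exact (degIn_mono hsub₂ v).trans (hmax.1 v)
    have hKr := fun L => hKrec E₁.card E₂.card d₁ d₂ L (by omega) (by omega) (by omega) hd₁' hd₂'
    have hrc := repairCost_nonneg n E.card d'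
    have he₁ : 0 ≤ (E₁.card : ℝ) * edgeCost n E₁.card d₁ :=
      mul_nonneg (Nat.cast_nonneg _) (by linarith [forty_le_edgeCost n E₁.card d₁])
    have he₂ : 0 ≤ (E₂.card : ℝ) * edgeCost n E₂.card d₂ :=
      mul_nonneg (Nat.cast_nonneg _) (by linarith [forty_le_edgeCost n E₂.card d₂])
    have hKr0 := hKr 0 (by omega)
    have hrc0 := hrc 0
    refine SpecAt.bind_exp hl (ih (d := d₁) (E := E₁) (by omega) hs₁
      (by rw [hsrc₂, hdst₂]; exact hE.subset hsub₁) (by rw [hsrc₂, hdst₂]; exact hmax₁) (by omega)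
      (by omega) (by omega) hd₂) (by push_cast; linarith) ?_
    rintro a m₃ t₃ ht₃ ⟨rfl, hr₃⟩
    have hsrc₃ : m₃ .src = m .src := by rw [hr₃.src, hsrc₂]
    have hdst₃ : m₃ .dst = m .dst := by rw [hr₃.dst, hdst₂]
    have hs₂₃ : Seg (m₃ .ord) mid hi E₂ := hs₂.congr fun i h1 h2 => hr₃.ord i (Or.inr h1)
    refine SpecAt.bind_exp hl (ih (d := d₂) (E := E₂) (by omega) hs₂₃
      (by rw [hsrc₃, hdst₃]; exact hE.subset hsub₂) (by rw [hsrc₃, hdst₃]; exact hmax₂) (by omega)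
      (by omega) (by omega) hr₃.dict) (by push_cast; linarith) ?_
    rintro b m₄ t₄ ht₄ ⟨rfl, hr₄⟩
    have hsrc₄ : m₄ .src = m .src := by rw [hr₄.src, hsrc₃]
    have hdst₄ : m₄ .dst = m .dst := by rw [hr₄.dst, hdst₃]
    have hs₁₄ : Seg (m₄ .ord) lo mid E₁ := hr₃.seg.congr fun i h1 h2 => hr₄.ord i (Or.inl h2)
    have hs₄ : Seg (m₄ .ord) lo hi E := hunion ▸ hs₁₄.append hr₄.seg hdisj
    refine Runs.bindAt_exp hl (runs_shiftColors (k := a + 1) hr₄.seg) ?_ ?_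
    · have : (E₂.card : ℝ) ≤ E.card := by exact_mod_cast Finset.card_le_card hsub₂
      push_cast; linarith
    rintro - m₅ t₅ ht₅ ⟨hf₅, hcol₅⟩
    have hord₅ : m₅ .ord = m₄ .ord := hf₅ .ord (by decide)
    have hnot : ∀ e ∈ E₁, e ∉ E₂ := fun e h1 h2 => Finset.disjoint_left.1 hdisj h1 h2
    have hcolE₁ : ∀ e ∈ E₁, m₅ .col e = m₃ .col e := fun e he => by
      rw [hcol₅, if_neg (hnot e he), hr₄.out e (hnot e he)]
    have hcolE₂ : ∀ e ∈ E₂, m₅ .col e = m₄ .col e + (a + 1) := fun e he => by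
      rw [hcol₅, if_pos he]
    have hp₃ := hr₃.proper
    have hp₄ := hr₄.proper
    rw [hsrc₂, hdst₂] at hp₃
    rw [hsrc₃, hdst₃] at hp₄
    have hp₅ : ProperOn (m .src) (m .dst) E (m₅ .col) := hunion ▸
      ProperOn.union hdisj hp₃ hp₄ hr₃.col (fun e he => (hr₄.col e he).1) hcolE₁ hcolE₂
    have hle₅ : ∀ e ∈ E, 1 ≤ m₅ .col e ∧ m₅ .col e ≤ (a + 1) + (b + 1) := by
      intro e he
      rw [← hunion] at he
      rcases Finset.mem_union.1 he with he | he
      · have := hr₃.col e he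
        have := hcolE₁ e he
        omega
      · have := hr₄.col e he
        have := hcolE₂ e he
        omega
    have hpr := runs_prune (m := m₅) (q := d' + 1) (by rw [hord₅]; exact hs₄) hle₅
    -- The halves use at most `d + 5` colors, so at most four classes are removed, and the loop has
    -- at most five rounds. Each round is linear in `|E|` because `d ≤ |E|`.
    have hcostp : ((((a + 1) + (b + 1)) - (d' + 1) + 1) *
        (2 * ((a + 1) + (b + 1)) + 4 * E.card + 6) + 5 * ((a + 1) + (b + 1)) + 10 * E.card + 4) ≤
        105 * E.card := by
      have h5 : ((a + 1) + (b + 1)) - (d' + 1) + 1 ≤ 5 := by omega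
      have := Nat.mul_le_mul_right (2 * ((a + 1) + (b + 1)) + 4 * E.card + 6) h5
      omega
    refine Runs.bindAt_exp hl (hpr.mono hcostp fun _ _ h => h) ?_ ?_
    · have : (E₂.card : ℝ) ≤ E.card := by exact_mod_cast Finset.card_le_card hsub₂
      push_cast; linarith
    rintro - m₆ t₆ ht₆ ⟨hle₆, hmerge, hout₆, hz, hf₆⟩
    have hsrc₆ : m₆ .src = m .src := by
      rw [hf₆ .src (by decide), hf₅ .src (by decide), hsrc₄]
    have hdst₆ : m₆ .dst = m .dst := by
      rw [hf₆ .dst (by decide), hf₅ .dst (by decide), hdst₄]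
    have hord₆ : m₆ .ord = m₄ .ord := by rw [hf₆ .ord (by decide), hord₅]
    have hL : classSize E (m₆ .col) 0 * (d' + 2) ≤ 4 * E.card := by
      refine hz.trans (Nat.mul_le_mul_right _ ?_)
      omega
    have hd₆ : DictHas D n cap N m₆ (fun _ _ => 0) 0 := by
      have hf₄₆ := (hf₅.mono (S' := [.cnt, .lab, .col]) (by decide)).trans hf₆
      exact hr₄.dict.congr (hf₄₆ _ (by decide)) (hf₄₆ _ (by decide)) (hf₄₆ _ (by decide))
        (hf₄₆ _ (by decide)) (hf₄₆ _ (by decide))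
    have hrep := spec_repair (lo := lo) (hi := hi) (N := N) (D := D) hl hlam (by rw [hord₆]; exact hs₄)
      (by rw [hsrc₆, hdst₆]; exact hE) hD hw hcap (by rw [hsrc₆, hdst₆]; exact hmax)
      (by
        rw [hsrc₆, hdst₆]
        intro e he e' he' v hv hv' hc h0
        exact hp₅ e he e' he' v hv hv' (hmerge e he e' he' h0 hc)
          (by have := hle₅ e he; omega)) hle₆ hd₆
    have hKL := hKr _ hL
    refine SpecAt.bind_exp hl (hrep.2 t₆) ?_ ?_
    · have : (E₂.card : ℝ) ≤ E.card := by exact_mod_cast Finset.card_le_card hsub₂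
      push_cast; linarith
    rintro - m₇ t₇ ht₇ ⟨hp₇, hle₇, hout₇, hd₇, hf₇⟩
    rw [hsrc₆, hdst₆] at hp₇
    refine Runs.specAt_exp (c := 0) hl ?_ ?_
    · have hord₇ : m₇ .ord = m₄ .ord := by rw [hf₇ .ord (by decide), hord₆]
      rw [runs_pure]
      refine ⟨rfl, hp₇, hle₇, fun e he => ?_, by rw [hord₇]; exact hs₄, fun i hi' => ?_, hd₇, ?_, ?_⟩
      · have h1 : e ∉ E₁ := fun h => he (hsub₁ h)
        have h2 : e ∉ E₂ := fun h => he (hsub₂ h)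
        rw [hout₇ e he, hout₆ e he, hcol₅, if_neg h2, hr₄.out e h2, hr₃.out e h1, hcol₂]
      · rw [hord₇, hr₄.ord i (by omega), hr₃.ord i (by omega), hout₂ i hi', hord₁]
      · rw [hf₇ .src (by decide), hsrc₆]
      · rw [hf₇ .dst (by decide), hdst₆]
    · have : (E₂.card : ℝ) ≤ E.card := by exact_mod_cast Finset.card_le_card hsub₂
      push_cast; linarith

/-! ### Initialization of the dictionary -/

/-- The search for `b` stops by `√n + 1`, since then `b ^ 2 * 2 m ≥ (n + 1) n` exceeds the universe.
As `b` balances the two tables, the number `U / b + 1` of ranges and the total size `2 m b` of the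
blocks are both `O(m √n)`. -/
lemma runs_dictInit {n m d : ℕ} (mem : Mem) (hn : n ≤ 2 * m) (hn1 : 1 ≤ n) (hd : d + 1 ≤ n) :
    Runs (dictInit n m d) mem (26 * m * (Nat.sqrt n + 1)) fun D m' =>
      D.width = d + 1 ∧ (∃ N, DictSize D n N ∧ DictHas D n (2 * m) N m' (fun _ _ => 0) 0) ∧
      Frame dictArrs mem m' := by
  unfold dictInit
  obtain ⟨U, hU⟩ : ∃ U, U = n * (d + 1) + 1 := ⟨_, rfl⟩
  obtain ⟨cap, hcap⟩ : ∃ cap, cap = 2 * m := ⟨_, rfl⟩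
  have hUn : U ≤ n * n + 1 := by rw [hU]; gcongr
  simp only [← hU, ← hcap]
  have hgoal : ∀ b, 1 ≤ b → b ≤ Nat.sqrt n + 1 → (U ≤ b * b * cap ∨ U ≤ b) →
      Nat.sqrt n + 1 + (((U / b + 1) * 3 + 1) + ((cap * b * 2 + 1) + ((cap * 2 + 1) + 1))) ≤
        26 * m * (Nat.sqrt n + 1) := by
    intro b hb hbs hUb
    have h1 : U / b ≤ b * cap + 1 := by
      rcases hUb with h | h
      · exact (Nat.div_le_of_le_mul (by rw [← mul_assoc]; exact h)).trans (Nat.le_succ _)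
      · exact (Nat.div_le_of_le_mul (by omega : U ≤ b * 1)).trans (Nat.le_add_left _ _)
    have h2 : b * cap ≤ (Nat.sqrt n + 1) * cap := Nat.mul_le_mul_right _ hbs
    have h3 : cap * b = b * cap := mul_comm _ _
    have h4 : 26 * m * (Nat.sqrt n + 1) = 13 * ((Nat.sqrt n + 1) * cap) := by rw [hcap]; ring
    have h5 : (Nat.sqrt n + 1) * 2 ≤ (Nat.sqrt n + 1) * cap := Nat.mul_le_mul_left _ (by omega)
    have h6 : 1 * cap ≤ (Nat.sqrt n + 1) * cap := Nat.mul_le_mul_right _ (by omega)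
    rw [h4, h3]
    omega
  refine Runs.bind (c₁ := Nat.sqrt n + 1) (Q := fun b m' => m' = mem ∧ 1 ≤ b ∧
    b ≤ Nat.sqrt n + 1 ∧ (U ≤ b * b * cap ∨ U ≤ b)) (runs_whileLoop
    (fun b m' c => m' = mem ∧ 1 ≤ b ∧ b ≤ Nat.sqrt n + 1 ∧ c = Nat.sqrt n + 2 - b) ?_
    ⟨rfl, le_rfl, by omega, by omega⟩) ?_ ?_
  · rintro b m' c ⟨rfl, hb, hbs, rfl⟩
    refine ⟨0, by omega, ?_⟩
    rw [runs_pure]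
    by_cases hc : b * b * cap < U ∧ b < U
    · rw [if_pos hc]
      refine ⟨_, ?_, rfl, by omega, ?_, rfl⟩
      · omega
      · have : b ≤ Nat.sqrt n := by
          rw [Nat.le_sqrt]
          by_contra h
          push Not at h
          have h1 : (n + 1) * n ≤ b * b * cap := Nat.mul_le_mul h (by omega)
          nlinarith
        omega
    · rw [if_neg hc]
      exact ⟨rfl, hb, hbs, by omega⟩
  · have := hgoal 1 le_rfl (by omega)
    by_cases h : U ≤ 1 * 1 * cap ∨ U ≤ 1
    · have := this h; omega
    · have h6 : 26 * m * 1 ≤ 26 * m * (Nat.sqrt n + 1) := Nat.mul_le_mul_left _ (by omega)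
      have h7 : 1 * (Nat.sqrt n + 1) ≤ 26 * m * (Nat.sqrt n + 1) :=
        Nat.mul_le_mul_right _ (by omega)
      omega
  rintro b m₀ ⟨rfl, hb, hbs, hUb⟩
  have hcost := hgoal b hb hbs hUb
  obtain ⟨N, hN⟩ : ∃ N, N = U / b + 1 := ⟨_, rfl⟩
  rw [← hN] at hcost ⊢
  refine Runs.bind (c₁ := N * 3 + 1) ((runs_forLoop 2 (lo := 0) (hi := N)
    (fun k m' => Frame [.dictA, .dictC] m₀ m' ∧ ∀ i < k, m' .dictA i = 0 ∧ m' .dictC i = 0)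
    (Nat.zero_le _) ⟨Frame.refl _ _, by simp⟩ ?_).mono (by omega) fun _ _ h => h) (by omega) ?_
  · rintro k m' - hk ⟨hf, hz⟩
    simp only [runs_write_bind, runs_write]
    refine ⟨by norm_num, by norm_num, (hf.upd (by decide) _ _).upd (by decide) _ _, fun i hi => ?_⟩
    by_cases hik : i = k
    · simp [hik]
    · simpa [hik] using hz i (by omega)
  rintro - m₁ ⟨hf₁, hz₁⟩
  refine Runs.bind (c₁ := cap * b * 2 + 1) ((runs_forLoop 1 (lo := 0) (hi := cap * b)
    (fun k m' => Frame [.dictB] m₁ m' ∧ ∀ i < k, m' .dictB i = 0)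
    (Nat.zero_le _) ⟨Frame.refl _ _, by simp⟩ ?_).mono (by omega) fun _ _ h => h) (by omega) ?_
  · rintro k m' - hk ⟨hf, hz⟩
    simp only [runs_write]
    refine ⟨by norm_num, hf.upd (by decide) _ _, fun i hi => ?_⟩
    by_cases hik : i = k
    · simp [hik]
    · simpa [hik] using hz i (by omega)
  rintro - m₂ ⟨hf₂, hz₂⟩
  refine Runs.bind (c₁ := cap * 2 + 1) ((runs_forLoop 1 (lo := 0) (hi := cap)
    (fun k m' => Frame [.dictE] m₂ m' ∧ ∀ i < k, m' .dictE i = i)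
    (Nat.zero_le _) ⟨Frame.refl _ _, by simp⟩ ?_).mono (by omega) fun _ _ h => h) (by omega) ?_
  · rintro k m' - hk ⟨hf, hz⟩
    simp only [runs_write]
    refine ⟨by norm_num, hf.upd (by decide) _ _, fun i hi => ?_⟩
    by_cases hik : i = k
    · simp [hik]
    · simpa [hik] using hz i (by omega)
  rintro - m₃ ⟨hf₃, hz₃⟩
  simp only [runs_write_bind, runs_pure]
  have hA : m₃ .dictA = m₁ .dictA := by rw [hf₃ .dictA (by decide), hf₂ .dictA (by decide)]
  have hC : m₃ .dictC = m₁ .dictC := by rw [hf₃ .dictC (by decide), hf₂ .dictC (by decide)]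
  have hB : m₃ .dictB = m₂ .dictB := hf₃ .dictB (by decide)
  refine ⟨by omega, trivial, ⟨N, ⟨hb, ?_⟩, fun _ _ => 0, ⟨?_, ?_, ?_, ?_, ?_, ?_, ?_, ?_, ?_⟩,
    by simp, ?_⟩, ((hf₁.mono (by decide)).trans ((hf₂.mono (by decide)).trans
      (hf₃.mono (by decide)))).upd (by decide) _ _⟩
  · have := Nat.lt_div_mul_add (a := U) (b := b) (by omega)
    simp only
    rw [hN, add_mul, one_mul]
    omega
  · simp
  · intro k hk
    simp [hC, (hz₁ k hk).2]
  · intro k hk h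
    simp [hA, (hz₁ k hk).1] at h
  · intro k hk h
    simp [hA, (hz₁ k hk).1] at h
  · intro k hk k' hk' h
    simp [hA, (hz₁ k hk).1] at h
  · intro i hi i' hi' h
    simp only [Mem.upd_same, Mem.upd_of_ne, ne_eq, reduceCtorEq, not_false_eq_true,
      Function.update_self] at hi hi' h
    rwa [hz₃ i hi, hz₃ i' hi'] at h
  · intro i hi k hk
    simp [hA, (hz₁ k hk).1]
  · intro i hi j hj
    simp only [Mem.upd_same, Mem.upd_of_ne, ne_eq, reduceCtorEq, not_false_eq_true,
      Function.update_self] at hi hj ⊢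
    rw [hz₃ i hi, hB]
    refine hz₂ _ ?_
    have := Nat.mul_le_mul_right b (show i + 1 ≤ cap by omega)
    rw [add_mul, one_mul] at this
    omega
  · simp only [Mem.upd_same, Mem.upd_of_ne, ne_eq, reduceCtorEq, not_false_eq_true,
      Function.update_self]
    rw [Finset.filter_false_of_mem]
    · simp
    · intro k hk
      simp [hA, (hz₁ k (Finset.mem_range.1 hk)).1]
  · refine Finset.sum_eq_zero fun k hk => ?_
    simp [hC, (hz₁ k (Finset.mem_range.1 hk)).2]

/-! ### The main theorem -/

lemma spec_randomEulerColor {lam : ℝ} (hl : 0 ≤ lam) {n m d : ℕ} {mem : Mem}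
    (hlam : lam * (93 * n) ≤ 1) (hn1 : 1 ≤ n) (hn : n ≤ 2 * m) (hm : m ≤ n ^ 2) (hdn : d + 1 ≤ n)
    (hE : SimpleEdges n (mem .src) (mem .dst) (Finset.range m))
    (hmax : IsMaxDeg (mem .src) (mem .dst) (Finset.range m) d) (T : ℕ) :
    SpecAt lam (randomEulerColor n m mem T) T (Real.exp (lam * (250100 * m * √(n : ℝ))))
      fun _ out => ProperOn (mem .src) (mem .dst) (Finset.range m) (out .col) ∧
        ∀ e ∈ Finset.range m, 1 ≤ out .col e ∧ out .col e ≤ d + 1 := by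
  have hm1 : 1 ≤ m := by omega
  have hq : 1 ≤ √(n : ℝ) := by rw [Real.one_le_sqrt]; exact_mod_cast hn1
  have hmr : (1 : ℝ) ≤ m := by exact_mod_cast hm1
  have hmq : (m : ℝ) ≤ m * √(n : ℝ) := le_mul_of_one_le_right (by linarith) hq
  have hsq : (Nat.sqrt n : ℝ) ≤ √(n : ℝ) := Real.nat_sqrt_le_real_sqrt
  have hinit : (26 : ℝ) * m * (Nat.sqrt n + 1) ≤ 52 * (m * √(n : ℝ)) := by nlinarith
  have hcost : (m : ℝ) * edgeCost n m d ≤ 250000 * (m * √(n : ℝ)) := by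
    have := mul_le_mul_of_nonneg_left (edgeCost_le (d := d) hn1 hm hm1) (by linarith : (0 : ℝ) ≤ m)
    linarith
  unfold randomEulerColor
  have hfor : Runs (forLoop 0 m fun i => write .ord i i) mem (2 * m + 1) fun _ m' =>
      Frame [.ord] mem m' ∧ ∀ i < m, m' .ord i = i := by
    refine (runs_forLoop 1 (fun k m' => Frame [.ord] mem m' ∧ ∀ i < k, m' .ord i = i)
      (Nat.zero_le _) ⟨Frame.refl _ _, by simp⟩ ?_).mono (by omega) fun _ _ h => h
    rintro k m' - hk ⟨hf, hz⟩
    simp only [runs_write]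
    refine ⟨by norm_num, hf.upd (by decide) _ _, fun i hi => ?_⟩
    by_cases hik : i = k
    · simp [hik]
    · simpa [hik] using hz i (by omega)
  refine Runs.bindAt_exp hl hfor (by push_cast; linarith) ?_
  rintro - m₁ t₁ - ⟨hf₁, hord₁⟩
  have hsrc₁ : m₁ .src = mem .src := hf₁ .src (by decide)
  have hdst₁ : m₁ .dst = mem .dst := hf₁ .dst (by decide)
  have hs : Seg (m₁ .ord) 0 m (Finset.range m) := by
    refine ⟨Nat.zero_le _, ?_, by simp⟩
    rw [segTo, Nat.Ico_zero_eq_range]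
    refine (Finset.image_congr fun i hi => ?_).trans Finset.image_id
    exact hord₁ i (Finset.mem_range.1 (Finset.mem_coe.1 hi))
  refine Runs.bindAt_exp hl (runs_scan (n := n) hs (by rw [hsrc₁, hdst₁]; exact hE))
    (by rw [Finset.card_range]; push_cast; linarith) ?_
  rintro ⟨d', nv⟩ m₂ t₂ - ⟨hmax', -, hf₂⟩
  rw [hsrc₁, hdst₁] at hmax'
  obtain rfl : d' = d := hmax'.unique hmax
  refine Runs.bindAt_exp hl (runs_dictInit m₂ hn hn1 hdn)
    (by rw [Finset.card_range]; push_cast; linarith) ?_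
  rintro D m₃ t₃ - ⟨hw, ⟨N, hD, hd⟩, hf₃⟩
  have hsrc₃ : m₃ .src = mem .src := by rw [hf₃ .src (by decide), hf₂ .src (by decide), hsrc₁]
  have hdst₃ : m₃ .dst = mem .dst := by rw [hf₃ .dst (by decide), hf₂ .dst (by decide), hdst₁]
  have hord₃ : m₃ .ord = m₁ .ord := by rw [hf₃ .ord (by decide), hf₂ .ord (by decide)]
  have hrec := spec_eulerColor hl hn1 hlam hD t₃ (d := d') (cap := 2 * m) le_rfl
    (by rw [hord₃]; exact hs) (by rw [hsrc₃, hdst₃]; exact hE) (by rw [hsrc₃, hdst₃]; exact hmax)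
    hw.ge (by simp) (by simpa using hm1) hd
  have hrec' : SpecAt lam (withFuel (fun fuel => eulerColor D fuel 0 m) m₃ t₃) t₃ _ _ := hrec
  refine SpecAt.bind_exp hl hrec' (by rw [Finset.card_range]; push_cast; linarith) ?_
  rintro a m₄ t₄ - ⟨-, hr⟩
  have hp := hr.proper
  rw [hsrc₃, hdst₃] at hp
  refine Runs.specAt_exp (c := 0) hl ?_ (by rw [Finset.card_range]; push_cast; linarith)
  rw [runs_pure]
  exact ⟨hp, hr.col⟩

/-! ### From the input graph to sets of edge numbers -/

section

variable {n m : ℕ} {G : SimpleGraph (Fin n)} {mem : Mem}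

lemma inc_iff_mem {edge : Fin m ≃ G.edgeSet} (h : ∀ i : Fin m,
    Sym2.map Fin.val (edge i : Sym2 (Fin n)) = s(mem .src i, mem .dst i)) (v : ℕ) (i : Fin m) :
    Inc (mem .src) (mem .dst) v i ↔ ∃ u : Fin n, u.val = v ∧ u ∈ (edge i : Sym2 (Fin n)) := by
  have : Inc (mem .src) (mem .dst) v i ↔ v ∈ s(mem .src i, mem .dst i) := by
    rw [Sym2.mem_iff, Inc, eq_comm, @eq_comm _ _ v]
  rw [this, ← h, Sym2.mem_map]
  constructor <;> rintro ⟨u, h1, h2⟩ <;> exact ⟨u, h2, h1⟩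

lemma Represents.simpleEdges (h : Represents mem m G) :
    SimpleEdges n (mem .src) (mem .dst) (Finset.range m) := by
  obtain ⟨edge, h⟩ := h
  refine ⟨fun e he v hv => ?_, fun e he => ?_, fun e he e' he' u v huv h1 h2 h3 h4 => ?_⟩
  · obtain ⟨u, rfl, -⟩ := (inc_iff_mem h v ⟨e, Finset.mem_range.1 he⟩).1 hv
    exact u.2
  · intro heq
    have h1 := h ⟨e, Finset.mem_range.1 he⟩
    have h2 := G.not_isDiag_of_mem_edgeSet (edge ⟨e, Finset.mem_range.1 he⟩).2
    refine h2 ((Sym2.isDiag_map Fin.val_injective).1 ?_)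
    rw [h1]
    exact Sym2.mk_isDiag_iff.2 heq
  · obtain ⟨a, rfl, ha⟩ := (inc_iff_mem h u ⟨e, Finset.mem_range.1 he⟩).1 h1
    obtain ⟨b, rfl, hb⟩ := (inc_iff_mem h v ⟨e, Finset.mem_range.1 he⟩).1 h2
    obtain ⟨a', ha', ha2⟩ := (inc_iff_mem h a ⟨e', Finset.mem_range.1 he'⟩).1 h3
    obtain ⟨b', hb', hb2⟩ := (inc_iff_mem h b ⟨e', Finset.mem_range.1 he'⟩).1 h4
    obtain rfl := Fin.ext ha'
    obtain rfl := Fin.ext hb'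
    have hab : a' ≠ b' := fun h => huv (by rw [h])
    have h5 := (Sym2.mem_and_mem_iff hab).1 ⟨ha, hb⟩
    have h6 := (Sym2.mem_and_mem_iff hab).1 ⟨ha2, hb2⟩
    have h7 := edge.injective (Subtype.ext (h5.trans h6.symm))
    exact congrArg Fin.val h7

lemma Represents.degIn_eq [DecidableRel G.Adj] (h : Represents mem m G) (v : Fin n) :
    degIn (mem .src) (mem .dst) (Finset.range m) v = G.degree v := by
  obtain ⟨edge, h⟩ := h
  rw [← G.card_incidenceFinset_eq_degree]
  have hmem : ∀ i (hi : i ∈ (Finset.range m).filter (Inc (mem .src) (mem .dst) v)), i < m :=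
    fun i hi => Finset.mem_range.1 (Finset.mem_filter.1 hi).1
  refine Finset.card_bij (fun i hi => (edge ⟨i, hmem i hi⟩ : Sym2 (Fin n))) (fun i hi => ?_)
    (fun i hi j hj hij => ?_) fun e he => ?_
  · obtain ⟨u, hu, hmem'⟩ := (inc_iff_mem h v ⟨i, hmem i hi⟩).1 (Finset.mem_filter.1 hi).2
    obtain rfl := Fin.ext hu
    rw [SimpleGraph.mem_incidenceFinset]
    exact ⟨(edge _).2, hmem'⟩
  · exact congrArg Fin.val (edge.injective (Subtype.ext hij))
  · rw [SimpleGraph.mem_incidenceFinset] at he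
    obtain ⟨i, hi⟩ := edge.surjective ⟨e, he.1⟩
    refine ⟨i, Finset.mem_filter.2 ⟨Finset.mem_range.2 i.2,
      (inc_iff_mem h v i).2 ⟨v, rfl, ?_⟩⟩, ?_⟩
    · rw [hi]; exact he.2
    · simp [hi]

lemma Represents.isMaxDeg [DecidableRel G.Adj] (h : Represents mem m G) (hn : 1 ≤ n) :
    IsMaxDeg (mem .src) (mem .dst) (Finset.range m) G.maxDegree := by
  have : Nonempty (Fin n) := ⟨⟨0, hn⟩⟩
  refine ⟨fun v => ?_, ?_⟩
  · by_cases hv : degIn (mem .src) (mem .dst) (Finset.range m) v = 0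
    · omega
    · obtain ⟨e, he, hve⟩ := exists_of_degIn_ne_zero hv
      have hvn := h.simpleEdges.lt e he v hve
      rw [h.degIn_eq ⟨v, hvn⟩]
      exact G.degree_le_maxDegree _
  · obtain ⟨v, hv⟩ := G.exists_maximal_degree_vertex
    exact ⟨v, by rw [h.degIn_eq, hv]⟩

/-- Handshake lemma, every degree being at least one. This is the only use of the absence of
isolated vertices; it lets costs in `n` be charged to `m`. -/
lemma Represents.le_two_mul (h : Represents mem m G) (hG : ∀ v, ∃ w, G.Adj v w) : n ≤ 2 * m := by
  classical
  have h1 := sum_degIn_le (src := mem .src) (dst := mem .dst) (Finset.range m) (Finset.range n)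
  rw [Finset.card_range] at h1
  refine le_trans ?_ h1
  have h2 := Finset.card_nsmul_le_sum (Finset.range n)
    (degIn (mem .src) (mem .dst) (Finset.range m)) 1 fun v hv => by
      have := h.degIn_eq ⟨v, Finset.mem_range.1 hv⟩
      simp only at this
      rw [this]
      obtain ⟨w, hw⟩ := hG ⟨v, Finset.mem_range.1 hv⟩
      exact (G.degree_pos_iff_exists_adj _).2 ⟨w, hw⟩
  simpa using h2

lemma Represents.le_sq (h : Represents mem m G) : m ≤ n ^ 2 := by
  classical
  obtain ⟨edge, -⟩ := h
  have h1 := Fintype.card_congr edge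
  rw [Fintype.card_fin, ← SimpleGraph.edgeFinset_card] at h1
  have h2 := G.card_edgeFinset_le_card_choose_two
  rw [Fintype.card_fin] at h2
  exact h1.le.trans (h2.trans (Nat.choose_le_pow n 2))

lemma isEdgeColoring_of_properOn {mem out : Mem} {m q : ℕ}
    (hp : ProperOn (mem .src) (mem .dst) (Finset.range m) (out .col))
    (hc : ∀ e ∈ Finset.range m, 1 ≤ out .col e ∧ out .col e ≤ q) : IsEdgeColoring mem m q out := by
  refine ⟨fun i hi => hc i (Finset.mem_range.2 hi), ?_⟩
  rintro i hi j hj hij ⟨v, hvi, hvj⟩ heq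
  rw [Sym2.mem_iff] at hvi hvj
  refine hij (hp i (Finset.mem_range.2 hi) j (Finset.mem_range.2 hj) v ?_ ?_ heq ?_)
  · exact hvi.imp Eq.symm Eq.symm
  · exact hvj.imp Eq.symm Eq.symm
  · have := hc i (Finset.mem_range.2 hi)
    omega

end

/-! ### From the moment bound to the probability of halting -/

open Classical in
lemma prob_none_add {α : Type} (μ : PMF (Option α)) :
    μ none + μ.toOuterMeasure {o | o ≠ none} = 1 := by
  rw [← μ.tsum_coe, ENNReal.tsum_eq_add_tsum_ite none, PMF.toOuterMeasure_apply]
  congr 1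
  refine tsum_congr fun o => ?_
  rw [Set.indicator_apply]
  by_cases ho : o = none <;> simp [ho]

lemma le_haltProb {α : Type} {p : Prog α} {mem : Mem} {T : ℕ} {ε : ℝ} (h0 : 0 ≤ ε)
    (h : p mem T none ≤ ENNReal.ofReal ε) : ENNReal.ofReal (1 - ε) ≤ haltProb p mem T := by
  rw [ENNReal.ofReal_sub _ h0, ENNReal.ofReal_one, tsub_le_iff_left,
    ← prob_none_add (p mem T)]
  exact add_le_add_left h _

end EdgeColoring

theorem mainTheorem5 :
    ∃ C : ℝ, 0 < C ∧
      ∀ (n m : ℕ) (G : SimpleGraph (Fin n)) [DecidableRel G.Adj],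
        (∀ v, ∃ w, G.Adj v w) →
        ∀ mem : EdgeColoring.Mem, EdgeColoring.Represents mem m G →
          (∀ (T t : ℕ) (out : EdgeColoring.Mem),
            some ((), out, t) ∈ (EdgeColoring.randomEulerColor n m mem T).support →
              EdgeColoring.IsEdgeColoring mem m (G.maxDegree + 1) out) ∧
          ENNReal.ofReal (1 - Real.exp (-Real.sqrt m)) ≤
            EdgeColoring.haltProb (EdgeColoring.randomEulerColor n m) mem
              ⌊C * m * Real.sqrt n⌋₊ := by
  refine ⟨260000, by norm_num, fun n m G _ hG mem h => ?_⟩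
  -- Without vertices there are no edges, and the claimed probability is `1 - exp 0 = 0`.
  rcases Nat.eq_zero_or_pos n with rfl | hn1
  · have hm : m ≤ 0 := by simpa using h.le_sq
    obtain rfl : m = 0 := by omega
    exact ⟨fun T t out _ => ⟨by simp, by simp⟩, by simp⟩
  have hn := h.le_two_mul hG
  have hdn : G.maxDegree + 1 ≤ n := by
    have : Nonempty (Fin n) := ⟨⟨0, hn1⟩⟩
    simpa using G.maxDegree_lt_card_verts
  have hnr : (1 : ℝ) ≤ n := by exact_mod_cast hn1
  -- This is the largest parameter for which the exponent of a single flip is at most `1`.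
  have hspec := fun T => EdgeColoring.spec_randomEulerColor (lam := 1 / (93 * n)) (by positivity)
    (by field_simp; exact le_rfl) hn1 hn h.le_sq hdn h.simpleEdges (h.isMaxDeg hn1) T
  refine ⟨fun T t out hout => ?_, EdgeColoring.le_haltProb (Real.exp_nonneg _)
    ((hspec _).prob_none.trans (ENNReal.ofReal_le_ofReal ?_))⟩
  · obtain ⟨hp, hc⟩ := (hspec T).post hout
    exact EdgeColoring.isEdgeColoring_of_properOn hp hc
  · rw [← Real.exp_add, Real.exp_le_exp]
    have hfloor := Nat.lt_floor_add_one (260000 * (m : ℝ) * √(n : ℝ))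
    obtain ⟨T, hT⟩ : ∃ T : ℝ, T = (⌊260000 * (m : ℝ) * √(n : ℝ)⌋₊ : ℝ) := ⟨_, rfl⟩
    rw [← hT] at hfloor ⊢
    obtain ⟨a, ha⟩ : ∃ a, a = √(m : ℝ) := ⟨_, rfl⟩
    obtain ⟨b, hb⟩ : ∃ b, b = √(n : ℝ) := ⟨_, rfl⟩
    have hm2 : a ^ 2 = m := ha ▸ Real.sq_sqrt (Nat.cast_nonneg _)
    have hn2 : b ^ 2 = n := hb ▸ Real.sq_sqrt (Nat.cast_nonneg _)
    have hmn : (n : ℝ) ≤ 2 * m := by exact_mod_cast hn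
    have ha0 : 0 ≤ a := ha ▸ Real.sqrt_nonneg _
    have hb1 : 1 ≤ b := by rw [hb, Real.one_le_sqrt]; exact hnr
    rw [← hb] at hfloor
    rw [← ha, ← hb]
    have hba : b ≤ 2 * a := by nlinarith
    have ha1 : 1 / 2 ≤ a := by linarith
    -- From `√n ≤ 2 √m` follows `n √m ≤ 2 m √n`. So the tail term costs at most `186 m √n`, and the
    -- gap between `250100` and `260000` also absorbs the rounding of `T`.
    have key : 93 * n * a + 250100 * m * b ≤ T := by
      have h1 : (n : ℝ) * a ≤ 2 * (m * b) := by
        rw [← hm2, ← hn2]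
        nlinarith [mul_nonneg (mul_nonneg ha0 (by linarith : 0 ≤ b)) (sub_nonneg.2 hba)]
      have h2 : 1 ≤ 2 * (m * b) := by nlinarith
      nlinarith
    have h3 : 1 / (93 * (n : ℝ)) * (250100 * m * b) + -(1 / (93 * n)) * T =
        (250100 * m * b - T) / (93 * n) := by ring
    rw [h3, div_le_iff₀ (by positivity)]
    linarith
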